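/- Let $\mathbb{R}^{1,4}$ be $\mathbb{R}^5$ with $\langle v,w\rangle=-v_0w_0+v_1w_1+\dots+v_4w_4$ and $\mathbb{H}^4=\{v:\langle v,v\rangle=-1,\ v_0>0\}$. A space-like vector $v$ defines the half-space $\{x\in\mathbb{H}^4:\langle x,v\rangle\le 0\}$, denoted by the same letter. Let $\sigma_0,\dots,\sigma_7\in\{\pm1\}^3$ be $(1,1,1)$, $(1,-1,1)$, $(1,-1,-1)$, $(1,1,-1)$, $(-1,1,-1)$, $(-1,1,1)$, $(-1,-1,1)$, $(-1,-1,-1)$, and for $t\in(0,1]$, $0\le i\le 7$ put $$i^+=(\sqrt2,\sigma_i,(-1)^i/t),\qquad i^-=(\sqrt2,\sigma_i,-(-1)^i t),$$ $$A,F=(1,\pm\sqrt2,0,0,0),\quad B,E=(1,0,\pm\sqrt2,0,0),\quad C,D=(1,0,0,\pm\sqrt2,0),\quad G,H=(1,0,0,0,\mp\sqrt2t)$$ (the first-named letter takes the upper sign). Let $t_1=\sqrt{3/5}$, $t_2=\sqrt{1/2}$. Let $P_t$ be the intersection of the 24 half-spaces when $t\in(t_2,1]$, and of the 22 half-spaces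 other than $G,H$ when $t\in(0,t_2]$. The strata of dimension $3,2,1,0$ of $P_t$ are its walls, faces, edges and finite vertices; its points at infinity are its ideal vertices. "Vertices" means finite and ideal vertices. Each half-space gives exactly one wall, denoted by the same letter. Set $$\cos\theta=\tfrac{3t^2-1}{1+t^2},\quad \cos\varphi=\tfrac{\sqrt2(1-t^2)}{\sqrt{(2t^2-1)(t^2+1)}},\quad \cos\psi=\tfrac{1-3t^2}{2(t^2-1)},\quad \cos\eta=\tfrac{3t^2-1}{3-5t^2}$$ (angles in $[0,\pi]$; $\varphi$, $\psi$, $\eta$ are used for $t>t_1$, $t<t_1$, $t<t_2$). Call $i,k$ adjacent if $\sigma_i,\sigma_k$ differ in exactly one coordinate, and say that the side $A$ contains $i$ if the first coordinate of $\sigma_i$ is $+1$, and similarly for $F$ (first, $-1$), $B,E$ (second, $\pm1$), $C,D$ (third, $\pm1$). Let $Z_k=G$ for $k$ even and $Z_k=H$ for $k$ odd. **(a)** $P_t$ has finite volume for all $t\in(0,1]$. Its combinatorics (the face poset of its closure in $\overline{\mathbb{H}^4}$, with ideal vertices distinguished from finite ones) is constant on each of $(0,t_2)$, $(t_2,t_1)$,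 $(t_1,1)$, by isomorphisms that preserve the names of the walls, and changes precisely at $t_2$, $t_1$ and $1$: for $s,t\in(0,1]$ the combinatorics of $P_s$ and $P_t$ agree if and only if $s=t$ or $s$ and $t$ lie in the same one of these intervals. **(b)** Every face of $P_t$, $t\in(0,1]$, is the intersection of two walls, and exactly these two walls contain it. All faces have right dihedral angles, except: - the 12 red polygons $i^+\cap j^+$, $i\ne j$ of the same parity, which are faces with dihedral angle $\theta$ for all $t\in(0,1)$; they have $4$ vertices for $t\in[t_1,1)$, $6$ for $t\in(t_2,t_1)$, and $5$ for $t\in(0,t_2]$; - the 8 green triangles $k^-\cap Z_k$, which have dihedral angle $\varphi$ for $t\in(t_1,1)$ (right angles at $t=1$), and are not faces for $t\le t_1$. **(c)** Let $t\in(0,1)$. Every edge lies on exactly three walls. If these are $a,b,c$, the three-dimensional dihedral angle of the wall $a$ along the edge is $\psi$ if $a,b,c$ are all positive (which happens only for $t<t_1$); otherwise it is $\theta$, $\varphi$ or $\frac\pi2$ according to whether $\{b,c\}$ is red, green or neither. At each finite vertex $a\cap b\cap c\cap d$ of a green triangle $a\cap b$, the interior angle of the triangle is $\theta$. At each finite vertex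 $a\cap b\cap c\cap d$ of a red polygon $a\cap b$, the interior angle of the polygon is $\eta$ if $c,d$ are both positive, $\varphi$ if $\{c,d\}$ is green, and $\frac\pi2$ otherwise. **(d)** For every $t\in(0,1]$ there are 12 ideal vertices of type (1), and for each odd $i$ exactly three of them lie on $i^+$. The numbers (walls, faces, edges, vertices) of $P_t$ and its vertices, in terms of the types below, are: - $t\in(t_1,1)$: $(24,108,144,60)$; 12 ideal vertices (1), 24 finite vertices (2), 24 finite vertices (3). - $t=t_1$ (where $\theta=\frac\pi3$): $(24,100,120,44)$; 12 ideal vertices (1), 8 ideal vertices (4), 24 finite vertices (2). - $t\in(t_2,t_1)$: $(24,100,128,52)$; 12 ideal vertices (1), 24 finite vertices (2), 16 finite vertices (8 of type (5) and 8 of type (6)). - $t\in(0,t_2]$: $(22,92,116,46)$; 12 ideal vertices (1), 24 finite vertices (2), 8 finite vertices (5), and 2 vertices (7), which are ideal at $t=t_2$ (where $\cos\theta=\frac13$) and finite for $t<t_2$. The types are as follows; in each case the walls listed are exactly those incident to the vertex. The link is the spherical polyhedron of inward unit tangent vectors at a finite vertex, and the section by any small horosphere at an ideal vertex. Links are given up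 to isometry, with their faces corresponding to the walls as described. 1. Walls $i^+,i^-,j^+,j^-,X,Y$ with $i$ odd, $j$ even, $i,j$ adjacent, and $X\neq Y$ in $\{A,\dots,F\}$ the two sides that contain both $i$ and $j$; the link is a Euclidean rectangular parallelepiped with pairs of opposite faces on $\{i^+,j^+\}$, $\{i^-,j^-\}$, $\{X,Y\}$. 2. Walls $i^+,j^+,k^-,X$ with $i\ne j$ both adjacent to $k$ and $X\in\{A,\dots,F\}$ a side that contains $i$ and $j$; the link is the spherical tetrahedron with dihedral angle $\theta$ between $i^+,j^+$ and all others right (the join $I_{\pi/2}*I_\theta$, where $I_\alpha$ is a circular arc of length $\alpha$). 3. Walls $i^+,j^+,k^-,Z_k$ with $i\ne j$ both adjacent to $k$; the link is the spherical tetrahedron with dihedral angles $\theta$ between $i^+,j^+$, $\varphi$ between $k^-,Z_k$, and all others right (the join $I_\varphi*I_\theta$). 4. Walls $i^+,j^+,l^+,k^-,Z_k$ with $i,j,l$ the three numbers adjacent to $k$; the link is a Euclidean right prism over an equilateral triangle, with bases on $k^-$ and $Z_k$. 5. Walls $i^+,j^+,l^+,k^-$ with $i,j,l$ as in 4; the link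 is the spherical tetrahedron with dihedral angles $\theta$ between any two positive walls, and all others right. 6. Walls $i^+,j^+,l^+,Z_k$ with $i,j,l$ as in 4; the link is as in 5, with $Z_k$ in place of $k^-$. 7. The four positive walls of one parity; the link is a regular tetrahedron, Euclidean at $t=t_2$ and spherical with all dihedral angles $\theta$ for $t<t_2$. -/

import Mathlib

open Set MeasureTheory
open scoped ENNReal

noncomputable section

namespace CellFamily

/-! ### Hyperbolic four-space in the hyperboloid model -/

/-- The ambient vector space of Minkowski space `ℝ^{1,4}`, with coordinates `x₀, …, x₄`. -/
abbrev Mink := Fin 5 → ℝ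

/-- The Lorentzian product of signature `(-,+,+,+,+)`. -/
def lor (x y : Mink) : ℝ :=
  -(x 0 * y 0) + x 1 * y 1 + x 2 * y 2 + x 3 * y 3 + x 4 * y 4

/-- Hyperbolic four-space: the upper sheet of the hyperboloid. -/
def Hyp : Set Mink := {x | lor x x = -1 ∧ 0 < x 0}

/-- The chart `ℝ⁴ → ℍ⁴` presenting the upper sheet as a graph. -/
def hypPoint (y : Fin 4 → ℝ) : Mink :=
  ![√(1 + y 0 ^ 2 + y 1 ^ 2 + y 2 ^ 2 + y 3 ^ 2), y 0, y 1, y 2, y 3]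

/-- Hyperbolic volume of a subset of `ℍ⁴`: in the graph chart the Riemannian volume form is
`dx₁ dx₂ dx₃ dx₄ / x₀`. -/
def hypVol (S : Set Mink) : ℝ≥0∞ :=
  ∫⁻ y in hypPoint ⁻¹' S, ENNReal.ofReal (1 / hypPoint y 0)

/-- The closure of a subset of `ℍ⁴` in the compactification of `ℍ⁴`, which is seen as the closed
unit ball in the affine slice `x₀ = 1` (projective model). -/
def compactification (S : Set Mink) : Set Mink :=
  closure ((fun x : Mink => (x 0)⁻¹ • x) '' S)

/-- The dihedral angle of the intersection of the half-spaces dual to two space-like vectors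
(`⟨·, v⟩ ≤ 0` and `⟨·, w⟩ ≤ 0`) whose boundaries meet. -/
def dihedralAngle (v w : Mink) : ℝ := Real.arccos (-lor v w / √(lor v v * lor w w))

/-- Orthogonal projection of `w` to the hyperplane `v^⊥`. -/
def proj (v w : Mink) : Mink := w - (lor w v / lor v v) • v

/-! ### The half-spaces and the polytopes `P_t` -/

/-- Names of the half-spaces: positive ones, negative ones, and letters. -/
inductive Label
  | pos (i : Fin 8)
  | neg (i : Fin 8)
  | A | B | C | D | E | F | G | H

open Label

/-- The vectors that define the half-spaces at the time `t`. -/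
def vec (t : ℝ) : Label → Mink
  | pos i => (![
      ![√2, 1, 1, 1, 1 / t],
      ![√2, 1, -1, 1, -1 / t],
      ![√2, 1, -1, -1, 1 / t],
      ![√2, 1, 1, -1, -1 / t],
      ![√2, -1, 1, -1, 1 / t],
      ![√2, -1, 1, 1, -1 / t],
      ![√2, -1, -1, 1, 1 / t],
      ![√2, -1, -1, -1, -1 / t]] : Fin 8 → Mink) i
  | neg i => (![
      ![√2, 1, 1, 1, -t],
      ![√2, 1, -1, 1, t],
      ![√2, 1, -1, -1, -t],
      ![√2, 1, 1, -1, t],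
      ![√2, -1, 1, -1, -t],
      ![√2, -1, 1, 1, t],
      ![√2, -1, -1, 1, -t],
      ![√2, -1, -1, -1, t]] : Fin 8 → Mink) i
  | A => ![1, √2, 0, 0, 0]
  | B => ![1, 0, √2, 0, 0]
  | C => ![1, 0, 0, √2, 0]
  | D => ![1, 0, 0, -√2, 0]
  | E => ![1, 0, -√2, 0, 0]
  | F => ![1, -√2, 0, 0, 0]
  | G => ![1, 0, 0, 0, -√2 * t]
  | H => ![1, 0, 0, 0, √2 * t]

/-- The critical time `t₁`. -/
def t₁ : ℝ := √(3 / 5)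

/-- The critical time `t₂`. -/
def t₂ : ℝ := √(1 / 2)

/-- The half-spaces present at the time `t`: all of them when `t > t₂`, all except `G` and `H`
when `t ≤ t₂`. -/
def active (t : ℝ) : Set Label := {l | l = G ∨ l = H → t₂ < t}

/-- The polytope `P_t`. -/
def P (t : ℝ) : Set Mink := {x ∈ Hyp | ∀ l ∈ active t, lor x (vec t l) ≤ 0}

/-! ### Strata, ideal vertices, combinatorics -/

/-- The points of `P_t` that lie on the boundaries of all the half-spaces in `I`. -/
def stratum (t : ℝ) (I : Set Label) : Set Mink := {x ∈ P t | ∀ l ∈ I, lor x (vec t l) = 0}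

/-- The part of `P_t` on the boundary of the half-space `l`. -/
def wall (t : ℝ) (l : Label) : Set Mink := stratum t {l}

/-- The closed strata of `P_t` of dimension `k` in `ℍ⁴`: walls (`k = 3`), faces (`k = 2`),
edges (`k = 1`), finite vertices (`k = 0`). A stratum of dimension `k` spans a linear subspace of
dimension `k + 1`. -/
def strata (t : ℝ) (k : ℕ) : Set (Set Mink) :=
  {S | (∃ I ⊆ active t, S = stratum t I) ∧ S.Nonempty ∧
    Module.finrank ℝ (Submodule.span ℝ S) = k + 1}

/-- The finite vertices of `P_t`, as points of `ℍ⁴`. -/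
def finVertices (t : ℝ) : Set Mink := {x | {x} ∈ strata t 0}

/-- The ideal vertices of `P_t`: the points at infinity of its closure, as light-like vectors
with `x₀ = 1`. -/
def idealVertices (t : ℝ) : Set Mink := {n ∈ compactification (P t) | lor n n = 0}

/-- The number of vertices, finite or ideal. -/
def numVertices (t : ℝ) : ℕ∞ := (finVertices t).encard + (idealVertices t).encard

/-- The number of vertices, finite or ideal, of a stratum. -/
def numCorners (t : ℝ) (S : Set Mink) : ℕ∞ :=
  {x ∈ finVertices t | x ∈ S}.encard + {n ∈ idealVertices t | n ∈ compactification S}.encard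

/-- The walls that contain a set of points of `P_t`. -/
def wallsThrough (t : ℝ) (S : Set Mink) : Set Label := {l ∈ active t | S ⊆ wall t l}

/-- The walls whose closures contain an ideal point. -/
def wallsAtIdeal (t : ℝ) (n : Mink) : Set Label :=
  {l ∈ active t | n ∈ compactification (wall t l)}

/-- The face poset of the compactified polytope (ordered by inclusion): the closures of all
nonempty strata, `P_t` included, together with the ideal vertices. -/
def closedFaces (t : ℝ) : Set (Set Mink) :=
  {K | ∃ I ⊆ active t, (stratum t I).Nonempty ∧ K = compactification (stratum t I)} ∪
    {K | ∃ n ∈ idealVertices t, K = {n}}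

/-- An isomorphism of face posets that respects dimensions and the distinction between ideal
vertices and everything else. -/
def IsCombIso {s t : ℝ} (e : closedFaces s ≃o closedFaces t) : Prop :=
  ∀ K : closedFaces s,
    Module.finrank ℝ (Submodule.span ℝ (e K : Set Mink)) =
      Module.finrank ℝ (Submodule.span ℝ (K : Set Mink)) ∧
    ((∃ n ∈ idealVertices s, (K : Set Mink) = {n}) ↔
      ∃ n ∈ idealVertices t, (e K : Set Mink) = {n})

/-- `P_s` and `P_t` have the same combinatorics. -/
def CombEquiv (s t : ℝ) : Prop :=
  ∃ e : closedFaces s ≃o closedFaces t, IsCombIso e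

/-- `P_s` and `P_t` have the same combinatorics, through an isomorphism that respects the names of
the walls. -/
def LabelledCombEquiv (s t : ℝ) : Prop :=
  active s = active t ∧ ∃ e : closedFaces s ≃o closedFaces t, IsCombIso e ∧
    ∀ l ∈ active s, ∀ K : closedFaces s,
      (K : Set Mink) ⊆ compactification (wall s l) ↔
        (e K : Set Mink) ⊆ compactification (wall t l)

/-- `s` and `t` lie in the same one of the pieces
`(0,t₂)`, `{t₂}`, `(t₂,t₁)`, `{t₁}`, `(t₁,1)`, `{1}`. -/
def SamePiece (s t : ℝ) : Prop :=
  s = t ∨ (s ∈ Ioo 0 t₂ ∧ t ∈ Ioo 0 t₂) ∨ (s ∈ Ioo t₂ t₁ ∧ t ∈ Ioo t₂ t₁) ∨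
    (s ∈ Ioo t₁ 1 ∧ t ∈ Ioo t₁ 1)

/-! ### The varying angles -/

/-- `cos θ = (3t² - 1) / (1 + t²)`. -/
def theta (t : ℝ) : ℝ := Real.arccos ((3 * t ^ 2 - 1) / (1 + t ^ 2))

/-- `cos φ = √2 (1 - t²) / √((2t² - 1)(t² + 1))`, for `t > t₁`. -/
def phi (t : ℝ) : ℝ :=
  Real.arccos (√2 * (1 - t ^ 2) / √((2 * t ^ 2 - 1) * (t ^ 2 + 1)))

/-- `cos ψ = cos θ / (1 - cos θ) = (1 - 3t²) / (2(t² - 1))`, for `t < t₁`. -/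
def psi (t : ℝ) : ℝ := Real.arccos ((1 - 3 * t ^ 2) / (2 * (t ^ 2 - 1)))

/-- `cos η = cos θ / (1 - 2 cos θ) = (3t² - 1) / (3 - 5t²)`, for `t < t₂`. -/
def eta (t : ℝ) : ℝ := Real.arccos ((3 * t ^ 2 - 1) / (3 - 5 * t ^ 2))

/-- The red pairs: two distinct positive walls of the same parity. -/
def Red (a b : Label) : Prop :=
  ∃ i j : Fin 8, i ≠ j ∧ (Even i.val ↔ Even j.val) ∧ a = pos i ∧ b = pos j

/-- The green pairs, as ordered pairs: `{G, neg i}` with `i` even, `{H, neg i}` with `i` odd. -/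
def GreenOrd (a b : Label) : Prop :=
  ∃ i : Fin 8, b = neg i ∧ ((Even i.val ∧ a = G) ∨ (Odd i.val ∧ a = H))

/-- The green pairs. -/
def Green (a b : Label) : Prop := GreenOrd a b ∨ GreenOrd b a

/-- A positive wall. -/
def IsPos (a : Label) : Prop := ∃ i, a = pos i

/-- The red faces of `P_t`. -/
def redFaces (t : ℝ) : Set (Set Mink) :=
  {S ∈ strata t 2 | ∃ a b, Red a b ∧ wallsThrough t S = {a, b}}

/-- The green faces of `P_t`. -/
def greenFaces (t : ℝ) : Set (Set Mink) :=
  {S ∈ strata t 2 | ∃ a b, Green a b ∧ wallsThrough t S = {a, b}}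

/-- The three-dimensional dihedral angle of the wall `a` along its edge `a ∩ b ∩ c`. -/
def edgeAngle (t : ℝ) (a b c : Label) : ℝ :=
  dihedralAngle (proj (vec t a) (vec t b)) (proj (vec t a) (vec t c))

/-- The interior angle of the polygon `a ∩ b` at its vertex `a ∩ b ∩ c ∩ d`. -/
def cornerAngle (t : ℝ) (a b c d : Label) : ℝ :=
  dihedralAngle
    (proj (proj (vec t a) (vec t b)) (proj (vec t a) (vec t c)))
    (proj (proj (vec t a) (vec t b)) (proj (vec t a) (vec t d)))

/-! ### Links of vertices -/

/-- The link of a finite vertex: the unit tangent vectors at `x` that point into `P_t`. -/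
def link (t : ℝ) (x : Mink) : Set Mink :=
  {u | lor u x = 0 ∧ lor u u = 1 ∧
    ∃ ε > 0, ∀ r ∈ Ioo 0 ε, Real.cosh r • x + Real.sinh r • u ∈ P t}

/-- The link of the finite vertex `x` is isometric to a spherical tetrahedron in `S³` whose faces
correspond to the walls `w 0, …, w 3` and whose dihedral angle at the edge between the `i`-th and
the `j`-th face is `α i j` (the diagonal of `α` is irrelevant). The `N i` are the outer unit
normals of the tetrahedron. -/
def LinkIsTetrahedron (t : ℝ) (x : Mink) (w : Fin 4 → Label) (α : Fin 4 → Fin 4 → ℝ) : Prop :=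
  ∃ N : Fin 4 → EuclideanSpace ℝ (Fin 4), LinearIndependent ℝ N ∧ (∀ i, ‖N i‖ = 1) ∧
    (∀ i j, i ≠ j → inner ℝ (N i) (N j) = -Real.cos (α i j)) ∧
    ∃ f : Mink → EuclideanSpace ℝ (Fin 4),
      (∀ u ∈ link t x, ∀ u' ∈ link t x, inner ℝ (f u) (f u') = lor u u') ∧
      f '' link t x = {y | ‖y‖ = 1 ∧ ∀ i, inner ℝ y (N i) ≤ 0} ∧
      ∀ u ∈ link t x, ∀ i, inner ℝ (f u) (N i) = 0 ↔ lor u (vec t (w i)) = 0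

/-- The dihedral angles of the spherical join `I_α * I_β` of two circular arcs. -/
def joinAngles (α β : ℝ) : Fin 4 → Fin 4 → ℝ :=
  ![![0, α, Real.pi / 2, Real.pi / 2], ![α, 0, Real.pi / 2, Real.pi / 2],
    ![Real.pi / 2, Real.pi / 2, 0, β], ![Real.pi / 2, Real.pi / 2, β, 0]]

/-- Three faces that meet pairwise at the angle `α`, and a fourth one orthogonal to them. -/
def coneAngles (α : ℝ) : Fin 4 → Fin 4 → ℝ :=
  ![![0, α, α, Real.pi / 2], ![α, 0, α, Real.pi / 2],
    ![α, α, 0, Real.pi / 2], ![Real.pi / 2, Real.pi / 2, Real.pi / 2, 0]]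

/-- The dihedral angles of the regular tetrahedron `Δ³(α)`. -/
def regularAngles (α : ℝ) : Fin 4 → Fin 4 → ℝ := fun _ _ => α

/-- Euclidean three-space. -/
abbrev E3 := EuclideanSpace ℝ (Fin 3)

/-- The intersection of `P_t` with the horosphere of level `c` at the light-like vector `n`;
the horosphere shrinks to `n` as `c → 0`. -/
def horoSection (t : ℝ) (n : Mink) (c : ℝ) : Set Mink := {x ∈ P t | lor x n = -c}

/-- `f` restricts to an isometry from the horospherical section to Euclidean three-space: the
intrinsic metric of a horosphere is flat, and its squared distance is `⟨x - y, x - y⟩`. -/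
def IsHoroIsometry (t : ℝ) (n : Mink) (c : ℝ) (f : Mink → E3) : Prop :=
  ∀ x ∈ horoSection t n c, ∀ y ∈ horoSection t n c, dist (f x) (f y) ^ 2 = lor (x - y) (x - y)

/-- The link of the ideal vertex `n` (its section by any small horosphere) is a rectangular
parallelepiped; its `k`-th pair of opposite faces belongs to the walls `w k` and `w' k`. -/
def LinkIsBox (t : ℝ) (n : Mink) (w w' : Fin 3 → Label) : Prop :=
  ∃ c₀ > 0, ∀ c ∈ Ioo 0 c₀, ∃ (a : Fin 3 → ℝ) (f : Mink → E3), (∀ k, 0 < a k) ∧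
    IsHoroIsometry t n c f ∧
    f '' horoSection t n c = {y | ∀ k, 0 ≤ y k ∧ y k ≤ a k} ∧
    ∀ x ∈ horoSection t n c, ∀ k,
      (x ∈ wall t (w k) ↔ f x k = 0) ∧ (x ∈ wall t (w' k) ↔ f x k = a k)

/-- The union of the segments from `p` to `p + h • e`, for `p ∈ A`. -/
def prismOver (A : Set E3) (e : E3) (h : ℝ) : Set E3 :=
  {y | ∃ p ∈ A, ∃ r ∈ Icc 0 h, y = p + r • e}

/-- The link of the ideal vertex `n` is a right prism over an equilateral triangle; the lateral
faces belong to the walls `w 0, w 1, w 2` and the bases to the walls `b` and `b'`. -/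
def LinkIsPrism (t : ℝ) (n : Mink) (w : Fin 3 → Label) (b b' : Label) : Prop :=
  ∃ c₀ > 0, ∀ c ∈ Ioo 0 c₀,
    ∃ (q : Fin 3 → E3) (e : E3) (s h : ℝ) (f : Mink → E3), 0 < s ∧ 0 < h ∧ ‖e‖ = 1 ∧
      (∀ i j, i ≠ j → dist (q i) (q j) = s) ∧ (∀ i j, inner ℝ e (q i - q j) = 0) ∧
      IsHoroIsometry t n c f ∧
      f '' horoSection t n c = prismOver (convexHull ℝ (range q)) e h ∧
      ∀ x ∈ horoSection t n c,
        (∀ i, x ∈ wall t (w i) ↔ f x ∈ prismOver (convexHull ℝ (q '' {i}ᶜ)) e h) ∧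
        (x ∈ wall t b ↔ f x ∈ convexHull ℝ (range q)) ∧
        (x ∈ wall t b' ↔ f x ∈ convexHull ℝ (range fun i => q i + h • e))

/-- The link of the ideal vertex `n` is a regular Euclidean tetrahedron, with faces in the walls
`w 0, …, w 3`. -/
def LinkIsRegularTetrahedron (t : ℝ) (n : Mink) (w : Fin 4 → Label) : Prop :=
  ∃ c₀ > 0, ∀ c ∈ Ioo 0 c₀, ∃ (q : Fin 4 → E3) (s : ℝ) (f : Mink → E3), 0 < s ∧
    (∀ i j, i ≠ j → dist (q i) (q j) = s) ∧ IsHoroIsometry t n c f ∧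
    f '' horoSection t n c = convexHull ℝ (range q) ∧
    ∀ x ∈ horoSection t n c, ∀ i, x ∈ wall t (w i) ↔ f x ∈ convexHull ℝ (q '' {i}ᶜ)

/-! ### The kinds of vertices

The numbers `0, …, 7` label the vertices of a cube, the letters `A, …, F` its six sides. -/

/-- The vertices of the cube. -/
def corner : Fin 8 → Fin 3 → ℤ :=
  ![![1, 1, 1], ![1, -1, 1], ![1, -1, -1], ![1, 1, -1],
    ![-1, 1, -1], ![-1, 1, 1], ![-1, -1, 1], ![-1, -1, -1]]

/-- Two vertices of the cube joined by an edge, that is, differing in exactly one coordinate. -/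
def CubeAdj (i j : Fin 8) : Prop := ∃! k, corner i k ≠ corner j k

/-- A letter of type `A, …, F` whose side of the cube contains the vertex `i`. -/
def OnSide (X : Label) (i : Fin 8) : Prop :=
  (X = A ∧ corner i 0 = 1) ∨ (X = F ∧ corner i 0 = -1) ∨
  (X = B ∧ corner i 1 = 1) ∨ (X = E ∧ corner i 1 = -1) ∨
  (X = C ∧ corner i 2 = 1) ∨ (X = D ∧ corner i 2 = -1)

/-- The letter `G` for even numbers and the letter `H` for odd numbers. -/
def pole (k : Fin 8) : Label := if Even k.val then G else H

/-- The ideal vertices of type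
`∂∞(pos i) ∩ ∂∞(neg i) ∩ ∂∞(pos j) ∩ ∂∞(neg j) ∩ ∂∞X ∩ ∂∞Y` with `i` odd, `j` even,
and `X`, `Y` letters of type `A, …, F`, whose link is a rectangular parallelepiped. -/
def boxVertices (t : ℝ) : Set Mink :=
  {n ∈ idealVertices t | ∃ (i j : Fin 8) (X Y : Label), Odd i.val ∧ Even j.val ∧ CubeAdj i j ∧
    X ≠ Y ∧ OnSide X i ∧ OnSide X j ∧ OnSide Y i ∧ OnSide Y j ∧
    wallsAtIdeal t n = {pos i, neg i, pos j, neg j, X, Y} ∧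
    LinkIsBox t n ![pos i, neg i, X] ![pos j, neg j, Y]}

/-- The finite vertices on two positive walls, a negative wall and a letter wall of type
`A, …, F`, with link `I_{π/2} * I_θ`. -/
def letterVertices (t : ℝ) : Set Mink :=
  {x ∈ finVertices t | ∃ (i j k : Fin 8) (X : Label), i ≠ j ∧ CubeAdj i k ∧ CubeAdj j k ∧
    OnSide X i ∧ OnSide X j ∧ wallsThrough t {x} = {pos i, pos j, neg k, X} ∧
    LinkIsTetrahedron t x ![pos i, pos j, neg k, X] (joinAngles (theta t) (Real.pi / 2))}

/-- The finite vertices on two positive walls, a negative wall and one of the walls `G`, `H`, with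
link `I_φ * I_θ`. -/
def poleVertices (t : ℝ) : Set Mink :=
  {x ∈ finVertices t | ∃ i j k : Fin 8, i ≠ j ∧ CubeAdj i k ∧ CubeAdj j k ∧
    wallsThrough t {x} = {pos i, pos j, neg k, pole k} ∧
    LinkIsTetrahedron t x ![pos i, pos j, neg k, pole k] (joinAngles (theta t) (phi t))}

/-- `i`, `j`, `l` are the three neighbours of `k`. -/
def Neighbours (k i j l : Fin 8) : Prop :=
  i ≠ j ∧ i ≠ l ∧ j ≠ l ∧ CubeAdj i k ∧ CubeAdj j k ∧ CubeAdj l k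

/-- The ideal vertices on three positive walls, a negative wall and one of the walls `G`, `H`, with
link a right prism over an equilateral triangle. -/
def prismVertices (t : ℝ) : Set Mink :=
  {n ∈ idealVertices t | ∃ k i j l : Fin 8, Neighbours k i j l ∧
    wallsAtIdeal t n = {pos i, pos j, pos l, neg k, pole k} ∧
    LinkIsPrism t n ![pos i, pos j, pos l] (neg k) (pole k)}

/-- The finite vertices on three positive walls and a negative wall, with a link that has three
dihedral angles `θ` (between the positive walls) and three right ones. -/
def tripleNegVertices (t : ℝ) : Set Mink :=
  {x ∈ finVertices t | ∃ k i j l : Fin 8, Neighbours k i j l ∧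
    wallsThrough t {x} = {pos i, pos j, pos l, neg k} ∧
    LinkIsTetrahedron t x ![pos i, pos j, pos l, neg k] (coneAngles (theta t))}

/-- The finite vertices on three positive walls and one of the walls `G`, `H`, with the same kind
of link. -/
def triplePoleVertices (t : ℝ) : Set Mink :=
  {x ∈ finVertices t | ∃ k i j l : Fin 8, Neighbours k i j l ∧
    wallsThrough t {x} = {pos i, pos j, pos l, pole k} ∧
    LinkIsTetrahedron t x ![pos i, pos j, pos l, pole k] (coneAngles (theta t))}

/-- The four positive walls of a given parity: even for `true`, odd for `false`. -/
def parityWalls : Bool → Fin 4 → Label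
  | true => ![pos 0, pos 2, pos 4, pos 6]
  | false => ![pos 1, pos 3, pos 5, pos 7]

/-- The finite vertices on four positive walls of the same parity, with link the regular spherical
tetrahedron `Δ³(θ)`. -/
def apexVertices (t : ℝ) : Set Mink :=
  {x ∈ finVertices t | ∃ even : Bool, wallsThrough t {x} = range (parityWalls even) ∧
    LinkIsTetrahedron t x (parityWalls even) (regularAngles (theta t))}

/-- The ideal vertices on four positive walls of the same parity, with link a regular Euclidean
tetrahedron. -/
def idealApexVertices (t : ℝ) : Set Mink :=
  {n ∈ idealVertices t | ∃ even : Bool, wallsAtIdeal t n = range (parityWalls even) ∧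
    LinkIsRegularTetrahedron t n (parityWalls even)}

/-- The numbers of walls, faces, edges and (finite or ideal) vertices of `P_t`. -/
def HasCounts (t : ℝ) (walls faces edges vertices : ℕ∞) : Prop :=
  (strata t 3).encard = walls ∧ (strata t 2).encard = faces ∧ (strata t 1).encard = edges ∧
    numVertices t = vertices

end CellFamily

end

/-!
# The deforming polytopes `P_t`

The polytopes have a symmetry group of order 48, isomorphic to that of the cube, which is generated
by the isometries `gen`. Up to symmetry it suffices to consider a chamber
(`chamber_induction`, `slice_induction`), and there the inequalities of the four walls `A`, `pos 0`,
`neg 3` and `H` imply all the others (`pt_mem_slice_iff`). In the projective model `x₀ = 1` the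
polytope becomes a Euclidean polyhedron, and two elementary estimates show that this polyhedron lies
in the closed ball and touches the sphere only in the expected points (`InChamber.ball`,
`InChamber.sphere`). These points are the ideal vertices; their links are computed in Euclidean
coordinates on horospheres (`exists_horoSection`).

The chamber also shows which sets of walls can meet in a finite point (`tight_chamber`, `Covers`).
These sets are few orbits; the maximal ones are realized by explicit points (`Realized`) and consist
of independent half-spaces (`Free`). Hence the sets of walls that meet form an explicit simplicial
complex, and the polytope is simple (`IsComplex`): its strata of dimension `k` correspond to the
members of the complex with `4 - k` elements (`IsComplex.encard_strata`). Together with the incidence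
sets of the ideal vertices this determines the whole combinatorics (`HasType`). The numbers of walls,
faces, edges, vertices and corners are therefore obtained by inspection of finite lists, and the
face posets of two polytopes of the same type are identified through the incidence sets
(`HasType.labelledCombEquiv`). Conversely, the numbers of finite vertices on the six pieces of the
parameter interval are `34`, `32`, `40`, `24`, `48` and `0`, and they are invariants of the
combinatorics (`piece_cases`, `CombEquiv.encard_finVertices`).

At a finite vertex the link is determined by the Gram matrix of the four walls
(`linkIsTetrahedron_of`). Two walls that meet are orthogonal unless they form a red or a green pair,
and this determines the angles along edges and at corners by orthogonal projection
(`edgeAngle_spec`, `cornerAngle_spec`).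

The volume is finite since the polyhedron in the model is the convex hull of finitely many points of
the closed ball, by the Krein–Milman theorem. Distinct points of the ball have negative
products, so that far away the polytope is concentrated near the finitely many rays through these
points (`exists_near_rays`, `hypVol_P_lt_top`).
-/

namespace CellFamily

open Label

/-! ### The Lorentzian product -/

theorem lor_comm (x y : Mink) : lor x y = lor y x := by simp only [lor]; ring

theorem lor_add_left (x y z : Mink) : lor (x + y) z = lor x z + lor y z := by
  simp only [lor, Pi.add_apply]; ring

theorem lor_smul_left (c : ℝ) (x z : Mink) : lor (c • x) z = c * lor x z := by
  simp only [lor, Pi.smul_apply, smul_eq_mul]; ring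

theorem lor_sub_left (x y z : Mink) : lor (x - y) z = lor x z - lor y z := by
  simp only [lor, Pi.sub_apply]; ring

theorem lor_add_right (x y z : Mink) : lor x (y + z) = lor x y + lor x z := by
  simp only [lor, Pi.add_apply]; ring

theorem lor_smul_right (c : ℝ) (x z : Mink) : lor x (c • z) = c * lor x z := by
  simp only [lor, Pi.smul_apply, smul_eq_mul]; ring

theorem lor_sub_right (x y z : Mink) : lor x (y - z) = lor x y - lor x z := by
  simp only [lor, Pi.sub_apply]; ring

/-- The Lorentzian product as a linear form in its first argument. -/
def lorForm (v : Mink) : Mink →ₗ[ℝ] ℝ where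
  toFun x := lor x v
  map_add' x y := lor_add_left x y v
  map_smul' c x := lor_smul_left c x v

@[simp] theorem lorForm_apply (v x : Mink) : lorForm v x = lor x v := rfl

theorem lor_sum_left {ι : Type*} (s : Finset ι) (f : ι → Mink) (z : Mink) :
    lor (∑ i ∈ s, f i) z = ∑ i ∈ s, lor (f i) z :=
  map_sum (lorForm z) f s

theorem lor_sum_right {ι : Type*} (s : Finset ι) (f : ι → Mink) (z : Mink) :
    lor z (∑ i ∈ s, f i) = ∑ i ∈ s, lor z (f i) := by
  simp only [lor_comm z, lor_sum_left]

@[fun_prop]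
theorem continuous_lor {X : Type*} [TopologicalSpace X] {f g : X → Mink} (hf : Continuous f)
    (hg : Continuous g) : Continuous fun x => lor (f x) (g x) := by
  unfold lor; fun_prop

/-- Two distinct points of the closed unit ball of the slice `x₀ = 1` have a negative product. -/
theorem lor_neg_of_ne {p q : Mink} (hp : p 0 = 1) (hq : q 0 = 1) (hpp : lor p p ≤ 0)
    (hqq : lor q q ≤ 0) (hne : p ≠ q) : lor p q < 0 := by
  have h : 0 < lor (p - q) (p - q) := by
    have h0 : ¬ (p 1 = q 1 ∧ p 2 = q 2 ∧ p 3 = q 3 ∧ p 4 = q 4) := by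
      rintro ⟨h1, h2, h3, h4⟩
      apply hne
      ext i
      fin_cases i <;> simp [*]
    simp only [lor, Pi.sub_apply, hp, hq]
    by_contra hle
    apply h0
    have e1 := sq_nonneg (p 1 - q 1)
    have e2 := sq_nonneg (p 2 - q 2)
    have e3 := sq_nonneg (p 3 - q 3)
    have e4 := sq_nonneg (p 4 - q 4)
    refine ⟨?_, ?_, ?_, ?_⟩ <;> refine sub_eq_zero.1 (pow_eq_zero_iff (two_ne_zero)|>.1 ?_) <;> nlinarith
  rw [lor_sub_left, lor_sub_right, lor_sub_right, lor_comm q p] at h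
  linarith

/-! ### The half-spaces and their symmetries -/

/-- A numbering of the labels. -/
def code : Label → ℕ
  | pos i => i
  | neg i => 8 + i
  | A => 16 | B => 17 | C => 18 | D => 19 | E => 20 | F => 21 | G => 22 | H => 23

theorem code_injective : Function.Injective code := by
  intro a b h
  cases a <;> cases b <;> simp only [code] at h <;> first | rfl | omega | (congr 1; omega)

instance : DecidableEq Label := fun a b => decidable_of_iff (code a = code b) code_injective.eq_iff

theorem code_lt (l : Label) : code l < 24 := by
  cases l <;> simp only [code] <;> omega

instance : Finite Label :=
  Finite.of_injective (fun l => (⟨code l, code_lt l⟩ : Fin 24)) fun a b h =>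
    code_injective (by simpa using h)

/-- The parity sign `(-1)^i`, which is the product of the coordinates of the vertex `i` of the
cube. -/
def eps (i : Fin 8) : ℤ := corner i 0 * corner i 1 * corner i 2

theorem vec_pos (t : ℝ) (i : Fin 8) :
    vec t (pos i) = ![√2, corner i 0, corner i 1, corner i 2, eps i / t] := by
  fin_cases i <;> simp [vec, corner, eps]

theorem vec_neg (t : ℝ) (i : Fin 8) :
    vec t (neg i) = ![√2, corner i 0, corner i 1, corner i 2, -(eps i * t)] := by
  fin_cases i <;> simp [vec, corner, eps]

/-- The point of the slice `x₀ = 1` with the coordinates `y₁, y₂, y₃, z`, all scaled by `1 / √2`,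
which makes the equations of the walls rational in `t`. -/
noncomputable def pt (y₁ y₂ y₃ z : ℝ) : Mink := ![1, y₁ / √2, y₂ / √2, y₃ / √2, z / √2]

/-- Every point of the slice `x₀ = 1` has such coordinates. -/
theorem eq_pt {p : Mink} (h : p 0 = 1) : p = pt (√2 * p 1) (√2 * p 2) (√2 * p 3) (√2 * p 4) := by
  ext i
  fin_cases i <;> simp [pt, h]

theorem lor_pt_pt (y₁ y₂ y₃ z y₁' y₂' y₃' z' : ℝ) : lor (pt y₁ y₂ y₃ z) (pt y₁' y₂' y₃' z') =
    (y₁ * y₁' + y₂ * y₂' + y₃ * y₃' + z * z' - 2) / 2 := by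
  have h : √2 * √2 = 2 := Real.mul_self_sqrt (by norm_num)
  simp [pt, lor, div_mul_div_comm, h]
  ring

theorem lor_pt_pos (y₁ y₂ y₃ z t : ℝ) (i : Fin 8) : lor (pt y₁ y₂ y₃ z) (vec t (pos i)) =
    (corner i 0 * y₁ + corner i 1 * y₂ + corner i 2 * y₃ + eps i * (z / t) - 2) / √2 := by
  have h : √2 * √2 = 2 := Real.mul_self_sqrt (by norm_num)
  have h0 : √2 ≠ 0 := by positivity
  rw [vec_pos, eq_div_iff h0]
  simp [pt, lor]
  field_simp
  linear_combination -h

theorem lor_pt_neg (y₁ y₂ y₃ z t : ℝ) (i : Fin 8) : lor (pt y₁ y₂ y₃ z) (vec t (neg i)) =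
    (corner i 0 * y₁ + corner i 1 * y₂ + corner i 2 * y₃ - eps i * (t * z) - 2) / √2 := by
  have h : √2 * √2 = 2 := Real.mul_self_sqrt (by norm_num)
  have h0 : √2 ≠ 0 := by positivity
  rw [vec_neg, eq_div_iff h0]
  simp [pt, lor]
  field_simp
  linear_combination -h

section

variable (y₁ y₂ y₃ z t : ℝ)

theorem lor_pt_A : lor (pt y₁ y₂ y₃ z) (vec t A) = y₁ - 1 := by
  simp [pt, vec, lor]; ring

theorem lor_pt_B : lor (pt y₁ y₂ y₃ z) (vec t B) = y₂ - 1 := by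
  simp [pt, vec, lor]; ring

theorem lor_pt_C : lor (pt y₁ y₂ y₃ z) (vec t C) = y₃ - 1 := by
  simp [pt, vec, lor]; ring

theorem lor_pt_D : lor (pt y₁ y₂ y₃ z) (vec t D) = -y₃ - 1 := by
  simp [pt, vec, lor]; ring

theorem lor_pt_E : lor (pt y₁ y₂ y₃ z) (vec t E) = -y₂ - 1 := by
  simp [pt, vec, lor]; ring

theorem lor_pt_F : lor (pt y₁ y₂ y₃ z) (vec t F) = -y₁ - 1 := by
  simp [pt, vec, lor]; ring

theorem lor_pt_G : lor (pt y₁ y₂ y₃ z) (vec t G) = -(t * z) - 1 := by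
  have h0 : √2 ≠ 0 := by positivity
  simp [pt, vec, lor]; field_simp; ring

theorem lor_pt_H : lor (pt y₁ y₂ y₃ z) (vec t H) = t * z - 1 := by
  have h0 : √2 ≠ 0 := by positivity
  simp [pt, vec, lor]; field_simp; ring

end

/-- The permutations of the vertices of the cube induced by the isometries `gen j` below. -/
def cornerPerm : Fin 3 → Fin 8 → Fin 8 :=
  ![![0, 5, 4, 3, 2, 1, 6, 7], ![0, 3, 2, 1, 6, 5, 4, 7], ![3, 2, 1, 0, 5, 4, 7, 6]]

/-- The permutations of the half-spaces induced by the isometries `gen j`. -/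
def genLabel : Fin 3 → Label → Label
  | j, pos i => pos (cornerPerm j i)
  | j, neg i => neg (cornerPerm j i)
  | 0, A => B | 0, B => A | 0, E => F | 0, F => E
  | 1, B => C | 1, C => B | 1, D => E | 1, E => D
  | 2, C => D | 2, D => C | 2, G => H | 2, H => G
  | _, l => l

/-- Generators of the symmetry group of all the polytopes `P_t`, which is isomorphic to the symmetry
group of the cube: the exchange of the first two and of the second two of the coordinates
`x₁, x₂, x₃`, and the change of the signs of `x₃` and `x₄`. -/
def gen : Fin 3 → Mink →ₗ[ℝ] Mink :=
  ![{ toFun := fun x => ![x 0, x 2, x 1, x 3, x 4]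
      map_add' := fun x y => by ext i; fin_cases i <;> simp
      map_smul' := fun c x => by ext i; fin_cases i <;> simp },
    { toFun := fun x => ![x 0, x 1, x 3, x 2, x 4]
      map_add' := fun x y => by ext i; fin_cases i <;> simp
      map_smul' := fun c x => by ext i; fin_cases i <;> simp },
    { toFun := fun x => ![x 0, x 1, x 2, -x 3, -x 4]
      map_add' := fun x y => by ext i; fin_cases i <;> simp [add_comm]
      map_smul' := fun c x => by ext i; fin_cases i <;> simp }]

theorem gen_zero_apply (x : Mink) : gen 0 x = ![x 0, x 2, x 1, x 3, x 4] := rfl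

theorem gen_one_apply (x : Mink) : gen 1 x = ![x 0, x 1, x 3, x 2, x 4] := rfl

theorem gen_two_apply (x : Mink) : gen 2 x = ![x 0, x 1, x 2, -x 3, -x 4] := rfl

theorem gen_coord_zero (j : Fin 3) (x : Mink) : gen j x 0 = x 0 := by
  fin_cases j <;> simp [gen]

theorem gen_gen (j : Fin 3) (x : Mink) : gen j (gen j x) = x := by
  fin_cases j <;> ext i <;> fin_cases i <;> simp [gen]

theorem lor_gen_gen (j : Fin 3) (x y : Mink) : lor (gen j x) (gen j y) = lor x y := by
  fin_cases j <;> simp [gen, lor] <;> ring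

theorem genLabel_genLabel (j : Fin 3) (l : Label) : genLabel j (genLabel j l) = l := by
  have h : ∀ j i, cornerPerm j (cornerPerm j i) = i := by decide
  cases l with
  | pos i => simp only [genLabel, h]
  | neg i => simp only [genLabel, h]
  | _ => fin_cases j <;> rfl

theorem gen_vec (j : Fin 3) (t : ℝ) (l : Label) : gen j (vec t l) = vec t (genLabel j l) := by
  cases l with
  | pos i =>
    fin_cases j <;> fin_cases i <;> simp [gen, vec, genLabel, cornerPerm, neg_div]
  | neg i =>
    fin_cases j <;> fin_cases i <;> simp [gen, vec, genLabel, cornerPerm]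
  | _ => fin_cases j <;> simp [gen, vec, genLabel]

theorem lor_gen_vec (j : Fin 3) (t : ℝ) (x : Mink) (l : Label) :
    lor (gen j x) (vec t (genLabel j l)) = lor x (vec t l) := by
  rw [← gen_vec, lor_gen_gen]

theorem lor_gen_vec' (j : Fin 3) (t : ℝ) (x : Mink) (l : Label) :
    lor (gen j x) (vec t l) = lor x (vec t (genLabel j l)) := by
  rw [← lor_gen_vec j t _ l, gen_gen]

theorem genLabel_mem_active {t : ℝ} (j : Fin 3) {l : Label} (h : l ∈ active t) :
    genLabel j l ∈ active t := by
  unfold active at *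
  simp only [mem_ofPred_eq] at *
  intro hG
  apply h
  fin_cases j <;> cases l <;> simp_all [genLabel]

/-- Every vector can be moved by the symmetries to one with `x₁ ≥ x₂ ≥ |x₃|` and `x₄ ≥ 0`. -/
theorem chamber_induction {Q : Mink → Prop}
    (chamber : ∀ x : Mink, x 2 ≤ x 1 → x 3 ≤ x 2 → -x 3 ≤ x 2 → 0 ≤ x 4 → Q x)
    (hgen : ∀ j x, Q (gen j x) → Q x) (x : Mink) : Q x := by
  have h0 : ∀ a b c d e : ℝ, Q ![a, c, b, d, e] → Q ![a, b, c, d, e] := fun a b c d e h =>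
    hgen 0 _ (by simpa [gen_zero_apply] using h)
  have h1 : ∀ a b c d e : ℝ, Q ![a, b, d, c, e] → Q ![a, b, c, d, e] := fun a b c d e h =>
    hgen 1 _ (by simpa [gen_one_apply] using h)
  have h2 : ∀ a b c d e : ℝ, Q ![a, b, c, -d, -e] → Q ![a, b, c, d, e] := fun a b c d e h =>
    hgen 2 _ (by simpa [gen_two_apply] using h)
  have hx : x = ![x 0, x 1, x 2, x 3, x 4] := by ext i; fin_cases i <;> rfl
  rw [hx]
  generalize x 0 = a
  generalize x 1 = b
  generalize x 2 = c
  generalize x 3 = d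
  generalize x 4 = e
  -- sign changes of two of the first three spatial coordinates
  have s23 : ∀ a b c d e : ℝ, Q ![a, b, -c, -d, e] → Q ![a, b, c, d, e] := fun a b c d e h =>
    h2 _ _ _ _ _ (h1 _ _ _ _ _ (h2 _ _ _ _ _ (h1 _ _ _ _ _ (by simpa using h))))
  have s13 : ∀ a b c d e : ℝ, Q ![a, -b, c, -d, e] → Q ![a, b, c, d, e] := fun a b c d e h =>
    h0 _ _ _ _ _ (s23 _ _ _ _ _ (h0 _ _ _ _ _ h))
  have key : ∀ a b c d e : ℝ, 0 ≤ e → |c| ≤ |b| → |d| ≤ |c| → Q ![a, b, c, d, e] := by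
    intro a b c d e he hbc hcd
    have base : ∀ b c d : ℝ, 0 ≤ b → 0 ≤ c → |c| ≤ |b| → |d| ≤ |c| → Q ![a, b, c, d, e] := by
      intro b c d hb hc h h'
      rw [abs_of_nonneg hb, abs_of_nonneg hc] at h
      rw [abs_of_nonneg hc, abs_le] at h'
      apply chamber <;> simp <;> linarith
    have base2 : ∀ b c d : ℝ, 0 ≤ b → |c| ≤ |b| → |d| ≤ |c| → Q ![a, b, c, d, e] := by
      intro b c d hb h h'
      rcases le_total 0 c with hc | hc
      · exact base _ _ _ hb hc h h'
      · exact s23 _ _ _ _ _ (base _ _ _ hb (by linarith) (by simpa) (by simpa))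
    rcases le_total 0 b with hb | hb
    · exact base2 _ _ _ hb hbc hcd
    · exact s13 _ _ _ _ _ (base2 _ _ _ (by linarith) (by simpa) (by simpa))
  have key2 : ∀ a b c d e : ℝ, 0 ≤ e → Q ![a, b, c, d, e] := by
    intro a b c d e he
    rcases le_total |c| |b| with h | h <;> rcases le_total |d| |c| with h' | h' <;>
      rcases le_total |d| |b| with h'' | h''
    · exact key _ _ _ _ _ he h h'
    · exact key _ _ _ _ _ he h h'
    · exact h1 _ _ _ _ _ (key _ _ _ _ _ he h'' h')
    · exact h1 _ _ _ _ _ (h0 _ _ _ _ _ (key _ _ _ _ _ he h'' h))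
    · exact h0 _ _ _ _ _ (key _ _ _ _ _ he h h'')
    · exact h0 _ _ _ _ _ (h1 _ _ _ _ _ (key _ _ _ _ _ he h' h''))
    · exact h0 _ _ _ _ _ (h1 _ _ _ _ _ (h0 _ _ _ _ _ (key _ _ _ _ _ he h' h)))
    · exact h0 _ _ _ _ _ (h1 _ _ _ _ _ (h0 _ _ _ _ _ (key _ _ _ _ _ he h' h)))
  rcases le_total 0 e with he | he
  · exact key2 _ _ _ _ _ he
  · exact h2 _ _ _ _ _ (key2 _ _ _ _ _ (by linarith))

end CellFamily

namespace CellFamily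

open Label Filter Topology

/-! ### Strata and their closures -/

/-- The polyhedron in the slice `x₀ = 1` cut out by the half-spaces. -/
def slice (t : ℝ) : Set Mink := {p | p 0 = 1 ∧ ∀ l ∈ active t, lor p (vec t l) ≤ 0}

/-- The half-spaces whose boundaries contain `x`. -/
def tight (t : ℝ) (x : Mink) : Set Label := {l ∈ active t | lor x (vec t l) = 0}

/-- The vectors orthogonal to the vectors of `T`. -/
def perp (t : ℝ) (T : Set Label) : Submodule ℝ Mink where
  carrier := {u | ∀ l ∈ T, lor u (vec t l) = 0}
  add_mem' ha hb l hl := by rw [lor_add_left, ha l hl, hb l hl, add_zero]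
  zero_mem' l _ := by simp [lor]
  smul_mem' c u hu l hl := by rw [lor_smul_left, hu l hl, mul_zero]

/-- The face of the compactified polytope cut out by the walls in `I`. -/
def closedStratum (t : ℝ) (I : Set Label) : Set Mink :=
  {p ∈ slice t | lor p p ≤ 0 ∧ ∀ l ∈ I, lor p (vec t l) = 0}

/-- The polytope is simple: the half-spaces whose boundaries meet in a point of `P_t` are
independent. -/
def IsSimple (t : ℝ) : Prop :=
  ∀ x ∈ P t, ∀ b : Label → ℝ, ∃ u, ∀ l ∈ tight t x, lor u (vec t l) = b l

variable {t : ℝ}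

theorem tight_subset_active (x : Mink) : tight t x ⊆ active t := fun _ h => h.1

theorem lor_neg_of_notMem_tight {x : Mink} (hx : x ∈ P t) {l : Label} (hl : l ∈ active t)
    (h : l ∉ tight t x) : lor x (vec t l) < 0 :=
  lt_of_le_of_ne (hx.2 l hl) fun h0 => h ⟨hl, h0⟩

theorem tight_smul {c : ℝ} (hc : c ≠ 0) (x : Mink) : tight t (c • x) = tight t x := by
  ext l; simp [tight, lor_smul_left, hc]

theorem tight_gen (j : Fin 3) (x : Mink) : tight t (gen j x) = genLabel j ⁻¹' tight t x := by
  ext l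
  simp only [tight, lor_gen_vec', mem_preimage, mem_ofPred_eq]
  refine and_congr_left fun _ => ⟨genLabel_mem_active j, fun h => ?_⟩
  rw [← genLabel_genLabel j l]
  exact genLabel_mem_active j h

theorem gen_mem_slice (j : Fin 3) {x : Mink} (hx : x ∈ slice t) : gen j x ∈ slice t :=
  ⟨by rw [gen_coord_zero, hx.1], fun l hl => by
    rw [lor_gen_vec']; exact hx.2 _ (genLabel_mem_active j hl)⟩

theorem exists_smul_mem_P {p : Mink} (h0 : 0 < p 0) (hp : lor p p < 0)
    (h : ∀ l ∈ active t, lor p (vec t l) ≤ 0) : ∃ c : ℝ, 0 < c ∧ c • p ∈ P t := by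
  have hs : 0 < √(-lor p p) := Real.sqrt_pos.2 (by linarith)
  refine ⟨(√(-lor p p))⁻¹, inv_pos.2 hs, ⟨?_, ?_⟩, ?_⟩
  · rw [lor_smul_left, lor_smul_right]
    have h2 : √(-lor p p) * √(-lor p p) = -lor p p := Real.mul_self_sqrt (by linarith)
    field_simp
    linarith
  · simpa using mul_pos (inv_pos.2 hs) h0
  · intro l hl
    rw [lor_smul_left]
    exact mul_nonpos_of_nonneg_of_nonpos (inv_pos.2 hs).le (h l hl)

theorem inv_smul_mem_slice {x : Mink} (hx : x ∈ P t) : (x 0)⁻¹ • x ∈ slice t := by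
  have h0 := hx.1.2
  refine ⟨by simp [h0.ne'], fun l hl => ?_⟩
  rw [lor_smul_left]
  exact mul_nonpos_of_nonneg_of_nonpos (inv_pos.2 h0).le (hx.2 l hl)

theorem lor_inv_smul_neg {x : Mink} (hx : x ∈ Hyp) : lor ((x 0)⁻¹ • x) ((x 0)⁻¹ • x) < 0 := by
  rw [lor_smul_left, lor_smul_right, hx.1]
  have := inv_pos.2 hx.2
  nlinarith [mul_pos this this]

theorem exists_mem_P_of_slice {p : Mink} (hp : p ∈ slice t) (h : lor p p < 0) :
    ∃ c : ℝ, 0 < c ∧ c • p ∈ P t :=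
  exists_smul_mem_P (by rw [hp.1]; norm_num) h hp.2

/-- Two points of the hyperboloid on a common ray are equal. -/
theorem eq_of_smul_mem_Hyp {x y : Mink} (hx : x ∈ Hyp) (hy : y ∈ Hyp) {c : ℝ} (h : y = c • x) :
    y = x := by
  have h1 := hy.1
  have h2 := hy.2
  rw [h, lor_smul_left, lor_smul_right, hx.1] at h1
  have h3 : 0 < c * x 0 := by simpa [h] using h2
  have hc : 0 < c := pos_of_mul_pos_left h3 hx.2.le
  have : c = 1 := by nlinarith
  rw [h, this, one_smul]

/-- A point `x` of the polytope can be moved a little in any direction that does not leave the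
half-spaces whose boundaries contain `x`; it then stays on those walls that are parallel to the
direction, and meets no others. -/
theorem exists_perturbation {x : Mink} (hx : x ∈ P t) {u : Mink}
    (hu : ∀ l ∈ tight t x, lor u (vec t l) ≤ 0) :
    ∃ ε > (0 : ℝ), ∃ c > (0 : ℝ), c • (x + ε • u) ∈ P t ∧
      tight t (c • (x + ε • u)) = {l ∈ tight t x | lor u (vec t l) = 0} := by
  have c1 : Continuous fun ε : ℝ => (x + ε • u) 0 := by fun_prop
  have c2 : Continuous fun ε : ℝ => lor (x + ε • u) (x + ε • u) := by fun_prop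
  have c3 : ∀ l, Continuous fun ε : ℝ => lor (x + ε • u) (vec t l) := fun l => by fun_prop
  have e1 : ∀ᶠ ε in 𝓝[>] (0 : ℝ), 0 < (x + ε • u) 0 :=
    nhdsWithin_le_nhds (c1.continuousAt.eventually (lt_mem_nhds (by simpa using hx.1.2)))
  have e2 : ∀ᶠ ε in 𝓝[>] (0 : ℝ), lor (x + ε • u) (x + ε • u) < 0 :=
    nhdsWithin_le_nhds (c2.continuousAt.eventually (gt_mem_nhds (by simp [hx.1.1])))
  have e3 : ∀ᶠ ε in 𝓝[>] (0 : ℝ), ∀ l, l ∈ active t → l ∉ tight t x →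
      lor (x + ε • u) (vec t l) < 0 := by
    refine eventually_all.2 fun l => ?_
    by_cases hl : l ∈ active t ∧ l ∉ tight t x
    · filter_upwards [nhdsWithin_le_nhds ((c3 l).continuousAt.eventually
        (gt_mem_nhds (by simpa using lor_neg_of_notMem_tight hx hl.1 hl.2)))] with ε h _ _ using h
    · exact Eventually.of_forall fun ε h h' => absurd ⟨h, h'⟩ hl
  obtain ⟨ε, ⟨⟨h1, h2⟩, h3⟩, hε⟩ := (((e1.and e2).and e3).and self_mem_nhdsWithin).exists
  have hε : 0 < ε := hε
  have h4 : ∀ l ∈ tight t x, lor (x + ε • u) (vec t l) = ε * lor u (vec t l) := fun l hl => by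
    rw [lor_add_left, lor_smul_left, hl.2, zero_add]
  obtain ⟨c, hc, hm⟩ := exists_smul_mem_P (t := t) h1 h2 fun l hl => by
    by_cases h : l ∈ tight t x
    · rw [h4 l h]; exact mul_nonpos_of_nonneg_of_nonpos hε.le (hu l h)
    · exact (h3 l hl h).le
  refine ⟨ε, hε, c, hc, hm, ?_⟩
  rw [tight_smul hc.ne']
  ext l
  constructor
  · rintro ⟨hl, h0⟩
    by_cases h : l ∈ tight t x
    · rw [h4 l h] at h0
      exact ⟨h, (mul_eq_zero.1 h0).resolve_left hε.ne'⟩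
    · exact absurd h0 (h3 l hl h).ne
  · rintro ⟨h, h0⟩
    exact ⟨h.1, by rw [h4 l h, h0, mul_zero]⟩

/-- If the polytope is simple, every set of walls through a point occurs as the full set of walls
through some other point. -/
theorem IsSimple.exists_tight_eq (hs : IsSimple t) {x : Mink} (hx : x ∈ P t) {S : Set Label}
    (hS : S ⊆ tight t x) : ∃ y ∈ P t, tight t y = S := by
  classical
  obtain ⟨u, hu⟩ := hs x hx fun l => if l ∈ S then 0 else -1
  obtain ⟨ε, _, c, _, hm, ht⟩ := exists_perturbation hx (u := u) fun _ hl => by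
    rw [hu _ hl]; split_ifs <;> norm_num
  refine ⟨_, hm, ht.trans ?_⟩
  ext l
  constructor
  · rintro ⟨h, h0⟩
    by_contra hl
    rw [hu l h, if_neg hl] at h0
    norm_num at h0
  · intro hl
    exact ⟨hS hl, by rw [hu l (hS hl), if_pos hl]⟩

theorem self_mem_stratum {x : Mink} (hx : x ∈ P t) : x ∈ stratum t (tight t x) :=
  ⟨hx, fun _ hl => hl.2⟩

theorem mem_stratum_iff {x : Mink} (hx : x ∈ P t) {I : Set Label} (hI : I ⊆ active t) :
    x ∈ stratum t I ↔ I ⊆ tight t x :=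
  ⟨fun h l hl => ⟨hI hl, h.2 l hl⟩, fun h => ⟨hx, fun _ hl => (h hl).2⟩⟩

/-- The linear hull of a stratum is the orthogonal complement of the walls through its relatively
interior points. -/
theorem span_stratum {x : Mink} (hx : x ∈ P t) :
    Submodule.span ℝ (stratum t (tight t x)) = perp t (tight t x) := by
  apply le_antisymm
  · rw [Submodule.span_le]
    exact fun y hy => hy.2
  · intro u hu
    obtain ⟨ε, hε, c, hc, hm, ht⟩ := exists_perturbation hx (u := u) fun l hl => (hu l hl).le
    have h1 : x + ε • u ∈ Submodule.span ℝ (stratum t (tight t x)) := by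
      rw [← Submodule.smul_mem_iff _ hc.ne']
      refine Submodule.subset_span ⟨hm, fun l hl => ?_⟩
      rw [lor_smul_left, lor_add_left, lor_smul_left, hl.2, hu l hl, mul_zero, add_zero, mul_zero]
    have h2 := Submodule.sub_mem _ h1 (Submodule.subset_span (self_mem_stratum hx))
    rw [add_sub_cancel_left] at h2
    exact (Submodule.smul_mem_iff _ hε.ne').1 h2

/-- Independent half-spaces cut the dimension down by one each. -/
theorem finrank_perp {T : Set Label} (hT : ∀ b : Label → ℝ, ∃ u, ∀ l ∈ T, lor u (vec t l) = b l) :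
    Module.finrank ℝ (perp t T) + T.ncard = 5 := by
  classical
  have : Fintype T := Fintype.ofFinite T
  let f : Mink →ₗ[ℝ] (T → ℝ) := LinearMap.pi fun l => lorForm (vec t l)
  have hf : Function.Surjective f := by
    intro b
    obtain ⟨u, hu⟩ := hT fun l => if h : l ∈ T then b ⟨l, h⟩ else 0
    refine ⟨u, ?_⟩
    ext l
    simp [f, hu l l.2]
  have hk : LinearMap.ker f = perp t T := by
    ext u
    rw [LinearMap.mem_ker, funext_iff]
    exact ⟨fun h l hl => h ⟨l, hl⟩, fun h l => h l l.2⟩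
  have h := LinearMap.finrank_range_add_finrank_ker f
  rw [LinearMap.range_eq_top.2 hf, finrank_top, hk, Module.finrank_fintype_fun_eq_card,
    Module.finrank_fintype_fun_eq_card, Fintype.card_fin, ← Nat.card_eq_fintype_card,
    Nat.card_coe_set_eq] at h
  omega

/-- The midpoint of two points of the polytope lies exactly on the walls that contain both. -/
theorem exists_add_mem_P {x y : Mink} (hx : x ∈ P t) (hy : y ∈ P t) :
    ∃ c > (0 : ℝ), c • (x + y) ∈ P t ∧ tight t (c • (x + y)) = tight t x ∩ tight t y := by
  have hxy : lor x y < 0 := by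
    rcases eq_or_ne ((x 0)⁻¹ • x) ((y 0)⁻¹ • y) with h | h
    · have h2 : y = (y 0 * (x 0)⁻¹) • x := by
        rw [mul_smul, h, smul_inv_smul₀ hy.1.2.ne']
      rw [eq_of_smul_mem_Hyp hx.1 hy.1 h2, hx.1.1]
      norm_num
    · have := lor_neg_of_ne (inv_smul_mem_slice hx).1 (inv_smul_mem_slice hy).1
        (lor_inv_smul_neg hx.1).le (lor_inv_smul_neg hy.1).le h
      rw [lor_smul_left, lor_smul_right] at this
      have hx0 := inv_pos.2 hx.1.2
      have hy0 := inv_pos.2 hy.1.2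
      by_contra hle
      nlinarith [mul_nonneg hx0.le (mul_nonneg hy0.le (not_lt.1 hle))]
  obtain ⟨c, hc, hm⟩ := exists_smul_mem_P (t := t) (p := x + y) (by
      simpa using add_pos hx.1.2 hy.1.2) (by
      rw [lor_add_left, lor_add_right, lor_add_right, hx.1.1, hy.1.1, lor_comm y x]
      linarith) fun l hl => by
      rw [lor_add_left]; linarith [hx.2 l hl, hy.2 l hl]
  refine ⟨c, hc, hm, ?_⟩
  rw [tight_smul hc.ne']
  ext l
  constructor
  · rintro ⟨hl, h0⟩
    rw [lor_add_left] at h0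
    have h1 := hx.2 l hl
    have h2 := hy.2 l hl
    exact ⟨⟨hl, by linarith⟩, ⟨hl, by linarith⟩⟩
  · rintro ⟨h1, h2⟩
    exact ⟨h1.1, by rw [lor_add_left, h1.2, h2.2, add_zero]⟩

/-- Every nonempty stratum has a relatively interior point. -/
theorem exists_stratum_eq {I : Set Label} (hI : I ⊆ active t) (hne : (stratum t I).Nonempty) :
    ∃ x ∈ P t, I ⊆ tight t x ∧ stratum t I = stratum t (tight t x) := by
  obtain ⟨x, hx, hmin⟩ := exists_minimalFor_of_wellFoundedLT (· ∈ stratum t I)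
    (fun x => (tight t x).ncard) hne
  have hIx := (mem_stratum_iff hx.1 hI).1 hx
  refine ⟨x, hx.1, hIx, Subset.antisymm (fun y hy => ?_) fun y hy => ⟨hy.1, fun l hl =>
    hy.2 l (hIx hl)⟩⟩
  obtain ⟨c, hc, hm, ht⟩ := exists_add_mem_P hx.1 hy.1
  have h1 : c • (x + y) ∈ stratum t I := by
    rw [mem_stratum_iff hm hI, ht]
    exact subset_inter hIx ((mem_stratum_iff hy.1 hI).1 hy)
  have h2 := hmin h1 (by simp only [ht]; exact ncard_le_ncard inter_subset_left)
  simp only [ht] at h2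
  have h3 : tight t x ∩ tight t y = tight t x := eq_of_subset_of_ncard_le inter_subset_left h2
  rw [mem_stratum_iff hy.1 (tight_subset_active x), ← h3]
  exact inter_subset_right

theorem wallsThrough_stratum {x : Mink} (hx : x ∈ P t) :
    wallsThrough t (stratum t (tight t x)) = tight t x := by
  ext l
  constructor
  · rintro ⟨hl, h⟩
    exact ⟨hl, (h (self_mem_stratum hx)).2 l rfl⟩
  · intro hl
    exact ⟨hl.1, fun y hy => ⟨hy.1, fun l' hl' => by rw [hl']; exact hy.2 l hl⟩⟩

theorem wallsThrough_singleton {x : Mink} (hx : x ∈ P t) : wallsThrough t {x} = tight t x := by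
  ext l
  simp only [wallsThrough, wall, stratum, tight, mem_ofPred_eq, singleton_subset_iff,
    mem_singleton_iff, forall_eq, hx, true_and]

/-- In a simple polytope the strata of dimension `k` are those cut out by the `4 - k` walls through
one of their points. -/
theorem mem_strata_iff (hs : IsSimple t) {k : ℕ} {S : Set Mink} :
    S ∈ strata t k ↔ ∃ x ∈ P t, (tight t x).ncard + k = 4 ∧ S = stratum t (tight t x) := by
  constructor
  · rintro ⟨⟨I, hI, rfl⟩, hne, hk⟩
    obtain ⟨x, hx, -, he⟩ := exists_stratum_eq hI hne
    refine ⟨x, hx, ?_, he⟩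
    rw [he, span_stratum hx] at hk
    have := finrank_perp (hs x hx)
    omega
  · rintro ⟨x, hx, hk, rfl⟩
    refine ⟨⟨_, tight_subset_active x, rfl⟩, ⟨x, self_mem_stratum hx⟩, ?_⟩
    rw [span_stratum hx]
    have := finrank_perp (hs x hx)
    omega

theorem stratum_eq_singleton (hs : IsSimple t) {x : Mink} (hx : x ∈ P t)
    (h : (tight t x).ncard = 4) : stratum t (tight t x) = {x} := by
  have h1 := finrank_perp (hs x hx)
  have h2 : Module.finrank ℝ (perp t (tight t x)) = 1 := by omega
  have hx' : x ∈ perp t (tight t x) := fun l hl => hl.2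
  have hx0 : (⟨x, hx'⟩ : perp t (tight t x)) ≠ 0 := by
    intro h0
    have : x = 0 := congrArg Subtype.val h0
    have h3 := hx.1.2
    simp [this] at h3
  refine Subset.antisymm (fun y hy => ?_) (singleton_subset_iff.2 (self_mem_stratum hx))
  obtain ⟨c, hc⟩ := (finrank_eq_one_iff_of_nonzero' _ hx0).1 h2 ⟨y, hy.2⟩
  exact eq_of_smul_mem_Hyp hx.1 hy.1.1 (congrArg Subtype.val hc).symm

theorem finVertices_eq (hs : IsSimple t) : finVertices t = {x ∈ P t | (tight t x).ncard = 4} := by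
  ext x
  simp only [finVertices, mem_ofPred_eq, mem_strata_iff hs]
  constructor
  · rintro ⟨y, hy, hk, he⟩
    rw [stratum_eq_singleton hs hy (by omega)] at he
    rw [singleton_injective he]
    exact ⟨hy, by omega⟩
  · rintro ⟨hx, h⟩
    exact ⟨x, hx, by omega, (stratum_eq_singleton hs hx h).symm⟩

theorem mem_image_normalization {I : Set Label} {p : Mink} (hp : p ∈ slice t)
    (hneg : lor p p < 0) (h : ∀ l ∈ I, lor p (vec t l) = 0) :
    p ∈ (fun x : Mink => (x 0)⁻¹ • x) '' stratum t I := by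
  obtain ⟨c, hc, hm⟩ := exists_mem_P_of_slice hp hneg
  refine ⟨c • p, ⟨hm, fun l hl => by rw [lor_smul_left, h l hl, mul_zero]⟩, ?_⟩
  simp [hp.1, smul_smul, hc.ne']

theorem isClosed_closedStratum (I : Set Label) : IsClosed (closedStratum t I) := by
  have h : closedStratum t I = {p | p 0 = 1} ∩ (⋂ l ∈ active t, {p | lor p (vec t l) ≤ 0}) ∩
      ({p | lor p p ≤ 0} ∩ ⋂ l ∈ I, {p | lor p (vec t l) = 0}) := by
    ext p; simp [closedStratum, slice]
  rw [h]
  refine ((isClosed_eq (by fun_prop) continuous_const).inter (isClosed_biInter fun l _ =>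
    isClosed_le (by fun_prop) continuous_const)).inter ((isClosed_le (by fun_prop)
      continuous_const).inter (isClosed_biInter fun l _ => isClosed_eq (by fun_prop)
        continuous_const))

theorem slice_convexComb {p q : Mink} (hp : p ∈ slice t) (hq : q ∈ slice t) {a b : ℝ} (ha : 0 ≤ a)
    (hb : 0 ≤ b) (hab : a + b = 1) : a • p + b • q ∈ slice t := by
  refine ⟨by simp [hp.1, hq.1, hab], fun l hl => ?_⟩
  rw [lor_add_left, lor_smul_left, lor_smul_left]
  nlinarith [hp.2 l hl, hq.2 l hl, mul_nonneg ha (neg_nonneg.2 (hp.2 l hl)),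
    mul_nonneg hb (neg_nonneg.2 (hq.2 l hl))]

/-- The closure of a nonempty stratum in the projective ball is cut out by the same conditions. -/
theorem compactification_stratum {I : Set Label} (hne : (stratum t I).Nonempty) :
    compactification (stratum t I) = closedStratum t I := by
  apply Subset.antisymm
  · refine closure_minimal ?_ (isClosed_closedStratum I)
    rintro _ ⟨x, hx, rfl⟩
    refine ⟨inv_smul_mem_slice hx.1, (lor_inv_smul_neg hx.1.1).le, fun l hl => ?_⟩
    simp only [lor_smul_left, hx.2 l hl, mul_zero]
  · rintro p ⟨hp, hpp, hI⟩
    obtain ⟨x, hx⟩ := hne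
    set q := (x 0)⁻¹ • x with hq
    have hqs : q ∈ slice t := inv_smul_mem_slice hx.1
    have hqq : lor q q < 0 := lor_inv_smul_neg hx.1.1
    have hqI : ∀ l ∈ I, lor q (vec t l) = 0 := fun l hl => by
      rw [hq, lor_smul_left, hx.2 l hl, mul_zero]
    have hpq : lor p q ≤ 0 := by
      rcases eq_or_ne p q with h | h
      · rw [h]; exact hqq.le
      · exact (lor_neg_of_ne hp.1 hqs.1 hpp hqq.le h).le
    have hc : Continuous fun ε : ℝ => (1 - ε) • p + ε • q := by fun_prop
    have ht : Tendsto (fun ε : ℝ => (1 - ε) • p + ε • q) (𝓝[>] 0) (𝓝 p) := by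
      have := hc.tendsto 0
      simp only [sub_zero, one_smul, zero_smul, add_zero] at this
      exact this.mono_left nhdsWithin_le_nhds
    refine mem_closure_of_tendsto ht ?_
    filter_upwards [Ioo_mem_nhdsGT (zero_lt_one (α := ℝ))] with ε hε
    refine mem_image_normalization (slice_convexComb hp hqs (by linarith [hε.2]) hε.1.le (by ring))
      ?_ fun l hl => ?_
    · simp only [lor_add_left, lor_add_right, lor_smul_left, lor_smul_right, lor_comm q p]
      have h1 : 0 < 1 - ε := by linarith [hε.2]
      have h2 := hε.1
      nlinarith [mul_nonneg h1.le (mul_nonneg h1.le (neg_nonneg.2 hpp)),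
        mul_nonneg h1.le (mul_nonneg h2.le (neg_nonneg.2 hpq)), mul_pos h2 (mul_pos h2 (neg_pos.2 hqq))]
    · rw [lor_add_left, lor_smul_left, lor_smul_left, hI l hl, hqI l hl, mul_zero, mul_zero, add_zero]

theorem stratum_empty : stratum t ∅ = P t := by
  ext x; simp [stratum]

theorem idealVertices_eq (hne : (P t).Nonempty) :
    idealVertices t = {n ∈ slice t | lor n n = 0} := by
  ext n
  simp only [idealVertices, ← stratum_empty (t := t)]
  rw [compactification_stratum (by rwa [stratum_empty])]
  simp only [closedStratum, mem_ofPred_eq, mem_empty_iff_false, false_imp_iff, implies_true,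
    and_true]
  exact ⟨fun h => ⟨h.1.1, h.2⟩, fun h => ⟨⟨h.1, h.2.le⟩, h.2⟩⟩

theorem mem_compactification_iff {I : Set Label} (hI : I ⊆ active t) (hne : (stratum t I).Nonempty)
    {n : Mink} (hn : n ∈ idealVertices t) :
    n ∈ compactification (stratum t I) ↔ I ⊆ tight t n := by
  rw [idealVertices_eq (hne.mono fun x hx => hx.1)] at hn
  rw [compactification_stratum hne]
  exact ⟨fun h l hl => ⟨hI hl, h.2.2 l hl⟩, fun h => ⟨hn.1, hn.2.le, fun l hl => (h hl).2⟩⟩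

/-- Each half-space contributes a wall. -/
def WallsNonempty (t : ℝ) : Prop := ∀ l ∈ active t, ∃ x ∈ P t, l ∈ tight t x

theorem WallsNonempty.wall_nonempty (hw : WallsNonempty t) {l : Label} (hl : l ∈ active t) :
    (wall t l).Nonempty := by
  obtain ⟨x, hx, h⟩ := hw l hl
  exact ⟨x, hx, fun l' hl' => by rw [hl']; exact h.2⟩

theorem wallsAtIdeal_eq (hw : WallsNonempty t) {n : Mink} (hn : n ∈ idealVertices t) :
    wallsAtIdeal t n = tight t n := by
  ext l
  constructor
  · rintro ⟨hl, h⟩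
    exact (mem_compactification_iff (singleton_subset_iff.2 hl) (hw.wall_nonempty hl) hn).1 h rfl
  · intro h
    exact ⟨h.1, (mem_compactification_iff (singleton_subset_iff.2 h.1) (hw.wall_nonempty h.1) hn).2
      (singleton_subset_iff.2 h)⟩

theorem span_compactification {S : Set Mink} (hS : S ⊆ Hyp) :
    Submodule.span ℝ (compactification S) = Submodule.span ℝ S := by
  apply le_antisymm
  · rw [Submodule.span_le]
    refine closure_minimal ?_ (Submodule.closed_of_finiteDimensional _)
    rintro _ ⟨x, hx, rfl⟩
    exact Submodule.smul_mem _ _ (Submodule.subset_span hx)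
  · rw [Submodule.span_le]
    intro x hx
    have h0 : x 0 ≠ 0 := (hS hx).2.ne'
    have h1 : (x 0)⁻¹ • x ∈ Submodule.span ℝ (compactification S) :=
      Submodule.subset_span (subset_closure ⟨x, hx, rfl⟩)
    exact (Submodule.smul_mem_iff _ (inv_ne_zero h0)).1 h1

end CellFamily

namespace CellFamily

open Label

/-! ### The chamber

In the chamber `y₁ ≥ y₂ ≥ |y₃|`, `z ≥ 0`, the inequalities of the walls `A`, `pos 0`, `neg 3` and `H`
imply all the others. -/

/-- The intersection of the slice polyhedron with the chamber, in the coordinates `y₁, y₂, y₃` and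
`w = z / t`, for `q = t ^ 2`. -/
structure InChamber (q y₁ y₂ y₃ w : ℝ) : Prop where
  q_pos : 0 < q
  q_le : q ≤ 1
  h12 : y₂ ≤ y₁
  h23 : y₃ ≤ y₂
  h23' : -y₃ ≤ y₂
  w_nonneg : 0 ≤ w
  hA : y₁ ≤ 1
  hpos : y₁ + y₂ + y₃ + w ≤ 2
  hneg : y₁ + y₂ - y₃ + q * w ≤ 2
  hH : 1 / 2 < q → q * w ≤ 1

namespace InChamber

variable {q y₁ y₂ y₃ w : ℝ}

/-- In the part `y₁ + y₂ - y₃ ≤ 1` of the chamber, the sum of squares is bounded by the linear form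
of the wall `pos 0`. -/
theorem sq_sum_le (h : InChamber q y₁ y₂ y₃ w) (hs : y₁ + y₂ - y₃ ≤ 1) :
    y₁ ^ 2 + y₂ ^ 2 + y₃ ^ 2 ≤ y₁ + y₂ + y₃ := by
  obtain ⟨h1, h2, h3, h4, h5, h6, h7, h8, h9, h10⟩ := h
  rcases le_total 0 y₃ with h0 | h0
  · nlinarith
  · nlinarith [mul_nonneg (show 0 ≤ y₁ by linarith) (sub_nonneg.2 hs),
      mul_nonneg (show 0 ≤ y₂ by linarith) (sub_nonneg.2 h3),
      mul_nonneg (neg_nonneg.2 h0) (show 0 ≤ y₁ + y₃ by linarith)]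

/-- The case of equality in `sq_sum_le`. -/
theorem eq_zero_of_sq_sum_eq (h : InChamber q y₁ y₂ y₃ w) (hs : y₁ + y₂ - y₃ < 1)
    (he : y₁ + y₂ + y₃ ≤ y₁ ^ 2 + y₂ ^ 2 + y₃ ^ 2) : y₁ = 0 := by
  obtain ⟨h1, h2, h3, h4, h5, h6, h7, h8, h9, h10⟩ := h
  rcases le_total 0 y₃ with h0 | h0
  · have e1 : y₁ * (1 - y₁) = 0 := by nlinarith
    rcases mul_eq_zero.1 e1 with e1 | e1
    · exact e1
    · have e2 : y₂ * (1 - y₂) = 0 := by nlinarith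
      rcases mul_eq_zero.1 e2 with e2 | e2 <;> linarith
  · have e1 : y₁ * (1 - (y₁ + y₂ - y₃)) ≤ 0 := by
      nlinarith [mul_nonneg (show 0 ≤ y₂ by linarith) (sub_nonneg.2 h3),
        mul_nonneg (neg_nonneg.2 h0) (show 0 ≤ y₁ + y₃ by linarith)]
    nlinarith

/-- Three nonnegative products whose combination with coefficients `1`, `2`, `2` is
`2 - (y₁ ^ 2 + y₂ ^ 2 + y₃ ^ 2 + q * w ^ 2)`; this bounds the norm in the part `1 ≤ y₁ + y₂ - y₃`
of the chamber. -/
theorem sq_sum_add_mul (h : InChamber q y₁ y₂ y₃ w) (hs : 1 ≤ y₁ + y₂ - y₃) :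
    0 ≤ (2 - (y₁ + y₂ + y₃)) * (2 - (y₁ + y₂ - y₃)) - q * w ^ 2 ∧ 0 ≤ y₂ * (y₁ - y₂) ∧
      0 ≤ (1 - y₁) * (y₁ + 2 * y₂ - 1) := by
  obtain ⟨h1, h2, h3, h4, h5, h6, h7, h8, h9, h10⟩ := h
  refine ⟨?_, mul_nonneg (by linarith) (by linarith), mul_nonneg (by linarith) (by linarith)⟩
  have := mul_le_mul (show w ≤ 2 - (y₁ + y₂ + y₃) by linarith)
    (show q * w ≤ 2 - (y₁ + y₂ - y₃) by linarith) (by positivity) (by linarith)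
  linarith only [this]

/-- The part of the polyhedron in the chamber lies in the ball. -/
theorem ball (h : InChamber q y₁ y₂ y₃ w) : y₁ ^ 2 + y₂ ^ 2 + y₃ ^ 2 + q * w ^ 2 ≤ 2 := by
  rcases le_total 1 (y₁ + y₂ - y₃) with hs | hs
  · obtain ⟨a, b, c⟩ := h.sq_sum_add_mul hs
    linarith only [a, b, c]
  · have h0 := h.sq_sum_le hs
    obtain ⟨h1, h2, h3, h4, h5, h6, h7, h8, h9, h10⟩ := h
    by_cases hq : 1 / 2 < q
    · have := mul_nonneg h6 (sub_nonneg.2 (h10 hq))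
      linarith only [this, h0, h8]
    · have hsn : 0 ≤ y₁ + y₂ + y₃ := by linarith
      have : q * w ^ 2 ≤ (2 - (y₁ + y₂ + y₃)) ^ 2 / 2 := by
        have : w ^ 2 ≤ (2 - (y₁ + y₂ + y₃)) ^ 2 := pow_le_pow_left₀ h6 (by linarith) 2
        have h12 := mul_nonneg (sub_nonneg.2 (not_lt.1 hq)) (sq_nonneg w)
        linarith only [this, h12]
      have h13 := mul_nonneg hsn (show 0 ≤ 2 - (y₁ + y₂ + y₃) by linarith)
      linarith only [this, h0, h13]

/-- The points of the polyhedron in the chamber that lie on the sphere. -/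
theorem sphere (h : InChamber q y₁ y₂ y₃ w) (hq1 : q < 1)
    (he : y₁ ^ 2 + y₂ ^ 2 + y₃ ^ 2 + q * w ^ 2 = 2) :
    (y₁ = 1 ∧ y₂ = 1 ∧ y₃ = 0 ∧ w = 0) ∨
      (q = 3 / 5 ∧ y₁ = 1 / 3 ∧ y₂ = 1 / 3 ∧ y₃ = -1 / 3 ∧ w = 5 / 3) ∨
      (q = 1 / 2 ∧ y₁ = 0 ∧ y₂ = 0 ∧ y₃ = 0 ∧ w = 2) := by
  rcases le_or_gt 1 (y₁ + y₂ - y₃) with hs | hs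
  · obtain ⟨a, b, c⟩ := h.sq_sum_add_mul hs
    obtain ⟨h1, h2, h3, h4, h5, h6, h7, h8, h9, h10⟩ := h
    have a0 : (2 - (y₁ + y₂ + y₃)) * (2 - (y₁ + y₂ - y₃)) - q * w ^ 2 = 0 := by
      linarith only [a, b, c, he]
    have b0 : y₂ * (y₁ - y₂) = 0 := by linarith only [a, b, c, he]
    have c0 : (1 - y₁) * (y₁ + 2 * y₂ - 1) = 0 := by linarith only [a, b, c, he]
    have hqw : 0 ≤ q * w := by positivity
    rcases mul_eq_zero.1 b0 with hb | hb
    · exfalso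
      rw [hb] at c0
      have hy1 : y₁ = 1 := by nlinarith
      have hy3 : y₃ = 0 := by linarith
      rw [hb, hy1, hy3] at a0
      have hw : w ≤ 1 := by linarith
      nlinarith
    · have hy : y₁ = y₂ := by linarith
      rcases mul_eq_zero.1 c0 with hc | hc
      · left
        refine ⟨by linarith, by linarith, by linarith, by linarith⟩
      · right; left
        have hy1 : y₁ = 1 / 3 := by linarith
        have hy2 : y₂ = 1 / 3 := by linarith
        have hy3 : y₃ = -1 / 3 := by linarith
        rw [hy1, hy2, hy3] at a0
        have hw : w ≤ 5 / 3 := by linarith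
        have hqw1 : q * w ≤ 1 := by linarith
        have hw2 : w = 5 / 3 := by
          have := mul_nonneg h6 (sub_nonneg.2 hqw1)
          exact le_antisymm hw (by nlinarith only [this, a0])
        rw [hw2] at a0
        exact ⟨by linarith, hy1, hy2, hy3, hw2⟩
  · have h0 := h.sq_sum_le hs.le
    have hz := h.eq_zero_of_sq_sum_eq hs
    obtain ⟨h1, h2, h3, h4, h5, h6, h7, h8, h9, h10⟩ := h
    by_cases hq : 1 / 2 < q
    · exfalso
      have h11 := h10 hq
      have e1 : w * (1 - q * w) = 0 :=
        le_antisymm (by linarith only [he, h0, h8]) (mul_nonneg h6 (sub_nonneg.2 h11))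
      have e2 : y₁ = 0 := hz (by linarith only [e1, he, h8])
      have hy2 : y₂ = 0 := by linarith
      have hy3 : y₃ = 0 := by linarith
      rw [e2, hy2, hy3] at he h8
      rcases mul_eq_zero.1 e1 with e | e
      · rw [e] at he; norm_num at he
      · nlinarith
    · right; right
      have hsn : 0 ≤ y₁ + y₂ + y₃ := by linarith
      obtain ⟨S, hS⟩ : ∃ S, S = y₁ + y₂ + y₃ := ⟨_, rfl⟩
      rw [← hS] at h0 hz hsn h8
      have hle : q * w ^ 2 ≤ (2 - S) ^ 2 / 2 := by
        have : w ^ 2 ≤ (2 - S) ^ 2 := pow_le_pow_left₀ h6 (by linarith) 2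
        have h12 := mul_nonneg (sub_nonneg.2 (not_lt.1 hq)) (sq_nonneg w)
        linarith only [this, h12]
      have e2 : y₁ = 0 := by
        have e3 : S * (2 - S) = 0 := by
          have : 0 ≤ S * (2 - S) := mul_nonneg hsn (by linarith)
          linarith
        rcases mul_eq_zero.1 e3 with e | e
        · linarith
        · refine hz ?_
          have e4 : S = 2 := by linarith
          rw [e4] at hle ⊢
          linarith
      have hy2 : y₂ = 0 := by linarith
      have hy3 : y₃ = 0 := by linarith
      rw [e2, hy2, hy3] at he hS
      rw [hS] at h8
      have hw4 := mul_nonneg (sub_nonneg.2 (not_lt.1 hq)) (sq_nonneg w)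
      have hw : w = 2 := le_antisymm (by linarith) (by nlinarith only [hw4, he, h6])
      rw [hw] at he
      exact ⟨by linarith, e2, hy2, hy3, hw⟩

end InChamber

variable {t : ℝ}

theorem half_lt_sq_iff (ht : 0 < t) : 1 / 2 < t ^ 2 ↔ t₂ < t := by
  rw [t₂, Real.sqrt_lt' ht]

theorem t₂_lt_t₁ : t₂ < t₁ := Real.sqrt_lt_sqrt (by norm_num) (by norm_num)

theorem t₁_lt_one : t₁ < 1 := by
  rw [t₁, Real.sqrt_lt' one_pos]; norm_num

theorem t₂_pos : 0 < t₂ := Real.sqrt_pos.2 (by norm_num)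

theorem t₁_pos : 0 < t₁ := Real.sqrt_pos.2 (by norm_num)

theorem t₁_sq : t₁ ^ 2 = 3 / 5 := Real.sq_sqrt (by norm_num)

theorem t₂_sq : t₂ ^ 2 = 1 / 2 := Real.sq_sqrt (by norm_num)

theorem div_sqrt_two_nonpos {a : ℝ} : a / √2 ≤ 0 ↔ a ≤ 0 := by
  rw [div_le_iff₀ (by positivity), zero_mul]

theorem div_sqrt_two_eq_zero {a : ℝ} : a / √2 = 0 ↔ a = 0 := by
  rw [div_eq_zero_iff]; simp

theorem pos_mem_active (i : Fin 8) : pos i ∈ active t := by simp [active]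

theorem neg_mem_active (i : Fin 8) : neg i ∈ active t := by simp [active]

/-- In the chamber the inequalities `InChamber` are equivalent to membership in the slice
polyhedron. -/
theorem pt_mem_slice_iff (ht : t ∈ Ioc (0 : ℝ) 1) {y₁ y₂ y₃ z : ℝ} (h12 : y₂ ≤ y₁) (h23 : y₃ ≤ y₂)
    (h23' : -y₃ ≤ y₂) (hz : 0 ≤ z) :
    pt y₁ y₂ y₃ z ∈ slice t ↔ InChamber (t ^ 2) y₁ y₂ y₃ (z / t) := by
  have ht0 := ht.1
  have e1 : t ^ 2 * (z / t) = t * z := by field_simp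
  have hw : 0 ≤ z / t := div_nonneg hz ht0.le
  have hv : 0 ≤ t * z := by positivity
  constructor
  · rintro ⟨-, h⟩
    have hA := h A (by simp [active])
    have h0 := h (pos 0) (by simp [active])
    have h3 := h (neg 3) (by simp [active])
    rw [lor_pt_A] at hA
    rw [lor_pt_pos, div_sqrt_two_nonpos] at h0
    rw [lor_pt_neg, div_sqrt_two_nonpos] at h3
    simp [corner, eps] at h0 h3
    refine ⟨by positivity, ?_, h12, h23, h23', hw, by linarith, by linarith, by linarith, fun hq => ?_⟩
    · have := ht.2
      nlinarith
    · have := h H fun _ => (half_lt_sq_iff ht0).1 hq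
      rw [lor_pt_H] at this
      linarith
  · rintro ⟨g1, g2, g3, g4, g5, g6, g7, g8, g9, g10⟩
    rw [e1] at g9 g10
    refine ⟨by simp [pt], fun l hl => ?_⟩
    cases l with
    | pos i =>
      rw [lor_pt_pos, div_sqrt_two_nonpos]
      fin_cases i <;> simp [corner, eps] <;> linarith
    | neg i =>
      rw [lor_pt_neg, div_sqrt_two_nonpos]
      fin_cases i <;> simp [corner, eps] <;> linarith
    | A => rw [lor_pt_A]; linarith
    | B => rw [lor_pt_B]; linarith
    | C => rw [lor_pt_C]; linarith
    | D => rw [lor_pt_D]; linarith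
    | E => rw [lor_pt_E]; linarith
    | F => rw [lor_pt_F]; linarith
    | G => rw [lor_pt_G]; linarith
    | H =>
      have := g10 ((half_lt_sq_iff ht0).2 (hl (Or.inr rfl)))
      rw [lor_pt_H]; linarith

theorem lor_pt_self (ht : 0 < t) (y₁ y₂ y₃ z : ℝ) : lor (pt y₁ y₂ y₃ z) (pt y₁ y₂ y₃ z) =
    (y₁ ^ 2 + y₂ ^ 2 + y₃ ^ 2 + t ^ 2 * (z / t) ^ 2 - 2) / 2 := by
  rw [lor_pt_pt]
  field_simp

/-- An invariant property holds on the slice if it holds in the chamber. -/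
theorem slice_induction (ht : t ∈ Ioc (0 : ℝ) 1) {Q : Mink → Prop}
    (chamber : ∀ y₁ y₂ y₃ z : ℝ, InChamber (t ^ 2) y₁ y₂ y₃ (z / t) → pt y₁ y₂ y₃ z ∈ slice t →
      Q (pt y₁ y₂ y₃ z))
    (hgen : ∀ j x, x ∈ slice t → Q (gen j x) → Q x) {x : Mink} (hx : x ∈ slice t) : Q x := by
  refine chamber_induction (Q := fun x => x ∈ slice t → Q x) ?_ ?_ x hx
  · intro x h12 h23 h23' hz hx
    have h0 := hx
    have h2 : 0 ≤ √2 := Real.sqrt_nonneg 2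
    rw [eq_pt hx.1] at h0 ⊢
    exact chamber _ _ _ _ ((pt_mem_slice_iff ht (by gcongr) (by gcongr)
      (by rw [← mul_neg]; gcongr) (by positivity)).1 h0) h0
  · intro j x h hx
    exact hgen j x hx (h (gen_mem_slice j hx))

/-- The slice polyhedron lies in the closed ball. -/
theorem slice_subset_ball (ht : t ∈ Ioc (0 : ℝ) 1) {p : Mink} (hp : p ∈ slice t) : lor p p ≤ 0 := by
  refine slice_induction ht (Q := fun p => lor p p ≤ 0) ?_ ?_ hp
  · intro y₁ y₂ y₃ z h _
    rw [lor_pt_self ht.1]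
    linarith [h.ball]
  · intro j x _ h
    rwa [lor_gen_gen] at h

end CellFamily

namespace CellFamily

open Label

/-! ### The vertex figures as finite data -/

/-- The bit mask of a list of labels. It identifies the underlying set of a list without
repetitions, and is fast to compare. -/
def mask (L : List Label) : ℕ := (L.map fun l => 2 ^ code l).sum

/-- Words in the generators `gen j` for all the 48 symmetries. -/
def words : List (List (Fin 3)) :=
  [[], [0], [1], [0, 1], [1, 0], [0, 1, 0]].flatMap fun p =>
    [[], [2], [1, 2, 1], [0, 1, 2, 1, 0], [2, 1, 2, 1], [2, 0, 1, 2, 1, 0],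
      [1, 2, 1, 0, 1, 2, 1, 0], [2, 1, 2, 1, 0, 1, 2, 1, 0]].map (p ++ ·)

/-- The orbit of a list of labels under the symmetries, without repetitions of the same set. -/
def orbit (L : List Label) : List (List Label) :=
  (words.reverse.map fun w => w.foldr (fun j M => M.map (genLabel j)) L).pwFilter (mask · ≠ mask ·)

/-- A family of sets of labels that is mapped to itself by the symmetries. -/
def GenClosed (Ls : List (List Label)) : Prop :=
  ∀ L ∈ Ls, ∀ j, ∃ M ∈ Ls, ∀ l ∈ L, genLabel j l ∈ M

/-- The edges on a wall `A, …, F` and on both walls `pos i` and `neg i` for some `i`. -/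
def boxEdges : List (List Label) := orbit [A, pos 0, neg 0]

/-- The incidence sets of the finite vertices on a wall `A, …, F`. -/
def letterSets : List (List Label) := orbit [pos 0, pos 2, neg 3, A]

/-- The incidence sets of the finite vertices of green triangles. -/
def poleSets : List (List Label) := orbit [pos 0, pos 2, neg 3, H]

/-- The incidence sets of the vertices on three positive walls and a negative one. -/
def tripleNegSets : List (List Label) := orbit [pos 0, pos 2, pos 4, neg 3]

/-- The incidence sets of the vertices on three positive walls and `G` or `H`. -/
def triplePoleSets : List (List Label) := orbit [pos 0, pos 2, pos 4, H]

/-- The positive walls of each parity. -/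
def apexSets : List (List Label) := orbit [pos 0, pos 2, pos 4, pos 6]

/-- The edges between two ideal vertices at the time `t₁` that lie on `G` or `H`. -/
def poleEdges : List (List Label) := orbit [pos 0, pos 2, H]

/-- The edges on a wall `A, …, F` at the time `1` that lie on no pair `pos i`, `neg i`. -/
def letterEdgesOne : List (List Label) := orbit [pos 0, neg 3, A]

/-- The edges on `G` and `H` at the time `1`. -/
def poleEdgesOne : List (List Label) := orbit [pos 0, neg 3, H]

/-- The incidence sets of the ideal vertices whose links are parallelepipeds. -/
def boxSets : List (List Label) := orbit [pos 3, neg 3, pos 0, neg 0, A, B]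

/-- The incidence sets of the ideal vertices whose links are prisms. -/
def prismSets : List (List Label) := orbit [pos 0, pos 2, pos 4, neg 3, H]

theorem GenClosed.append {Ls Ms : List (List Label)} (h : GenClosed Ls) (h' : GenClosed Ms) :
    GenClosed (Ls ++ Ms) := by
  intro L hL j
  rcases List.mem_append.1 hL with hL | hL
  · obtain ⟨M, hM, hm⟩ := h L hL j
    exact ⟨M, List.mem_append_left _ hM, hm⟩
  · obtain ⟨M, hM, hm⟩ := h' L hL j
    exact ⟨M, List.mem_append_right _ hM, hm⟩

instance (Ls : List (List Label)) : Decidable (GenClosed Ls) := by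
  unfold GenClosed; infer_instance

theorem genClosed_boxEdges : GenClosed boxEdges := by decide +kernel
theorem genClosed_letterSets : GenClosed letterSets := by decide +kernel
theorem genClosed_poleSets : GenClosed poleSets := by decide +kernel
theorem genClosed_tripleNegSets : GenClosed tripleNegSets := by decide +kernel
theorem genClosed_triplePoleSets : GenClosed triplePoleSets := by decide +kernel
theorem genClosed_apexSets : GenClosed apexSets := by decide +kernel
theorem genClosed_poleEdges : GenClosed poleEdges := by decide +kernel
theorem genClosed_letterEdgesOne : GenClosed letterEdgesOne := by decide +kernel
theorem genClosed_poleEdgesOne : GenClosed poleEdgesOne := by decide +kernel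

end CellFamily

namespace CellFamily

open Label

variable {t : ℝ}

/-! ### Incidences in the chamber

The sets of walls that meet in a finite point are found by listing the walls through the points of
the chamber. -/

namespace InChamber

variable {q y₁ y₂ y₃ w : ℝ}

/-- In the chamber this keeps finite points off the walls `neg 1`, `neg 5` and `neg 7`. -/
theorem add_mul_lt_two (h : InChamber q y₁ y₂ y₃ w) (hq1 : q < 1)
    (hb : y₁ ^ 2 + y₂ ^ 2 + y₃ ^ 2 + q * w ^ 2 < 2) : y₁ + q * w < 2 := by
  obtain ⟨h1, h2, h3, h4, h5, h6, h7, h8, h9, h10⟩ := h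
  by_contra hc
  have hqw : 1 ≤ q * w := by linarith
  by_cases hq : 1 / 2 < q
  · have := h10 hq
    have hw : w ≤ 1 := by linarith
    have := mul_nonneg h1.le (sub_nonneg.2 hw)
    linarith
  · have hw : 2 ≤ w := by
      have := mul_nonneg (sub_nonneg.2 (not_lt.1 hq)) h6
      linarith
    have := mul_nonneg h6 (sub_nonneg.2 hqw)
    linarith only [this, hw, hb, sq_nonneg y₁, sq_nonneg y₂, sq_nonneg y₃]

end InChamber

/-- The walls through a point of the chamber with `z = 0`. -/
inductive TightZero (y₁ y₂ y₃ : ℝ) : Label → Prop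
  | A : TightZero y₁ y₂ y₃ A
  | pos_zero : y₁ + y₂ + y₃ = 2 → TightZero y₁ y₂ y₃ (pos 0)
  | neg_zero : y₁ + y₂ + y₃ = 2 → TightZero y₁ y₂ y₃ (neg 0)
  | pos_three : y₁ + y₂ - y₃ = 2 → TightZero y₁ y₂ y₃ (pos 3)
  | neg_three : y₁ + y₂ - y₃ = 2 → TightZero y₁ y₂ y₃ (neg 3)

/-- The walls through a point of the chamber with `z > 0`, with the equations that hold on each. -/
inductive TightPos (q y₁ y₂ y₃ w : ℝ) : Label → Prop
  | pos_zero : TightPos q y₁ y₂ y₃ w (pos 0)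
  | pos_two : y₁ + w = 2 → y₃ = -y₂ → TightPos q y₁ y₂ y₃ w (pos 2)
  | pos_four : y₁ + w = 2 → y₃ = -y₂ → y₂ = y₁ → TightPos q y₁ y₂ y₃ w (pos 4)
  | pos_six : w = 2 → y₁ = 0 → y₂ = 0 → y₃ = 0 → TightPos q y₁ y₂ y₃ w (pos 6)
  | neg_three : y₁ + y₂ - y₃ + q * w = 2 → TightPos q y₁ y₂ y₃ w (neg 3)
  | A : y₁ = 1 → TightPos q y₁ y₂ y₃ w A
  | H : 1 / 2 < q → q * w = 1 → TightPos q y₁ y₂ y₃ w H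

/-- The walls that pass through a finite point of the chamber. -/
theorem tight_chamber (ht : t ∈ Ioo (0 : ℝ) 1) {y₁ y₂ y₃ z : ℝ}
    (h : InChamber (t ^ 2) y₁ y₂ y₃ (z / t)) (hb : lor (pt y₁ y₂ y₃ z) (pt y₁ y₂ y₃ z) < 0)
    {l : Label} (hl : l ∈ tight t (pt y₁ y₂ y₃ z)) :
    (z / t = 0 ∧ TightZero y₁ y₂ y₃ l) ∨ (0 < z / t ∧ TightPos (t ^ 2) y₁ y₂ y₃ (z / t) l) := by
  have ht0 := ht.1
  have e1 : t * z = t ^ 2 * (z / t) := by field_simp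
  have hq1 : t ^ 2 < 1 := by nlinarith [ht.2]
  rw [lor_pt_self ht0] at hb
  have hn := h.add_mul_lt_two hq1 (by linarith)
  obtain ⟨hact, h0⟩ := hl
  have hG : l = G ∨ l = H → 1 / 2 < t ^ 2 := fun h => (half_lt_sq_iff ht0).2 (hact h)
  obtain ⟨g1, g2, g3, g4, g5, g6, g7, g8, g9, g10⟩ := h
  have hpos : ∀ i, l = pos i → corner i 0 * y₁ + corner i 1 * y₂ + corner i 2 * y₃ +
      eps i * (z / t) - 2 = 0 := by
    rintro i rfl
    rwa [lor_pt_pos, div_sqrt_two_eq_zero] at h0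
  have hneg : ∀ i, l = neg i → corner i 0 * y₁ + corner i 1 * y₂ + corner i 2 * y₃ -
      eps i * (t ^ 2 * (z / t)) - 2 = 0 := by
    rintro i rfl
    rwa [lor_pt_neg, div_sqrt_two_eq_zero, e1] at h0
  have hGH : (l = G → -(t ^ 2 * (z / t)) - 1 = 0) ∧ (l = H → t ^ 2 * (z / t) - 1 = 0) := by
    constructor <;> rintro rfl
    · rwa [lor_pt_G, e1] at h0
    · rwa [lor_pt_H, e1] at h0
  generalize z / t = w at *
  generalize t ^ 2 = q at *
  have hqw : 0 ≤ q * w := by positivity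
  have hqw' : 0 < w → 0 < q * w := fun h => by positivity
  cases l with
  | pos i =>
    have h1 := hpos i rfl
    fin_cases i <;> simp [corner, eps] at h1 ⊢ <;> rcases eq_or_lt_of_le g6 with hw | hw
    · exact .inl ⟨hw.symm, .pos_zero (by linarith)⟩
    · exact .inr ⟨hw, .pos_zero⟩
    · linarith
    · linarith
    · linarith
    · exact .inr ⟨hw, .pos_two (by linarith) (by linarith)⟩
    · exact .inl ⟨hw.symm, .pos_three (by linarith)⟩
    · linarith
    · linarith
    · exact .inr ⟨hw, .pos_four (by linarith) (by linarith) (by linarith)⟩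
    · linarith
    · linarith
    · linarith
    · exact .inr ⟨hw, .pos_six (by linarith) (by linarith) (by linarith) (by linarith)⟩
    · linarith
    · linarith
  | neg i =>
    have h1 := hneg i rfl
    fin_cases i <;> simp [corner, eps] at h1 ⊢ <;> rcases eq_or_lt_of_le g6 with hw | hw
    · rw [← hw] at h1
      exact .inl ⟨hw.symm, .neg_zero (by linarith)⟩
    · linarith
    · linarith
    · linarith
    · linarith
    · linarith
    · rw [← hw] at h1
      exact .inl ⟨hw.symm, .neg_three (by linarith)⟩
    · exact .inr ⟨hw, .neg_three (by linarith)⟩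
    · linarith
    · linarith
    · linarith
    · linarith
    · linarith
    · linarith
    · linarith
    · linarith
  | A =>
    rw [lor_pt_A] at h0
    rcases eq_or_lt_of_le g6 with hw | hw
    · exact .inl ⟨hw.symm, .A⟩
    · exact .inr ⟨hw, .A (by linarith)⟩
  | B =>
    rw [lor_pt_B] at h0
    have e2 : y₁ = 1 := by linarith
    have e3 : y₂ = 1 := by linarith
    nlinarith [sq_nonneg y₃, sq_nonneg w]
  | C => rw [lor_pt_C] at h0; linarith
  | D => rw [lor_pt_D] at h0; linarith
  | E => rw [lor_pt_E] at h0; linarith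
  | F => rw [lor_pt_F] at h0; linarith
  | G => linarith [hGH.1 rfl]
  | H =>
    rcases eq_or_lt_of_le g6 with hw | hw
    · have := hGH.2 rfl
      rw [← hw] at this
      linarith
    · exact .inr ⟨hw, .H (hG (.inr rfl)) (by linarith [hGH.2 rfl])⟩

/-- Every point of the polytope lies on a set of walls of the family `Ls`. -/
def Covers (t : ℝ) (Ls : List (List Label)) : Prop :=
  ∀ p ∈ slice t, lor p p < 0 → ∃ L ∈ Ls, ∀ l ∈ tight t p, l ∈ L

/-- By symmetry it suffices to consider the points of the chamber. -/
theorem Covers.of_chamber (ht : t ∈ Ioc (0 : ℝ) 1) {Ls : List (List Label)} (hc : GenClosed Ls)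
    (h : ∀ y₁ y₂ y₃ z, InChamber (t ^ 2) y₁ y₂ y₃ (z / t) → pt y₁ y₂ y₃ z ∈ slice t →
      lor (pt y₁ y₂ y₃ z) (pt y₁ y₂ y₃ z) < 0 →
      ∃ L ∈ Ls, ∀ l ∈ tight t (pt y₁ y₂ y₃ z), l ∈ L) : Covers t Ls := by
  intro p hp
  refine slice_induction ht (Q := fun p => lor p p < 0 → ∃ L ∈ Ls, ∀ l ∈ tight t p, l ∈ L) h ?_ hp
  intro j x _ ih hneg
  obtain ⟨L, hL, hl⟩ := ih (by rwa [lor_gen_gen])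
  obtain ⟨M, hM, hm⟩ := hc L hL j
  refine ⟨M, hM, fun l hlx => ?_⟩
  rw [← genLabel_genLabel j l]
  refine hm _ (hl _ ?_)
  rw [tight_gen, mem_preimage, genLabel_genLabel]
  exact hlx

/-- For `t < 1` it suffices to consider points of the chamber with `z > 0`. -/
theorem Covers.of_tightPos (ht : t ∈ Ioo (0 : ℝ) 1) {Ls : List (List Label)} (hc : GenClosed Ls)
    (hbox : ∀ L ∈ boxEdges, L ∈ Ls)
    (h : ∀ y₁ y₂ y₃ w, InChamber (t ^ 2) y₁ y₂ y₃ w → 0 < w →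
      y₁ ^ 2 + y₂ ^ 2 + y₃ ^ 2 + t ^ 2 * w ^ 2 < 2 →
      ∃ L ∈ Ls, ∀ l, TightPos (t ^ 2) y₁ y₂ y₃ w l → l ∈ L) : Covers t Ls := by
  refine Covers.of_chamber ⟨ht.1, ht.2.le⟩ hc fun y₁ y₂ y₃ z hch _ hb => ?_
  have hl := fun l => tight_chamber ht hch hb (l := l)
  rw [lor_pt_self ht.1] at hb
  rcases eq_or_lt_of_le hch.w_nonneg with hw | hw
  · rw [← hw] at hch hl hb
    simp only [lt_irrefl, false_and, or_false, true_and] at hl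
    have m0 : [A, pos 0, neg 0] ∈ boxEdges := by decide +kernel
    have m3 : [A, pos 3, neg 3] ∈ boxEdges := by decide +kernel
    by_cases h3 : y₁ + y₂ - y₃ = 2
    · refine ⟨_, hbox _ m3, fun l hlt => ?_⟩
      cases hl l hlt <;> simp
      all_goals
        obtain ⟨g1, g2, g3, g4, g5, g6, g7, g8, g9, g10⟩ := hch
        have e1 : y₁ = 1 := by linarith
        have e2 : y₂ = 1 := by linarith
        rw [e1, e2] at hb
        nlinarith [sq_nonneg y₃]
    · refine ⟨_, hbox _ m0, fun l hlt => ?_⟩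
      cases hl l hlt <;> first | contradiction | simp
  · obtain ⟨L, hL, hl'⟩ := h y₁ y₂ y₃ (z / t) hch hw (by linarith)
    refine ⟨L, hL, fun l hlt => hl' l ?_⟩
    rcases hl l hlt with ⟨h0, _⟩ | ⟨_, h1⟩
    · exact absurd h0 hw.ne'
    · exact h1

namespace InChamber

variable {q y₁ y₂ y₃ w : ℝ}

/-- The walls `A` and `H` do not meet. -/
theorem not_A_H (h : InChamber q y₁ y₂ y₃ w) (hq1 : q < 1) (hA : y₁ = 1) : q * w ≠ 1 := by
  intro hH
  obtain ⟨h1, h2, h3, h4, h5, h6, h7, h8, h9, h10⟩ := h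
  have := mul_nonneg h1.le (show 0 ≤ 1 - w by linarith)
  linarith

/-- The walls `neg 3` and `H` meet only from the time `t₁` on. -/
theorem le_of_neg_three_H (h : InChamber q y₁ y₂ y₃ w) (h3 : y₁ + y₂ - y₃ + q * w = 2)
    (hH : q * w = 1) : 3 / 5 ≤ q := by
  obtain ⟨h1, h2, h3, h4, h5, h6, h7, h8, h9, h10⟩ := h
  have hw : w ≤ 5 / 3 := by linarith
  have := mul_nonneg h1.le (show 0 ≤ 5 / 3 - w by linarith)
  linarith

/-- The walls `pos 0`, `pos 2` and `pos 4` meet inside the half-space `H` only up to the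
time `t₁`. -/
theorem le_of_pos_four (h : InChamber q y₁ y₂ y₃ w) (h2 : y₁ + w = 2) (h3 : y₃ = -y₂)
    (h4 : y₂ = y₁) (hqw : q * w ≤ 1) : q ≤ 3 / 5 := by
  obtain ⟨h1, -, -, -, -, h6, h7, h8, h9, h10⟩ := h
  have : 4 ≤ (3 - q) * w := by rw [h3, h4] at h9; linarith
  nlinarith

end InChamber

theorem covers_above (ht : t ∈ Ioo t₁ 1) : Covers t (boxEdges ++ letterSets ++ poleSets) := by
  have ht0 : 0 < t := t₁_pos.trans ht.1
  have hq : 3 / 5 < t ^ 2 := by rw [← t₁_sq]; exact pow_lt_pow_left₀ ht.1 t₁_pos.le two_ne_zero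
  have hq1 : t ^ 2 < 1 := by nlinarith [ht.2]
  refine Covers.of_tightPos ⟨ht0, ht.2⟩
    ((genClosed_boxEdges.append genClosed_letterSets).append genClosed_poleSets)
    (fun L hL => by simp [hL]) fun y₁ y₂ y₃ w h hw hb => ?_
  have hqw := h.hH (by linarith)
  by_cases hH : t ^ 2 * w = 1
  · refine ⟨[pos 0, pos 2, neg 3, H], List.mem_append_right _ (by decide +kernel), fun l hl => ?_⟩
    cases hl with
    | pos_four a b c => exact absurd (h.le_of_pos_four a b c hqw) hq.not_ge
    | pos_six a b c d => rw [a] at hqw; linarith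
    | A a => exact absurd hH (h.not_A_H hq1 a)
    | _ => simp
  · refine ⟨[pos 0, pos 2, neg 3, A], List.mem_append_left _ (List.mem_append_right _
      (by decide +kernel)), fun l hl => ?_⟩
    cases hl with
    | pos_four a b c => exact absurd (h.le_of_pos_four a b c hqw) hq.not_ge
    | pos_six a b c d => rw [a] at hqw; linarith
    | H a b => exact absurd b hH
    | _ => simp

theorem covers_at_t₁ : Covers t₁ (boxEdges ++ letterSets ++ poleEdges) := by
  have hq1 : t₁ ^ 2 < 1 := by rw [t₁_sq]; norm_num
  refine Covers.of_tightPos ⟨t₁_pos, t₁_lt_one⟩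
    ((genClosed_boxEdges.append genClosed_letterSets).append genClosed_poleEdges)
    (fun L hL => by simp [hL]) fun y₁ y₂ y₃ w h hw hb => ?_
  rw [t₁_sq] at *
  have hqw := h.hH (by linarith)
  have h4 : y₁ + w = 2 → y₃ = -y₂ → y₂ = y₁ → False := by
    intro a b c
    have := h.hneg
    have e1 : y₁ = 1 / 3 := by linarith
    have e2 : w = 5 / 3 := by linarith
    rw [b, c, e1, e2] at hb
    norm_num at hb
  by_cases hH : 3 / 5 * w = 1
  · refine ⟨[pos 0, pos 2, H], List.mem_append_right _ (by decide +kernel), fun l hl => ?_⟩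
    cases hl with
    | pos_four a b c => exact (h4 a b c).elim
    | pos_six a b c d => linarith
    | A a => exact absurd hH (h.not_A_H hq1 a)
    | neg_three a =>
      exfalso
      obtain ⟨g1, g2, g3, g4, g5, g6, g7, g8, g9, g10⟩ := h
      have e1 : y₁ = 1 / 3 := by linarith
      have e2 : y₂ = 1 / 3 := by linarith
      have e3 : y₃ = -1 / 3 := by linarith
      have e4 : w = 5 / 3 := by linarith
      rw [e1, e2, e3, e4] at hb
      norm_num at hb
    | _ => simp
  · refine ⟨[pos 0, pos 2, neg 3, A], List.mem_append_left _ (List.mem_append_right _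
      (by decide +kernel)), fun l hl => ?_⟩
    cases hl with
    | pos_four a b c => exact (h4 a b c).elim
    | pos_six a b c d => linarith
    | H a b => exact absurd b hH
    | _ => simp

theorem covers_between (ht : t ∈ Ioo t₂ t₁) :
    Covers t (boxEdges ++ letterSets ++ tripleNegSets ++ triplePoleSets) := by
  have ht0 : 0 < t := t₂_pos.trans ht.1
  have hq : 1 / 2 < t ^ 2 := by rw [← t₂_sq]; exact pow_lt_pow_left₀ ht.1 t₂_pos.le two_ne_zero
  have hq1 : t ^ 2 < 3 / 5 := by rw [← t₁_sq]; exact pow_lt_pow_left₀ ht.2 ht0.le two_ne_zero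
  refine Covers.of_tightPos ⟨ht0, ht.2.trans t₁_lt_one⟩
    (((genClosed_boxEdges.append genClosed_letterSets).append genClosed_tripleNegSets).append
      genClosed_triplePoleSets) (fun L hL => by simp [hL]) fun y₁ y₂ y₃ w h hw hb => ?_
  have hqw := h.hH hq
  by_cases hH : t ^ 2 * w = 1
  · refine ⟨[pos 0, pos 2, pos 4, H], List.mem_append_right _ (by decide +kernel), fun l hl => ?_⟩
    cases hl with
    | pos_six a b c d => rw [a] at hqw; linarith
    | A a => exact absurd hH (h.not_A_H (by linarith) a)
    | neg_three a => linarith [h.le_of_neg_three_H a hH]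
    | _ => simp
  by_cases h4 : y₁ + w = 2 ∧ y₃ = -y₂ ∧ y₂ = y₁
  · refine ⟨[pos 0, pos 2, pos 4, neg 3], List.mem_append_left _ (List.mem_append_right _
      (by decide +kernel)), fun l hl => ?_⟩
    cases hl with
    | pos_six a b c d => rw [a] at hqw; linarith
    | A a =>
      have := h.hneg
      rw [h4.2.1, h4.2.2, a] at this
      have := mul_nonneg h.q_pos.le hw.le
      linarith
    | H a b => exact absurd b hH
    | _ => simp
  · refine ⟨[pos 0, pos 2, neg 3, A], List.mem_append_left _ (List.mem_append_left _
      (List.mem_append_right _ (by decide +kernel))), fun l hl => ?_⟩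
    cases hl with
    | pos_four a b c => exact absurd ⟨a, b, c⟩ h4
    | pos_six a b c d => rw [a] at hqw; linarith
    | H a b => exact absurd b hH
    | _ => simp

theorem sq_le_half (ht : t ∈ Ioc (0 : ℝ) t₂) : t ^ 2 ≤ 1 / 2 := by
  rw [← t₂_sq]; exact pow_le_pow_left₀ ht.1.le ht.2 2

theorem covers_at_t₂ : Covers t₂ (boxEdges ++ letterSets ++ tripleNegSets) := by
  refine Covers.of_tightPos ⟨t₂_pos, t₂_lt_t₁.trans t₁_lt_one⟩
    ((genClosed_boxEdges.append genClosed_letterSets).append genClosed_tripleNegSets)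
    (fun L hL => by simp [hL]) fun y₁ y₂ y₃ w h hw hb => ?_
  have h6 : w = 2 → y₁ = 0 → y₂ = 0 → y₃ = 0 → False := by
    intro a b c d
    rw [a, b, c, d, t₂_sq] at hb
    norm_num at hb
  rw [t₂_sq] at *
  by_cases h4 : y₁ + w = 2 ∧ y₃ = -y₂ ∧ y₂ = y₁
  · refine ⟨[pos 0, pos 2, pos 4, neg 3], List.mem_append_right _ (by decide +kernel),
      fun l hl => ?_⟩
    cases hl with
    | pos_six a b c d => exact (h6 a b c d).elim
    | A a =>
      have := h.hneg
      rw [h4.2.1, h4.2.2, a] at this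
      linarith
    | H a b => norm_num at a
    | _ => simp
  · refine ⟨[pos 0, pos 2, neg 3, A], List.mem_append_left _
      (List.mem_append_right _ (by decide +kernel)), fun l hl => ?_⟩
    cases hl with
    | pos_four a b c => exact absurd ⟨a, b, c⟩ h4
    | pos_six a b c d => exact (h6 a b c d).elim
    | H a b => norm_num at a
    | _ => simp

theorem covers_below (ht : t ∈ Ioo 0 t₂) :
    Covers t (boxEdges ++ letterSets ++ tripleNegSets ++ apexSets) := by
  have hq := sq_le_half ⟨ht.1, ht.2.le⟩
  refine Covers.of_tightPos ⟨ht.1, ht.2.trans (t₂_lt_t₁.trans t₁_lt_one)⟩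
    (((genClosed_boxEdges.append genClosed_letterSets).append genClosed_tripleNegSets).append
      genClosed_apexSets) (fun L hL => by simp [hL]) fun y₁ y₂ y₃ w h hw hb => ?_
  by_cases h6 : w = 2 ∧ y₁ = 0 ∧ y₂ = 0 ∧ y₃ = 0
  · refine ⟨[pos 0, pos 2, pos 4, pos 6], List.mem_append_right _ (by decide +kernel),
      fun l hl => ?_⟩
    obtain ⟨a, b, c, d⟩ := h6
    cases hl with
    | neg_three e => rw [a, b, c, d] at e; linarith
    | A e => linarith
    | H e f => linarith
    | _ => simp
  by_cases h4 : y₁ + w = 2 ∧ y₃ = -y₂ ∧ y₂ = y₁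
  · refine ⟨[pos 0, pos 2, pos 4, neg 3], List.mem_append_left _ (List.mem_append_right _
      (by decide +kernel)), fun l hl => ?_⟩
    cases hl with
    | pos_six a b c d => exact absurd ⟨a, b, c, d⟩ h6
    | A a =>
      have := h.hneg
      rw [h4.2.1, h4.2.2, a] at this
      have := mul_nonneg h.q_pos.le hw.le
      linarith
    | H a b => linarith
    | _ => simp
  · refine ⟨[pos 0, pos 2, neg 3, A], List.mem_append_left _ (List.mem_append_left _
      (List.mem_append_right _ (by decide +kernel))), fun l hl => ?_⟩
    cases hl with
    | pos_four a b c => exact absurd ⟨a, b, c⟩ h4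
    | pos_six a b c d => exact absurd ⟨a, b, c, d⟩ h6
    | H a b => linarith
    | _ => simp

end CellFamily

namespace CellFamily

open Label

variable {t : ℝ}

theorem covers_at_one : Covers 1 (boxEdges ++ letterEdgesOne ++ poleEdgesOne) := by
  refine Covers.of_chamber ⟨one_pos, le_rfl⟩
    ((genClosed_boxEdges.append genClosed_letterEdgesOne).append genClosed_poleEdgesOne)
    fun y₁ y₂ y₃ z h _ hb => ?_
  rw [lor_pt_self one_pos] at hb
  simp only [one_pow, div_one, one_mul] at h hb
  have hH := h.hH (by norm_num)
  rw [one_mul] at hH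
  obtain ⟨-, -, g3, g4, g5, g6, g7, g8, g9, -⟩ := h
  rw [one_mul] at g9
  have hs : y₁ + z < 2 := by
    by_contra hc
    have e1 : y₁ = 1 := by linarith
    have e2 : z = 1 := by linarith
    rw [e1, e2] at hb
    nlinarith [sq_nonneg y₂, sq_nonneg y₃]
  have hpos : ∀ i, pos i ∈ tight 1 (pt y₁ y₂ y₃ z) → corner i 0 * y₁ + corner i 1 * y₂ +
      corner i 2 * y₃ + eps i * z - 2 = 0 := by
    intro i h
    have := h.2
    rwa [lor_pt_pos, div_sqrt_two_eq_zero, div_one] at this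
  have hneg : ∀ i, neg i ∈ tight 1 (pt y₁ y₂ y₃ z) → corner i 0 * y₁ + corner i 1 * y₂ +
      corner i 2 * y₃ - eps i * z - 2 = 0 := by
    intro i h
    have := h.2
    rwa [lor_pt_neg, div_sqrt_two_eq_zero, one_mul] at this
  have hB : B ∉ tight 1 (pt y₁ y₂ y₃ z) := by
    rintro ⟨-, h⟩
    rw [lor_pt_B] at h
    have e1 : y₁ = 1 := by linarith
    have e2 : y₂ = 1 := by linarith
    rw [e1, e2] at hb
    nlinarith [sq_nonneg y₃, sq_nonneg z]
  have hlet : ∀ l ∈ tight 1 (pt y₁ y₂ y₃ z), l = C ∨ l = D ∨ l = E ∨ l = F ∨ l = G → False := by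
    rintro l ⟨-, h⟩ (rfl | rfl | rfl | rfl | rfl)
    · rw [lor_pt_C] at h; linarith
    · rw [lor_pt_D] at h; linarith
    · rw [lor_pt_E] at h; linarith
    · rw [lor_pt_F] at h; linarith
    · rw [lor_pt_G] at h; linarith
  have hH' : H ∈ tight 1 (pt y₁ y₂ y₃ z) → z = 1 := by
    rintro ⟨-, h⟩
    rw [lor_pt_H] at h; linarith
  have hA' : A ∈ tight 1 (pt y₁ y₂ y₃ z) → y₁ = 1 := by
    rintro ⟨-, h⟩
    rw [lor_pt_A] at h; linarith
  rcases eq_or_lt_of_le g6 with hw | hw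
  · subst hw
    have hy : y₁ + y₂ + y₃ = 2 → y₁ + y₂ - y₃ = 2 → False := by
      intro h1 h2
      have e1 : y₁ = 1 := by linarith
      have e2 : y₂ = 1 := by linarith
      rw [e1, e2] at hb
      nlinarith [sq_nonneg y₃]
    have m0 : [A, pos 0, neg 0] ∈ boxEdges := by decide +kernel
    have m3 : [A, pos 3, neg 3] ∈ boxEdges := by decide +kernel
    by_cases h3 : y₁ + y₂ - y₃ = 2
    · refine ⟨_, List.mem_append_left _ (List.mem_append_left _ m3), fun l hl => ?_⟩
      cases l with
      | pos i =>
        have := hpos i hl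
        fin_cases i <;> simp [corner, eps] at this ⊢ <;>
          first | linarith | (exact hy (by linarith) (by linarith))
      | neg i =>
        have := hneg i hl
        fin_cases i <;> simp [corner, eps] at this ⊢ <;>
          first | linarith | (exact hy (by linarith) (by linarith))
      | A => simp
      | B => exact absurd hl hB
      | H => linarith [hH' hl]
      | _ => exact (hlet _ hl (by simp)).elim
    · refine ⟨_, List.mem_append_left _ (List.mem_append_left _ m0), fun l hl => ?_⟩
      cases l with
      | pos i =>
        have := hpos i hl
        fin_cases i <;> simp [corner, eps] at this ⊢ <;>
          first | linarith | exact h3 (by linarith)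
      | neg i =>
        have := hneg i hl
        fin_cases i <;> simp [corner, eps] at this ⊢ <;>
          first | linarith | exact h3 (by linarith)
      | A => simp
      | B => exact absurd hl hB
      | H => linarith [hH' hl]
      | _ => exact (hlet _ hl (by simp)).elim
  · by_cases hz : z = 1
    · refine ⟨[pos 0, neg 3, H], List.mem_append_right _ (by decide +kernel), fun l hl => ?_⟩
      cases l with
      | pos i =>
        have := hpos i hl
        fin_cases i <;> simp [corner, eps] at this ⊢ <;> linarith
      | neg i =>
        have := hneg i hl
        fin_cases i <;> simp [corner, eps] at this ⊢ <;> linarith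
      | A => linarith [hA' hl]
      | B => exact absurd hl hB
      | H => simp
      | _ => exact (hlet _ hl (by simp)).elim
    · refine ⟨[pos 0, neg 3, A], List.mem_append_left _ (List.mem_append_right _
        (by decide +kernel)), fun l hl => ?_⟩
      cases l with
      | pos i =>
        have := hpos i hl
        fin_cases i <;> simp [corner, eps] at this ⊢ <;> linarith
      | neg i =>
        have := hneg i hl
        fin_cases i <;> simp [corner, eps] at this ⊢ <;> linarith
      | A => simp
      | B => exact absurd hl hB
      | H => exact absurd (hH' hl) hz
      | _ => exact (hlet _ hl (by simp)).elim

/-! ### Points with prescribed incidence -/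

/-- A property of sets of walls that is invariant under the symmetries passes to orbits. -/
theorem orbit_induction {Q : List Label → Prop} {L : List Label} (hL : Q L)
    (hgen : ∀ j M, Q M → Q (M.map (genLabel j))) : ∀ M ∈ orbit L, Q M := by
  intro M hM
  obtain ⟨w, -, rfl⟩ := List.mem_map.1 ((List.pwFilter_subset _) hM)
  clear hM
  induction w with
  | nil => exact hL
  | cons j w ih => exact hgen _ _ ih

/-- Some finite point of the polytope lies exactly on the walls in `L`. -/
def Realized (t : ℝ) (L : List Label) : Prop :=
  ∃ p ∈ slice t, lor p p < 0 ∧ tight t p = {l | l ∈ L}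

/-- The half-spaces in `L` are independent. -/
def Free (t : ℝ) (L : List Label) : Prop :=
  ∀ b : Label → ℝ, ∃ u, ∀ l ∈ L, lor u (vec t l) = b l

theorem mem_map_genLabel {j : Fin 3} {L : List Label} {l : Label} :
    l ∈ L.map (genLabel j) ↔ genLabel j l ∈ L := by
  rw [List.mem_map]
  exact ⟨by rintro ⟨m, hm, rfl⟩; rwa [genLabel_genLabel], fun h => ⟨_, h, genLabel_genLabel j l⟩⟩

theorem Realized.map {L : List Label} (h : Realized t L) (j : Fin 3) :
    Realized t (L.map (genLabel j)) := by
  obtain ⟨p, hp, hn, ht⟩ := h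
  refine ⟨gen j p, gen_mem_slice j hp, by rwa [lor_gen_gen], ?_⟩
  rw [tight_gen, ht]
  ext l
  exact mem_map_genLabel.symm

theorem Realized.orbit {L : List Label} (h : Realized t L) : ∀ M ∈ orbit L, Realized t M :=
  orbit_induction h fun j _ hM => hM.map j

theorem Free.map {L : List Label} (h : Free t L) (j : Fin 3) : Free t (L.map (genLabel j)) := by
  intro b
  obtain ⟨u, hu⟩ := h fun l => b (genLabel j l)
  refine ⟨gen j u, fun l hl => ?_⟩
  rw [lor_gen_vec', hu _ (mem_map_genLabel.1 hl), genLabel_genLabel]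

theorem Free.orbit {L : List Label} (h : Free t L) : ∀ M ∈ orbit L, Free t M :=
  orbit_induction h fun j _ hM => hM.map j

theorem Free.mono {L M : List Label} (h : Free t L) (hM : ∀ l ∈ M, l ∈ L) : Free t M := fun b =>
  (h b).imp fun _ hu l hl => hu l (hM l hl)

/-- The products of the vector with spatial coordinates `a`, `b`, `c`, `d` and vanishing time
coordinate with the vectors of the walls. They suffice to show that walls are independent. -/
theorem exists_lor_eq (t a b c d : ℝ) : ∃ u : Mink,
    (∀ i, lor u (vec t (pos i)) = corner i 0 * a + corner i 1 * b + corner i 2 * c + eps i * (d / t)) ∧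
    (∀ i, lor u (vec t (neg i)) = corner i 0 * a + corner i 1 * b + corner i 2 * c - eps i * (t * d)) ∧
    lor u (vec t A) = √2 * a ∧ lor u (vec t H) = √2 * (t * d) := by
  refine ⟨![0, a, b, c, d], fun i => ?_, fun i => ?_, ?_, ?_⟩
  · rw [vec_pos]; simp [lor]; ring
  · rw [vec_neg]; simp [lor]; ring
  · simp [lor, vec]; ring
  · simp [lor, vec]; ring

theorem free_letter (ht : 0 < t) : Free t [pos 0, pos 2, neg 3, A] := by
  intro β
  set a := β A / √2
  set d := t * ((β (pos 0) + β (pos 2)) / 2 - a) with hd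
  set s := (β (pos 0) - β (pos 2)) / 2
  set r := β (neg 3) - a - t * d with hr
  have hd' : d / t = (β (pos 0) + β (pos 2)) / 2 - a := by rw [hd]; field_simp
  obtain ⟨u, h1, h2, h3, -⟩ := exists_lor_eq t a ((s + r) / 2) ((s - r) / 2) d
  refine ⟨u, fun l hl => ?_⟩
  simp only [List.mem_cons, List.not_mem_nil, or_false] at hl
  rcases hl with rfl | rfl | rfl | rfl
  · rw [h1, hd']; simp [corner, eps]; ring
  · rw [h1, hd']; simp [corner, eps]; ring
  · rw [h2]; simp [corner, eps, hr]; ring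
  · rw [h3]; exact mul_div_cancel₀ _ (by positivity)

theorem free_pole (ht : 0 < t) : Free t [pos 0, pos 2, neg 3, H] := by
  intro β
  have h2 : √2 ≠ 0 := by positivity
  set d := β H / √2 / t with hd
  set a := (β (pos 0) + β (pos 2)) / 2 - d / t with ha
  set s := (β (pos 0) - β (pos 2)) / 2
  set r := β (neg 3) - a - t * d with hr
  obtain ⟨u, h1, h2, -, h3⟩ := exists_lor_eq t a ((s + r) / 2) ((s - r) / 2) d
  refine ⟨u, fun l hl => ?_⟩
  simp only [List.mem_cons, List.not_mem_nil, or_false] at hl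
  rcases hl with rfl | rfl | rfl | rfl
  · rw [h1]; simp [corner, eps, ha]; ring
  · rw [h1]; simp [corner, eps, ha]; ring
  · rw [h2]; simp [corner, eps, hr]; ring
  · rw [h3, hd]; field_simp

theorem free_triplePole (ht : 0 < t) : Free t [pos 0, pos 2, pos 4, H] := by
  intro β
  have h2 : √2 ≠ 0 := by positivity
  set d := β H / √2 / t with hd
  set a := (β (pos 0) + β (pos 2)) / 2 - d / t with ha
  set s := (β (pos 0) - β (pos 2)) / 2
  set r := β (pos 4) + a - d / t with hr
  obtain ⟨u, h1, -, -, h3⟩ := exists_lor_eq t a ((s + r) / 2) ((s - r) / 2) d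
  refine ⟨u, fun l hl => ?_⟩
  simp only [List.mem_cons, List.not_mem_nil, or_false] at hl
  rcases hl with rfl | rfl | rfl | rfl
  · rw [h1]; simp [corner, eps, ha]; ring
  · rw [h1]; simp [corner, eps, ha]; ring
  · rw [h1]; simp [corner, eps, hr]; ring
  · rw [h3, hd]; field_simp

theorem free_tripleNeg (ht : t ∈ Ioc (0 : ℝ) 1) : Free t [pos 0, pos 2, pos 4, neg 3] := by
  intro β
  have ht0 := ht.1
  have h3 : 3 - t ^ 2 ≠ 0 := by nlinarith [ht.2]
  set δ := (β (pos 0) + β (pos 2) + β (pos 4) - β (neg 3)) / (3 - t ^ 2) with hδ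
  have hδ' : β (neg 3) = β (pos 0) + β (pos 2) + β (pos 4) - (3 - t ^ 2) * δ := by
    rw [hδ]; field_simp; ring
  set a := (β (pos 0) + β (pos 2)) / 2 - δ with ha
  set s := (β (pos 0) - β (pos 2)) / 2
  set r := β (pos 4) + a - δ with hr
  obtain ⟨u, h1, h2, -, -⟩ := exists_lor_eq t a ((s + r) / 2) ((s - r) / 2) (t * δ)
  have hd' : t * δ / t = δ := by field_simp
  refine ⟨u, fun l hl => ?_⟩
  simp only [List.mem_cons, List.not_mem_nil, or_false] at hl
  rcases hl with rfl | rfl | rfl | rfl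
  · rw [h1, hd']; simp [corner, eps, ha]; ring
  · rw [h1, hd']; simp [corner, eps, ha]; ring
  · rw [h1, hd']; simp [corner, eps, hr]; ring
  · rw [h2, hδ']; simp [corner, eps, hr, ha]; ring

theorem free_apex (ht : 0 < t) : Free t [pos 0, pos 2, pos 4, pos 6] := by
  intro β
  obtain ⟨u, h1, -, -, -⟩ := exists_lor_eq t
    ((β (pos 0) + β (pos 2) - β (pos 4) - β (pos 6)) / 4)
    ((β (pos 0) - β (pos 2) + β (pos 4) - β (pos 6)) / 4)
    ((β (pos 0) - β (pos 2) - β (pos 4) + β (pos 6)) / 4)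
    (t * ((β (pos 0) + β (pos 2) + β (pos 4) + β (pos 6)) / 4))
  refine ⟨u, fun l hl => ?_⟩
  simp only [List.mem_cons, List.not_mem_nil, or_false] at hl
  rcases hl with rfl | rfl | rfl | rfl <;> rw [h1, mul_div_cancel_left₀ _ ht.ne'] <;>
    simp [corner, eps] <;> ring

theorem free_boxEdge (ht : 0 < t) : Free t [A, pos 0, neg 0] := by
  intro β
  have h3 : 1 + t ^ 2 ≠ 0 := by positivity
  set a := β A / √2
  set δ := (β (pos 0) - β (neg 0)) / (1 + t ^ 2) with hδ
  have hδ' : β (neg 0) = β (pos 0) - (1 + t ^ 2) * δ := by rw [hδ]; field_simp; ring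
  obtain ⟨u, h1, h2, h3, -⟩ := exists_lor_eq t a (β (pos 0) - δ - a) 0 (t * δ)
  have hd' : t * δ / t = δ := by field_simp
  refine ⟨u, fun l hl => ?_⟩
  simp only [List.mem_cons, List.not_mem_nil, or_false] at hl
  rcases hl with rfl | rfl | rfl
  · rw [h3]; exact mul_div_cancel₀ _ (by positivity)
  · rw [h1, hd']; simp [corner, eps]
  · rw [h2, hδ']; simp [corner, eps]; ring

theorem mem_tight_pos {y₁ y₂ y₃ z : ℝ} (i : Fin 8) : pos i ∈ tight t (pt y₁ y₂ y₃ z) ↔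
    corner i 0 * y₁ + corner i 1 * y₂ + corner i 2 * y₃ + eps i * (z / t) - 2 = 0 := by
  rw [← div_sqrt_two_eq_zero, ← lor_pt_pos]
  exact and_iff_right (pos_mem_active i)

theorem mem_tight_neg {y₁ y₂ y₃ z : ℝ} (i : Fin 8) : neg i ∈ tight t (pt y₁ y₂ y₃ z) ↔
    corner i 0 * y₁ + corner i 1 * y₂ + corner i 2 * y₃ - eps i * (t * z) - 2 = 0 := by
  rw [← div_sqrt_two_eq_zero, ← lor_pt_neg]
  exact and_iff_right (neg_mem_active i)

theorem mem_tight_A {y₁ y₂ y₃ z : ℝ} : A ∈ tight t (pt y₁ y₂ y₃ z) ↔ y₁ = 1 := by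
  rw [← sub_eq_zero, ← lor_pt_A y₁ y₂ y₃ z t]
  exact and_iff_right (by simp [active])

theorem mem_tight_H {y₁ y₂ y₃ z : ℝ} (ht : t₂ < t) :
    H ∈ tight t (pt y₁ y₂ y₃ z) ↔ t * z = 1 := by
  rw [← sub_eq_zero, ← lor_pt_H y₁ y₂ y₃ z t]
  exact and_iff_right fun _ => ht

/-- To realize `L` before the time `1`, it suffices to give a point of the chamber on the walls in
`L` such that all the walls listed by `tight_chamber` belong to `L`. -/
theorem Realized.of_chamber (ht : t ∈ Ioo (0 : ℝ) 1) {y₁ y₂ y₃ w : ℝ} {L : List Label}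
    (h : InChamber (t ^ 2) y₁ y₂ y₃ w) (hb : y₁ ^ 2 + y₂ ^ 2 + y₃ ^ 2 + t ^ 2 * w ^ 2 < 2)
    (h1 : ∀ l, (w = 0 ∧ TightZero y₁ y₂ y₃ l) ∨ (0 < w ∧ TightPos (t ^ 2) y₁ y₂ y₃ w l) → l ∈ L)
    (h2 : ∀ l ∈ L, l ∈ tight t (pt y₁ y₂ y₃ (t * w))) : Realized t L := by
  have hw : t * w / t = w := mul_div_cancel_left₀ _ ht.1.ne'
  have hb' : lor (pt y₁ y₂ y₃ (t * w)) (pt y₁ y₂ y₃ (t * w)) < 0 := by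
    rw [lor_pt_self ht.1, hw]; linarith
  refine ⟨pt y₁ y₂ y₃ (t * w), ?_, hb', ?_⟩
  · rwa [pt_mem_slice_iff ⟨ht.1, ht.2.le⟩ h.h12 h.h23 h.h23' (mul_nonneg ht.1.le h.w_nonneg), hw]
  · ext l
    refine ⟨fun hl => h1 l ?_, h2 l⟩
    have := tight_chamber ht (by rwa [hw]) hb' hl
    rwa [hw] at this

theorem realized_boxEdge (ht : t ∈ Ioo (0 : ℝ) 1) : Realized t [A, pos 0, neg 0] := by
  have hq : t ^ 2 < 1 := by nlinarith [ht.1, ht.2]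
  have hq0 : 0 < t ^ 2 := by have := ht.1; positivity
  refine Realized.of_chamber ht (y₁ := 1) (y₂ := 1 / 2) (y₃ := 1 / 2) (w := 0)
    ⟨hq0, hq.le, by norm_num, by norm_num, by norm_num, le_rfl, le_rfl, by norm_num, by norm_num,
      by norm_num⟩ (by norm_num) ?_ ?_
  · rintro l (⟨-, h⟩ | ⟨h, -⟩)
    · cases h with
      | pos_three h => norm_num at h
      | neg_three h => norm_num at h
      | _ => simp
    · exact absurd h (lt_irrefl 0)
  · simp [mem_tight_pos, mem_tight_neg, mem_tight_A, corner, eps]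
    norm_num

theorem realized_letter (ht : t ∈ Ioo (0 : ℝ) 1) : Realized t [pos 0, pos 2, neg 3, A] := by
  have hq : t ^ 2 < 1 := by nlinarith [ht.1, ht.2]
  have hq0 : 0 < t ^ 2 := by have := ht.1; positivity
  refine Realized.of_chamber ht (y₁ := 1) (y₂ := (1 - t ^ 2) / 2) (y₃ := -((1 - t ^ 2) / 2))
    (w := 1) ⟨hq0, hq.le, by linarith, by linarith, by linarith, zero_le_one, le_rfl, by linarith,
      by linarith, fun _ => by linarith⟩ (by nlinarith) ?_ ?_
  · rintro l (⟨h, -⟩ | ⟨-, h⟩)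
    · norm_num at h
    · cases h with
      | pos_four h h' h'' => linarith
      | pos_six h => norm_num at h
      | H h h' => linarith
      | _ => simp
  · simp [mem_tight_pos, mem_tight_neg, mem_tight_A, corner, eps, ht.1.ne']
    exact ⟨by ring, by ring⟩

theorem realized_pole (ht : t ∈ Ioo t₁ 1) : Realized t [pos 0, pos 2, neg 3, H] := by
  have ht0 : 0 < t := t₁_pos.trans ht.1
  have hq3 : 3 / 5 < t ^ 2 := by rw [← t₁_sq]; exact pow_lt_pow_left₀ ht.1 t₁_pos.le two_ne_zero
  have hq : t ^ 2 < 1 := by nlinarith [ht.2]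
  have hq0 : 0 < t ^ 2 := by positivity
  obtain ⟨r, hr⟩ : ∃ r, r = 1 / t ^ 2 := ⟨_, rfl⟩
  have hqr : t ^ 2 * r = 1 := by rw [hr]; field_simp
  have hr1 : 1 < r := by rw [hr, lt_div_iff₀ hq0]; linarith
  have hr2 : r < 5 / 3 := by rw [hr, div_lt_iff₀ hq0]; linarith
  refine Realized.of_chamber ⟨ht0, ht.2⟩ (y₁ := 2 - r) (y₂ := (r - 1) / 2) (y₃ := -((r - 1) / 2))
    (w := r) ⟨hq0, hq.le, by linarith, by linarith, by linarith, by linarith, by linarith,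
      by linarith, by linarith, fun _ => by linarith⟩ (by nlinarith) ?_ ?_
  · rintro l (⟨h, -⟩ | ⟨-, h⟩)
    · linarith
    · cases h with
      | pos_four h h' h'' => linarith
      | pos_six h => linarith
      | A h => linarith
      | _ => simp
  · have e : t * (t * r) = 1 := by linarith
    simp [mem_tight_pos, mem_tight_neg, mem_tight_H (t₂_lt_t₁.trans ht.1), corner, eps, ht0.ne', e]
    ring

theorem realized_tripleNeg (ht : t ∈ Ioo 0 t₁) : Realized t [pos 0, pos 2, pos 4, neg 3] := by
  have ht0 : 0 < t := ht.1
  have hq : t ^ 2 < 3 / 5 := by rw [← t₁_sq]; exact pow_lt_pow_left₀ ht.2 ht0.le two_ne_zero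
  have hq0 : 0 < t ^ 2 := by positivity
  have h3 : 0 < 3 - t ^ 2 := by linarith
  obtain ⟨w, hw⟩ : ∃ w, w = 4 / (3 - t ^ 2) := ⟨_, rfl⟩
  have hqw : (3 - t ^ 2) * w = 4 := by rw [hw]; field_simp
  have hw1 : 4 / 3 < w := by rw [hw, lt_div_iff₀ h3]; linarith
  have hw2 : w < 5 / 3 := by rw [hw, div_lt_iff₀ h3]; linarith
  refine Realized.of_chamber ⟨ht0, ht.2.trans t₁_lt_one⟩ (y₁ := 2 - w) (y₂ := 2 - w)
    (y₃ := -(2 - w)) (w := w) ⟨hq0, by linarith, by linarith, by linarith, by linarith, by linarith,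
      by linarith, by linarith, by linarith, fun _ => by linarith⟩ (by nlinarith) ?_ ?_
  · rintro l (⟨h, -⟩ | ⟨-, h⟩)
    · linarith
    · cases h with
      | pos_six h => linarith
      | A h => linarith
      | H h h' => linarith
      | _ => simp
  · have e : t * (t * w) = t ^ 2 * w := by ring
    simp [mem_tight_pos, mem_tight_neg, corner, eps, ht0.ne', e]
    constructor <;> linarith

theorem realized_triplePole (ht : t ∈ Ioo t₂ t₁) : Realized t [pos 0, pos 2, pos 4, H] := by
  have ht0 : 0 < t := t₂_pos.trans ht.1
  have hq3 : 1 / 2 < t ^ 2 := by rw [← t₂_sq]; exact pow_lt_pow_left₀ ht.1 t₂_pos.le two_ne_zero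
  have hq : t ^ 2 < 3 / 5 := by rw [← t₁_sq]; exact pow_lt_pow_left₀ ht.2 ht0.le two_ne_zero
  have hq0 : 0 < t ^ 2 := by positivity
  obtain ⟨r, hr⟩ : ∃ r, r = 1 / t ^ 2 := ⟨_, rfl⟩
  have hqr : t ^ 2 * r = 1 := by rw [hr]; field_simp
  have hr1 : 5 / 3 < r := by rw [hr, lt_div_iff₀ hq0]; linarith
  have hr2 : r < 2 := by rw [hr, div_lt_iff₀ hq0]; linarith
  refine Realized.of_chamber ⟨ht0, ht.2.trans t₁_lt_one⟩ (y₁ := 2 - r) (y₂ := 2 - r)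
    (y₃ := -(2 - r)) (w := r) ⟨hq0, by linarith, by linarith, by linarith, by linarith, by linarith,
      by linarith, by linarith, by linarith, fun _ => by linarith⟩ (by nlinarith) ?_ ?_
  · rintro l (⟨h, -⟩ | ⟨-, h⟩)
    · linarith
    · cases h with
      | pos_six h => linarith
      | neg_three h => linarith
      | A h => linarith
      | _ => simp
  · have e : t * (t * r) = 1 := by linarith
    simp [mem_tight_pos, mem_tight_H ht.1, corner, eps, ht0.ne', e]
    ring

theorem realized_apex (ht : t ∈ Ioo 0 t₂) : Realized t [pos 0, pos 2, pos 4, pos 6] := by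
  have ht0 : 0 < t := ht.1
  have hq : t ^ 2 < 1 / 2 := by rw [← t₂_sq]; exact pow_lt_pow_left₀ ht.2 ht0.le two_ne_zero
  have hq0 : 0 < t ^ 2 := by positivity
  refine Realized.of_chamber ⟨ht0, ht.2.trans (t₂_lt_t₁.trans t₁_lt_one)⟩ (y₁ := 0) (y₂ := 0)
    (y₃ := 0) (w := 2) ⟨hq0, by linarith, by norm_num, by norm_num, by norm_num, by norm_num,
      by norm_num, by norm_num, by linarith, fun _ => by linarith⟩ (by linarith) ?_ ?_
  · rintro l (⟨h, -⟩ | ⟨-, h⟩)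
    · norm_num at h
    · cases h with
      | neg_three h => linarith
      | A h => norm_num at h
      | H h h' => linarith
      | _ => simp
  · simp [mem_tight_pos, corner, eps, ht0.ne']

theorem realized_poleEdge : Realized t₁ [pos 0, pos 2, H] := by
  have ht0 := t₁_pos
  have hq := t₁_sq
  refine Realized.of_chamber ⟨ht0, t₁_lt_one⟩ (y₁ := 1 / 3) (y₂ := 0) (y₃ := 0) (w := 5 / 3) ?_ ?_ ?_ ?_
  · rw [hq]; constructor <;> norm_num
  · rw [hq]; norm_num
  · rw [hq]
    rintro l (⟨h, -⟩ | ⟨-, h⟩)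
    · norm_num at h
    · cases h with
      | pos_four h h' h'' => norm_num at h''
      | pos_six h => norm_num at h
      | neg_three h => norm_num at h
      | A h => norm_num at h
      | _ => simp
  · have e : t₁ * (t₁ * (5 / 3)) = 1 := by rw [← mul_assoc, ← pow_two, hq]; norm_num
    simp [mem_tight_pos, mem_tight_H t₂_lt_t₁, corner, eps, ht0.ne', e]
    norm_num

/-- To realize `L` at the time `1`, it suffices to give a point of the chamber that lies exactly on
the walls in `L`. -/
theorem realized_one {y₁ y₂ y₃ z : ℝ} {L : List Label} (h : InChamber 1 y₁ y₂ y₃ z)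
    (hb : y₁ ^ 2 + y₂ ^ 2 + y₃ ^ 2 + z ^ 2 < 2)
    (hL : ∀ l, lor (pt y₁ y₂ y₃ z) (vec 1 l) = 0 ↔ l ∈ L) : Realized 1 L := by
  refine ⟨pt y₁ y₂ y₃ z, ?_, ?_, ?_⟩
  · rwa [pt_mem_slice_iff ⟨one_pos, le_rfl⟩ h.h12 h.h23 h.h23' h.w_nonneg, one_pow, div_one]
  · rw [lor_pt_self one_pos]
    simp only [one_pow, div_one, one_mul]
    linarith
  · ext l
    refine ⟨fun hl => (hL l).1 hl.2, fun hl => ⟨fun _ => t₂_lt_t₁.trans t₁_lt_one, (hL l).2 hl⟩⟩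

theorem realized_boxEdge_one : Realized 1 [A, pos 0, neg 0] := by
  refine realized_one (y₁ := 1) (y₂ := 1 / 2) (y₃ := 1 / 2) (z := 0)
    (by constructor <;> norm_num) (by norm_num) fun l => ?_
  cases l with
  | pos i => rw [lor_pt_pos, div_sqrt_two_eq_zero]; fin_cases i <;> simp [corner, eps] <;> norm_num
  | neg i => rw [lor_pt_neg, div_sqrt_two_eq_zero]; fin_cases i <;> simp [corner, eps] <;> norm_num
  | _ => simp [lor_pt_A, lor_pt_B, lor_pt_C, lor_pt_D, lor_pt_E, lor_pt_F, lor_pt_G, lor_pt_H] <;> norm_num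

theorem realized_letterEdge_one : Realized 1 [pos 0, neg 3, A] := by
  refine realized_one (y₁ := 1) (y₂ := 1 / 2) (y₃ := 0) (z := 1 / 2)
    (by constructor <;> norm_num) (by norm_num) fun l => ?_
  cases l with
  | pos i => rw [lor_pt_pos, div_sqrt_two_eq_zero]; fin_cases i <;> simp [corner, eps] <;> norm_num
  | neg i => rw [lor_pt_neg, div_sqrt_two_eq_zero]; fin_cases i <;> simp [corner, eps] <;> norm_num
  | _ => simp [lor_pt_A, lor_pt_B, lor_pt_C, lor_pt_D, lor_pt_E, lor_pt_F, lor_pt_G, lor_pt_H] <;> norm_num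

theorem realized_poleEdge_one : Realized 1 [pos 0, neg 3, H] := by
  refine realized_one (y₁ := 1 / 2) (y₂ := 1 / 2) (y₃ := 0) (z := 1)
    (by constructor <;> norm_num) (by norm_num) fun l => ?_
  cases l with
  | pos i => rw [lor_pt_pos, div_sqrt_two_eq_zero]; fin_cases i <;> simp [corner, eps] <;> norm_num
  | neg i => rw [lor_pt_neg, div_sqrt_two_eq_zero]; fin_cases i <;> simp [corner, eps] <;> norm_num
  | _ => simp [lor_pt_A, lor_pt_B, lor_pt_C, lor_pt_D, lor_pt_E, lor_pt_F, lor_pt_G, lor_pt_H] <;> norm_num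

end CellFamily

namespace CellFamily

open Label

variable {t : ℝ}

/-! ### The simplicial complex of incidences -/

/-- The sets of walls that meet in a point of `P_t` are the subsets of the members of the family
`Ls`, and the polytope is simple. -/
structure IsComplex (t : ℝ) (Ls : List (List Label)) : Prop where
  covers : Covers t Ls
  realized : ∀ L ∈ Ls, Realized t L
  free : ∀ L ∈ Ls, Free t L
  nodup : ∀ L ∈ Ls, L.Nodup
  walls : ∀ l ∈ active t, ∃ L ∈ Ls, l ∈ L

/-- The number of different sets among the members of `Ls`, each of which is a list without
repetitions. -/
def count (Ls : List (List Label)) : ℕ := (Ls.map mask).dedup.length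

/-- The subsets with `k` elements of the members of `Ls`. -/
def subsets (Ls : List (List Label)) (k : ℕ) : List (List Label) :=
  Ls.flatMap (List.sublistsLen k)

theorem mem_iff_of_mask_eq {L M : List Label} (hL : L.Nodup) (hM : M.Nodup) (h : mask L = mask M)
    (l : Label) : l ∈ L ↔ l ∈ M := by
  have key : ∀ L : List Label, L.Nodup → mask L = ∑ i ∈ (L.map code).toFinset, 2 ^ i := by
    intro L hL
    rw [List.sum_toFinset _ (hL.map code_injective), List.map_map]
    rfl
  rw [key L hL, key M hM] at h
  have h2 := congrArg (code l ∈ ·) (Finset.geomSum_injective le_rfl h)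
  simpa [code_injective.eq_iff] using h2

theorem mask_eq_of_mem_iff {L M : List Label} (hL : L.Nodup) (hM : M.Nodup)
    (h : ∀ l, l ∈ L ↔ l ∈ M) : mask L = mask M :=
  (((List.perm_ext_iff_of_nodup hL hM).2 h).map _).sum_eq

theorem encard_image_setOf_mem {Ls : List (List Label)} (h : ∀ L ∈ Ls, L.Nodup) :
    ((fun L : List Label => {l | l ∈ L}) '' {L | L ∈ Ls}).encard = count Ls := by
  have h1 : (fun L : List Label => {l | l ∈ L}) '' {L | L ∈ Ls} =
      (fun m => {l | ∃ L ∈ Ls, mask L = m ∧ l ∈ L}) '' {m | m ∈ Ls.map mask} := by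
    have h2 : ∀ L ∈ Ls, {l | l ∈ L} = {l | ∃ M ∈ Ls, mask M = mask L ∧ l ∈ M} := by
      intro L hL
      ext l
      exact ⟨fun hl => ⟨L, hL, rfl, hl⟩, fun ⟨M, hM, hm, hl⟩ =>
        (mem_iff_of_mask_eq (h M hM) (h L hL) hm l).1 hl⟩
    ext S
    constructor
    · rintro ⟨L, hL, rfl⟩
      exact ⟨mask L, List.mem_map_of_mem hL, (h2 L hL).symm⟩
    · rintro ⟨m, hm, rfl⟩
      obtain ⟨L, hL, rfl⟩ := List.mem_map.1 hm
      exact ⟨L, hL, h2 L hL⟩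
  have h3 : {m | m ∈ Ls.map mask} = ((Ls.map mask).toFinset : Set ℕ) := by ext; simp
  rw [h1, InjOn.encard_image, h3, encard_coe_eq_coe_finsetCard, List.card_toFinset, count]
  rintro m hm m' hm' heq
  obtain ⟨L, hL, rfl⟩ := List.mem_map.1 hm
  obtain ⟨M, hM, rfl⟩ := List.mem_map.1 hm'
  refine mask_eq_of_mem_iff (h L hL) (h M hM) fun l => ?_
  have h4 := congrArg (l ∈ ·) heq
  simp only [mem_ofPred_eq, eq_iff_iff] at h4
  exact ⟨fun hl => by
    obtain ⟨N, hN, hm, hl⟩ := h4.1 ⟨L, hL, rfl, hl⟩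
    exact (mem_iff_of_mask_eq (h N hN) (h M hM) hm l).1 hl, fun hl => by
    obtain ⟨N, hN, hm, hl⟩ := h4.2 ⟨M, hM, rfl, hl⟩
    exact (mem_iff_of_mask_eq (h N hN) (h L hL) hm l).1 hl⟩

theorem ncard_setOf_mem {L : List Label} (h : L.Nodup) : {l | l ∈ L}.ncard = L.length := by
  have : {l | l ∈ L} = (L.toFinset : Set Label) := by ext; simp
  rw [this, ncard_coe_finset, List.toFinset_card_of_nodup h]

namespace IsComplex

variable {Ls : List (List Label)}

theorem exists_of_mem_P (h : IsComplex t Ls) {x : Mink} (hx : x ∈ P t) :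
    ∃ L ∈ Ls, ∀ l ∈ tight t x, l ∈ L := by
  obtain ⟨L, hL, hl⟩ := h.covers _ (inv_smul_mem_slice hx) (lor_inv_smul_neg hx.1)
  rw [tight_smul (inv_ne_zero hx.1.2.ne')] at hl
  exact ⟨L, hL, hl⟩

theorem isSimple (h : IsComplex t Ls) : IsSimple t := by
  intro x hx b
  obtain ⟨L, hL, hl⟩ := h.exists_of_mem_P hx
  obtain ⟨u, hu⟩ := h.free L hL b
  exact ⟨u, fun l hlx => hu l (hl l hlx)⟩

theorem exists_tight_eq_iff (h : IsComplex t Ls) {S : Set Label} :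
    (∃ x ∈ P t, tight t x = S) ↔ ∃ L ∈ Ls, ∀ l ∈ S, l ∈ L := by
  constructor
  · rintro ⟨x, hx, rfl⟩
    exact h.exists_of_mem_P hx
  · rintro ⟨L, hL, hS⟩
    obtain ⟨p, hp, hn, ht⟩ := h.realized L hL
    obtain ⟨c, hc, hx⟩ := exists_mem_P_of_slice hp hn
    refine h.isSimple.exists_tight_eq hx ?_
    rw [tight_smul hc.ne', ht]
    exact hS

theorem wallsNonempty (h : IsComplex t Ls) : WallsNonempty t := by
  intro l hl
  obtain ⟨L, hL, hlL⟩ := h.walls l hl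
  obtain ⟨x, hx, ht⟩ := h.exists_tight_eq_iff.2 ⟨L, hL, fun l (hl : l ∈ {l | l ∈ L}) => hl⟩
  exact ⟨x, hx, by rw [ht]; exact hlL⟩

theorem nonempty (h : IsComplex t Ls) : (P t).Nonempty := by
  obtain ⟨x, hx, -⟩ := h.wallsNonempty A (by simp [active])
  exact ⟨x, hx⟩

theorem exists_subset (h : IsComplex t Ls) {k : ℕ} {S : Set Label} :
    (∃ x ∈ P t, tight t x = S ∧ S.ncard = k) ↔ ∃ L ∈ subsets Ls k, S = {l | l ∈ L} := by
  classical
  constructor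
  · rintro ⟨x, hx, rfl, hk⟩
    obtain ⟨L, hL, hl⟩ := h.exists_of_mem_P hx
    have hS : tight t x = {l | l ∈ L.filter (· ∈ tight t x)} := by
      ext l
      simp only [List.mem_filter, decide_eq_true_eq, mem_ofPred_eq]
      exact ⟨fun h => ⟨hl l h, h⟩, fun h => h.2⟩
    refine ⟨_, List.mem_flatMap.2 ⟨L, hL, List.mem_sublistsLen.2 ⟨List.filter_sublist, ?_⟩⟩, hS⟩
    rw [← hk, ← ncard_setOf_mem ((h.nodup L hL).filter _), ← hS]
  · rintro ⟨M, hM, rfl⟩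
    obtain ⟨L, hL, hML⟩ := List.mem_flatMap.1 hM
    obtain ⟨hs, hlen⟩ := List.mem_sublistsLen.1 hML
    obtain ⟨x, hx, ht⟩ := h.exists_tight_eq_iff.2
      ⟨L, hL, fun l (hl : l ∈ {l | l ∈ M}) => hs.subset hl⟩
    exact ⟨x, hx, ht, by rw [ncard_setOf_mem ((h.nodup L hL).sublist hs), hlen]⟩

theorem nodup_of_mem_subsets (h : IsComplex t Ls) {k : ℕ} {M : List Label}
    (hM : M ∈ subsets Ls k) : M.Nodup := by
  obtain ⟨L, hL, hML⟩ := List.mem_flatMap.1 hM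
  exact (h.nodup L hL).sublist (List.mem_sublistsLen.1 hML).1

theorem mem_strata (h : IsComplex t Ls) {k : ℕ} {S : Set Mink} (hS : S ∈ strata t k) :
    ∃ L ∈ subsets Ls (4 - k), wallsThrough t S = {l | l ∈ L} ∧ S = stratum t {l | l ∈ L} ∧
      (wallsThrough t S).ncard + k = 4 := by
  obtain ⟨x, hx, hk, rfl⟩ := (mem_strata_iff h.isSimple).1 hS
  obtain ⟨L, hL, he⟩ := h.exists_subset.1 ⟨x, hx, rfl, show _ = 4 - k by omega⟩
  exact ⟨L, hL, by rw [wallsThrough_stratum hx, he], by rw [he],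
    by rw [wallsThrough_stratum hx, hk]⟩

theorem encard_strata (h : IsComplex t Ls) {k : ℕ} (hk : k ≤ 4) (Q : Set Label → Prop)
    (q : List Label → Bool) (hq : ∀ L ∈ subsets Ls (4 - k), Q {l | l ∈ L} ↔ q L = true) :
    {S ∈ strata t k | Q (wallsThrough t S)}.encard =
      count ((subsets Ls (4 - k)).filter q) := by
  rw [← encard_image_setOf_mem fun L hL => h.nodup_of_mem_subsets (List.mem_filter.1 hL).1]
  rw [← InjOn.encard_image (f := wallsThrough t)]
  · congr 1
    ext T
    constructor
    · rintro ⟨S, ⟨hS, hQ⟩, rfl⟩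
      obtain ⟨L, hL, he, -⟩ := h.mem_strata hS
      exact ⟨L, List.mem_filter.2 ⟨hL, (hq L hL).1 (he ▸ hQ)⟩, he.symm⟩
    · rintro ⟨L, hL, rfl⟩
      obtain ⟨hL, hqL⟩ := List.mem_filter.1 hL
      obtain ⟨x, hx, ht, hn⟩ := h.exists_subset.2 ⟨L, hL, rfl⟩
      refine ⟨stratum t (tight t x), ⟨(mem_strata_iff h.isSimple).2 ⟨x, hx, ?_, rfl⟩, ?_⟩, ?_⟩
      · rw [ht, hn]; omega
      · rw [wallsThrough_stratum hx, ht]; exact (hq L hL).2 hqL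
      · rw [wallsThrough_stratum hx, ht]
  · rintro S ⟨hS, -⟩ S' ⟨hS', -⟩ he
    obtain ⟨L, hL, e1, e2, -⟩ := h.mem_strata hS
    obtain ⟨L', hL', e1', e2', -⟩ := h.mem_strata hS'
    rw [e2, e2', ← e1, ← e1', he]

theorem mem_finVertices_iff (h : IsComplex t Ls) {x : Mink} :
    x ∈ finVertices t ↔ x ∈ P t ∧ (tight t x).ncard = 4 := by
  rw [finVertices_eq h.isSimple]; rfl

theorem injOn_tight (h : IsComplex t Ls) : InjOn (tight t) (finVertices t) := by
  intro x hx y hy he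
  rw [h.mem_finVertices_iff] at hx hy
  have h1 := stratum_eq_singleton h.isSimple hx.1 hx.2
  have h2 := stratum_eq_singleton h.isSimple hy.1 hy.2
  rw [he, h2] at h1
  exact (singleton_injective h1).symm

theorem encard_finVertices (h : IsComplex t Ls) (Q : Set Label → Prop)
    (q : List Label → Bool) (hq : ∀ L ∈ subsets Ls 4, Q {l | l ∈ L} ↔ q L = true) :
    {x ∈ finVertices t | Q (tight t x)}.encard = count ((subsets Ls 4).filter q) := by
  rw [← encard_image_setOf_mem fun L hL => h.nodup_of_mem_subsets (List.mem_filter.1 hL).1]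
  rw [← InjOn.encard_image (f := tight t) (h.injOn_tight.mono fun x hx => hx.1)]
  congr 1
  ext T
  constructor
  · rintro ⟨x, ⟨hx, hQ⟩, rfl⟩
    rw [h.mem_finVertices_iff] at hx
    obtain ⟨L, hL, he⟩ := h.exists_subset.1 ⟨x, hx.1, rfl, hx.2⟩
    exact ⟨L, List.mem_filter.2 ⟨hL, (hq L hL).1 (he ▸ hQ)⟩, he.symm⟩
  · rintro ⟨L, hL, rfl⟩
    obtain ⟨hL, hqL⟩ := List.mem_filter.1 hL
    obtain ⟨x, hx, ht, hn⟩ := h.exists_subset.2 ⟨L, hL, rfl⟩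
    exact ⟨x, ⟨h.mem_finVertices_iff.2 ⟨hx, by rw [ht, hn]⟩, by rw [ht]; exact (hq L hL).2 hqL⟩, ht⟩

theorem encard_strata_eq_count (h : IsComplex t Ls) {k : ℕ} (hk : k ≤ 4) :
    (strata t k).encard = count (subsets Ls (4 - k)) := by
  have := h.encard_strata hk (fun _ => True) (fun _ => true) (by simp)
  simpa [List.filter_eq_self.2] using this

theorem encard_finVertices_eq_count (h : IsComplex t Ls) :
    (finVertices t).encard = count (subsets Ls 4) := by
  have := h.encard_finVertices (fun _ => True) (fun _ => true) (by simp)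
  simpa [List.filter_eq_self.2] using this

end IsComplex

/-- The maximal sets of walls that meet between `t₁` and `1`. -/
def aboveSets : List (List Label) := boxEdges ++ letterSets ++ poleSets

/-- The maximal sets of walls that meet at the time `t₁`. -/
def atT₁Sets : List (List Label) := boxEdges ++ letterSets ++ poleEdges

/-- The maximal sets of walls that meet between `t₂` and `t₁`. -/
def betweenSets : List (List Label) := boxEdges ++ letterSets ++ tripleNegSets ++ triplePoleSets

/-- The maximal sets of walls that meet at the time `t₂`. -/
def atT₂Sets : List (List Label) := boxEdges ++ letterSets ++ tripleNegSets

/-- The maximal sets of walls that meet before the time `t₂`. -/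
def belowSets : List (List Label) := boxEdges ++ letterSets ++ tripleNegSets ++ apexSets

/-- The maximal sets of walls that meet at the time `1`. -/
def atOneSets : List (List Label) := boxEdges ++ letterEdgesOne ++ poleEdgesOne

/-- All the labels. -/
def allLabels : List Label :=
  [pos 0, pos 1, pos 2, pos 3, pos 4, pos 5, pos 6, pos 7,
    neg 0, neg 1, neg 2, neg 3, neg 4, neg 5, neg 6, neg 7, A, B, C, D, E, F, G, H]

/-- The labels of the walls up to the time `t₂`, that is, all except `G` and `H`. -/
def someLabels : List Label :=
  [pos 0, pos 1, pos 2, pos 3, pos 4, pos 5, pos 6, pos 7,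
    neg 0, neg 1, neg 2, neg 3, neg 4, neg 5, neg 6, neg 7, A, B, C, D, E, F]

theorem mem_allLabels (l : Label) : l ∈ allLabels := by
  cases l with
  | pos i => fin_cases i <;> decide
  | neg i => fin_cases i <;> decide
  | _ => decide

theorem mem_someLabels (ht : t ≤ t₂) {l : Label} (hl : l ∈ active t) : l ∈ someLabels := by
  have := mem_allLabels l
  have h1 : l ≠ G := fun h => absurd (hl (.inl h)) ht.not_gt
  have h2 : l ≠ H := fun h => absurd (hl (.inr h)) ht.not_gt
  simp only [allLabels, someLabels, List.mem_cons, List.not_mem_nil, or_false] at this ⊢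
  tauto

theorem isComplex_above (ht : t ∈ Ioo t₁ 1) : IsComplex t aboveSets := by
  have ht0 : 0 < t := t₁_pos.trans ht.1
  refine ⟨covers_above ht, ?_, ?_, by decide +kernel, fun l _ => ?_⟩
  · simp only [aboveSets, List.mem_append, or_imp, forall_and]
    exact ⟨⟨(realized_boxEdge ⟨ht0, ht.2⟩).orbit, (realized_letter ⟨ht0, ht.2⟩).orbit⟩,
      (realized_pole ht).orbit⟩
  · simp only [aboveSets, List.mem_append, or_imp, forall_and]
    exact ⟨⟨(free_boxEdge ht0).orbit, (free_letter ht0).orbit⟩, (free_pole ht0).orbit⟩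
  · exact (show ∀ l ∈ allLabels, ∃ L ∈ aboveSets, l ∈ L by decide +kernel) l (mem_allLabels l)

theorem isComplex_at_t₁ : IsComplex t₁ atT₁Sets := by
  have ht0 := t₁_pos
  have ht : t₁ ∈ Ioo (0 : ℝ) 1 := ⟨ht0, t₁_lt_one⟩
  refine ⟨covers_at_t₁, ?_, ?_, by decide +kernel, fun l _ => ?_⟩
  · simp only [atT₁Sets, List.mem_append, or_imp, forall_and]
    exact ⟨⟨(realized_boxEdge ht).orbit, (realized_letter ht).orbit⟩, realized_poleEdge.orbit⟩
  · simp only [atT₁Sets, List.mem_append, or_imp, forall_and]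
    exact ⟨⟨(free_boxEdge ht0).orbit, (free_letter ht0).orbit⟩,
      ((free_pole ht0).mono (by simp)).orbit⟩
  · exact (show ∀ l ∈ allLabels, ∃ L ∈ atT₁Sets, l ∈ L by decide +kernel) l (mem_allLabels l)

theorem isComplex_between (ht : t ∈ Ioo t₂ t₁) : IsComplex t betweenSets := by
  have ht0 : 0 < t := t₂_pos.trans ht.1
  have ht' : t ∈ Ioo (0 : ℝ) 1 := ⟨ht0, ht.2.trans t₁_lt_one⟩
  refine ⟨covers_between ht, ?_, ?_, by decide +kernel, fun l _ => ?_⟩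
  · simp only [betweenSets, List.mem_append, or_imp, forall_and]
    exact ⟨⟨⟨(realized_boxEdge ht').orbit, (realized_letter ht').orbit⟩,
      (realized_tripleNeg ⟨ht0, ht.2⟩).orbit⟩, (realized_triplePole ht).orbit⟩
  · simp only [betweenSets, List.mem_append, or_imp, forall_and]
    exact ⟨⟨⟨(free_boxEdge ht0).orbit, (free_letter ht0).orbit⟩,
      (free_tripleNeg ⟨ht0, ht'.2.le⟩).orbit⟩, (free_triplePole ht0).orbit⟩
  · exact (show ∀ l ∈ allLabels, ∃ L ∈ betweenSets, l ∈ L by decide +kernel) l (mem_allLabels l)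

theorem isComplex_at_t₂ : IsComplex t₂ atT₂Sets := by
  have ht0 := t₂_pos
  have ht : t₂ ∈ Ioo (0 : ℝ) 1 := ⟨ht0, t₂_lt_t₁.trans t₁_lt_one⟩
  refine ⟨covers_at_t₂, ?_, ?_, by decide +kernel, fun l hl => ?_⟩
  · simp only [atT₂Sets, List.mem_append, or_imp, forall_and]
    exact ⟨⟨(realized_boxEdge ht).orbit, (realized_letter ht).orbit⟩,
      (realized_tripleNeg ⟨ht0, t₂_lt_t₁⟩).orbit⟩
  · simp only [atT₂Sets, List.mem_append, or_imp, forall_and]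
    exact ⟨⟨(free_boxEdge ht0).orbit, (free_letter ht0).orbit⟩,
      (free_tripleNeg ⟨ht0, ht.2.le⟩).orbit⟩
  · exact (show ∀ l ∈ someLabels, ∃ L ∈ atT₂Sets, l ∈ L by decide +kernel) l
      (mem_someLabels le_rfl hl)

theorem isComplex_below (ht : t ∈ Ioo 0 t₂) : IsComplex t belowSets := by
  have ht0 := ht.1
  have ht' : t ∈ Ioo (0 : ℝ) 1 := ⟨ht0, ht.2.trans (t₂_lt_t₁.trans t₁_lt_one)⟩
  refine ⟨covers_below ht, ?_, ?_, by decide +kernel, fun l hl => ?_⟩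
  · simp only [belowSets, List.mem_append, or_imp, forall_and]
    exact ⟨⟨⟨(realized_boxEdge ht').orbit, (realized_letter ht').orbit⟩,
      (realized_tripleNeg ⟨ht0, ht.2.trans t₂_lt_t₁⟩).orbit⟩, (realized_apex ht).orbit⟩
  · simp only [belowSets, List.mem_append, or_imp, forall_and]
    exact ⟨⟨⟨(free_boxEdge ht0).orbit, (free_letter ht0).orbit⟩,
      (free_tripleNeg ⟨ht0, ht'.2.le⟩).orbit⟩, (free_apex ht0).orbit⟩
  · exact (show ∀ l ∈ someLabels, ∃ L ∈ belowSets, l ∈ L by decide +kernel) l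
      (mem_someLabels ht.2.le hl)

theorem isComplex_at_one : IsComplex 1 atOneSets := by
  refine ⟨covers_at_one, ?_, ?_, by decide +kernel, fun l _ => ?_⟩
  · simp only [atOneSets, List.mem_append, or_imp, forall_and]
    exact ⟨⟨realized_boxEdge_one.orbit, realized_letterEdge_one.orbit⟩,
      realized_poleEdge_one.orbit⟩
  · simp only [atOneSets, List.mem_append, or_imp, forall_and]
    exact ⟨⟨(free_boxEdge one_pos).orbit, ((free_letter one_pos).mono (by simp)).orbit⟩,
      ((free_pole one_pos).mono (by simp)).orbit⟩
  · exact (show ∀ l ∈ allLabels, ∃ L ∈ atOneSets, l ∈ L by decide +kernel) l (mem_allLabels l)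

theorem count_above :
    count (subsets aboveSets 1) = 24 ∧ count (subsets aboveSets 2) = 108 ∧
      count (subsets aboveSets 3) = 144 ∧ count (subsets aboveSets 4) = 48 := by
  decide +kernel

theorem count_at_t₁ :
    count (subsets atT₁Sets 1) = 24 ∧ count (subsets atT₁Sets 2) = 100 ∧
      count (subsets atT₁Sets 3) = 120 ∧ count (subsets atT₁Sets 4) = 24 := by
  decide +kernel

theorem count_between :
    count (subsets betweenSets 1) = 24 ∧ count (subsets betweenSets 2) = 100 ∧
      count (subsets betweenSets 3) = 128 ∧ count (subsets betweenSets 4) = 40 := by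
  decide +kernel

theorem count_at_t₂ :
    count (subsets atT₂Sets 1) = 22 ∧ count (subsets atT₂Sets 2) = 92 ∧
      count (subsets atT₂Sets 3) = 116 ∧ count (subsets atT₂Sets 4) = 32 := by
  decide +kernel

theorem count_below :
    count (subsets belowSets 1) = 22 ∧ count (subsets belowSets 2) = 92 ∧
      count (subsets belowSets 3) = 116 ∧ count (subsets belowSets 4) = 34 := by
  decide +kernel

theorem count_at_one : count (subsets atOneSets 4) = 0 := by decide +kernel

end CellFamily

namespace CellFamily

open Label

variable {t : ℝ}

/-! ### Sections by small horospheres -/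

/-- An orthonormal basis of the tangent space of a horosphere is completed by a light-like vector. -/
theorem exists_lightlike {n : Mink} (h0 : n 0 = 1) (hn : lor n n = 0) {e : Fin 3 → Mink}
    (he : ∀ i j, lor (e i) (e j) = if i = j then 1 else 0) (hen : ∀ i, lor (e i) n = 0) :
    ∃ m, lor m m = 0 ∧ lor m n = -1 ∧ ∀ i, lor m (e i) = 0 := by
  set b : Mink := ![1, 0, 0, 0, 0] with hb
  have hbn : lor b n = -1 := by simp [lor, hb, h0]
  set p : Mink := b - ∑ i, lor b (e i) • e i with hp
  have hpe : ∀ i, lor p (e i) = 0 := by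
    intro i
    rw [hp, lor_sub_left, lor_sum_left]
    simp [lor_smul_left, he]
  have hpn : lor p n = -1 := by
    rw [hp, lor_sub_left, lor_sum_left, hbn]
    simp [lor_smul_left, hen]
  refine ⟨p + (lor p p / 2) • n, ?_, ?_, fun i => ?_⟩
  · simp only [lor_add_left, lor_add_right, lor_smul_left, lor_smul_right, hn, hpn, lor_comm n p]
    ring
  · rw [lor_add_left, lor_smul_left, hn, hpn]; ring
  · rw [lor_add_left, lor_smul_left, hpe, lor_comm n, hen]; ring

/-- The expansion of a vector in the frame that consists of two light-like vectors `n`, `m` and an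
orthonormal basis `e` of their orthogonal complement. -/
theorem eq_of_lor_eq {n m : Mink} (hn : lor n n = 0) (hm : lor m m = 0) (hmn : lor m n = -1)
    {e : Fin 3 → Mink} (he : ∀ i j, lor (e i) (e j) = if i = j then 1 else 0)
    (hen : ∀ i, lor (e i) n = 0) (hme : ∀ i, lor m (e i) = 0) (x : Mink) :
    x = (-lor x m) • n + (-lor x n) • m + ∑ i, lor x (e i) • e i := by
  -- the five vectors `n, m, e i` are independent, hence span the space
  let f : Fin 5 → Mink := ![n, m, e 0, e 1, e 2]
  have hnm : lor n m = -1 := by rw [lor_comm, hmn]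
  have hne : ∀ i, lor n (e i) = 0 := fun i => by rw [lor_comm, hen]
  have hem : ∀ i, lor (e i) m = 0 := fun i => by rw [lor_comm, hme]
  have hli : LinearIndependent ℝ f := by
    rw [Fintype.linearIndependent_iff]
    intro g hg
    have key : ∀ v, g 0 * lor n v + g 1 * lor m v + g 2 * lor (e 0) v + g 3 * lor (e 1) v +
        g 4 * lor (e 2) v = 0 := by
      intro v
      have h0 : lor 0 v = 0 := by simp [lor]
      have := congrArg (fun y => lor y v) hg
      simpa [Fin.sum_univ_five, lor_add_left, lor_smul_left, f, h0] using this
    have k0 := key m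
    have k1 := key n
    have k2 := key (e 0)
    have k3 := key (e 1)
    have k4 := key (e 2)
    simp [hn, hm, hmn, hnm, hen, hem, hne, hme, he] at k0 k1 k2 k3 k4
    intro i
    fin_cases i <;> simpa
  have hspan : Submodule.span ℝ (Set.range f) = ⊤ :=
    hli.span_eq_top_of_card_eq_finrank (by simp)
  have hx : x ∈ Submodule.span ℝ (Set.range f) := by rw [hspan]; trivial
  obtain ⟨g, rfl⟩ := (Submodule.mem_span_range_iff_exists_fun ℝ).1 hx
  simp only [Fin.sum_univ_five, Fin.sum_univ_three, f]
  simp [lor_add_left, lor_smul_left, hn, hm, hmn, hnm, hen, hem, hne, hme, he]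
  abel

/-- The Euclidean coordinates on horospheres given by an orthonormal frame. -/
noncomputable def horoCoord (e : Fin 3 → Mink) (x : Mink) : E3 :=
  WithLp.toLp 2 fun i => lor x (e i)

theorem horoCoord_apply (e : Fin 3 → Mink) (x : Mink) (i : Fin 3) :
    horoCoord e x i = lor x (e i) := rfl

/-- The section of the polytope by a small horosphere at an ideal point `n` is the Euclidean
polyhedron cut out by the walls through `n`, provided that this polyhedron is bounded. Here `e` is
an orthonormal frame of the horosphere, and the constants `γ l` describe the normals of the walls
modulo the frame. -/
theorem exists_horoSection {n : Mink} (hns : n ∈ slice t) (hn : lor n n = 0) {e : Fin 3 → Mink}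
    (he : ∀ i j, lor (e i) (e j) = if i = j then 1 else 0) (hen : ∀ i, lor (e i) n = 0)
    (γ : Label → ℝ)
    (hγ : ∀ l ∈ tight t n, vec t l = γ l • n + ∑ i, lor (e i) (vec t l) • e i) {K : ℝ}
    (hK : ∀ c > 0, ∀ y : E3, (∀ l ∈ tight t n, ∑ i, y i * lor (e i) (vec t l) ≤ γ l * c) →
      ∀ i, |y i| ≤ K * c) :
    ∃ c₀ > 0, ∀ c ∈ Ioo 0 c₀, IsHoroIsometry t n c (horoCoord e) ∧
      horoCoord e '' horoSection t n c =
        {y | ∀ l ∈ tight t n, ∑ i, y i * lor (e i) (vec t l) ≤ γ l * c} ∧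
      ∀ x ∈ horoSection t n c, ∀ l ∈ tight t n,
        (x ∈ wall t l ↔ ∑ i, horoCoord e x i * lor (e i) (vec t l) = γ l * c) := by
  obtain ⟨m, hm, hmn, hme⟩ := exists_lightlike hns.1 hn he hen
  have hdec := eq_of_lor_eq hn hm hmn he hen hme
  have hwall : ∀ (c : ℝ) (x : Mink), lor x n = -c → ∀ l ∈ tight t n,
      lor x (vec t l) = ∑ i, horoCoord e x i * lor (e i) (vec t l) - γ l * c := by
    intro c x hx l hl
    conv_lhs => rw [hγ l hl]
    rw [lor_add_right, lor_smul_right, hx, lor_sum_right]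
    simp only [lor_smul_right, horoCoord_apply]
    rw [Finset.sum_congr rfl fun i _ => mul_comm _ _]
    ring
  -- the walls that do not pass through `n` do not meet the section when `c` is small
  have hsmall : ∀ l, ∃ δ > 0, ∀ c ∈ Ioo 0 δ, l ∈ active t → l ∉ tight t n → ∀ g : E3,
      (∀ i, |g i| ≤ K * c) → lor (((1 + ∑ i, g i ^ 2) / (2 * c)) • n + c • m + ∑ i, g i • e i)
        (vec t l) ≤ 0 := by
    intro l
    by_cases hl : l ∈ active t ∧ l ∉ tight t n
    swap
    · exact ⟨1, one_pos, fun c _ h1 h2 => absurd ⟨h1, h2⟩ hl⟩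
    have hneg : lor n (vec t l) < 0 := lt_of_le_of_ne (hns.2 l hl.1) fun h => hl.2 ⟨hl.1, h⟩
    set B := |lor m (vec t l)| + ∑ i, |K| * |lor (e i) (vec t l)| + 1 with hB
    have hBpos : 0 < B := by positivity
    refine ⟨√(-lor n (vec t l) / (2 * B)), Real.sqrt_pos.2 (by
      apply div_pos <;> linarith), fun c hc _ _ g hg => ?_⟩
    have hc0 := hc.1
    have hc2 : c ^ 2 < -lor n (vec t l) / (2 * B) := (Real.lt_sqrt hc0.le).1 hc.2
    rw [lt_div_iff₀ (by positivity)] at hc2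
    simp only [lor_add_left, lor_smul_left, lor_sum_left]
    have h1 : (1 + ∑ i, g i ^ 2) / (2 * c) * lor n (vec t l) ≤ lor n (vec t l) / (2 * c) := by
      have : 0 ≤ ∑ i, g i ^ 2 := Finset.sum_nonneg fun i _ => sq_nonneg _
      rw [div_mul_eq_mul_div]
      gcongr
      nlinarith
    have h2 : ∑ i, g i * lor (e i) (vec t l) ≤ c * ∑ i, |K| * |lor (e i) (vec t l)| := by
      rw [Finset.mul_sum]
      refine Finset.sum_le_sum fun i _ => ?_
      calc g i * lor (e i) (vec t l) ≤ |g i| * |lor (e i) (vec t l)| := by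
            rw [← abs_mul]; exact le_abs_self _
        _ ≤ (|K| * c) * |lor (e i) (vec t l)| := by
            gcongr
            exact (hg i).trans (by gcongr; exact le_abs_self K)
        _ = _ := by ring
    have h3 : c * lor m (vec t l) ≤ c * |lor m (vec t l)| := by
      gcongr; exact le_abs_self _
    have h4 : lor n (vec t l) / (2 * c) + c * B ≤ 0 := by
      rw [div_add' _ _ _ (by positivity)]
      apply div_nonpos_of_nonpos_of_nonneg _ (by positivity)
      nlinarith
    have h5 : c * B = c * |lor m (vec t l)| + c * ∑ i, |K| * |lor (e i) (vec t l)| + c := by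
      rw [hB]; ring
    linarith
  choose δ hδ hδ' using hsmall
  obtain ⟨c₀, hc₀, hc₀'⟩ : ∃ c₀ > 0, ∀ l, c₀ ≤ δ l := by
    have : Nonempty Label := ⟨A⟩
    obtain ⟨l, hl⟩ := Finite.exists_min δ
    exact ⟨δ l, hδ l, hl⟩
  refine ⟨c₀, hc₀, fun c hc => ⟨?_, ?_, ?_⟩⟩
  · intro x hx y hy
    have hxy : lor (x - y) n = 0 := by rw [lor_sub_left, hx.2, hy.2, sub_self]
    rw [EuclideanSpace.dist_eq, Real.sq_sqrt (Finset.sum_nonneg fun i _ => sq_nonneg _)]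
    conv_rhs => rw [hdec (x - y)]
    simp only [lor_add_left, lor_add_right, lor_smul_left, lor_smul_right, lor_sum_left,
      lor_sum_right, hxy, hn, he, hen, lor_comm n (e _), Real.dist_eq, sq_abs, horoCoord_apply]
    simp [lor_sub_left, pow_two]
  · ext y
    constructor
    · rintro ⟨x, hx, rfl⟩ l hl
      have := hx.1.2 l hl.1
      rw [hwall c x hx.2 l hl] at this
      linarith
    · intro hy
      have hyK := hK c hc.1 y hy
      set x : Mink := ((1 + ∑ i, y i ^ 2) / (2 * c)) • n + c • m + ∑ i, y i • e i with hx
      have hxn : lor x n = -c := by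
        simp only [hx, lor_add_left, lor_smul_left, lor_sum_left, hn, hmn, hen]; simp
      have hxe : ∀ i, lor x (e i) = y i := by
        intro i
        simp only [hx, lor_add_left, lor_smul_left, lor_sum_left, he, hme, lor_comm n (e _), hen]
        simp
      have hxm : lor x m = -((1 + ∑ i, y i ^ 2) / (2 * c)) := by
        simp only [hx, lor_add_left, lor_smul_left, lor_sum_left, hm, lor_comm n m, hmn,
          lor_comm (e _) m, hme]
        simp
      have hxx : lor x x = -1 := by
        conv_lhs => arg 2; rw [hx]
        simp only [lor_add_right, lor_smul_right, lor_sum_right, hxn, hxe, hxm]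
        have : c ≠ 0 := hc.1.ne'
        have h2 : ∑ i, y i * y i = ∑ i, y i ^ 2 := by simp only [pow_two]
        rw [h2]
        field_simp
        ring
      have hfx : horoCoord e x = y := by
        ext i; exact hxe i
      have hx0 : 0 < x 0 := by
        -- a time-like vector with negative product with a future light-like vector is future
        by_contra hle
        have h1 := hxn
        have h2 := hxx
        simp only [lor, hns.1] at h1 h2 hn
        have hcs : (x 1 * n 1 + x 2 * n 2 + x 3 * n 3 + x 4 * n 4) ^ 2 ≤
            (x 1 ^ 2 + x 2 ^ 2 + x 3 ^ 2 + x 4 ^ 2) * (n 1 ^ 2 + n 2 ^ 2 + n 3 ^ 2 + n 4 ^ 2) := by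
          nlinarith [sq_nonneg (x 1 * n 2 - x 2 * n 1), sq_nonneg (x 1 * n 3 - x 3 * n 1),
            sq_nonneg (x 1 * n 4 - x 4 * n 1), sq_nonneg (x 2 * n 3 - x 3 * n 2),
            sq_nonneg (x 2 * n 4 - x 4 * n 2), sq_nonneg (x 3 * n 4 - x 4 * n 3)]
        have e1 : n 1 ^ 2 + n 2 ^ 2 + n 3 ^ 2 + n 4 ^ 2 = 1 := by linarith
        have e2 : x 1 ^ 2 + x 2 ^ 2 + x 3 ^ 2 + x 4 ^ 2 = x 0 ^ 2 - 1 := by linarith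
        have e3 : x 1 * n 1 + x 2 * n 2 + x 3 * n 3 + x 4 * n 4 = x 0 - c := by linarith
        rw [e1, e2, e3] at hcs
        nlinarith [hc.1, mul_nonneg hc.1.le (neg_nonneg.2 (not_lt.1 hle))]
      refine ⟨x, ⟨⟨⟨hxx, hx0⟩, fun l hl => ?_⟩, hxn⟩, hfx⟩
      by_cases h : l ∈ tight t n
      · rw [hwall c x hxn l h, hfx]
        linarith [hy l h]
      · exact hδ' l c ⟨hc.1, hc.2.trans_le (hc₀' l)⟩ hl h y hyK
  · intro x hx l hl
    have : x ∈ wall t l ↔ lor x (vec t l) = 0 :=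
      ⟨fun h => h.2 l rfl, fun h => ⟨hx.1, fun l' hl' => by rw [hl']; exact h⟩⟩
    rw [this, hwall c x hx.2 l hl, sub_eq_zero]

end CellFamily

namespace CellFamily

open Label

variable {t : ℝ}

/-! ### Ideal vertices -/

/-- Some ideal point of the slice polyhedron lies exactly on the walls in `I`. -/
def IdealRealized (t : ℝ) (I : List Label) : Prop :=
  ∃ n ∈ slice t, lor n n = 0 ∧ tight t n = {l | l ∈ I}

/-- The ideal points whose incidence sets belong to a family. -/
def idealOfType (t : ℝ) (Is : List (List Label)) : Set Mink :=
  {n ∈ idealVertices t | ∃ I ∈ Is, tight t n = {l | l ∈ I}}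

/-- A family of ideal incidence sets: they are realized, and none of them is the incidence set of
finite points. -/
structure IsIdealFamily (t : ℝ) (Ls Is : List (List Label)) : Prop where
  realized : ∀ I ∈ Is, IdealRealized t I
  nodup : ∀ I ∈ Is, I.Nodup
  not_subset : ∀ I ∈ Is, ∀ L ∈ Ls, ¬ ∀ l ∈ I, l ∈ L

/-- An ideal point is determined by its walls, since otherwise the segment between two points on
the same walls would contain a finite point on these walls. -/
theorem IsComplex.eq_of_tight_eq {Ls : List (List Label)} (h : IsComplex t Ls) {n m : Mink}
    (hn : n ∈ slice t) (hn0 : lor n n = 0) (hm : m ∈ slice t) (hm0 : lor m m = 0)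
    (he : tight t n = tight t m) (hsub : ∀ L ∈ Ls, ¬ tight t n ⊆ {l | l ∈ L}) : n = m := by
  by_contra hne
  have hneg := lor_neg_of_ne hn.1 hm.1 hn0.le hm0.le hne
  set p : Mink := (1 / 2 : ℝ) • n + (1 / 2 : ℝ) • m with hp
  have hps : p ∈ slice t := slice_convexComb hn hm (by norm_num) (by norm_num) (by norm_num)
  have hpp : lor p p < 0 := by
    simp only [hp, lor_add_left, lor_add_right, lor_smul_left, lor_smul_right, hn0, hm0,
      lor_comm m n]
    linarith
  obtain ⟨L, hL, hl⟩ := h.covers p hps hpp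
  refine hsub L hL fun l hlt => hl l ⟨hlt.1, ?_⟩
  have h1 := hlt.2
  have h2 : lor m (vec t l) = 0 := (he ▸ hlt).2
  simp [hp, lor_add_left, lor_smul_left, h1, h2]

namespace IsIdealFamily

variable {Ls Is : List (List Label)}

theorem eq_of_tight_eq (h : IsIdealFamily t Ls Is) (hc : IsComplex t Ls) {n m : Mink}
    {I : List Label} (hI : I ∈ Is) (hn : n ∈ slice t) (hn0 : lor n n = 0) (hm : m ∈ slice t)
    (hm0 : lor m m = 0) (hnI : tight t n = {l | l ∈ I}) (hmI : tight t m = {l | l ∈ I}) :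
    n = m :=
  hc.eq_of_tight_eq hn hn0 hm hm0 (hnI.trans hmI.symm) (by rw [hnI]; exact h.not_subset I hI)

theorem mono (h : IsIdealFamily t Ls Is) {Js : List (List Label)} (hJ : ∀ J ∈ Js, J ∈ Is) :
    IsIdealFamily t Ls Js :=
  ⟨fun J h1 => h.realized J (hJ J h1), fun J h1 => h.nodup J (hJ J h1),
    fun J h1 => h.not_subset J (hJ J h1)⟩

theorem append {Js : List (List Label)} (h : IsIdealFamily t Ls Is) (h' : IsIdealFamily t Ls Js) :
    IsIdealFamily t Ls (Is ++ Js) := by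
  constructor <;> simp only [List.mem_append, or_imp, forall_and]
  · exact ⟨h.realized, h'.realized⟩
  · exact ⟨h.nodup, h'.nodup⟩
  · exact ⟨h.not_subset, h'.not_subset⟩

theorem encard_idealOfType (h : IsIdealFamily t Ls Is) (hc : IsComplex t Ls) :
    (idealOfType t Is).encard = count Is := by
  rw [← encard_image_setOf_mem h.nodup, ← InjOn.encard_image (f := tight t)]
  · congr 1
    ext T
    constructor
    · rintro ⟨n, ⟨-, I, hI, he⟩, rfl⟩
      exact ⟨I, hI, he.symm⟩
    · rintro ⟨I, hI, rfl⟩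
      obtain ⟨n, hn, hn0, he⟩ := h.realized I hI
      refine ⟨n, ⟨?_, I, hI, he⟩, he⟩
      rw [idealVertices_eq hc.nonempty]
      exact ⟨hn, hn0⟩
  · rintro n ⟨hn, I, hI, hnI⟩ m ⟨hm, -⟩ he
    rw [idealVertices_eq hc.nonempty] at hn hm
    exact h.eq_of_tight_eq hc hI hn.1 hn.2 hm.1 hm.2 hnI (he.symm.trans hnI)

end IsIdealFamily

theorem IdealRealized.map {I : List Label} (h : IdealRealized t I) (j : Fin 3) :
    IdealRealized t (I.map (genLabel j)) := by
  obtain ⟨p, hp, hn, ht⟩ := h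
  refine ⟨gen j p, gen_mem_slice j hp, by rwa [lor_gen_gen], ?_⟩
  rw [tight_gen, ht]
  ext l
  exact mem_map_genLabel.symm

theorem IdealRealized.orbit {I : List Label} (h : IdealRealized t I) :
    ∀ J ∈ orbit I, IdealRealized t J :=
  orbit_induction h fun j _ hM => hM.map j

/-- The ideal point on the walls `pos 0`, `neg 0`, `pos 3`, `neg 3`, `A` and `B`. -/
noncomputable def boxPoint : Mink := pt 1 1 0 0

/-- The ideal point on the walls `pos 0`, `pos 2`, `pos 4`, `neg 3` and `H` at the time `t₁`. -/
noncomputable def prismPoint : Mink := pt (1 / 3) (1 / 3) (-1 / 3) (t₁ * (5 / 3))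

/-- The ideal point on the positive walls of even index at the time `t₂`. -/
noncomputable def apexPoint : Mink := pt 0 0 0 (t₂ * 2)

theorem tight_boxPoint : tight t boxPoint = {l | l ∈ [pos 3, neg 3, pos 0, neg 0, A, B]} := by
  ext l
  simp only [tight, boxPoint, mem_ofPred_eq]
  cases l with
  | pos i =>
    rw [lor_pt_pos, div_sqrt_two_eq_zero]
    fin_cases i <;> simp [corner, eps, active] <;> norm_num
  | neg i =>
    rw [lor_pt_neg, div_sqrt_two_eq_zero]
    fin_cases i <;> simp [corner, eps, active] <;> norm_num
  | _ =>
    simp [lor_pt_A, lor_pt_B, lor_pt_C, lor_pt_D, lor_pt_E, lor_pt_F, lor_pt_G, lor_pt_H, active]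
    try norm_num

theorem tight_prismPoint :
    tight t₁ prismPoint = {l | l ∈ [pos 0, pos 2, pos 4, neg 3, H]} := by
  have e1 : t₁ * (5 / 3) / t₁ = 5 / 3 := mul_div_cancel_left₀ _ t₁_pos.ne'
  have e2 : t₁ * (t₁ * (5 / 3)) = 1 := by rw [← mul_assoc, ← pow_two, t₁_sq]; norm_num
  ext l
  simp only [tight, prismPoint, mem_ofPred_eq]
  cases l with
  | pos i =>
    rw [lor_pt_pos, div_sqrt_two_eq_zero, e1]
    fin_cases i <;> simp [corner, eps, active] <;> norm_num
  | neg i =>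
    rw [lor_pt_neg, div_sqrt_two_eq_zero, e2]
    fin_cases i <;> simp [corner, eps, active] <;> norm_num
  | _ =>
    simp [lor_pt_A, lor_pt_B, lor_pt_C, lor_pt_D, lor_pt_E, lor_pt_F, lor_pt_G, lor_pt_H, active,
      e2, t₂_lt_t₁]
    try norm_num

theorem tight_apexPoint :
    tight t₂ apexPoint = {l | l ∈ [pos 0, pos 2, pos 4, pos 6]} := by
  have e1 : t₂ * 2 / t₂ = 2 := mul_div_cancel_left₀ _ t₂_pos.ne'
  have e2 : t₂ * (t₂ * 2) = 1 := by rw [← mul_assoc, ← pow_two, t₂_sq]; norm_num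
  ext l
  simp only [tight, apexPoint, mem_ofPred_eq]
  cases l with
  | pos i =>
    rw [lor_pt_pos, div_sqrt_two_eq_zero, e1]
    fin_cases i <;> simp [corner, eps, active] <;> norm_num
  | neg i =>
    rw [lor_pt_neg, div_sqrt_two_eq_zero, e2]
    fin_cases i <;> simp [corner, eps, active] <;> norm_num
  | _ =>
    simp [lor_pt_A, lor_pt_B, lor_pt_C, lor_pt_D, lor_pt_E, lor_pt_F, lor_pt_G, lor_pt_H, active]

theorem boxPoint_mem_slice (ht : t ∈ Ioc (0 : ℝ) 1) : boxPoint ∈ slice t := by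
  have hq0 : 0 < t ^ 2 := by have := ht.1; positivity
  rw [boxPoint, pt_mem_slice_iff ht le_rfl zero_le_one (by norm_num) le_rfl]
  constructor <;> first | positivity | nlinarith [ht.2, ht.1] | norm_num

theorem lor_boxPoint : lor boxPoint boxPoint = 0 := by
  rw [boxPoint, lor_pt_pt]; norm_num

theorem prismPoint_mem_slice : prismPoint ∈ slice t₁ := by
  have := t₁_pos
  rw [prismPoint, pt_mem_slice_iff ⟨t₁_pos, t₁_lt_one.le⟩ le_rfl (by norm_num) (by norm_num)
    (by positivity), mul_div_cancel_left₀ _ t₁_pos.ne', t₁_sq]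
  constructor <;> norm_num

theorem lor_prismPoint : lor prismPoint prismPoint = 0 := by
  rw [prismPoint, lor_pt_pt]
  linear_combination (25 / 18) * t₁_sq

theorem apexPoint_mem_slice : apexPoint ∈ slice t₂ := by
  have := t₂_pos
  rw [apexPoint, pt_mem_slice_iff ⟨t₂_pos, (t₂_lt_t₁.trans t₁_lt_one).le⟩ le_rfl le_rfl
    (by norm_num) (by positivity), mul_div_cancel_left₀ _ t₂_pos.ne', t₂_sq]
  constructor <;> norm_num

theorem lor_apexPoint : lor apexPoint apexPoint = 0 := by
  rw [apexPoint, lor_pt_pt]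
  linear_combination 2 * t₂_sq

/-- A family of sets of labels that is mapped to itself by the symmetries, up to the order of the
labels. -/
def ExactClosed (Is : List (List Label)) : Prop :=
  ∀ I ∈ Is, ∀ j, ∃ J ∈ Is, (∀ l ∈ I, genLabel j l ∈ J) ∧ ∀ l ∈ J, genLabel j l ∈ I

instance (Is : List (List Label)) : Decidable (ExactClosed Is) := by
  unfold ExactClosed; infer_instance

/-- To find the incidence sets of the ideal points it suffices to consider the chamber. -/
theorem idealVertices_eq_idealOfType (ht : t ∈ Ioc (0 : ℝ) 1) (hne : (P t).Nonempty)
    {Is : List (List Label)} (hc : ExactClosed Is)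
    (h : ∀ y₁ y₂ y₃ z, InChamber (t ^ 2) y₁ y₂ y₃ (z / t) →
      y₁ ^ 2 + y₂ ^ 2 + y₃ ^ 2 + t ^ 2 * (z / t) ^ 2 = 2 →
      ∃ I ∈ Is, tight t (pt y₁ y₂ y₃ z) = {l | l ∈ I}) :
    idealVertices t = idealOfType t Is := by
  refine Subset.antisymm (fun n hn => ⟨hn, ?_⟩) fun n hn => hn.1
  rw [idealVertices_eq hne] at hn
  refine slice_induction ht
    (Q := fun n => lor n n = 0 → ∃ I ∈ Is, tight t n = {l | l ∈ I}) ?_ ?_ hn.1 hn.2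
  · intro y₁ y₂ y₃ z hch _ h0
    rw [lor_pt_self ht.1] at h0
    exact h _ _ _ _ hch (by linarith)
  · intro j x _ ih h0
    obtain ⟨I, hI, he⟩ := ih (by rwa [lor_gen_gen])
    obtain ⟨J, hJ, h1, h2⟩ := hc I hI j
    refine ⟨J, hJ, ?_⟩
    rw [← gen_gen j x, tight_gen, he]
    ext l
    refine ⟨fun hl => ?_, fun hl => h2 l hl⟩
    rw [← genLabel_genLabel j l]
    exact h1 _ hl

theorem isIdealFamily_box (ht : t ∈ Ioc (0 : ℝ) 1) {Ls : List (List Label)}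
    (hL : ∀ I ∈ boxSets, ∀ L ∈ Ls, ¬ ∀ l ∈ I, l ∈ L) : IsIdealFamily t Ls boxSets := by
  refine ⟨IdealRealized.orbit ?_, by decide +kernel, hL⟩
  exact ⟨boxPoint, boxPoint_mem_slice ht, lor_boxPoint, tight_boxPoint⟩

theorem isIdealFamily_prism : IsIdealFamily t₁ atT₁Sets prismSets := by
  refine ⟨IdealRealized.orbit ?_, by decide +kernel, by decide +kernel⟩
  exact ⟨prismPoint, prismPoint_mem_slice, lor_prismPoint, tight_prismPoint⟩

theorem isIdealFamily_apex : IsIdealFamily t₂ atT₂Sets apexSets := by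
  refine ⟨IdealRealized.orbit ?_, by decide +kernel, by decide +kernel⟩
  exact ⟨apexPoint, apexPoint_mem_slice, lor_apexPoint, tight_apexPoint⟩

theorem eq_mul_of_div_eq (ht : 0 < t) {z w : ℝ} (h : z / t = w) : z = t * w := by
  rw [← h]; field_simp

theorem mem_boxSets : [pos 3, neg 3, pos 0, neg 0, A, B] ∈ boxSets := by decide +kernel

theorem idealVertices_eq_box (ht : t ∈ Ioo (0 : ℝ) 1) (hne : (P t).Nonempty)
    (h1 : t ≠ t₁) (h2 : t ≠ t₂) : idealVertices t = idealOfType t boxSets := by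
  refine idealVertices_eq_idealOfType ⟨ht.1, ht.2.le⟩ hne (by decide +kernel)
    fun y₁ y₂ y₃ z hch h0 => ?_
  rcases hch.sphere (by nlinarith [ht.1, ht.2]) h0 with h | h | h
  · obtain ⟨rfl, rfl, rfl, hw⟩ := h
    rw [eq_mul_of_div_eq ht.1 hw, mul_zero]
    exact ⟨_, mem_boxSets, tight_boxPoint⟩
  · exact absurd ((pow_left_inj₀ ht.1.le t₁_pos.le two_ne_zero).1 (h.1.trans t₁_sq.symm)) h1
  · exact absurd ((pow_left_inj₀ ht.1.le t₂_pos.le two_ne_zero).1 (h.1.trans t₂_sq.symm)) h2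

theorem idealVertices_t₁ : idealVertices t₁ = idealOfType t₁ (boxSets ++ prismSets) := by
  refine idealVertices_eq_idealOfType ⟨t₁_pos, t₁_lt_one.le⟩ isComplex_at_t₁.nonempty
    (by decide +kernel) fun y₁ y₂ y₃ z hch h0 => ?_
  rcases hch.sphere (by rw [t₁_sq]; norm_num) h0 with h | h | h
  · obtain ⟨rfl, rfl, rfl, hw⟩ := h
    rw [eq_mul_of_div_eq t₁_pos hw, mul_zero]
    exact ⟨_, List.mem_append_left _ mem_boxSets, tight_boxPoint⟩
  · obtain ⟨-, rfl, rfl, rfl, hw⟩ := h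
    rw [eq_mul_of_div_eq t₁_pos hw]
    exact ⟨[pos 0, pos 2, pos 4, neg 3, H], List.mem_append_right _ (by decide +kernel), tight_prismPoint⟩
  · rw [t₁_sq] at h
    norm_num at h

theorem idealVertices_t₂ : idealVertices t₂ = idealOfType t₂ (boxSets ++ apexSets) := by
  refine idealVertices_eq_idealOfType ⟨t₂_pos, (t₂_lt_t₁.trans t₁_lt_one).le⟩
    isComplex_at_t₂.nonempty (by decide +kernel) fun y₁ y₂ y₃ z hch h0 => ?_
  rcases hch.sphere (by rw [t₂_sq]; norm_num) h0 with h | h | h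
  · obtain ⟨rfl, rfl, rfl, hw⟩ := h
    rw [eq_mul_of_div_eq t₂_pos hw, mul_zero]
    exact ⟨_, List.mem_append_left _ mem_boxSets, tight_boxPoint⟩
  · rw [t₂_sq] at h
    norm_num at h
  · obtain ⟨-, rfl, rfl, rfl, hw⟩ := h
    rw [eq_mul_of_div_eq t₂_pos hw]
    exact ⟨[pos 0, pos 2, pos 4, pos 6], List.mem_append_right _ (by decide +kernel), tight_apexPoint⟩

end CellFamily

namespace CellFamily

open Label

variable {t : ℝ}

/-! ### Links of ideal vertices -/

theorem gen_mem_P {j : Fin 3} {x : Mink} : gen j x ∈ P t ↔ x ∈ P t := by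
  have key : ∀ x, x ∈ P t → gen j x ∈ P t := fun x hx =>
    ⟨⟨by rw [lor_gen_gen, hx.1.1], by rw [gen_coord_zero]; exact hx.1.2⟩, fun l hl => by
      rw [lor_gen_vec']; exact hx.2 _ (genLabel_mem_active j hl)⟩
  exact ⟨fun h => by simpa [gen_gen] using key _ h, key x⟩

theorem gen_mem_wall {j : Fin 3} {x : Mink} {l : Label} :
    gen j x ∈ wall t l ↔ x ∈ wall t (genLabel j l) := by
  simp only [wall, stratum, mem_ofPred_eq, mem_singleton_iff, forall_eq, gen_mem_P, lor_gen_vec']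

theorem gen_mem_horoSection {j : Fin 3} {n x : Mink} {c : ℝ} :
    gen j x ∈ horoSection t n c ↔ x ∈ horoSection t (gen j n) c := by
  have : lor (gen j x) n = lor x (gen j n) := by rw [← lor_gen_gen j, gen_gen]
  simp only [horoSection, mem_ofPred_eq, gen_mem_P, this]

theorem image_comp_gen {α : Type*} (j : Fin 3) (n : Mink) (c : ℝ) (f : Mink → α) :
    (fun x => f (gen j x)) '' horoSection t (gen j n) c = f '' horoSection t n c := by
  ext y
  constructor
  · rintro ⟨x, hx, rfl⟩
    exact ⟨_, gen_mem_horoSection.2 hx, rfl⟩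
  · rintro ⟨x, hx, rfl⟩
    exact ⟨gen j x, gen_mem_horoSection.1 (by rwa [gen_gen]), by simp only [gen_gen]⟩

theorem IsHoroIsometry.gen {n : Mink} {c : ℝ} {f : Mink → E3} (h : IsHoroIsometry t n c f)
    (j : Fin 3) : IsHoroIsometry t (gen j n) c fun x => f (gen j x) := by
  intro x hx y hy
  rw [h _ (gen_mem_horoSection.2 hx) _ (gen_mem_horoSection.2 hy), ← map_sub, lor_gen_gen]

theorem LinkIsBox.gen {n : Mink} {w w' : Fin 3 → Label} (h : LinkIsBox t n w w') (j : Fin 3) :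
    LinkIsBox t (gen j n) (fun k => genLabel j (w k)) fun k => genLabel j (w' k) := by
  obtain ⟨c₀, hc₀, h⟩ := h
  refine ⟨c₀, hc₀, fun c hc => ?_⟩
  obtain ⟨a, f, ha, hf, him, hw⟩ := h c hc
  refine ⟨a, fun x => f (CellFamily.gen j x), ha, hf.gen j, by rw [image_comp_gen, him], ?_⟩
  intro x hx k
  rw [← gen_mem_wall, ← gen_mem_wall]
  exact hw _ (gen_mem_horoSection.2 hx) k

theorem LinkIsPrism.gen {n : Mink} {w : Fin 3 → Label} {b b' : Label}
    (h : LinkIsPrism t n w b b') (j : Fin 3) :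
    LinkIsPrism t (gen j n) (fun k => genLabel j (w k)) (genLabel j b) (genLabel j b') := by
  obtain ⟨c₀, hc₀, h⟩ := h
  refine ⟨c₀, hc₀, fun c hc => ?_⟩
  obtain ⟨q, e, s, h, f, hs, hh, he, hd, ho, hf, him, hw⟩ := h c hc
  refine ⟨q, e, s, h, fun x => f (CellFamily.gen j x), hs, hh, he, hd, ho, hf.gen j,
    by rw [image_comp_gen, him], ?_⟩
  intro x hx
  simp only [← gen_mem_wall]
  exact hw _ (gen_mem_horoSection.2 hx)

theorem LinkIsRegularTetrahedron.gen {n : Mink} {w : Fin 4 → Label}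
    (h : LinkIsRegularTetrahedron t n w) (j : Fin 3) :
    LinkIsRegularTetrahedron t (gen j n) fun k => genLabel j (w k) := by
  obtain ⟨c₀, hc₀, h⟩ := h
  refine ⟨c₀, hc₀, fun c hc => ?_⟩
  obtain ⟨q, s, f, hs, hd, hf, him, hw⟩ := h c hc
  refine ⟨q, s, fun x => f (CellFamily.gen j x), hs, hd, hf.gen j,
    by rw [image_comp_gen, him], ?_⟩
  intro x hx
  simp only [← gen_mem_wall]
  exact hw _ (gen_mem_horoSection.2 hx)

/-- The numbering of the faces of a regular tetrahedron does not matter. -/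
theorem LinkIsRegularTetrahedron.perm {n : Mink} {w : Fin 4 → Label}
    (h : LinkIsRegularTetrahedron t n w) (e : Equiv.Perm (Fin 4)) :
    LinkIsRegularTetrahedron t n (w ∘ e) := by
  obtain ⟨c₀, hc₀, h⟩ := h
  refine ⟨c₀, hc₀, fun c hc => ?_⟩
  obtain ⟨q, s, f, hs, hd, hf, him, hw⟩ := h c hc
  refine ⟨q ∘ e, s, f, hs, fun i j hij => hd _ _ (e.injective.ne hij), hf,
    by rw [him, e.surjective.range_comp], fun x hx i => ?_⟩
  rw [image_comp, image_compl_eq e.bijective, image_singleton]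
  exact hw x hx (e i)

/-- The link of an ideal vertex is a rectangular parallelepiped if the three normals `w k` are
orthogonal and each of them is proportional to the normal `w' k` modulo the vertex. -/
theorem linkIsBox_of {n : Mink} (hns : n ∈ slice t) (hn : lor n n = 0) {w w' : Fin 3 → Label}
    (ht : tight t n = {l | (∃ k, l = w k) ∨ ∃ k, l = w' k}) {ν γ : Fin 3 → ℝ} (hν : ∀ k, 0 < ν k)
    (hγ : ∀ k, 0 < γ k)
    (ho : ∀ i j, lor (vec t (w i)) (vec t (w j)) = if i = j then ν i else 0)
    (hs : ∀ k, vec t (w' k) = γ k • n - vec t (w k)) : LinkIsBox t n w w' := by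
  set e : Fin 3 → Mink := fun k => (-(√(ν k))⁻¹) • vec t (w k) with he
  have hsq : ∀ k, 0 < √(ν k) := fun k => Real.sqrt_pos.2 (hν k)
  have hss : ∀ k, √(ν k) * √(ν k) = ν k := fun k => Real.mul_self_sqrt (hν k).le
  have hw0 : ∀ k, lor n (vec t (w k)) = 0 := fun k =>
    (show w k ∈ tight t n by rw [ht]; exact .inl ⟨k, rfl⟩).2
  have hen : ∀ i, lor (e i) n = 0 := fun i => by
    simp only [he, lor_smul_left]; rw [lor_comm, hw0, mul_zero]
  have hew : ∀ i k, lor (e i) (vec t (w k)) = if i = k then -√(ν k) else 0 := by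
    intro i k
    simp only [he, lor_smul_left, ho]
    split_ifs with h
    · subst h
      have := (hsq i).ne'
      nth_rewrite 2 [← hss i]
      field_simp
    · rw [mul_zero]
  have hee : ∀ i j, lor (e i) (e j) = if i = j then 1 else 0 := by
    intro i j
    conv_lhs => arg 2; simp only [he]
    rw [lor_smul_right, hew]
    split_ifs with h
    · subst h
      have := (hsq i).ne'
      field_simp
    · rw [mul_zero]
  have hew' : ∀ i k, lor (e i) (vec t (w' k)) = if i = k then √(ν k) else 0 := by
    intro i k
    rw [hs, lor_sub_right, lor_smul_right, hen, hew]
    split_ifs <;> ring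
  have hwe : ∀ k, ∑ i, lor (e i) (vec t (w k)) • e i = vec t (w k) := by
    intro k
    simp only [hew, ite_smul, zero_smul, Finset.sum_ite_eq', Finset.mem_univ, if_true]
    rw [show e k = (-(√(ν k))⁻¹) • vec t (w k) from rfl, smul_smul, neg_mul_neg, mul_inv_cancel₀ (hsq k).ne', one_smul]
  have hwe' : ∀ k, ∑ i, lor (e i) (vec t (w' k)) • e i = -vec t (w k) := by
    intro k
    rw [← hwe k, ← Finset.sum_neg_distrib]
    refine Finset.sum_congr rfl fun i _ => ?_
    rw [hew, hew', ← neg_smul]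
    congr 1
    split_ifs <;> ring
  -- the coefficient of `n`, read off from the coordinate `0`
  set g : Label → ℝ := fun l => (vec t l - ∑ i, lor (e i) (vec t l) • e i) 0 with hg
  have hgw : ∀ k, g (w k) = 0 := fun k => by simp only [hg, hwe, sub_self]; rfl
  have hgw' : ∀ k, g (w' k) = γ k := fun k => by
    simp only [hg, hwe']
    rw [hs, sub_neg_eq_add, sub_add_cancel]
    simp [hns.1]
  have hmem : ∀ {Q : Label → Prop}, (∀ l ∈ tight t n, Q l) ↔ ∀ k, Q (w k) ∧ Q (w' k) := by
    intro Q
    rw [ht]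
    exact ⟨fun h k => ⟨h _ (.inl ⟨k, rfl⟩), h _ (.inr ⟨k, rfl⟩)⟩, fun h l hl => by
      rcases hl with ⟨k, rfl⟩ | ⟨k, rfl⟩
      exacts [(h k).1, (h k).2]⟩
  have hy : ∀ (c : ℝ) (y : E3), (∀ l ∈ tight t n, ∑ i, y i * lor (e i) (vec t l) ≤ g l * c) ↔
      ∀ k, 0 ≤ y k ∧ y k ≤ γ k * c / √(ν k) := by
    intro c y
    rw [hmem]
    refine forall_congr' fun k => and_congr ?_ ?_
    · simp only [hew, hgw, mul_ite, mul_zero, Finset.sum_ite_eq', Finset.mem_univ, if_true, zero_mul]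
      rw [mul_neg, neg_nonpos, mul_nonneg_iff_of_pos_right (hsq k)]
    · simp only [hew', hgw', mul_ite, mul_zero, Finset.sum_ite_eq', Finset.mem_univ, if_true]
      rw [le_div_iff₀ (hsq k)]
  obtain ⟨c₀, hc₀, h⟩ := exists_horoSection hns hn hee hen g (by
    rw [hmem]
    intro k
    rw [hgw, hwe, hgw', hwe', hs]
    exact ⟨by simp, by abel⟩) (K := ∑ k, γ k / √(ν k)) (by
    intro c hc y h i
    have h1 := (hy c y).1 h i
    rw [abs_of_nonneg h1.1]
    refine h1.2.trans ?_
    rw [mul_div_right_comm]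
    refine mul_le_mul_of_nonneg_right ?_ hc.le
    exact Finset.single_le_sum (f := fun k => γ k / √(ν k))
      (fun k _ => (div_pos (hγ k) (hsq k)).le) (Finset.mem_univ i))
  refine ⟨c₀, hc₀, fun c hc => ?_⟩
  obtain ⟨h1, h2, h3⟩ := h c hc
  refine ⟨fun k => γ k * c / √(ν k), horoCoord e, fun k => div_pos (mul_pos (hγ k) hc.1) (hsq k),
    h1, ?_, fun x hx k => ?_⟩
  · rw [h2]
    ext y
    exact hy c y
  · have h4 := hmem.1 (h3 x hx) k
    rw [h4.1, h4.2]
    simp only [hew, hew', hgw, hgw', mul_ite, mul_zero, Finset.sum_ite_eq', Finset.mem_univ,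
      if_true, zero_mul]
    refine ⟨?_, ?_⟩
    · simp [(hsq k).ne']
    · rw [eq_div_iff (hsq k).ne']

/-- A simplex is described by inequalities through its barycentric coordinates
`(r - ℓ i y) / R`. -/
theorem mem_convexHull_image_iff {ι : Type*} [Fintype ι] [DecidableEq ι] {q : ι → E3}
    {ℓ : ι → E3 →ₗ[ℝ] ℝ} {D : Submodule ℝ E3} {r R : ℝ} (hR : 0 < R) (hq : ∀ i, q i ∈ D)
    (hqq : ∀ i j, ℓ i (q j) = if i = j then r - R else r)
    (h1 : ∀ y ∈ D, ∑ i, (r - ℓ i y) = R) (h2 : ∀ y ∈ D, ∑ i, (r - ℓ i y) • q i = R • y)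
    (s : Set ι) (y : E3) :
    y ∈ convexHull ℝ (q '' s) ↔ y ∈ D ∧ (∀ i, ℓ i y ≤ r) ∧ ∀ i ∉ s, ℓ i y = r := by
  constructor
  · have hc : Convex ℝ {y | y ∈ D ∧ (∀ i, ℓ i y ≤ r) ∧ ∀ i ∉ s, ℓ i y = r} := by
      rintro x ⟨hx1, hx2, hx3⟩ y ⟨hy1, hy2, hy3⟩ a b ha hb hab
      refine ⟨D.add_mem (D.smul_mem a hx1) (D.smul_mem b hy1), fun i => ?_, fun i hi => ?_⟩
      · simp only [map_add, map_smul, smul_eq_mul]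
        calc a * ℓ i x + b * ℓ i y ≤ a * r + b * r := by gcongr; exacts [hx2 i, hy2 i]
          _ = r := by rw [← add_mul, hab, one_mul]
      · simp only [map_add, map_smul, smul_eq_mul, hx3 i hi, hy3 i hi]
        rw [← add_mul, hab, one_mul]
    intro hy
    refine convexHull_min ?_ hc hy
    rintro _ ⟨j, hj, rfl⟩
    refine ⟨hq j, fun i => ?_, fun i hi => ?_⟩
    · rw [hqq]; split_ifs <;> linarith
    · rw [hqq, if_neg (by rintro rfl; exact hi hj)]
  · rintro ⟨hy, h3, h4⟩
    classical
    have hsum := h1 y hy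
    -- the weights outside `s` vanish, hence the vertices outside `s` may be replaced
    obtain ⟨i₀, hi₀⟩ : ∃ i, i ∈ s := by
      by_contra hs
      push Not at hs
      rw [Finset.sum_eq_zero fun i _ => by rw [h4 i (hs i), sub_self]] at hsum
      exact hR.ne hsum
    refine mem_convexHull_of_exists_fintype (fun i => (r - ℓ i y) / R)
      (fun i => if i ∈ s then q i else q i₀) (fun i => div_nonneg (sub_nonneg.2 (h3 i)) hR.le)
      (by rw [← Finset.sum_div, hsum, div_self hR.ne']) (fun i => ?_) ?_
    · split_ifs with h
      exacts [⟨i, h, rfl⟩, ⟨i₀, hi₀, rfl⟩]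
    · have : ∀ i, ((r - ℓ i y) / R) • (if i ∈ s then q i else q i₀) =
          R⁻¹ • ((r - ℓ i y) • q i) := by
        intro i
        split_ifs with h
        · rw [smul_smul, div_eq_inv_mul]
        · rw [h4 i h]; simp
      rw [Finset.sum_congr rfl fun i _ => this i, ← Finset.smul_sum, h2 y hy, inv_smul_smul₀ hR.ne']

/-- The linear form on Euclidean space with given coefficients. -/
noncomputable def dotForm (a : Fin 3 → ℝ) : E3 →ₗ[ℝ] ℝ where
  toFun y := ∑ i, y i * a i
  map_add' x y := by simp [add_mul, Finset.sum_add_distrib]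
  map_smul' c x := by simp [Finset.mul_sum, mul_assoc]

theorem dotForm_apply (a : Fin 3 → ℝ) (y : E3) : dotForm a y = ∑ i, y i * a i := rfl

theorem apexPoint_eq : apexPoint = ![1, 0, 0, 0, 1] := by
  have h : t₂ * 2 / √2 = 1 := by
    have h2 : √2 * √2 = 2 := Real.mul_self_sqrt (by norm_num)
    have h3 : √2 ≠ 0 := by positivity
    rw [t₂, Real.sqrt_div zero_le_one, Real.sqrt_one]
    field_simp
    linarith
  ext i
  fin_cases i <;> simp [apexPoint, pt, h]

theorem inv_t₂ : 1 / t₂ = √2 := by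
  rw [t₂, Real.sqrt_div zero_le_one, Real.sqrt_one, one_div_one_div]

/-- The link at the time `t₂` of the ideal vertex on the four positive walls of even index. The normals
of these walls, modulo the vertex, are the vertices of a regular tetrahedron with the center `0`. -/
theorem linkIsRegularTetrahedron_apex :
    LinkIsRegularTetrahedron t₂ apexPoint ![pos 0, pos 2, pos 4, pos 6] := by
  have hr : 0 < √2 := by positivity
  set e : Fin 3 → Mink := ![![0, 1, 0, 0, 0], ![0, 0, 1, 0, 0], ![0, 0, 0, 1, 0]] with he
  set σ : Fin 4 → Fin 3 → ℝ := ![![1, 1, 1], ![1, -1, -1], ![-1, 1, -1], ![-1, -1, 1]] with hσ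
  set w : Fin 4 → Label := ![pos 0, pos 2, pos 4, pos 6] with hw
  have hv : ∀ k, vec t₂ (w k) = ![√2, σ k 0, σ k 1, σ k 2, √2] := by
    intro k
    fin_cases k <;> simp [hw, hσ, vec, ← inv_t₂]
  have hev : ∀ i k, lor (e i) (vec t₂ (w k)) = σ k i := by
    intro i k
    rw [hv]
    fin_cases i <;> simp [he, lor]
  have htight : ∀ {Q : Label → Prop}, (∀ l ∈ tight t₂ apexPoint, Q l) ↔ ∀ k, Q (w k) := by
    intro Q
    rw [tight_apexPoint]
    simp [hw, Fin.forall_fin_succ]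
  obtain ⟨c₀, hc₀, h⟩ := exists_horoSection apexPoint_mem_slice lor_apexPoint (e := e)
    (by intro i j; fin_cases i <;> fin_cases j <;> simp [he, lor])
    (by intro i; rw [apexPoint_eq]; fin_cases i <;> simp [he, lor]) (fun _ => √2)
    (by
      rw [htight]
      intro k
      simp only [hev]
      rw [hv, apexPoint_eq]
      ext i
      fin_cases i <;> simp [he, Fin.sum_univ_three])
    (K := √2) (by
      intro c hc y
      rw [htight]
      simp only [hev]
      intro hy i
      have h0 := hy 0
      have h1 := hy 1
      have h2 := hy 2
      have h3 := hy 3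
      simp [Fin.sum_univ_three, hσ] at h0 h1 h2 h3
      rw [abs_le]
      fin_cases i <;> simp <;> constructor <;> linarith)
  refine ⟨c₀, hc₀, fun c hc => ?_⟩
  have hrc : 0 < √2 * c := mul_pos hr hc.1
  obtain ⟨h1, h2, h3⟩ := h c hc
  simp only [htight, hev] at h2 h3
  set q : Fin 4 → E3 := fun k => WithLp.toLp 2 fun i => -(√2 * c) * σ k i with hq
  have key := mem_convexHull_image_iff (q := q) (ℓ := fun k => dotForm (σ k)) (D := ⊤)
    (r := √2 * c) (R := 4 * (√2 * c)) (by positivity) (fun _ => trivial)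
    (by
      intro i j
      fin_cases i <;> fin_cases j <;> simp [dotForm_apply, hq, hσ, Fin.sum_univ_three] <;> ring)
    (by
      intro y _
      simp [dotForm_apply, hσ, Fin.sum_univ_three, Fin.sum_univ_four]; ring)
    (by
      intro y _
      ext i
      fin_cases i <;>
        simp [dotForm_apply, hq, hσ, Fin.sum_univ_three, Fin.sum_univ_four] <;> ring)
  simp only [Submodule.mem_top, true_and, dotForm_apply] at key
  refine ⟨q, √(8 * (√2 * c) ^ 2), horoCoord e, Real.sqrt_pos.2 (by positivity), ?_, h1, ?_, ?_⟩
  · intro i j hij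
    rw [EuclideanSpace.dist_eq]
    congr 1
    simp only [hq, Fin.sum_univ_three, Real.dist_eq, sq_abs]
    revert hij
    fin_cases i <;> fin_cases j <;> simp [hσ] <;> ring
  · rw [h2, ← image_univ]
    ext y
    rw [key]
    simp
  · intro x hx i
    rw [h3 x hx i, key]
    have hx' : horoCoord e x ∈ horoCoord e '' horoSection t₂ apexPoint c := ⟨x, hx, rfl⟩
    rw [h2] at hx'
    simp only [mem_compl_iff, mem_singleton_iff, not_not, forall_eq]
    exact ⟨fun h => ⟨hx', h⟩, fun h => h.2⟩

end CellFamily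

namespace CellFamily

open Label

variable {t : ℝ}

/-! #### Prisms and parallelepipeds -/

/-- Points of a prism, in terms of the inequalities of its base. -/
theorem mem_prismOver_iff {q : Fin 3 → E3} {ℓ : Fin 3 → E3 →ₗ[ℝ] ℝ} {e : E3} {D : Submodule ℝ E3}
    {r h : ℝ} {z : E3 →ₗ[ℝ] ℝ} (hz : z e = 1) (hD : ∀ y, y ∈ D ↔ z y = 0) (hℓ : ∀ i, ℓ i e = 0)
    {s : Set (Fin 3)} (key : ∀ y, y ∈ convexHull ℝ (q '' s) ↔
      y ∈ D ∧ (∀ i, ℓ i y ≤ r) ∧ ∀ i ∉ s, ℓ i y = r) (y : E3) :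
    y ∈ prismOver (convexHull ℝ (q '' s)) e h ↔
      (0 ≤ z y ∧ z y ≤ h) ∧ (∀ i, ℓ i y ≤ r) ∧ ∀ i ∉ s, ℓ i y = r := by
  constructor
  · rintro ⟨p, hp, ρ, hρ, rfl⟩
    obtain ⟨h1, h2, h3⟩ := (key p).1 hp
    have hp0 := (hD p).1 h1
    simp only [map_add, map_smul, hz, hℓ, hp0, smul_eq_mul, mul_one, mul_zero, add_zero, zero_add]
    exact ⟨hρ, h2, h3⟩
  · rintro ⟨h1, h2, h3⟩
    refine ⟨y - z y • e, (key _).2 ⟨(hD _).2 (by simp [hz]), ?_, ?_⟩, z y, h1, by abel⟩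
    · simpa [hℓ] using h2
    · simpa [hℓ] using h3

open scoped Pointwise in
/-- Membership in the translate of a simplex. -/
theorem mem_convexHull_range_add_iff {q : Fin 3 → E3} (v y : E3) :
    y ∈ convexHull ℝ (range fun i => q i + v) ↔ y - v ∈ convexHull ℝ (q '' univ) := by
  have : (range fun i => q i + v) = v +ᵥ range q := by
    ext x
    simp [Set.mem_vadd_set, add_comm]
  rw [this, convexHull_vadd, mem_vadd_set_iff_neg_vadd_mem, image_univ, vadd_eq_add,
    neg_add_eq_sub]

theorem prismPoint_eq :
    prismPoint = ![1, 1 / (3 * √2), 1 / (3 * √2), -(1 / (3 * √2)), t₁ * 5 / (3 * √2)] := by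
  have h : √2 ≠ 0 := by positivity
  ext i
  fin_cases i <;> simp [prismPoint, pt] <;> field_simp

theorem inv_t₁ : t₁⁻¹ = t₁ * 5 / 3 := by
  have := t₁_sq
  have h0 := t₁_pos.ne'
  field_simp
  linarith

/-- The link of an ideal vertex that exists only at the time `t₁`. Modulo the vertex, the normals of
the positive walls add up to `0` and are orthogonal to those of `neg 3` and `H`, which are opposite
to each other. -/
theorem linkIsPrism_prismPoint :
    LinkIsPrism t₁ prismPoint ![pos 0, pos 2, pos 4] (neg 3) H := by
  have hT := t₁_sq
  have hT0 := t₁_pos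
  have hr : 0 < √2 := by positivity
  have hr2 : √2 * √2 = 2 := Real.mul_self_sqrt (by norm_num)
  obtain ⟨ρ, hρ0, hρ⟩ : ∃ ρ : ℝ, 0 < ρ ∧ ρ * ρ = 6 :=
    ⟨√6, by positivity, Real.mul_self_sqrt (by norm_num)⟩
  -- the length of the vector of `neg 3`
  obtain ⟨m, hm0, hm⟩ : ∃ m : ℝ, 0 < m ∧ m * m = 8 / 5 :=
    ⟨√(8 / 5), by positivity, Real.mul_self_sqrt (by norm_num)⟩
  set v : Mink := vec t₁ (neg 3) with hv
  have hv' : v = ![√2, 1, 1, -1, t₁] := by rw [hv]; simp [vec]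
  set e : Fin 3 → Mink := ![(-m⁻¹) • v, ![0, 1 / √2, -1 / √2, 0, 0],
    ![0, 1 / ρ, 1 / ρ, 2 / ρ, 0]] with he
  set a : Fin 3 → Fin 3 → ℝ := ![![0, 0, 4 / ρ], ![0, √2, -2 / ρ], ![0, -√2, -2 / ρ]] with ha
  set w : Fin 3 → Label := ![pos 0, pos 2, pos 4] with hw
  have hvv : lor v v = 8 / 5 := by
    rw [hv']; simp [lor]; linarith only [hr2, hT]
  have hve : ∀ i, i ≠ 0 → lor v (e i) = 0 := by
    intro i hi
    fin_cases i
    · exact absurd rfl hi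
    · rw [hv']; simp [he, lor]; ring
    · rw [hv']; simp [he, lor]; ring
  have he0 : e 0 = (-m⁻¹) • v := rfl
  have hee : ∀ i j, lor (e i) (e j) = if i = j then 1 else 0 := by
    intro i j
    by_cases hi : i = 0 <;> by_cases hj : j = 0
    · subst hi hj
      rw [he0, lor_smul_left, lor_smul_right, hvv, if_pos rfl, ← hm]
      field_simp
    · subst hi
      rw [he0, lor_smul_left, hve j hj, mul_zero, if_neg (Ne.symm hj)]
    · subst hj
      rw [lor_comm, he0, lor_smul_left, hve i hi, mul_zero, if_neg hi]
    · fin_cases i <;> fin_cases j <;> simp [he, lor] at hi hj ⊢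
      · field_simp; linarith
      · ring
      · ring
      · field_simp; linarith
  have hvn : lor v prismPoint = 0 := by
    rw [hv', prismPoint_eq]
    simp [lor]
    field_simp
    linarith only [hr2, hT]
  have hen : ∀ i, lor (e i) prismPoint = 0 := by
    intro i
    by_cases hi : i = 0
    · subst hi; rw [he0, lor_smul_left, hvn, mul_zero]
    · rw [prismPoint_eq]
      fin_cases i <;> simp [he, lor] at hi ⊢ <;> ring
  have hew : ∀ i k, lor (e i) (vec t₁ (w k)) = a k i := by
    intro i k
    by_cases hi : i = 0
    · subst hi
      rw [he0, lor_smul_left, hv']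
      fin_cases k <;> simp [hw, ha, vec, lor] <;> right <;> field_simp <;> linarith only [hr2]
    · fin_cases i
      · exact absurd rfl hi
      · fin_cases k <;> simp [hw, ha, he, vec, lor] <;> field_simp <;> linarith only [hr2]
      · fin_cases k <;> simp [hw, ha, he, vec, lor] <;> ring
  have hev : ∀ i, lor (e i) v = if i = 0 then -m else 0 := by
    intro i
    split_ifs with hi
    · subst hi
      rw [he0, lor_smul_left, hvv, ← hm]
      field_simp
    · rw [lor_comm, hve i hi]
  have heH : ∀ i, lor (e i) (vec t₁ H) = if i = 0 then 2 / 5 * √2 / m else 0 := by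
    intro i
    split_ifs with hi
    · subst hi
      rw [he0, lor_smul_left, hv']
      simp [vec, lor]
      field_simp
      linear_combination (-5) * hT
    · fin_cases i <;> simp [he, vec, lor] at hi ⊢
  have htight : ∀ {Q : Label → Prop}, (∀ l ∈ tight t₁ prismPoint, Q l) ↔
      (∀ k, Q (w k)) ∧ Q (neg 3) ∧ Q H := by
    intro Q
    rw [tight_prismPoint]
    simp [hw, Fin.forall_fin_succ, and_assoc]
  set γ : Label → ℝ := fun l => if l = neg 3 then 0 else if l = H then 3 / 2 else √2 with hγ
  have hγw : ∀ k, γ (w k) = √2 := by intro k; fin_cases k <;> simp [hγ, hw]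
  have hγ3 : γ (neg 3) = 0 := by simp [hγ]
  have hγH : γ H = 3 / 2 := by simp [hγ]
  have hcond : ∀ (c : ℝ) (y : E3),
      (∀ l ∈ tight t₁ prismPoint, ∑ i, y i * lor (e i) (vec t₁ l) ≤ γ l * c) ↔
        (0 ≤ y 0 ∧ y 0 ≤ 15 / 4 * m / √2 * c) ∧ ∀ k, dotForm (a k) y ≤ √2 * c := by
    intro c y
    rw [htight]
    simp only [hew, ← hv, hev, heH, mul_ite, mul_zero, Finset.sum_ite_eq', Finset.mem_univ, if_true,
      hγw, hγ3, hγH, zero_mul, ← dotForm_apply]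
    have h1 : y 0 * -m ≤ 0 ↔ 0 ≤ y 0 := by
      rw [mul_neg, neg_nonpos, mul_nonneg_iff_of_pos_right hm0]
    have h2 : y 0 * (2 / 5 * √2 / m) ≤ 3 / 2 * c ↔ y 0 ≤ 15 / 4 * m / √2 * c := by
      rw [← le_div_iff₀ (by positivity)]
      congr! 1
      field_simp
      ring
    rw [h1, h2]
    tauto
  have hmem : ∀ {c : ℝ} {y : E3}, (∀ k, dotForm (a k) y ≤ √2 * c) →
      |y 1| ≤ 2 * c ∧ |y 2| ≤ ρ * √2 * c := by
    intro c y h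
    have g0 := h 0
    have g1 := h 1
    have g2 := h 2
    simp [dotForm_apply, ha, Fin.sum_univ_three] at g0 g1 g2
    have hs : y 2 * (2 / ρ) = y 2 * (4 / ρ) / 2 := by ring
    have e1 : √2 * y 1 ≤ √2 * (2 * c) := by
      have : y 2 * (-2 / ρ) = -(y 2 * (4 / ρ) / 2) := by ring
      linarith
    have e2 : √2 * -y 1 ≤ √2 * (2 * c) := by
      have : y 2 * (-2 / ρ) = -(y 2 * (4 / ρ) / 2) := by ring
      linarith
    have e3 : -(√2 * c) ≤ y 2 * (2 / ρ) := by
      have : y 2 * (-2 / ρ) = -(y 2 * (2 / ρ)) := by ring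
      linarith
    have e4 : ρ * (y 2 * (2 / ρ)) = 2 * y 2 := by field_simp
    have e5 : ρ * (y 2 * (4 / ρ)) = 4 * y 2 := by field_simp
    have e6 := mul_le_mul_of_nonneg_left e3 hρ0.le
    have e7 := mul_le_mul_of_nonneg_left g0 hρ0.le
    have e8 : 0 ≤ √2 * c := by linarith
    have e9 := mul_nonneg hρ0.le e8
    refine ⟨abs_le.2 ⟨?_, ?_⟩, abs_le.2 ⟨?_, ?_⟩⟩
    · linarith [le_of_mul_le_mul_left e2 hr]
    · exact le_of_mul_le_mul_left e1 hr
    · linarith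
    · linarith
  obtain ⟨c₀, hc₀, h⟩ := exists_horoSection prismPoint_mem_slice lor_prismPoint hee hen γ
    (by
      rw [htight]
      simp only [hew, ← hv, hev, heH, hγw, hγ3, hγH, ite_smul, zero_smul, Finset.sum_ite_eq',
        Finset.mem_univ, if_true, zero_add, he0, smul_smul]
      refine ⟨fun k => ?_, ?_, ?_⟩
      · rw [prismPoint_eq, Fin.sum_univ_three]
        ext i
        fin_cases k <;> fin_cases i <;> simp [hw, ha, he, vec, inv_t₁] <;> field_simp <;>
          linarith only [hr2, hρ]
      · rw [neg_mul_neg, mul_inv_cancel₀ hm0.ne', one_smul]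
      · rw [prismPoint_eq, hv', show 2 / 5 * √2 / m * -m⁻¹ = -(√2 / 4) by
          rw [div_mul_eq_mul_div, div_eq_iff hm0.ne', mul_neg, neg_mul, neg_inj]
          field_simp
          linear_combination (-5 : ℝ) * hm]
        ext i
        fin_cases i <;> simp [vec] <;> field_simp <;> linarith only [hr2])
    (K := 15 / 4 * m / √2 + 2 + ρ * √2) (by
      intro c hc y hy
      rw [hcond] at hy
      obtain ⟨h1, h2⟩ := hmem hy.2
      have p1 : 0 ≤ 15 / 4 * m / √2 * c := by positivity
      have p2 : 0 ≤ ρ * √2 * c := by positivity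
      intro i
      rw [add_mul, add_mul]
      fin_cases i
      · change |y 0| ≤ _
        rw [abs_of_nonneg hy.1.1]
        linarith [hy.1.2]
      · change |y 1| ≤ _
        linarith
      · change |y 2| ≤ _
        linarith)
  refine ⟨c₀, hc₀, fun c hc => ?_⟩
  have hrc : 0 < √2 * c := mul_pos hr hc.1
  obtain ⟨h1, h2, h3⟩ := h c hc
  set q : Fin 3 → E3 := fun k => WithLp.toLp 2 fun i => -(3 / 4 * (√2 * c)) * a k i with hq
  set u : E3 := EuclideanSpace.single 0 1 with hu
  set z : E3 →ₗ[ℝ] ℝ := dotForm ![1, 0, 0] with hz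
  have hz0 : ∀ y, z y = y 0 := by intro y; simp [hz, dotForm_apply, Fin.sum_univ_three]
  have hG : ∀ i j, ∑ k, a i k * a j k = if i = j then 8 / 3 else -(4 / 3) := by
    intro i j
    fin_cases i <;> fin_cases j <;> simp [ha, Fin.sum_univ_three] <;> field_simp <;>
      linarith only [hr2, hρ]
  have hS0 : ∀ j, ∑ i, a i j = 0 := by
    intro j
    fin_cases j <;> simp [ha, Fin.sum_univ_three]; ring
  have hS : ∀ y : E3, y 0 = 0 → ∀ j, ∑ i, dotForm (a i) y * a i j = 4 * y j := by
    intro y hy j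
    fin_cases j
    · simp [ha, hy, Fin.sum_univ_three]
    · simp [dotForm_apply, ha, hy, Fin.sum_univ_three]
      linear_combination 2 * y 1 * hr2
    · have : 24 / (ρ * ρ) = 4 := by rw [hρ]; norm_num
      simp [dotForm_apply, ha, hy, Fin.sum_univ_three]
      linear_combination y 2 * this
  have key := mem_convexHull_image_iff (q := q) (ℓ := fun k => dotForm (a k)) (D := LinearMap.ker z)
    (r := √2 * c) (R := 3 * (√2 * c)) (by positivity)
    (by intro i; rw [LinearMap.mem_ker, hz0]; fin_cases i <;> simp [hq, ha])
    (by
      intro i j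
      have : dotForm (a i) (q j) = -(3 / 4 * (√2 * c)) * ∑ k, a i k * a j k := by
        simp only [dotForm_apply, hq, Fin.sum_univ_three]; ring
      rw [this, hG]
      split_ifs <;> ring)
    (by
      intro y _
      simp [dotForm_apply, ha, Fin.sum_univ_three]; ring)
    (by
      intro y hy
      rw [LinearMap.mem_ker, hz0] at hy
      ext j
      have e1 := hS y hy j
      have e2 := hS0 j
      simp only [Fin.sum_univ_three] at e1 e2
      simp only [hq, Fin.sum_univ_three, PiLp.add_apply, PiLp.smul_apply, smul_eq_mul]
      linear_combination (3 / 4 * (√2 * c)) * e1 - (3 / 4 * (√2 * c) ^ 2) * e2)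
  have hue : ∀ i, dotForm (a i) u = 0 := by
    intro i
    fin_cases i <;> simp [dotForm_apply, hu, ha]
  have key2 := fun s => mem_prismOver_iff (q := q) (ℓ := fun k => dotForm (a k))
    (h := 15 / 4 * m / √2 * c) (e := u) (z := z) (by rw [hz0]; simp [hu])
    (fun y => LinearMap.mem_ker) hue (key s)
  refine ⟨q, u, √(8 * (3 / 4 * (√2 * c)) ^ 2), 15 / 4 * m / √2 * c, horoCoord e,
    Real.sqrt_pos.2 (by positivity), by have := hc.1; positivity, by simp [hu], ?_, ?_, h1, ?_, ?_⟩
  · intro i j hij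
    rw [EuclideanSpace.dist_eq]
    congr 1
    have e1 := hG i i
    have e2 := hG j j
    have e3 := hG i j
    rw [if_neg hij] at e3
    rw [if_pos rfl] at e1 e2
    simp only [Fin.sum_univ_three] at e1 e2 e3
    simp only [hq, Fin.sum_univ_three, Real.dist_eq, sq_abs]
    linear_combination (3 / 4 * (√2 * c)) ^ 2 * (e1 + e2 - 2 * e3)
  · intro i j
    fin_cases i <;> fin_cases j <;> simp [hu, hq, ha, EuclideanSpace.inner_single_left]
  · rw [h2, ← image_univ]
    ext y
    rw [key2]
    simp only [mem_ofPred_eq, hcond, hz0]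
    simp
  · intro x hx
    have hx' : horoCoord e x ∈ horoCoord e '' horoSection t₁ prismPoint c := ⟨x, hx, rfl⟩
    rw [h2, mem_ofPred_eq, hcond] at hx'
    obtain ⟨h4, h5, h6⟩ := htight.1 (h3 x hx)
    simp only [hew, ← dotForm_apply, hγw] at h4
    refine ⟨fun i => ?_, ?_, ?_⟩
    · rw [h4 i, key2]
      simp only [mem_compl_iff, mem_singleton_iff, not_not, forall_eq, hz0]
      exact ⟨fun h => ⟨hx'.1, hx'.2, h⟩, fun h => h.2.2⟩
    · rw [h5, ← image_univ, key, ← hv, LinearMap.mem_ker, hz0]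
      simp only [hev, hγ3, mul_ite, mul_zero, Finset.sum_ite_eq', Finset.mem_univ, if_true, zero_mul,
        mul_neg, neg_eq_zero, mul_eq_zero, hm0.ne', or_false, mem_univ, not_true_eq_false,
        false_imp_iff, implies_true, and_true]
      exact ⟨fun h => ⟨h, hx'.2⟩, fun h => h.1⟩
    · rw [h6, mem_convexHull_range_add_iff, key, LinearMap.mem_ker]
      simp only [heH, hγH, mul_ite, mul_zero, Finset.sum_ite_eq', Finset.mem_univ, if_true,
        map_sub, map_smul, hue, smul_zero, sub_zero, mem_univ, not_true_eq_false,
        false_imp_iff, implies_true, and_true]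
      have : z u = 1 := by rw [hz0]; simp [hu]
      rw [this, hz0, smul_eq_mul, mul_one, sub_eq_zero, ← eq_div_iff (by positivity)]
      have : 3 / 2 * c / (2 / 5 * √2 / m) = 15 / 4 * m / √2 * c := by field_simp; ring
      rw [this]
      exact ⟨fun h => ⟨h, hx'.2⟩, fun h => h.1⟩

theorem linkIsBox_boxPoint (ht : t ∈ Ioc (0 : ℝ) 1) :
    LinkIsBox t boxPoint ![pos 3, neg 3, A] ![pos 0, neg 0, B] := by
  have hr : 0 < √2 := by positivity
  have hr2 : √2 * √2 = 2 := Real.mul_self_sqrt (by norm_num)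
  have ht0 := ht.1
  have hp : 0 < 1 + 1 / t ^ 2 := by positivity
  have hn : 0 < 1 + t ^ 2 := by positivity
  have hb : boxPoint = ![1, 1 / √2, 1 / √2, 0, 0] := by simp [boxPoint, pt]
  refine linkIsBox_of (boxPoint_mem_slice ht) lor_boxPoint
    (ν := ![1 + 1 / t ^ 2, 1 + t ^ 2, 1]) (γ := ![2 * √2, 2 * √2, 2]) ?_ ?_ ?_ ?_ ?_
  · rw [tight_boxPoint]
    ext l
    simp [Fin.exists_fin_succ]
    tauto
  · intro k; fin_cases k <;> simp <;> positivity
  · intro k; fin_cases k <;> simp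
  · intro i j
    fin_cases i <;> fin_cases j <;> simp [vec, lor] <;> field_simp <;> linarith only [hr2]
  · intro k
    rw [hb]
    fin_cases k <;> ext i <;> fin_cases i <;> simp [vec] <;> field_simp <;> linarith only [hr2]

end CellFamily

namespace CellFamily

open Label

variable {t : ℝ}

/-! ### The types of ideal vertices -/

/-- The adjacency matrix of the cube, with rows encoded as bit masks. Adjacency is decided by this
table, as evaluating its definition many times would be slow. -/
def cubeRows : Fin 8 → ℕ := ![42, 69, 138, 21, 168, 81, 162, 84]

theorem testBit_cubeRows (i j : Fin 8) : (cubeRows i).testBit j = true ↔ CubeAdj i j := by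
  have : ∀ i j : Fin 8, (cubeRows i).testBit j = true ↔
      ∃ k, corner i k ≠ corner j k ∧ ∀ k', corner i k' ≠ corner j k' → k' = k := by decide +kernel
  exact this i j

instance (i j : Fin 8) : Decidable (CubeAdj i j) := decidable_of_iff _ (testBit_cubeRows i j)

instance (X : Label) (i : Fin 8) : Decidable (OnSide X i) := by unfold OnSide; infer_instance

instance (k i j l : Fin 8) : Decidable (Neighbours k i j l) := by unfold Neighbours; infer_instance

theorem cubeAdj_cornerPerm (g : Fin 3) (i j : Fin 8) :
    CubeAdj (cornerPerm g i) (cornerPerm g j) ↔ CubeAdj i j := by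
  revert g i j; decide +kernel

theorem cornerPerm_injective (g : Fin 3) : Function.Injective (cornerPerm g) := by
  intro i j; revert g i j; decide +kernel

theorem onSide_genLabel (g : Fin 3) (X : Label) (i : Fin 8) :
    OnSide (genLabel g X) (cornerPerm g i) ↔ OnSide X i :=
  (show ∀ X ∈ allLabels, ∀ g i, OnSide (genLabel g X) (cornerPerm g i) ↔ OnSide X i by
    decide +kernel) X (mem_allLabels X) g i

theorem pole_cornerPerm (g : Fin 3) (k : Fin 8) : pole (cornerPerm g k) = genLabel g (pole k) := by
  revert g k; decide +kernel

theorem parity_cornerPerm (g : Fin 3) :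
    (∀ i, Odd (cornerPerm g i).val ↔ Odd i.val) ∨ ∀ i, Odd (cornerPerm g i).val ↔ Even i.val := by
  revert g; decide +kernel

theorem Neighbours.cornerPerm {k i j l : Fin 8} (h : Neighbours k i j l) (g : Fin 3) :
    Neighbours (cornerPerm g k) (cornerPerm g i) (cornerPerm g j) (cornerPerm g l) := by
  have := cornerPerm_injective g
  simpa only [Neighbours, this.ne_iff, cubeAdj_cornerPerm] using h

/-- The letters of the sides of the cube. -/
def sides : List Label := [A, B, C, D, E, F]

theorem OnSide.mem_sides {X : Label} {i : Fin 8} (h : OnSide X i) : X ∈ sides := by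
  rcases h with ⟨rfl, -⟩ | ⟨rfl, -⟩ | ⟨rfl, -⟩ | ⟨rfl, -⟩ | ⟨rfl, -⟩ | ⟨rfl, -⟩ <;> simp [sides]

/-- The two families of opposite faces of a parallelepiped can be exchanged. -/
theorem LinkIsBox.swap {n : Mink} {w w' : Fin 3 → Label} (h : LinkIsBox t n w w') :
    LinkIsBox t n w' w := by
  obtain ⟨c₀, hc₀, h⟩ := h
  refine ⟨c₀, hc₀, fun c hc => ?_⟩
  obtain ⟨a, f, ha, hf, him, hw⟩ := h c hc
  refine ⟨a, fun x => WithLp.toLp 2 a - f x, ha, fun x hx y hy => ?_, ?_, fun x hx k => ?_⟩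
  · rw [dist_sub_left]; exact hf x hx y hy
  · rw [← image_image (fun y => WithLp.toLp 2 a - y) f, him]
    ext y
    constructor
    · rintro ⟨z, hz, rfl⟩ k
      have := hz k
      simp only [PiLp.sub_apply]
      constructor <;> linarith
    · intro hy
      refine ⟨WithLp.toLp 2 a - y, fun k => ?_, by simp⟩
      have := hy k
      simp only [PiLp.sub_apply]
      constructor <;> linarith
  · have := hw x hx k
    rw [this.1, this.2]
    simp only [PiLp.sub_apply, sub_eq_zero, eq_comm (a := a k), sub_eq_self, and_self]

theorem gen_mem_idealVertices (hne : (P t).Nonempty) {n : Mink} (hn : n ∈ idealVertices t)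
    (j : Fin 3) : gen j n ∈ idealVertices t := by
  rw [idealVertices_eq hne] at hn ⊢
  exact ⟨gen_mem_slice j hn.1, by rw [lor_gen_gen]; exact hn.2⟩

theorem wallsAtIdeal_gen (hne : (P t).Nonempty) (hw : WallsNonempty t) {n : Mink}
    (hn : n ∈ idealVertices t) (j : Fin 3) :
    wallsAtIdeal t (gen j n) = genLabel j '' wallsAtIdeal t n := by
  rw [wallsAtIdeal_eq hw hn, wallsAtIdeal_eq hw (gen_mem_idealVertices hne hn j), tight_gen,
    image_eq_preimage_of_inverse] <;> exact genLabel_genLabel j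

/-- A type of ideal vertices that is invariant under the symmetries contains the ideal points over
an orbit of incidence sets if it contains one of them. -/
theorem idealOfType_orbit_subset {Ls : List (List Label)} {I : List Label}
    (hc : IsComplex t Ls) (hI : IsIdealFamily t Ls (orbit I)) {V : Set Mink}
    (hV : V ⊆ idealVertices t)
    (hgen : ∀ j n, n ∈ V → gen j n ∈ V) {n : Mink} (hn : n ∈ V) (ht : tight t n = {l | l ∈ I}) :
    idealOfType t (orbit I) ⊆ V := by
  rintro m ⟨hm, J, hJ, hmJ⟩
  obtain ⟨p, hp, hpJ⟩ : ∃ p ∈ V, tight t p = {l | l ∈ J} := by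
    revert J
    suffices h : ∀ J ∈ orbit I, ∃ p ∈ V, tight t p = {l | l ∈ J} from fun J hJ _ => h J hJ
    refine orbit_induction ⟨n, hn, ht⟩ fun j M ⟨p, hp, hpM⟩ => ⟨gen j p, hgen j p hp, ?_⟩
    rw [tight_gen, hpM]
    ext l
    exact mem_map_genLabel.symm
  have hp' := hV hp
  rw [idealVertices_eq hc.nonempty] at hp' hm
  rwa [hI.eq_of_tight_eq hc hJ hm.1 hm.2 hp'.1 hp'.2 hmJ hpJ]

theorem gen_mem_boxVertices (hne : (P t).Nonempty) (hw : WallsNonempty t) (g : Fin 3) {n : Mink}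
    (hn : n ∈ boxVertices t) : gen g n ∈ boxVertices t := by
  obtain ⟨hni, i, j, X, Y, hi, hj, hij, hXY, h1, h2, h3, h4, h5, h6⟩ := hn
  refine ⟨gen_mem_idealVertices hne hni g, ?_⟩
  have hXY' : genLabel g X ≠ genLabel g Y := fun h => hXY (by
    rw [← genLabel_genLabel g X, h, genLabel_genLabel])
  have hset := wallsAtIdeal_gen hne hw hni g
  rw [h5] at hset
  have hlink := h6.gen g
  rcases parity_cornerPerm g with hg | hg
  · refine ⟨cornerPerm g i, cornerPerm g j, genLabel g X, genLabel g Y, (hg i).2 hi, ?_,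
      (cubeAdj_cornerPerm g i j).2 hij, hXY', (onSide_genLabel g X i).2 h1,
      (onSide_genLabel g X j).2 h2, (onSide_genLabel g Y i).2 h3, (onSide_genLabel g Y j).2 h4,
      ?_, ?_⟩
    · rwa [← Nat.not_odd_iff_even, hg j, Nat.not_odd_iff_even]
    · rw [hset]; simp only [image_insert_eq, image_singleton, genLabel]
    · convert hlink using 1 <;> ext k <;> fin_cases k <;> simp [genLabel]
  · refine ⟨cornerPerm g j, cornerPerm g i, genLabel g Y, genLabel g X, (hg j).2 hj, ?_,
      (cubeAdj_cornerPerm g j i).2 ?_, hXY'.symm, (onSide_genLabel g Y j).2 h4,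
      (onSide_genLabel g Y i).2 h3, (onSide_genLabel g X j).2 h2, (onSide_genLabel g X i).2 h1,
      ?_, ?_⟩
    · rwa [← Nat.not_odd_iff_even, hg i, Nat.not_even_iff_odd]
    · simpa only [CubeAdj, ne_comm] using hij
    · rw [hset]
      simp only [image_insert_eq, image_singleton, genLabel]
      ext l
      simp only [mem_insert_iff, mem_singleton_iff]
      tauto
    · convert hlink.swap using 1 <;> ext k <;> fin_cases k <;> simp [genLabel]

/-- The ideal vertices whose links are parallelepipeds are those over `boxSets`. Each set of labels as
in the definition of `boxVertices` belongs to `boxSets`, up to order; conversely, by symmetry it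
suffices to know the link of `boxPoint`. -/
theorem boxVertices_eq (ht : t ∈ Ioc (0 : ℝ) 1) {Ls : List (List Label)} (hc : IsComplex t Ls)
    (hI : IsIdealFamily t Ls boxSets) : boxVertices t = idealOfType t boxSets := by
  apply Subset.antisymm
  · rintro n ⟨hn, i, j, X, Y, hi, hj, hij, hXY, h1, h2, h3, h4, h5, -⟩
    rw [wallsAtIdeal_eq hc.wallsNonempty hn] at h5
    have key : ∀ i j : Fin 8, CubeAdj i j → ∀ X ∈ sides, OnSide X i → OnSide X j → ∀ Y ∈ sides,
        X ≠ Y → OnSide Y i → OnSide Y j → ∃ I ∈ boxSets,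
          (∀ l ∈ I, l ∈ [pos i, neg i, pos j, neg j, X, Y]) ∧
          ∀ l ∈ [pos i, neg i, pos j, neg j, X, Y], l ∈ I := by decide +kernel
    obtain ⟨I, hI, hl, hl'⟩ := key i j hij X h1.mem_sides h1 h2 Y h3.mem_sides hXY h3 h4
    refine ⟨hn, I, hI, ?_⟩
    rw [h5]
    ext l
    simp only [mem_insert_iff, mem_singleton_iff, mem_ofPred_eq]
    exact ⟨fun h => hl' l (by simpa using h), fun h => by simpa using hl l h⟩
  · have hb : boxPoint ∈ idealVertices t := by
      rw [idealVertices_eq hc.nonempty]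
      exact ⟨boxPoint_mem_slice ht, lor_boxPoint⟩
    refine idealOfType_orbit_subset hc hI (fun n hn => hn.1)
      (fun j n => gen_mem_boxVertices hc.nonempty hc.wallsNonempty j) (n := boxPoint) ?_
      tight_boxPoint
    refine ⟨hb, 3, 0, A, B, by decide, by decide, by decide, by decide, by decide, by decide,
      by decide, by decide, ?_, linkIsBox_boxPoint ht⟩
    rw [wallsAtIdeal_eq hc.wallsNonempty hb, tight_boxPoint]
    ext l
    simp

theorem gen_mem_prismVertices (hne : (P t).Nonempty) (hw : WallsNonempty t) (g : Fin 3) {n : Mink}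
    (hn : n ∈ prismVertices t) : gen g n ∈ prismVertices t := by
  obtain ⟨hni, k, i, j, l, h1, h2, h3⟩ := hn
  have hset := wallsAtIdeal_gen hne hw hni g
  rw [h2] at hset
  have hlink := h3.gen g
  refine ⟨gen_mem_idealVertices hne hni g, _, _, _, _, h1.cornerPerm g, ?_, ?_⟩
  · rw [hset, pole_cornerPerm]; simp only [image_insert_eq, image_singleton, genLabel]
  · rw [pole_cornerPerm]
    convert hlink using 1
    · ext k; fin_cases k <;> simp [genLabel]
    · simp [genLabel]

/-- The ideal vertices whose links are prisms are those over `prismSets`, as for `boxVertices_eq`. -/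
theorem prismVertices_eq : prismVertices t₁ = idealOfType t₁ prismSets := by
  have hc := isComplex_at_t₁
  apply Subset.antisymm
  · rintro n ⟨hn, k, i, j, l, h1, h2, -⟩
    rw [wallsAtIdeal_eq hc.wallsNonempty hn] at h2
    have key : ∀ k i, CubeAdj i k → ∀ j, CubeAdj j k → ∀ l, CubeAdj l k → Neighbours k i j l →
        ∃ I ∈ prismSets, (∀ m ∈ I, m ∈ [pos i, pos j, pos l, neg k, pole k]) ∧
          ∀ m ∈ [pos i, pos j, pos l, neg k, pole k], m ∈ I := by decide +kernel
    obtain ⟨I, hI, hl, hl'⟩ := key k i h1.2.2.2.1 j h1.2.2.2.2.1 l h1.2.2.2.2.2 h1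
    refine ⟨hn, I, hI, ?_⟩
    rw [h2]
    ext m
    simp only [mem_insert_iff, mem_singleton_iff, mem_ofPred_eq]
    exact ⟨fun h => hl' m (by simpa using h), fun h => by simpa using hl m h⟩
  · have hb : prismPoint ∈ idealVertices t₁ := by
      rw [idealVertices_eq hc.nonempty]
      exact ⟨prismPoint_mem_slice, lor_prismPoint⟩
    refine idealOfType_orbit_subset hc isIdealFamily_prism (fun n hn => hn.1)
      (fun j n => gen_mem_prismVertices hc.nonempty hc.wallsNonempty j) (n := prismPoint) ?_
      tight_prismPoint
    refine ⟨hb, 3, 0, 2, 4, by decide, ?_, linkIsPrism_prismPoint⟩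
    rw [wallsAtIdeal_eq hc.wallsNonempty hb, tight_prismPoint]
    have : pole 3 = H := by decide
    ext l
    simp [this]

/-- The symmetries permute the positive walls of each parity. -/
theorem exists_genLabel_parityWalls (g : Fin 3) (b : Bool) : ∃ b', ∃ e : Equiv.Perm (Fin 4),
    (fun k => genLabel g (parityWalls b k)) = parityWalls b' ∘ e := by
  have key : ∀ (g : Fin 3) (b : Bool), ∃ b', ∃ e : Equiv.Perm (Fin 4),
      ∀ k, genLabel g (parityWalls b k) = parityWalls b' (e k) := by decide +kernel
  obtain ⟨b', e, h⟩ := key g b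
  exact ⟨b', e, funext h⟩

theorem gen_mem_idealApexVertices (hne : (P t).Nonempty) (hw : WallsNonempty t) (g : Fin 3)
    {n : Mink} (hn : n ∈ idealApexVertices t) : gen g n ∈ idealApexVertices t := by
  obtain ⟨hni, b, h1, h2⟩ := hn
  have hset := wallsAtIdeal_gen hne hw hni g
  have hlink := h2.gen g
  obtain ⟨b', e, he⟩ := exists_genLabel_parityWalls g b
  refine ⟨gen_mem_idealVertices hne hni g, b', ?_, ?_⟩
  · rw [hset, h1, ← range_comp]
    change range (fun k => genLabel g (parityWalls b k)) = _
    rw [he, e.surjective.range_comp]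
  · rw [he] at hlink
    have := hlink.perm e.symm
    rwa [Function.comp_assoc, e.self_comp_symm, Function.comp_id] at this

/-- The ideal vertices whose links are regular tetrahedra are those over `apexSets`. -/
theorem idealApexVertices_eq : idealApexVertices t₂ = idealOfType t₂ apexSets := by
  have hc := isComplex_at_t₂
  have hb : apexPoint ∈ idealVertices t₂ := by
    rw [idealVertices_eq hc.nonempty]
    exact ⟨apexPoint_mem_slice, lor_apexPoint⟩
  apply Subset.antisymm
  · rintro n ⟨hn, b, h1, -⟩
    rw [wallsAtIdeal_eq hc.wallsNonempty hn] at h1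
    have key : ∀ b, ∃ I ∈ apexSets, (∀ m ∈ I, ∃ k, parityWalls b k = m) ∧
        ∀ k, parityWalls b k ∈ I := by decide +kernel
    obtain ⟨I, hI, hl, hl'⟩ := key b
    refine ⟨hn, I, hI, ?_⟩
    rw [h1]
    ext m
    exact ⟨fun ⟨k, hk⟩ => hk ▸ hl' k, fun h => hl m h⟩
  · refine idealOfType_orbit_subset hc isIdealFamily_apex (fun n hn => hn.1)
      (fun j n => gen_mem_idealApexVertices hc.nonempty hc.wallsNonempty j) (n := apexPoint) ?_
      tight_apexPoint
    refine ⟨hb, true, ?_, linkIsRegularTetrahedron_apex⟩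
    rw [wallsAtIdeal_eq hc.wallsNonempty hb, tight_apexPoint]
    ext l
    simp [parityWalls]
    tauto

end CellFamily

namespace CellFamily

open Label Filter Topology

variable {t : ℝ}

/-! ### Links of finite vertices -/

/-- The link of a point is cut out by the walls through it: a tangent vector satisfies these
inequalities if and only if the geodesic in its direction starts inside the polytope. -/
theorem link_eq {x : Mink} (hx : x ∈ P t) :
    link t x = {u | lor u x = 0 ∧ lor u u = 1 ∧ ∀ l ∈ tight t x, lor u (vec t l) ≤ 0} := by
  ext u
  refine and_congr_right fun hux => and_congr_right fun huu => ?_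
  have hexp : ∀ (r : ℝ) (l : Label), lor (Real.cosh r • x + Real.sinh r • u) (vec t l) =
      Real.cosh r * lor x (vec t l) + Real.sinh r * lor u (vec t l) := fun r l => by
    rw [lor_add_left, lor_smul_left, lor_smul_left]
  constructor
  · rintro ⟨ε, hε, h⟩ l hl
    have h1 := (h (ε / 2) ⟨half_pos hε, half_lt_self hε⟩).2 l hl.1
    rw [hexp, hl.2, mul_zero, zero_add] at h1
    exact nonpos_of_mul_nonpos_right h1 (Real.sinh_pos_iff.2 (half_pos hε))
  · intro h
    have c0 : Continuous fun r : ℝ => (Real.cosh r • x + Real.sinh r • u) 0 := by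
      simp only [Pi.add_apply, Pi.smul_apply, smul_eq_mul]; fun_prop
    have cl : ∀ l, Continuous fun r : ℝ => lor (Real.cosh r • x + Real.sinh r • u) (vec t l) := by
      intro l; simp only [hexp]; fun_prop
    have h0 : ∀ᶠ r in 𝓝 (0 : ℝ), 0 < (Real.cosh r • x + Real.sinh r • u) 0 :=
      c0.continuousAt.eventually (lt_mem_nhds (by simpa using hx.1.2))
    have h1 : ∀ᶠ r in 𝓝 (0 : ℝ), ∀ l, l ∈ active t → l ∉ tight t x →
        lor (Real.cosh r • x + Real.sinh r • u) (vec t l) < 0 := by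
      rw [eventually_all]
      intro l
      by_cases hl : l ∈ active t ∧ l ∉ tight t x
      · refine ((cl l).continuousAt.eventually (gt_mem_nhds ?_)).mono fun _ h _ _ => h
        simpa using lor_neg_of_notMem_tight hx hl.1 hl.2
      · exact Eventually.of_forall fun _ h1 h2 => absurd ⟨h1, h2⟩ hl
    obtain ⟨ε, hε, hball⟩ := Metric.eventually_nhds_iff.1 (h0.and h1)
    refine ⟨ε, hε, fun r hr => ?_⟩
    obtain ⟨g0, g1⟩ := hball (y := r) (by rw [Real.dist_0_eq_abs, abs_of_pos hr.1]; exact hr.2)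
    refine ⟨⟨?_, g0⟩, fun l hl => ?_⟩
    · simp only [lor_add_left, lor_add_right, lor_smul_left, lor_smul_right, hx.1.1, hux, huu,
        lor_comm x u]
      linear_combination -Real.cosh_sq r
    · by_cases hlt : l ∈ tight t x
      · rw [hexp, hlt.2, mul_zero, zero_add]
        exact mul_nonpos_of_nonneg_of_nonpos (Real.sinh_nonneg_iff.2 hr.1.le) (h l hlt)
      · exact (g1 l hl hlt).le

/-- The isometry from the tangent space of `ℍ⁴` at `x` to Euclidean space given by the rotation that
takes `x` to the base point. -/
noncomputable def tangentMap (x u : Mink) : EuclideanSpace ℝ (Fin 4) :=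
  !₂[u 1 - u 0 / (1 + x 0) * x 1, u 2 - u 0 / (1 + x 0) * x 2, u 3 - u 0 / (1 + x 0) * x 3,
    u 4 - u 0 / (1 + x 0) * x 4]

theorem inner_tangentMap {x u v : Mink} (hx : x ∈ Hyp) (hu : lor u x = 0) (hv : lor v x = 0) :
    inner ℝ (tangentMap x u) (tangentMap x v) = lor u v := by
  obtain ⟨h1, h2⟩ := hx
  have h3 : 1 + x 0 ≠ 0 := by positivity
  simp only [PiLp.inner_apply, Fin.sum_univ_four, tangentMap]
  simp [lor] at *
  obtain ⟨a, ha⟩ : ∃ a, a = u 0 / (1 + x 0) := ⟨_, rfl⟩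
  obtain ⟨b, hb⟩ : ∃ b, b = v 0 / (1 + x 0) := ⟨_, rfl⟩
  have ha' : u 0 = a * (1 + x 0) := by rw [ha]; field_simp
  have hb' : v 0 = b * (1 + x 0) := by rw [hb]; field_simp
  rw [← ha, ← hb]
  rw [ha'] at hu ⊢
  rw [hb'] at hv ⊢
  linear_combination (-b) * hu - a * hv + a * b * h1

theorem exists_tangentMap_eq {x : Mink} (hx : x ∈ Hyp) (y : EuclideanSpace ℝ (Fin 4)) :
    ∃ u, lor u x = 0 ∧ tangentMap x u = y := by
  obtain ⟨h1, h2⟩ := hx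
  have h3 : 1 + x 0 ≠ 0 := by positivity
  set s := y 0 * x 1 + y 1 * x 2 + y 2 * x 3 + y 3 * x 4 with hs
  obtain ⟨a, ha⟩ : ∃ a, a = s / (1 + x 0) := ⟨_, rfl⟩
  have ha' : s = a * (1 + x 0) := by rw [ha]; field_simp
  refine ⟨![s, y 0 + a * x 1, y 1 + a * x 2, y 2 + a * x 3, y 3 + a * x 4], ?_, ?_⟩
  · simp [lor] at *
    linear_combination a * h1 - hs + (1 - x 0) * ha'
  · ext i
    fin_cases i <;> simp [tangentMap, ← ha]

/-- The link of a simple vertex is determined by the Gram matrix of its walls. -/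
theorem linkIsTetrahedron_of {x : Mink} (hx : x ∈ P t) {w : Fin 4 → Label}
    (ht : tight t x = range w)
    (hfree : ∀ b : Fin 4 → ℝ, ∃ u, ∀ k, lor u (vec t (w k)) = b k)
    (hpos : ∀ k, 0 < lor (vec t (w k)) (vec t (w k))) {α : Fin 4 → Fin 4 → ℝ}
    (hα : ∀ i j, i ≠ j → -lor (vec t (w i)) (vec t (w j)) /
      √(lor (vec t (w i)) (vec t (w i)) * lor (vec t (w j)) (vec t (w j))) = Real.cos (α i j)) :
    LinkIsTetrahedron t x w α := by
  set ν : Fin 4 → ℝ := fun k => √(lor (vec t (w k)) (vec t (w k))) with hν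
  have hν0 : ∀ k, 0 < ν k := fun k => Real.sqrt_pos.2 (hpos k)
  have hνν : ∀ k, ν k * ν k = lor (vec t (w k)) (vec t (w k)) := fun k =>
    Real.mul_self_sqrt (hpos k).le
  have hxv : ∀ k, lor (vec t (w k)) x = 0 := fun k => by
    rw [lor_comm]
    exact (show w k ∈ tight t x by rw [ht]; exact ⟨k, rfl⟩).2
  set N : Fin 4 → EuclideanSpace ℝ (Fin 4) := fun k => (ν k)⁻¹ • tangentMap x (vec t (w k)) with hN
  have hNN : ∀ i j, inner ℝ (N i) (N j) =
      (ν i)⁻¹ * ((ν j)⁻¹ * lor (vec t (w i)) (vec t (w j))) := fun i j => by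
    simp only [hN, real_inner_smul_left, real_inner_smul_right]
    rw [inner_tangentMap hx.1 (hxv i) (hxv j)]
    ring
  have huN : ∀ u, lor u x = 0 → ∀ k, inner ℝ (tangentMap x u) (N k) =
      (ν k)⁻¹ * lor u (vec t (w k)) := fun u hu k => by
    simp only [hN, real_inner_smul_right]
    rw [inner_tangentMap hx.1 hu (hxv k)]
  rw [LinkIsTetrahedron, link_eq hx]
  refine ⟨N, ?_, fun i => ?_, fun i j hij => ?_, tangentMap x, fun u hu v hv =>
    inner_tangentMap hx.1 hu.1 hv.1, ?_, fun u hu k => ?_⟩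
  · rw [Fintype.linearIndependent_iff]
    intro g hg k
    obtain ⟨u, hu⟩ := hfree fun j => if j = k then 1 else 0
    -- the projection of `u` to the tangent space has the same products with the walls at `x`
    set u' := u + lor u x • x with hu'
    have h1 : lor u' x = 0 := by
      rw [hu', lor_add_left, lor_smul_left, hx.1.1]; ring
    have h2 : ∀ j, lor u' (vec t (w j)) = if j = k then 1 else 0 := fun j => by
      rw [hu', lor_add_left, lor_smul_left, lor_comm x, hxv, hu]; ring
    have h3 := congrArg (fun y => inner ℝ (tangentMap x u') y) hg
    simp only [inner_sum, real_inner_smul_right, inner_zero_right, huN u' h1, h2, mul_ite, mul_one,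
      mul_zero, Finset.sum_ite_eq', Finset.mem_univ, if_true] at h3
    exact (mul_eq_zero.1 h3).resolve_right (inv_ne_zero (hν0 k).ne')
  · have h1 := hNN i i
    rw [← hνν, real_inner_self_eq_norm_sq] at h1
    have h2 : (ν i)⁻¹ * ((ν i)⁻¹ * (ν i * ν i)) = 1 := by
      have := (hν0 i).ne'
      field_simp
    rw [h2] at h1
    exact (pow_eq_one_iff_of_nonneg (norm_nonneg _) two_ne_zero).1 h1
  · rw [hNN, ← hα i j hij, Real.sqrt_mul (hpos i).le]
    change _ = -(_ / (ν i * ν j))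
    have := (hν0 i).ne'
    have := (hν0 j).ne'
    field_simp
  · ext y
    have hle : ∀ u, lor u x = 0 → ((∀ l ∈ tight t x, lor u (vec t l) ≤ 0) ↔
        ∀ k, inner ℝ (tangentMap x u) (N k) ≤ 0) := by
      intro u hu
      rw [ht, forall_mem_range]
      refine forall_congr' fun k => ?_
      rw [huN u hu, mul_nonpos_iff_pos_imp_nonpos]
      have := inv_pos.2 (hν0 k)
      exact ⟨fun h => ⟨fun _ => h, fun h => this.le⟩, fun h => h.1 this⟩
    constructor
    · rintro ⟨u, ⟨hu, huu, hul⟩, rfl⟩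
      refine ⟨?_, (hle u hu).1 hul⟩
      have h1 := inner_tangentMap hx.1 hu hu
      rw [huu, real_inner_self_eq_norm_sq] at h1
      exact (pow_eq_one_iff_of_nonneg (norm_nonneg _) two_ne_zero).1 h1
    · rintro ⟨hy, hyl⟩
      obtain ⟨u, hu, rfl⟩ := exists_tangentMap_eq hx.1 y
      refine ⟨u, ⟨hu, ?_, (hle u hu).2 hyl⟩, rfl⟩
      rw [← inner_tangentMap hx.1 hu hu, real_inner_self_eq_norm_sq, hy, one_pow]
  · rw [huN u hu.1, mul_eq_zero, or_iff_right (inv_ne_zero (hν0 k).ne')]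

/-! ### Gram matrix -/

/-- The scalar product of two vertices of the cube. -/
def cornerDot (i j : Fin 8) : ℤ :=
  corner i 0 * corner j 0 + corner i 1 * corner j 1 + corner i 2 * corner j 2

theorem two_eq_sqrt_mul : √2 * √2 = 2 := Real.mul_self_sqrt (by norm_num)

theorem lor_pos_pos (i j : Fin 8) : lor (vec t (pos i)) (vec t (pos j)) =
    cornerDot i j - 2 + eps i * eps j / t ^ 2 := by
  rw [vec_pos, vec_pos]
  simp [lor, cornerDot]
  ring

theorem lor_pos_neg (ht : t ≠ 0) (i j : Fin 8) : lor (vec t (pos i)) (vec t (neg j)) =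
    cornerDot i j - 2 - eps i * eps j := by
  rw [vec_pos, vec_neg]
  simp [lor, cornerDot]
  field_simp
  ring

theorem lor_neg_neg (i : Fin 8) : lor (vec t (neg i)) (vec t (neg i)) = 1 + t ^ 2 := by
  have h : eps i * eps i = 1 ∧ cornerDot i i = 3 := by revert i; decide
  have h1 : (eps i : ℝ) * eps i = 1 := by exact_mod_cast h.1
  have h2 : (corner i 0 : ℝ) * corner i 0 + corner i 1 * corner i 1 + corner i 2 * corner i 2 = 3 := by
    exact_mod_cast h.2
  rw [vec_neg]
  simp [lor]
  linear_combination h2 + t ^ 2 * h1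

theorem lor_pos_self (i : Fin 8) : lor (vec t (pos i)) (vec t (pos i)) = 1 + 1 / t ^ 2 := by
  have h : eps i * eps i = 1 ∧ cornerDot i i = 3 := by revert i; decide
  have h1 : (eps i : ℝ) * eps i = 1 := by exact_mod_cast h.1
  rw [lor_pos_pos, h.2, h1]
  push_cast
  ring

theorem lor_of_red {a b : Label} (h : Red a b) : lor (vec t a) (vec t b) = 1 / t ^ 2 - 3 := by
  obtain ⟨i, j, hij, hp, rfl, rfl⟩ := h
  have h : ∀ i j : Fin 8, i ≠ j → (Even i.val ↔ Even j.val) →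
      eps i * eps j = 1 ∧ cornerDot i j = -1 := by decide
  obtain ⟨h1, h2⟩ := h i j hij hp
  have h1 : (eps i : ℝ) * eps j = 1 := by exact_mod_cast h1
  rw [lor_pos_pos, h2, h1]
  push_cast
  ring

theorem lor_pos_neg_eq_zero (ht : t ≠ 0) {i k : Fin 8} (h : i = k ∨ CubeAdj i k) :
    lor (vec t (pos i)) (vec t (neg k)) = 0 := by
  have key : ∀ i k : Fin 8, i = k ∨ CubeAdj i k → cornerDot i k - 2 - eps i * eps k = 0 := by
    decide +kernel
  rw [lor_pos_neg ht]
  exact_mod_cast key i k h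

theorem lor_pos_side {i : Fin 8} {X : Label} (h : OnSide X i) :
    lor (vec t (pos i)) (vec t X) = 0 := by
  rw [vec_pos]
  rcases h with ⟨rfl, h⟩ | ⟨rfl, h⟩ | ⟨rfl, h⟩ | ⟨rfl, h⟩ | ⟨rfl, h⟩ | ⟨rfl, h⟩ <;>
    simp [lor, vec, h]

theorem lor_neg_side {i : Fin 8} {X : Label} (h : OnSide X i) :
    lor (vec t (neg i)) (vec t X) = 0 := by
  rw [vec_neg]
  rcases h with ⟨rfl, h⟩ | ⟨rfl, h⟩ | ⟨rfl, h⟩ | ⟨rfl, h⟩ | ⟨rfl, h⟩ | ⟨rfl, h⟩ <;>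
    simp [lor, vec, h]

theorem lor_pos_pole (ht : t ≠ 0) {i k : Fin 8} (h : Even i.val ↔ ¬ Even k.val) :
    lor (vec t (pos i)) (vec t (pole k)) = 0 := by
  have key : ∀ i : Fin 8, eps i = if Even i.val then 1 else -1 := by decide
  rw [vec_pos, pole, key]
  by_cases hk : Even k.val
  · have hi : ¬ Even i.val := fun hi => (h.1 hi) hk
    simp [hk, hi, lor, vec]
    field_simp
    ring
  · have hi : Even i.val := h.2 hk
    simp [hk, hi, lor, vec]
    field_simp
    ring

theorem lor_of_greenOrd {a b : Label} (h : GreenOrd a b) :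
    lor (vec t a) (vec t b) = -(√2 * (1 - t ^ 2)) := by
  have key : ∀ i : Fin 8, eps i = if Even i.val then 1 else -1 := by decide
  obtain ⟨i, rfl, ⟨hi, rfl⟩ | ⟨hi, rfl⟩⟩ := h
  · rw [vec_neg, key, if_pos hi]
    simp [lor, vec]
    ring
  · rw [vec_neg, key, if_neg (Nat.not_even_iff_odd.2 hi)]
    simp [lor, vec]
    ring

theorem lor_of_green {a b : Label} (h : Green a b) :
    lor (vec t a) (vec t b) = -(√2 * (1 - t ^ 2)) := by
  rcases h with h | h
  · exact lor_of_greenOrd h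
  · rw [lor_comm]; exact lor_of_greenOrd h

theorem lor_G_G : lor (vec t G) (vec t G) = 2 * t ^ 2 - 1 := by
  simp [lor, vec]
  linear_combination t ^ 2 * two_eq_sqrt_mul

theorem lor_H_H : lor (vec t H) (vec t H) = 2 * t ^ 2 - 1 := by
  simp [lor, vec]
  linear_combination t ^ 2 * two_eq_sqrt_mul

theorem lor_side {X : Label} (h : X ∈ sides) : lor (vec t X) (vec t X) = 1 := by
  simp only [sides, List.mem_cons, List.not_mem_nil, or_false] at h
  rcases h with rfl | rfl | rfl | rfl | rfl | rfl <;> simp [lor, vec] <;> norm_num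

theorem lor_vec_self_pos (ht : 0 < t) {l : Label} (hl : l ∈ active t) :
    0 < lor (vec t l) (vec t l) := by
  have hG : t₂ < t → 0 < 2 * t ^ 2 - 1 := fun h => by
    have := (half_lt_sq_iff ht).2 h
    linarith
  cases l with
  | pos i => rw [lor_pos_self]; positivity
  | neg i => rw [lor_neg_neg]; positivity
  | G => rw [lor_G_G]; exact hG (hl (.inl rfl))
  | H => rw [lor_H_H]; exact hG (hl (.inr rfl))
  | _ => rw [lor_side (by simp [sides])]; exact one_pos

end CellFamily

namespace CellFamily

open Label

variable {t : ℝ}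

/-! ### Angles -/

/-- Combinatorial orthogonality of `a` and `b`, with a positive or negative wall as the first one. -/
def OrthOrd (a b : Label) : Prop :=
  (∃ i, a = pos i ∧ ((∃ k, b = neg k ∧ (i = k ∨ CubeAdj i k)) ∨ OnSide b i ∨
    ∃ k, b = pole k ∧ (Even i.val ↔ ¬ Even k.val))) ∨ ∃ i, a = neg i ∧ OnSide b i

/-- The pairs of walls that are orthogonal for combinatorial reasons. -/
def Orth (a b : Label) : Prop := OrthOrd a b ∨ OrthOrd b a

/-- A boolean test for `OrthOrd`. This test and those in terms of `code` below make the statements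
about all members of a family of sets of walls fast to decide. -/
def orthTest : Label → Label → Bool
  | pos i, neg k => i == k || decide (CubeAdj i k)
  | pos i, G => i % 2 == 1
  | pos i, H => i % 2 == 0
  | pos i, X => decide (OnSide X i)
  | neg i, X => decide (OnSide X i)
  | _, _ => false

theorem orthTest_iff (a b : Label) : orthTest a b = true ↔ OrthOrd a b := by
  have : ∀ a ∈ allLabels, ∀ b ∈ allLabels, orthTest a b = true ↔
      (∃ i, a = pos i ∧ ((∃ k, b = neg k ∧ (i = k ∨ CubeAdj i k)) ∨ OnSide b i ∨
        ∃ k, b = pole k ∧ (Even i.val ↔ ¬ Even k.val))) ∨ ∃ i, a = neg i ∧ OnSide b i := by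
    decide +kernel
  exact this a (mem_allLabels a) b (mem_allLabels b)

instance (a b : Label) : Decidable (OrthOrd a b) := decidable_of_iff _ (orthTest_iff a b)

instance (a b : Label) : Decidable (Orth a b) := by unfold Orth; infer_instance

theorem red_iff_code (a b : Label) :
    (code a < 8 ∧ code b < 8 ∧ code a ≠ code b ∧ code a % 2 = code b % 2) ↔ Red a b := by
  have : ∀ a ∈ allLabels, ∀ b ∈ allLabels,
      (code a < 8 ∧ code b < 8 ∧ code a ≠ code b ∧ code a % 2 = code b % 2) ↔
      ∃ i : Fin 8, a = pos i ∧ ∃ j : Fin 8, b = pos j ∧ i ≠ j ∧ (Even i.val ↔ Even j.val) := by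
    decide +kernel
  rw [this a (mem_allLabels a) b (mem_allLabels b)]
  constructor
  · rintro ⟨i, h1, j, h2, h3, h4⟩
    exact ⟨i, j, h3, h4, h1, h2⟩
  · rintro ⟨i, j, h3, h4, h1, h2⟩
    exact ⟨i, h1, j, h2, h3, h4⟩

instance (a b : Label) : Decidable (Red a b) := decidable_of_iff _ (red_iff_code a b)

theorem greenOrd_iff_code (a b : Label) :
    (8 ≤ code b ∧ code b < 16 ∧ code a = 22 + code b % 2) ↔ GreenOrd a b := by
  have : ∀ a ∈ allLabels, ∀ b ∈ allLabels,
      (8 ≤ code b ∧ code b < 16 ∧ code a = 22 + code b % 2) ↔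
      ∃ i : Fin 8, b = neg i ∧ ((Even i.val ∧ a = G) ∨ (Odd i.val ∧ a = H)) := by
    decide +kernel
  exact this a (mem_allLabels a) b (mem_allLabels b)

instance (a b : Label) : Decidable (GreenOrd a b) := decidable_of_iff _ (greenOrd_iff_code a b)

instance (a b : Label) : Decidable (Green a b) := by unfold Green; infer_instance

theorem isPos_iff_code (a : Label) : code a < 8 ↔ IsPos a := by
  have : ∀ a ∈ allLabels, code a < 8 ↔ ∃ i, a = pos i := by decide +kernel
  exact this a (mem_allLabels a)

instance (a : Label) : Decidable (IsPos a) := decidable_of_iff _ (isPos_iff_code a)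

theorem lor_of_orthOrd (ht : t ≠ 0) {a b : Label} (h : OrthOrd a b) :
    lor (vec t a) (vec t b) = 0 := by
  obtain ⟨i, rfl, ⟨k, rfl, h⟩ | h | ⟨k, rfl, h⟩⟩ | ⟨i, rfl, h⟩ := h
  exacts [lor_pos_neg_eq_zero ht h, lor_pos_side h, lor_pos_pole ht h, lor_neg_side h]

theorem lor_of_orth (ht : t ≠ 0) {a b : Label} (h : Orth a b) : lor (vec t a) (vec t b) = 0 := by
  rcases h with h | h
  · exact lor_of_orthOrd ht h
  · rw [lor_comm]; exact lor_of_orthOrd ht h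

theorem Orth.symm {a b : Label} (h : Orth a b) : Orth b a := Or.symm h

theorem IsPos.lor_self {a : Label} (h : IsPos a) : lor (vec t a) (vec t a) = 1 + 1 / t ^ 2 := by
  obtain ⟨i, rfl⟩ := h
  exact lor_pos_self i

theorem Red.isPos_left {a b : Label} (h : Red a b) : IsPos a := by
  obtain ⟨i, j, -, -, rfl, rfl⟩ := h
  exact ⟨i, rfl⟩

theorem Red.isPos_right {a b : Label} (h : Red a b) : IsPos b := by
  obtain ⟨i, j, -, -, rfl, rfl⟩ := h
  exact ⟨j, rfl⟩

/-- The ratio whose arc cosine is the dihedral angle of a red face. -/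
theorem cosine_of_red (ht : 0 < t) {a b : Label} (h : Red a b) :
    -lor (vec t a) (vec t b) / √(lor (vec t a) (vec t a) * lor (vec t b) (vec t b)) =
      (3 * t ^ 2 - 1) / (1 + t ^ 2) := by
  rw [lor_of_red h, h.isPos_left.lor_self, h.isPos_right.lor_self,
    Real.sqrt_mul_self (by positivity)]
  field_simp
  ring

theorem cosine_of_green {a b : Label} (h : Green a b) :
    -lor (vec t a) (vec t b) / √(lor (vec t a) (vec t a) * lor (vec t b) (vec t b)) =
      √2 * (1 - t ^ 2) / √((2 * t ^ 2 - 1) * (t ^ 2 + 1)) := by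
  have key : ∀ a b, GreenOrd a b → lor (vec t a) (vec t a) * lor (vec t b) (vec t b) =
      (2 * t ^ 2 - 1) * (t ^ 2 + 1) := by
    rintro a b ⟨i, rfl, ⟨-, rfl⟩ | ⟨-, rfl⟩⟩
    · rw [lor_neg_neg, lor_G_G]; ring
    · rw [lor_neg_neg, lor_H_H]; ring
  rw [lor_of_green h, neg_neg]
  rcases h with h | h
  · rw [key a b h]
  · rw [mul_comm (lor (vec t a) _), key b a h]

theorem dihedralAngle_of_red (ht : 0 < t) {a b : Label} (h : Red a b) :
    dihedralAngle (vec t a) (vec t b) = theta t := by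
  rw [dihedralAngle, cosine_of_red ht h, theta]

theorem dihedralAngle_of_green {a b : Label} (h : Green a b) :
    dihedralAngle (vec t a) (vec t b) = phi t := by
  rw [dihedralAngle, cosine_of_green h, phi]

theorem dihedralAngle_of_lor_eq_zero {v w : Mink} (h : lor v w = 0) :
    dihedralAngle v w = Real.pi / 2 := by
  rw [dihedralAngle, h, neg_zero, zero_div, Real.arccos_zero]

theorem cos_theta : Real.cos (theta t) = (3 * t ^ 2 - 1) / (1 + t ^ 2) ∨ 1 < t ^ 2 := by
  by_cases ht : 1 < t ^ 2
  · exact .inr ht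
  · left
    have h : 0 < 1 + t ^ 2 := by positivity
    refine Real.cos_arccos ?_ ?_
    · rw [le_div_iff₀ h]; nlinarith [sq_nonneg t]
    · rw [div_le_iff₀ h]; nlinarith

theorem cos_theta_eq (ht : t ∈ Ioc (0 : ℝ) 1) :
    Real.cos (theta t) = (3 * t ^ 2 - 1) / (1 + t ^ 2) :=
  cos_theta.resolve_right (by nlinarith [ht.1, ht.2])

theorem cos_phi_eq (ht : t ∈ Ioc t₁ 1) :
    Real.cos (phi t) = √2 * (1 - t ^ 2) / √((2 * t ^ 2 - 1) * (t ^ 2 + 1)) := by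
  have h1 : 3 / 5 < t ^ 2 := by rw [← t₁_sq]; exact pow_lt_pow_left₀ ht.1 t₁_pos.le two_ne_zero
  have h2 : t ^ 2 ≤ 1 := by nlinarith [ht.2, t₁_pos.trans ht.1]
  have h3 : 0 < (2 * t ^ 2 - 1) * (t ^ 2 + 1) := mul_pos (by linarith) (by linarith)
  have h4 : 0 ≤ √2 * (1 - t ^ 2) := mul_nonneg (Real.sqrt_nonneg 2) (by linarith)
  refine Real.cos_arccos ((neg_nonpos.2 zero_le_one).trans (div_nonneg h4 (Real.sqrt_nonneg _))) ?_
  rw [div_le_one (Real.sqrt_pos.2 h3)]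
  refine Real.le_sqrt_of_sq_le ?_
  rw [mul_pow, Real.sq_sqrt zero_le_two]
  nlinarith

/-! #### Projections -/

theorem lor_proj_proj {v : Mink} (hv : lor v v ≠ 0) (u w : Mink) :
    lor (proj v u) (proj v w) = lor u w - lor u v * lor w v / lor v v := by
  simp only [proj, lor_sub_left, lor_sub_right, lor_smul_left, lor_smul_right, lor_comm v]
  field_simp
  ring

theorem lor_proj_left {v : Mink} (u w : Mink) :
    lor u (proj v w) = lor u w - lor w v / lor v v * lor u v := by
  simp only [proj, lor_sub_right, lor_smul_right]

theorem proj_eq_self {v w : Mink} (h : lor w v = 0) : proj v w = w := by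
  rw [proj, h, zero_div, zero_smul, sub_zero]

/-- Three vectors of the same norm `p` with the same mutual product `r`. -/
structure IsRegular (p r : ℝ) (u v w : Mink) : Prop where
  huu : lor u u = p
  hvv : lor v v = p
  hww : lor w w = p
  huv : lor u v = r
  huw : lor u w = r
  hvw : lor v w = r

theorem IsRegular.lor_proj {p r : ℝ} {u v w : Mink} (h : IsRegular p r u v w) (hp : p ≠ 0) :
    lor (proj u v) (proj u v) = (p + r) * (p - r) / p ∧
      lor (proj u w) (proj u w) = (p + r) * (p - r) / p ∧
      lor (proj u v) (proj u w) = r * (p - r) / p := by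
  have hu : lor u u ≠ 0 := by rwa [h.huu]
  simp only [lor_proj_proj hu, lor_comm v u, lor_comm w u, h.huu, h.huv, h.huw, h.hvv, h.hww, h.hvw]
  refine ⟨?_, ?_, ?_⟩ <;> field_simp <;> ring

theorem IsRegular.dihedralAngle_proj {p r : ℝ} {u v w : Mink} (h : IsRegular p r u v w)
    (hp : 0 < p) (hpr : 0 < p - r) (hpr' : 0 < p + r) :
    dihedralAngle (proj u v) (proj u w) = Real.arccos (-r / (p + r)) := by
  obtain ⟨h1, h2, h3⟩ := h.lor_proj hp.ne'
  rw [dihedralAngle, h1, h2, h3, Real.sqrt_mul_self (by positivity)]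
  congr 1
  field_simp

/-! #### The angles of edges and corners -/

/-- The combinatorial properties of a set of walls that meet which determine the angles there: two
walls are red, green or orthogonal, and two positive ones are red; among three walls `a`, `b`, `c`
that are not all positive, `a` is orthogonal to `b` and `c` if these are not orthogonal to each other,
and to one of them otherwise; the walls that meet a green face are positive and orthogonal to it; the
walls other than positive ones that meet a red face are orthogonal to it. -/
structure AnglesOK (L : List Label) : Prop where
  pair : ∀ a ∈ L, ∀ b ∈ L, a ≠ b → (IsPos a → IsPos b → Red a b) ∧ (Red a b ∨ Green a b ∨ Orth a b)
  triple : ∀ a ∈ L, ∀ b ∈ L, a ≠ b → ∀ c ∈ L, a ≠ c → b ≠ c → ¬ (IsPos a ∧ IsPos b ∧ IsPos c) →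
    (Red b c ∨ Green b c → Orth a b ∧ Orth a c) ∧
    (¬ Red b c → ¬ Green b c → Orth a b ∨ Orth a c)
  green : ∀ a ∈ L, ∀ b ∈ L, Green a b → ∀ c ∈ L, a ≠ c → b ≠ c → Orth a c ∧ Orth b c ∧ IsPos c
  red : ∀ a ∈ L, ∀ b ∈ L, Red a b → ∀ c ∈ L, ¬ IsPos c → Orth a c ∧ Orth b c

set_option synthInstance.maxSize 1000 in
set_option synthInstance.maxHeartbeats 400000 in
instance (L : List Label) : Decidable (AnglesOK L) :=
  decidable_of_iff (_ ∧ _ ∧ _ ∧ _)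
    ⟨fun ⟨h1, h2, h3, h4⟩ => ⟨h1, h2, h3, h4⟩, fun ⟨h1, h2, h3, h4⟩ => ⟨h1, h2, h3, h4⟩⟩

theorem isRegular_of_isPos {L : List Label} (hL : AnglesOK L) {a b c : Label} (ha : a ∈ L)
    (hb : b ∈ L) (hc : c ∈ L) (hab : a ≠ b) (hac : a ≠ c) (hbc : b ≠ c) (pa : IsPos a)
    (pb : IsPos b) (pc : IsPos c) :
    IsRegular (1 + 1 / t ^ 2) (1 / t ^ 2 - 3) (vec t a) (vec t b) (vec t c) :=
  ⟨pa.lor_self, pb.lor_self, pc.lor_self, lor_of_red ((hL.pair a ha b hb hab).1 pa pb),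
    lor_of_red ((hL.pair a ha c hc hac).1 pa pc), lor_of_red ((hL.pair b hb c hc hbc).1 pb pc)⟩

theorem edgeAngle_eq_psi (ht : t ∈ Ioo (0 : ℝ) 1) {a b c : Label}
    (h : IsRegular (1 + 1 / t ^ 2) (1 / t ^ 2 - 3) (vec t a) (vec t b) (vec t c)) :
    edgeAngle t a b c = psi t := by
  have ht0 := ht.1
  have ht2 : 0 < 1 - t ^ 2 := by nlinarith [ht.1, ht.2]
  have h1 : 1 < 1 / t ^ 2 := by rw [lt_div_iff₀ (by positivity)]; linarith
  rw [edgeAngle, h.dihedralAngle_proj (by linarith) (by linarith) (by linarith), psi]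
  congr 1
  have h3 : t ^ 2 - 1 ≠ 0 := by linarith
  have h2 : 1 + 1 / t ^ 2 + (1 / t ^ 2 - 3) = -2 * (t ^ 2 - 1) / t ^ 2 := by field_simp; ring
  rw [h2]
  field_simp

theorem edgeAngle_of_orth (ht : t ≠ 0) {a b c : Label} (hb : Orth a b) (hc : Orth a c) :
    edgeAngle t a b c = dihedralAngle (vec t b) (vec t c) := by
  rw [edgeAngle, proj_eq_self (by rw [lor_comm]; exact lor_of_orth ht hb),
    proj_eq_self (by rw [lor_comm]; exact lor_of_orth ht hc)]

theorem edgeAngle_eq_pi_div_two (ht : t ≠ 0) {a b c : Label}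
    (ha : lor (vec t a) (vec t a) ≠ 0) (hbc : Orth b c) (h : Orth a b ∨ Orth a c) :
    edgeAngle t a b c = Real.pi / 2 := by
  refine dihedralAngle_of_lor_eq_zero ?_
  rw [lor_proj_proj ha, lor_of_orth ht hbc, lor_comm (vec t b), lor_comm (vec t c)]
  rcases h with h | h <;> rw [lor_of_orth ht h] <;> simp

/-- The dihedral angle of the wall `a` along the edge on `a`, `b`, `c` is `ψ` if the three walls are
positive. Otherwise `a` is orthogonal to `b` and `c`, so that it does not change the angle between
them, or `b` and `c` are orthogonal, and stay so in `a`, which is orthogonal to one of them. -/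
theorem edgeAngle_spec (ht : t ∈ Ioo (0 : ℝ) 1) {L : List Label} (hL : AnglesOK L) {a b c : Label}
    (ha : a ∈ L) (hb : b ∈ L) (hc : c ∈ L) (hab : a ≠ b) (hac : a ≠ c) (hbc : b ≠ c)
    (haa : 0 < lor (vec t a) (vec t a)) :
    (IsPos a → IsPos b → IsPos c → edgeAngle t a b c = psi t) ∧
      (¬ (IsPos a ∧ IsPos b ∧ IsPos c) →
        (Red b c → edgeAngle t a b c = theta t) ∧
        (Green b c → edgeAngle t a b c = phi t) ∧
        (¬ Red b c → ¬ Green b c → edgeAngle t a b c = Real.pi / 2)) := by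
  have ht0 := ht.1.ne'
  refine ⟨fun pa pb pc => edgeAngle_eq_psi ht (isRegular_of_isPos hL ha hb hc hab hac hbc pa pb pc),
    fun hp => ?_⟩
  have h := hL.triple a ha b hb hab c hc hac hbc hp
  refine ⟨fun hr => ?_, fun hg => ?_, fun hr hg => ?_⟩
  · rw [edgeAngle_of_orth ht0 (h.1 (.inl hr)).1 (h.1 (.inl hr)).2, dihedralAngle_of_red ht.1 hr]
  · rw [edgeAngle_of_orth ht0 (h.1 (.inr hg)).1 (h.1 (.inr hg)).2, dihedralAngle_of_green hg]
  · exact edgeAngle_eq_pi_div_two ht0 haa.ne'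
      (((hL.pair b hb c hc hbc).2.resolve_left hr).resolve_left hg) (h.2 hr hg)

theorem lor_proj_vec_of_orth (ht : t ≠ 0) {a b c : Label} (ha : Orth a c) (hb : Orth b c) :
    lor (vec t c) (proj (vec t a) (vec t b)) = 0 := by
  rw [lor_proj_left, lor_of_orth ht hb.symm, lor_of_orth ht ha.symm, mul_zero, sub_zero]

theorem proj_proj_of_orth (ht : t ≠ 0) {a b c : Label} (ha : Orth a c) (hb : Orth b c) :
    proj (proj (vec t a) (vec t b)) (proj (vec t a) (vec t c)) = vec t c := by
  rw [proj_eq_self (w := vec t c) (lor_of_orth ht ha.symm),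
    proj_eq_self (lor_proj_vec_of_orth ht ha hb)]

theorem cornerAngle_of_orth (ht : t ≠ 0) {a b c d : Label} (hac : Orth a c) (hbc : Orth b c)
    (had : Orth a d) (hbd : Orth b d) :
    cornerAngle t a b c d = dihedralAngle (vec t c) (vec t d) := by
  rw [cornerAngle, proj_proj_of_orth ht hac hbc, proj_proj_of_orth ht had hbd]

theorem dihedralAngle_comm (v w : Mink) : dihedralAngle v w = dihedralAngle w v := by
  rw [dihedralAngle, dihedralAngle, lor_comm v w, mul_comm (lor v v)]

theorem cornerAngle_comm (a b c d : Label) : cornerAngle t a b c d = cornerAngle t a b d c :=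
  dihedralAngle_comm _ _

/-- If the wall `c` is orthogonal to all the others, the angle is right. -/
theorem cornerAngle_eq_pi_div_two (ht : t ≠ 0) {a b c d : Label} (hac : Orth a c) (hbc : Orth b c)
    (hcd : Orth c d) : cornerAngle t a b c d = Real.pi / 2 := by
  refine dihedralAngle_of_lor_eq_zero ?_
  rw [proj_proj_of_orth ht hac hbc, lor_proj_left, lor_proj_vec_of_orth ht hac hbc, mul_zero,
    sub_zero, lor_proj_vec_of_orth ht hac hcd.symm]

/-- At a vertex on four positive walls, the projections of three of the vectors to the orthogonal
complement of the fourth one again have equal norms and equal products, so that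
`IsRegular.dihedralAngle_proj` applies to them. -/
theorem cornerAngle_eq_eta (ht : t ∈ Ioo (0 : ℝ) t₂) {L : List Label} (hL : AnglesOK L)
    {a b c d : Label} (ha : a ∈ L) (hb : b ∈ L) (hc : c ∈ L) (hd : d ∈ L)
    (hn : [a, b, c, d].Nodup) (pa : IsPos a) (pb : IsPos b) (pc : IsPos c) (pd : IsPos d) :
    cornerAngle t a b c d = eta t := by
  simp only [List.nodup_cons, List.mem_cons, List.not_mem_nil, or_false, not_or, not_false_eq_true,
    List.nodup_nil, and_true] at hn
  obtain ⟨⟨hab, hac, had⟩, ⟨hbc, hbd⟩, hcd⟩ := hn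
  have ht0 := ht.1
  have hq : t ^ 2 < 1 / 2 := by rw [← t₂_sq]; exact pow_lt_pow_left₀ ht.2 ht0.le two_ne_zero
  have h1 : 2 < 1 / t ^ 2 := by rw [lt_div_iff₀ (by positivity)]; linarith
  obtain ⟨p, hp⟩ : ∃ p, p = 1 + 1 / t ^ 2 := ⟨_, rfl⟩
  obtain ⟨r, hr⟩ : ∃ r, r = 1 / t ^ 2 - 3 := ⟨_, rfl⟩
  have g1 := isRegular_of_isPos (t := t) hL ha hb hc hab hac hbc pa pb pc
  have g2 := isRegular_of_isPos (t := t) hL ha hb hd hab had hbd pa pb pd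
  have g3 := isRegular_of_isPos (t := t) hL ha hc hd hac had hcd pa pc pd
  rw [← hp, ← hr] at g1 g2 g3
  have hp0 : 0 < p := by linarith
  have hpr : 0 < p - r := by linarith
  have hpr' : 0 < p + r := by linarith
  have hpr2 : 0 < p + 2 * r := by linarith
  obtain ⟨e1, e2, e3⟩ := g1.lor_proj hp0.ne'
  obtain ⟨-, e4, e5⟩ := g2.lor_proj hp0.ne'
  obtain ⟨-, -, e6⟩ := g3.lor_proj hp0.ne'
  have key := IsRegular.dihedralAngle_proj ⟨e1, e2, e4, e3, e5, e6⟩ (by positivity)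
    (by rw [← sub_div, ← sub_mul, add_sub_cancel_right]; positivity)
    (by rw [← add_div, ← add_mul]; exact div_pos (mul_pos (by linarith) hpr) hp0)
  rw [cornerAngle, key, eta]
  congr 1
  have h5 : 0 < 3 - 5 * t ^ 2 := by linarith
  have e7 : -(r * (p - r) / p) / ((p + r) * (p - r) / p + r * (p - r) / p) = -r / (p + 2 * r) := by
    rw [← add_div, ← add_mul, ← neg_div, div_div_div_cancel_right₀ hp0.ne', ← neg_mul,
      mul_div_mul_right _ _ hpr.ne']
    ring_nf
  have e8 : p + 2 * r = (3 - 5 * t ^ 2) / t ^ 2 := by rw [hp, hr]; field_simp; ring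
  rw [e7, e8, hr]
  field_simp
  ring

/-- The angle of the face on `a`, `b` at the vertex on `a`, `b`, `c`, `d` is the one between `c` and
`d` if these are orthogonal to the face, it is right if `c` or `d` is orthogonal to all the other
walls, and it is `η` if all four walls are positive. -/
theorem cornerAngle_spec (ht : t ∈ Ioo (0 : ℝ) 1) {L : List Label} (hL : AnglesOK L)
    {a b c d : Label} (ha : a ∈ L) (hb : b ∈ L) (hc : c ∈ L) (hd : d ∈ L)
    (hn : [a, b, c, d].Nodup)
    (h4 : t < t₂ ∨ ¬ (IsPos a ∧ IsPos b ∧ IsPos c ∧ IsPos d)) :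
    (Green a b → cornerAngle t a b c d = theta t) ∧
      (Red a b →
        (IsPos c → IsPos d → cornerAngle t a b c d = eta t) ∧
        (Green c d → cornerAngle t a b c d = phi t) ∧
        (¬ (IsPos c ∧ IsPos d) → ¬ Green c d → cornerAngle t a b c d = Real.pi / 2)) := by
  have ht0 := ht.1.ne'
  have hn' := hn
  simp only [List.nodup_cons, List.mem_cons, List.not_mem_nil, or_false, not_or, not_false_eq_true,
    List.nodup_nil, and_true] at hn
  obtain ⟨⟨hab, hac, had⟩, ⟨hbc, hbd⟩, hcd⟩ := hn
  refine ⟨fun hg => ?_, fun hr => ⟨fun pc pd => ?_, fun hg => ?_, fun hp hg => ?_⟩⟩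
  · obtain ⟨h1, h2, h3⟩ := hL.green a ha b hb hg c hc hac hbc
    obtain ⟨h1', h2', h3'⟩ := hL.green a ha b hb hg d hd had hbd
    rw [cornerAngle_of_orth ht0 h1 h2 h1' h2', dihedralAngle_of_red ht.1
      ((hL.pair c hc d hd hcd).1 h3 h3')]
  · have pa := hr.isPos_left
    have pb := hr.isPos_right
    exact cornerAngle_eq_eta ⟨ht.1, h4.resolve_right fun h => h ⟨pa, pb, pc, pd⟩⟩ hL ha hb hc hd hn'
      pa pb pc pd
  · obtain ⟨h1, h2, -⟩ := hL.green c hc d hd hg a ha (Ne.symm hac) (Ne.symm had)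
    obtain ⟨h1', h2', -⟩ := hL.green c hc d hd hg b hb (Ne.symm hbc) (Ne.symm hbd)
    rw [cornerAngle_of_orth ht0 h1.symm h1'.symm h2.symm h2'.symm, dihedralAngle_of_green hg]
  · have hcd' : Orth c d := by
      rcases (hL.pair c hc d hd hcd).2 with h | h | h
      exacts [absurd ⟨h.isPos_left, h.isPos_right⟩ hp, absurd h hg, h]
    by_cases pc : IsPos c
    · have pd : ¬ IsPos d := fun pd => hp ⟨pc, pd⟩
      obtain ⟨h1, h2⟩ := hL.red a ha b hb hr d hd pd
      rw [cornerAngle_comm]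
      exact cornerAngle_eq_pi_div_two ht0 h1 h2 hcd'.symm
    · obtain ⟨h1, h2⟩ := hL.red a ha b hb hr c hc pc
      exact cornerAngle_eq_pi_div_two ht0 h1 h2 hcd'

theorem anglesOK_above : ∀ L ∈ aboveSets, AnglesOK L := by decide +kernel
theorem anglesOK_at_t₁ : ∀ L ∈ atT₁Sets, AnglesOK L := by decide +kernel
theorem anglesOK_between : ∀ L ∈ betweenSets, AnglesOK L := by decide +kernel
theorem anglesOK_at_t₂ : ∀ L ∈ atT₂Sets, AnglesOK L := by decide +kernel
theorem anglesOK_below : ∀ L ∈ belowSets, AnglesOK L := by decide +kernel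
theorem anglesOK_at_one : ∀ L ∈ atOneSets, AnglesOK L := by decide +kernel

end CellFamily

namespace CellFamily

open Label

variable {t : ℝ}

/-! ### The types of finite vertices -/

/-- The finite vertices whose incidence sets belong to a family. -/
def finOfType (t : ℝ) (Ms : List (List Label)) : Set Mink :=
  {x ∈ finVertices t | ∃ M ∈ Ms, tight t x = {l | l ∈ M}}

theorem finOfType_append (Ms Ns : List (List Label)) :
    finOfType t (Ms ++ Ns) = finOfType t Ms ∪ finOfType t Ns := by
  ext x
  simp only [finOfType, List.mem_append, mem_ofPred_eq, mem_union, or_and_right, exists_or,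
    and_or_left]

theorem idealOfType_append (Is Js : List (List Label)) :
    idealOfType t (Is ++ Js) = idealOfType t Is ∪ idealOfType t Js := by
  ext x
  simp only [idealOfType, List.mem_append, mem_ofPred_eq, mem_union, or_and_right, exists_or,
    and_or_left]

namespace IsComplex

variable {Ls : List (List Label)}

theorem encard_finOfType (hc : IsComplex t Ls) {Ms : List (List Label)}
    (hM : ∀ M ∈ Ms, M ∈ Ls ∧ M.length = 4) : (finOfType t Ms).encard = count Ms := by
  rw [← encard_image_setOf_mem fun M h => hc.nodup M (hM M h).1,
    ← InjOn.encard_image (f := tight t) (hc.injOn_tight.mono fun x hx => hx.1)]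
  congr 1
  ext T
  constructor
  · rintro ⟨x, ⟨-, M, hMs, he⟩, rfl⟩
    exact ⟨M, hMs, he.symm⟩
  · rintro ⟨M, hMs, rfl⟩
    obtain ⟨h1, h2⟩ := hM M hMs
    obtain ⟨x, hx, ht⟩ := hc.exists_tight_eq_iff.2 ⟨M, h1, fun l (h : l ∈ {l | l ∈ M}) => h⟩
    refine ⟨x, ⟨hc.mem_finVertices_iff.2 ⟨hx, ?_⟩, M, hMs, ht⟩, ht⟩
    rw [ht, ncard_setOf_mem (hc.nodup M h1), h2]

theorem finVertices_eq_finOfType (hc : IsComplex t Ls) {Ms : List (List Label)}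
    (hM : ∀ L ∈ Ls, L.length < 4 ∨ L.length = 4 ∧ L ∈ Ms) : finVertices t = finOfType t Ms := by
  refine Subset.antisymm (fun x hx => ⟨hx, ?_⟩) fun x hx => hx.1
  rw [hc.mem_finVertices_iff] at hx
  obtain ⟨L, hL, hl⟩ := hc.exists_of_mem_P hx.1
  have h1 := ncard_setOf_mem (hc.nodup L hL)
  have h2 := ncard_le_ncard (show tight t x ⊆ {l | l ∈ L} from hl) (toFinite _)
  rcases hM L hL with h | ⟨h, hLM⟩
  · omega
  · exact ⟨L, hLM, eq_of_subset_of_ncard_le hl (by omega) (toFinite _)⟩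

theorem linkIsTetrahedron (hc : IsComplex t Ls) (ht0 : 0 < t) {x : Mink} (hx : x ∈ finVertices t)
    {w : Fin 4 → Label} (hw : wallsThrough t {x} = range w) {α : Fin 4 → Fin 4 → ℝ}
    (hα : ∀ i j, i ≠ j → -lor (vec t (w i)) (vec t (w j)) /
      √(lor (vec t (w i)) (vec t (w i)) * lor (vec t (w j)) (vec t (w j))) = Real.cos (α i j)) :
    LinkIsTetrahedron t x w α := by
  rw [hc.mem_finVertices_iff] at hx
  rw [wallsThrough_singleton hx.1] at hw
  have hmem : ∀ k, w k ∈ tight t x := fun k => hw ▸ mem_range_self k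
  have hinj : Function.Injective w := by
    rw [← injOn_univ]
    refine injOn_of_ncard_image_eq ?_
    rw [image_univ, ← hw, hx.2, ncard_univ, Nat.card_eq_fintype_card, Fintype.card_fin]
  refine linkIsTetrahedron_of hx.1 hw (fun b => ?_)
    (fun k => lor_vec_self_pos ht0 (hmem k).1) hα
  obtain ⟨u, hu⟩ := hc.isSimple x hx.1 (Function.extend w b 0)
  exact ⟨u, fun k => by rw [hu _ (hmem k), hinj.extend_apply]⟩

end IsComplex

theorem range_four {α : Type*} (a b c d : α) : range ![a, b, c, d] = {a, b, c, d} := by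
  ext x
  simp [eq_comm]
  tauto

theorem setOf_mem_four {α : Type*} (a b c d : α) : {l | l ∈ [a, b, c, d]} = {a, b, c, d} := by
  ext x
  simp

theorem CubeAdj.even_iff {i k : Fin 8} (h : CubeAdj i k) : Even i.val ↔ ¬ Even k.val := by
  revert i k; decide +kernel

theorem red_of_cubeAdj {i j k : Fin 8} (hij : i ≠ j) (hi : CubeAdj i k) (hj : CubeAdj j k) :
    Red (pos i) (pos j) :=
  ⟨i, j, hij, by rw [hi.even_iff, hj.even_iff], rfl, rfl⟩

theorem green_neg_pole (k : Fin 8) : Green (neg k) (pole k) := by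
  refine .inr ⟨k, rfl, ?_⟩
  unfold pole
  by_cases h : Even k.val
  · exact .inl ⟨h, if_pos h⟩
  · exact .inr ⟨Nat.not_even_iff_odd.1 h, if_neg h⟩

theorem orth_pos_neg {i k : Fin 8} (h : CubeAdj i k) : Orth (pos i) (neg k) :=
  .inl (.inl ⟨i, rfl, .inl ⟨k, rfl, .inr h⟩⟩)

theorem orth_pos_pole {i k : Fin 8} (h : CubeAdj i k) : Orth (pos i) (pole k) :=
  .inl (.inl ⟨i, rfl, .inr (.inr ⟨k, rfl, h.even_iff⟩)⟩)

theorem orth_pos_side {i : Fin 8} {X : Label} (h : OnSide X i) : Orth (pos i) X :=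
  .inl (.inl ⟨i, rfl, .inr (.inl h)⟩)

theorem orth_neg_side {i : Fin 8} {X : Label} (h : OnSide X i) : Orth (neg i) X :=
  .inl (.inr ⟨i, rfl, h⟩)

/-- The walls `a` and `b` meet at an angle with the same cosine as `α`. -/
def HasCosine (t : ℝ) (a b : Label) (α : ℝ) : Prop :=
  -lor (vec t a) (vec t b) / √(lor (vec t a) (vec t a) * lor (vec t b) (vec t b)) = Real.cos α

theorem HasCosine.symm {a b : Label} {α : ℝ} (h : HasCosine t a b α) : HasCosine t b a α := by
  rwa [HasCosine, lor_comm (vec t b), mul_comm (lor (vec t b) _)]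

theorem Orth.hasCosine (ht : t ≠ 0) {a b : Label} (h : Orth a b) :
    HasCosine t a b (Real.pi / 2) := by
  rw [HasCosine, lor_of_orth ht h, Real.cos_pi_div_two, neg_zero, zero_div]

theorem Red.hasCosine (ht : t ∈ Ioc (0 : ℝ) 1) {a b : Label} (h : Red a b) :
    HasCosine t a b (theta t) := by
  rw [HasCosine, cosine_of_red ht.1 h, cos_theta_eq ht]

theorem Green.hasCosine (ht : t ∈ Ioc t₁ 1) {a b : Label} (h : Green a b) :
    HasCosine t a b (phi t) := by
  rw [HasCosine, cosine_of_green h, cos_phi_eq ht]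

theorem hasCosine_joinAngles {a b c d : Label} {α β : ℝ} (ht : t ≠ 0) (hab : HasCosine t a b α)
    (hcd : HasCosine t c d β) (hac : Orth a c) (had : Orth a d) (hbc : Orth b c) (hbd : Orth b d)
    (i j : Fin 4) (hij : i ≠ j) :
    HasCosine t (![a, b, c, d] i) (![a, b, c, d] j) (joinAngles α β i j) := by
  have h1 := hac.hasCosine ht
  have h2 := had.hasCosine ht
  have h3 := hbc.hasCosine ht
  have h4 := hbd.hasCosine ht
  revert hij
  fin_cases i <;> fin_cases j <;> simp [joinAngles] <;>
    first | assumption | (apply HasCosine.symm; assumption)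

theorem hasCosine_coneAngles {a b c d : Label} {α : ℝ} (ht : t ≠ 0) (hab : HasCosine t a b α)
    (hac : HasCosine t a c α) (hbc : HasCosine t b c α) (had : Orth a d) (hbd : Orth b d)
    (hcd : Orth c d) (i j : Fin 4) (hij : i ≠ j) :
    HasCosine t (![a, b, c, d] i) (![a, b, c, d] j) (coneAngles α i j) := by
  have h1 := had.hasCosine ht
  have h2 := hbd.hasCosine ht
  have h3 := hcd.hasCosine ht
  revert hij
  fin_cases i <;> fin_cases j <;> simp [coneAngles] <;>
    first | assumption | (apply HasCosine.symm; assumption)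

/-- Each set of labels as in the definition of `letterVertices` belongs to `letterSets`, up to order, and
conversely; the links follow from the Gram matrix. The other types of finite vertices are treated in
the same way. -/
theorem letterVertices_eq (ht : t ∈ Ioc (0 : ℝ) 1) {Ls : List (List Label)}
    (hc : IsComplex t Ls) : letterVertices t = finOfType t letterSets := by
  apply Subset.antisymm
  · rintro x ⟨hx, i, j, k, X, hij, hi, hj, h1, h2, h3, -⟩
    rw [wallsThrough_singleton (hc.mem_finVertices_iff.1 hx).1] at h3
    have key : ∀ i k : Fin 8, CubeAdj i k → ∀ j, i ≠ j → CubeAdj j k → ∀ X ∈ sides, OnSide X i →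
        OnSide X j → ∃ M ∈ letterSets, (∀ l ∈ M, l ∈ [pos i, pos j, neg k, X]) ∧
          ∀ l ∈ [pos i, pos j, neg k, X], l ∈ M := by decide +kernel
    obtain ⟨M, hM, hl, hl'⟩ := key i k hi j hij hj X h1.mem_sides h1 h2
    refine ⟨hx, M, hM, ?_⟩
    rw [h3, ← setOf_mem_four]
    exact Subset.antisymm hl' hl
  · rintro x ⟨hx, M, hM, h⟩
    have key : ∀ M ∈ letterSets, ∃ (i j k : Fin 8) (X : Label), i ≠ j ∧ CubeAdj i k ∧ CubeAdj j k ∧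
        OnSide X i ∧ OnSide X j ∧ OnSide X k ∧ M = [pos i, pos j, neg k, X] := by
      refine orbit_induction ⟨0, 2, 3, A, by decide, by decide, by decide, by decide, by decide,
        by decide, rfl⟩ ?_
      rintro g _ ⟨i, j, k, X, h1, h2, h3, h4, h5, h6, rfl⟩
      exact ⟨cornerPerm g i, cornerPerm g j, cornerPerm g k, genLabel g X,
        (cornerPerm_injective g).ne h1, (cubeAdj_cornerPerm _ _ _).2 h2,
        (cubeAdj_cornerPerm _ _ _).2 h3, (onSide_genLabel _ _ _).2 h4, (onSide_genLabel _ _ _).2 h5,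
        (onSide_genLabel _ _ _).2 h6, rfl⟩
    obtain ⟨i, j, k, X, h1, h2, h3, h4, h5, h6, rfl⟩ := key M hM
    have hw : wallsThrough t {x} = {pos i, pos j, neg k, X} := by
      rw [wallsThrough_singleton (hc.mem_finVertices_iff.1 hx).1, h, setOf_mem_four]
    have ht0 := ht.1.ne'
    refine ⟨hx, i, j, k, X, h1, h2, h3, h4, h5, hw, hc.linkIsTetrahedron ht.1 hx ?_ ?_⟩
    · rw [hw, range_four]
    · exact hasCosine_joinAngles ht0 ((red_of_cubeAdj h1 h2 h3).hasCosine ht)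
        ((orth_neg_side h6).hasCosine ht0) (orth_pos_neg h2) (orth_pos_side h4) (orth_pos_neg h3)
        (orth_pos_side h5)

theorem poleVertices_eq (ht : t ∈ Ioc t₁ 1) {Ls : List (List Label)}
    (hc : IsComplex t Ls) : poleVertices t = finOfType t poleSets := by
  have ht' : t ∈ Ioc (0 : ℝ) 1 := ⟨t₁_pos.trans ht.1, ht.2⟩
  apply Subset.antisymm
  · rintro x ⟨hx, i, j, k, hij, hi, hj, h3, -⟩
    rw [wallsThrough_singleton (hc.mem_finVertices_iff.1 hx).1] at h3
    have key : ∀ i k : Fin 8, CubeAdj i k → ∀ j, i ≠ j → CubeAdj j k →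
        ∃ M ∈ poleSets, (∀ l ∈ M, l ∈ [pos i, pos j, neg k, pole k]) ∧
          ∀ l ∈ [pos i, pos j, neg k, pole k], l ∈ M := by decide +kernel
    obtain ⟨M, hM, hl, hl'⟩ := key i k hi j hij hj
    refine ⟨hx, M, hM, ?_⟩
    rw [h3, ← setOf_mem_four]
    exact Subset.antisymm hl' hl
  · rintro x ⟨hx, M, hM, h⟩
    have key : ∀ M ∈ poleSets, ∃ i j k : Fin 8, i ≠ j ∧ CubeAdj i k ∧ CubeAdj j k ∧
        M = [pos i, pos j, neg k, pole k] := by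
      refine orbit_induction ⟨0, 2, 3, by decide, by decide, by decide, by decide⟩ ?_
      rintro g _ ⟨i, j, k, h1, h2, h3, rfl⟩
      refine ⟨cornerPerm g i, cornerPerm g j, cornerPerm g k,
        (cornerPerm_injective g).ne h1, (cubeAdj_cornerPerm _ _ _).2 h2,
        (cubeAdj_cornerPerm _ _ _).2 h3, ?_⟩
      rw [pole_cornerPerm]
      rfl
    obtain ⟨i, j, k, h1, h2, h3, rfl⟩ := key M hM
    have hw : wallsThrough t {x} = {pos i, pos j, neg k, pole k} := by
      rw [wallsThrough_singleton (hc.mem_finVertices_iff.1 hx).1, h, setOf_mem_four]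
    refine ⟨hx, i, j, k, h1, h2, h3, hw, hc.linkIsTetrahedron ht'.1 hx ?_ ?_⟩
    · rw [hw, range_four]
    · exact hasCosine_joinAngles ht'.1.ne' ((red_of_cubeAdj h1 h2 h3).hasCosine ht')
        ((green_neg_pole k).hasCosine ht) (orth_pos_neg h2) (orth_pos_pole h2) (orth_pos_neg h3)
        (orth_pos_pole h3)

theorem tripleNegVertices_eq (ht : t ∈ Ioc (0 : ℝ) 1) {Ls : List (List Label)}
    (hc : IsComplex t Ls) : tripleNegVertices t = finOfType t tripleNegSets := by
  apply Subset.antisymm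
  · rintro x ⟨hx, k, i, j, l, hn, h3, -⟩
    rw [wallsThrough_singleton (hc.mem_finVertices_iff.1 hx).1] at h3
    have key : ∀ k i, CubeAdj i k → ∀ j, CubeAdj j k → ∀ l, CubeAdj l k → Neighbours k i j l →
        ∃ M ∈ tripleNegSets, (∀ m ∈ M, m ∈ [pos i, pos j, pos l, neg k]) ∧
          ∀ m ∈ [pos i, pos j, pos l, neg k], m ∈ M := by decide +kernel
    obtain ⟨M, hM, hl, hl'⟩ := key k i hn.2.2.2.1 j hn.2.2.2.2.1 l hn.2.2.2.2.2 hn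
    refine ⟨hx, M, hM, ?_⟩
    rw [h3, ← setOf_mem_four]
    exact Subset.antisymm hl' hl
  · rintro x ⟨hx, M, hM, h⟩
    have key : ∀ M ∈ tripleNegSets, ∃ k i j l : Fin 8, Neighbours k i j l ∧
        M = [pos i, pos j, pos l, neg k] := by
      refine orbit_induction ⟨3, 0, 2, 4, by decide, rfl⟩ ?_
      rintro g _ ⟨k, i, j, l, h1, rfl⟩
      exact ⟨_, _, _, _, h1.cornerPerm g, rfl⟩
    obtain ⟨k, i, j, l, hn, rfl⟩ := key M hM
    have hw : wallsThrough t {x} = {pos i, pos j, pos l, neg k} := by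
      rw [wallsThrough_singleton (hc.mem_finVertices_iff.1 hx).1, h, setOf_mem_four]
    refine ⟨hx, k, i, j, l, hn, hw, hc.linkIsTetrahedron ht.1 hx ?_ ?_⟩
    · rw [hw, range_four]
    · obtain ⟨n1, n2, n3, n4, n5, n6⟩ := hn
      exact hasCosine_coneAngles ht.1.ne' ((red_of_cubeAdj n1 n4 n5).hasCosine ht)
        ((red_of_cubeAdj n2 n4 n6).hasCosine ht) ((red_of_cubeAdj n3 n5 n6).hasCosine ht)
        (orth_pos_neg n4) (orth_pos_neg n5) (orth_pos_neg n6)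

theorem triplePoleVertices_eq (ht : t ∈ Ioc (0 : ℝ) 1) {Ls : List (List Label)}
    (hc : IsComplex t Ls) : triplePoleVertices t = finOfType t triplePoleSets := by
  apply Subset.antisymm
  · rintro x ⟨hx, k, i, j, l, hn, h3, -⟩
    rw [wallsThrough_singleton (hc.mem_finVertices_iff.1 hx).1] at h3
    have key : ∀ k i, CubeAdj i k → ∀ j, CubeAdj j k → ∀ l, CubeAdj l k → Neighbours k i j l →
        ∃ M ∈ triplePoleSets, (∀ m ∈ M, m ∈ [pos i, pos j, pos l, pole k]) ∧
          ∀ m ∈ [pos i, pos j, pos l, pole k], m ∈ M := by decide +kernel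
    obtain ⟨M, hM, hl, hl'⟩ := key k i hn.2.2.2.1 j hn.2.2.2.2.1 l hn.2.2.2.2.2 hn
    refine ⟨hx, M, hM, ?_⟩
    rw [h3, ← setOf_mem_four]
    exact Subset.antisymm hl' hl
  · rintro x ⟨hx, M, hM, h⟩
    have key : ∀ M ∈ triplePoleSets, ∃ k i j l : Fin 8, Neighbours k i j l ∧
        M = [pos i, pos j, pos l, pole k] := by
      refine orbit_induction ⟨3, 0, 2, 4, by decide, by decide⟩ ?_
      rintro g _ ⟨k, i, j, l, h1, rfl⟩
      exact ⟨_, _, _, _, h1.cornerPerm g, by rw [pole_cornerPerm]; rfl⟩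
    obtain ⟨k, i, j, l, hn, rfl⟩ := key M hM
    have hw : wallsThrough t {x} = {pos i, pos j, pos l, pole k} := by
      rw [wallsThrough_singleton (hc.mem_finVertices_iff.1 hx).1, h, setOf_mem_four]
    refine ⟨hx, k, i, j, l, hn, hw, hc.linkIsTetrahedron ht.1 hx ?_ ?_⟩
    · rw [hw, range_four]
    · obtain ⟨n1, n2, n3, n4, n5, n6⟩ := hn
      exact hasCosine_coneAngles ht.1.ne' ((red_of_cubeAdj n1 n4 n5).hasCosine ht)
        ((red_of_cubeAdj n2 n4 n6).hasCosine ht) ((red_of_cubeAdj n3 n5 n6).hasCosine ht)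
        (orth_pos_pole n4) (orth_pos_pole n5) (orth_pos_pole n6)

theorem apexVertices_eq (ht : t ∈ Ioc (0 : ℝ) 1) {Ls : List (List Label)}
    (hc : IsComplex t Ls) : apexVertices t = finOfType t apexSets := by
  apply Subset.antisymm
  · rintro x ⟨hx, b, h3, -⟩
    rw [wallsThrough_singleton (hc.mem_finVertices_iff.1 hx).1] at h3
    have key : ∀ b, ∃ I ∈ apexSets, (∀ m ∈ I, ∃ k, parityWalls b k = m) ∧
        ∀ k, parityWalls b k ∈ I := by decide +kernel
    obtain ⟨I, hI, hl, hl'⟩ := key b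
    refine ⟨hx, I, hI, ?_⟩
    rw [h3]
    ext m
    exact ⟨fun ⟨k, hk⟩ => hk ▸ hl' k, fun h => hl m h⟩
  · rintro x ⟨hx, M, hM, h⟩
    have key : ∀ M ∈ apexSets, ∃ b, (∀ m ∈ M, ∃ k, parityWalls b k = m) ∧
        ∀ k, parityWalls b k ∈ M := by decide +kernel
    obtain ⟨b, hl, hl'⟩ := key M hM
    have hw : wallsThrough t {x} = range (parityWalls b) := by
      rw [wallsThrough_singleton (hc.mem_finVertices_iff.1 hx).1, h]
      ext m
      exact ⟨fun h => hl m h, fun ⟨k, hk⟩ => hk ▸ hl' k⟩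
    refine ⟨hx, b, hw, hc.linkIsTetrahedron ht.1 hx hw fun i j hij => ?_⟩
    have hred : ∀ b i j, i ≠ j → Red (parityWalls b i) (parityWalls b j) := by decide +kernel
    exact (hred b i j hij).hasCosine ht

end CellFamily

namespace CellFamily

open Label

variable {t : ℝ}

/-! ### Walls, faces and edges -/

namespace IsComplex

variable {Ls : List (List Label)}

theorem wall_bijOn (hc : IsComplex t Ls) : BijOn (wall t) (active t) (strata t 3) := by
  have key : ∀ l ∈ active t, wall t l ∈ strata t 3 ∧ wallsThrough t (wall t l) = {l} := by
    intro l hl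
    obtain ⟨L, hL, hlL⟩ := hc.walls l hl
    obtain ⟨x, hx, ht⟩ := hc.exists_tight_eq_iff.2
      ⟨L, hL, fun m (hm : m ∈ ({l} : Set Label)) => (mem_singleton_iff.1 hm) ▸ hlL⟩
    have h : wall t l = stratum t (tight t x) := by rw [ht]; rfl
    rw [h, wallsThrough_stratum hx]
    exact ⟨(mem_strata_iff hc.isSimple).2 ⟨x, hx, by rw [ht, ncard_singleton], rfl⟩, ht⟩
  refine ⟨fun l hl => (key l hl).1, fun l hl m hm he => ?_, fun S hS => ?_⟩
  · have h1 := (key l hl).2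
    rw [he, (key m hm).2] at h1
    exact (singleton_injective h1).symm
  · obtain ⟨x, hx, hk, rfl⟩ := (mem_strata_iff hc.isSimple).1 hS
    obtain ⟨l, hl⟩ := ncard_eq_one.1 (show (tight t x).ncard = 1 by omega)
    have hlx : l ∈ tight t x := hl ▸ mem_singleton l
    exact ⟨l, hlx.1, by rw [hl]; rfl⟩

theorem wall_inter_wall (a b : Label) : wall t a ∩ wall t b = stratum t {a, b} := by
  ext x
  simp only [wall, stratum, mem_inter_iff, mem_ofPred_eq, mem_singleton_iff, forall_eq,
    mem_insert_iff, forall_eq_or_imp]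
  tauto

theorem exists_pair (hc : IsComplex t Ls) {S : Set Mink} (hS : S ∈ strata t 2) :
    ∃ a b, a ≠ b ∧ wallsThrough t S = {a, b} ∧ S = wall t a ∩ wall t b := by
  obtain ⟨x, hx, hk, rfl⟩ := (mem_strata_iff hc.isSimple).1 hS
  obtain ⟨a, b, hab, h⟩ := ncard_eq_two.1 (show (tight t x).ncard = 2 by omega)
  refine ⟨a, b, hab, by rw [wallsThrough_stratum hx, h], ?_⟩
  rw [wall_inter_wall, h]

theorem exists_triple (hc : IsComplex t Ls) {S : Set Mink} (hS : S ∈ strata t 1) :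
    ∃ a b c, [a, b, c].Nodup ∧ wallsThrough t S = {a, b, c} := by
  obtain ⟨x, hx, hk, rfl⟩ := (mem_strata_iff hc.isSimple).1 hS
  obtain ⟨a, b, c, hab, hac, hbc, h⟩ := ncard_eq_three.1 (show (tight t x).ncard = 3 by omega)
  refine ⟨a, b, c, by simp [hab, hac, hbc], by rw [wallsThrough_stratum hx, h]⟩

/-- The walls through a stratum belong to a member of the complex. -/
theorem exists_wallsThrough_subset (hc : IsComplex t Ls) {S : Set Mink} {k : ℕ}
    (hS : S ∈ strata t k) : ∃ L ∈ Ls, ∀ l ∈ wallsThrough t S, l ∈ L := by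
  obtain ⟨x, hx, -, rfl⟩ := (mem_strata_iff hc.isSimple).1 hS
  rw [wallsThrough_stratum hx]
  exact hc.exists_of_mem_P hx

theorem pair_mem_strata (hc : IsComplex t Ls) {a b : Label} (hab : a ≠ b) {L : List Label}
    (hL : L ∈ Ls) (ha : a ∈ L) (hb : b ∈ L) :
    wall t a ∩ wall t b ∈ strata t 2 ∧ wallsThrough t (wall t a ∩ wall t b) = {a, b} := by
  obtain ⟨x, hx, ht⟩ := hc.exists_tight_eq_iff.2
    ⟨L, hL, fun m (hm : m ∈ ({a, b} : Set Label)) => by rcases hm with rfl | rfl <;> assumption⟩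
  have h : wall t a ∩ wall t b = stratum t (tight t x) := by rw [ht, wall_inter_wall]
  rw [h, wallsThrough_stratum hx]
  exact ⟨(mem_strata_iff hc.isSimple).2 ⟨x, hx, by rw [ht, ncard_pair hab], rfl⟩, ht⟩

theorem setOf_mem_eq_pair_iff {L : List Label} (hn : L.Nodup) (hl : L.length = 2) {a b : Label}
    (hab : a ≠ b) : {l | l ∈ L} = {a, b} ↔ a ∈ L ∧ b ∈ L := by
  constructor
  · intro h
    have ha : a ∈ {l | l ∈ L} := h ▸ mem_insert a _
    have hb : b ∈ {l | l ∈ L} := h ▸ mem_insert_of_mem a rfl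
    exact ⟨ha, hb⟩
  · rintro ⟨ha, hb⟩
    refine (eq_of_subset_of_ncard_le (fun l h => ?_) ?_ (toFinite _)).symm
    · rcases h with rfl | rfl <;> assumption
    · rw [ncard_setOf_mem hn, hl, ncard_pair hab]

theorem encard_pairs (hc : IsComplex t Ls) (R : Label → Label → Prop) [DecidableRel R]
    (hR : ∀ a b, R a b → a ≠ b) :
    {S ∈ strata t 2 | ∃ a b, R a b ∧ wallsThrough t S = {a, b}}.encard =
      count ((subsets Ls 2).filter fun L => ∃ a ∈ L, ∃ b ∈ L, R a b) := by
  refine hc.encard_strata (k := 2) (by norm_num) (fun T => ∃ a b, R a b ∧ T = {a, b}) _ ?_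
  intro L hL
  have hn := hc.nodup_of_mem_subsets hL
  have hl : L.length = 2 := by
    obtain ⟨M, -, h⟩ := List.mem_flatMap.1 hL
    exact (List.mem_sublistsLen.1 h).2
  rw [decide_eq_true_eq]
  constructor
  · rintro ⟨a, b, h1, h2⟩
    obtain ⟨ha, hb⟩ := (setOf_mem_eq_pair_iff hn hl (hR a b h1)).1 h2
    exact ⟨a, ha, b, hb, h1⟩
  · rintro ⟨a, ha, b, hb, h1⟩
    exact ⟨a, b, h1, (setOf_mem_eq_pair_iff hn hl (hR a b h1)).2 ⟨ha, hb⟩⟩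

end IsComplex

theorem Red.ne {a b : Label} (h : Red a b) : a ≠ b := by
  obtain ⟨i, j, hij, -, rfl, rfl⟩ := h
  exact fun h => hij (by injection h)

theorem Green.ne {a b : Label} (h : Green a b) : a ≠ b := by
  rcases h with ⟨i, rfl, ⟨-, rfl⟩ | ⟨-, rfl⟩⟩ | ⟨i, rfl, ⟨-, rfl⟩ | ⟨-, rfl⟩⟩ <;>
    exact fun h => Label.noConfusion h

/-- The combinatorial data of `P_t`: the maximal sets of walls that meet, the incidence sets of the
finite vertices, and those of the ideal vertices. -/
structure HasType (t : ℝ) (Ls Ms Is : List (List Label)) : Prop where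
  complex : IsComplex t Ls
  fin_sub : ∀ M ∈ Ms, M ∈ Ls ∧ M.length = 4
  fin_eq : finVertices t = finOfType t Ms
  ideal : IsIdealFamily t Ls Is
  ideal_eq : idealVertices t = idealOfType t Is
  angles : ∀ L ∈ Ls, AnglesOK L

namespace HasType

variable {Ls Ms Is : List (List Label)}

theorem numVertices_eq (h : HasType t Ls Ms Is) :
    numVertices t = (count Ms + count Is : ℕ) := by
  rw [numVertices, h.fin_eq, h.ideal_eq, h.complex.encard_finOfType h.fin_sub,
    h.ideal.encard_idealOfType h.complex, Nat.cast_add]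

theorem hasCounts (h : HasType t Ls Ms Is) : HasCounts t (count (subsets Ls 1))
    (count (subsets Ls 2)) (count (subsets Ls 3)) (count Ms + count Is : ℕ) :=
  ⟨h.complex.encard_strata_eq_count (by norm_num), h.complex.encard_strata_eq_count (by norm_num),
    h.complex.encard_strata_eq_count (by norm_num), h.numVertices_eq⟩

/-- The number of vertices of the face between the walls `a` and `b`. -/
theorem numCorners_eq (h : HasType t Ls Ms Is) {S : Set Mink} (hS : S ∈ strata t 2) {a b : Label}
    (hab : wallsThrough t S = {a, b}) : numCorners t S =
      (count (Ms.filter fun M => a ∈ M ∧ b ∈ M) +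
        count (Is.filter fun I => a ∈ I ∧ b ∈ I) : ℕ) := by
  have hc := h.complex
  obtain ⟨x, hx, -, hSx⟩ := (mem_strata_iff hc.isSimple).1 hS
  have ht : tight t x = {a, b} := by rw [← hab, hSx, wallsThrough_stratum hx]
  rw [ht] at hSx
  have hact : ({a, b} : Set Label) ⊆ active t := ht ▸ tight_subset_active x
  have hne : (stratum t {a, b}).Nonempty := hSx ▸ hS.2.1
  have hsub : ∀ T : Set Label, {a, b} ⊆ T ↔ a ∈ T ∧ b ∈ T := fun T => pair_subset_iff
  have h1 : {x ∈ finVertices t | x ∈ S} =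
      finOfType t (Ms.filter fun M => a ∈ M ∧ b ∈ M) := by
    ext y
    simp only [mem_ofPred_eq, finOfType, List.mem_filter, decide_eq_true_eq]
    refine and_congr_right fun hy => ?_
    rw [hSx, mem_stratum_iff (hc.mem_finVertices_iff.1 hy).1 hact, hsub]
    rw [h.fin_eq] at hy
    obtain ⟨-, M, hM, he⟩ := hy
    constructor
    · intro hh
      rw [he] at hh
      exact ⟨M, ⟨hM, hh⟩, he⟩
    · rintro ⟨M', ⟨-, hh⟩, he'⟩
      rw [he']
      exact hh
  have h2 : {n ∈ idealVertices t | n ∈ compactification S} =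
      idealOfType t (Is.filter fun M => a ∈ M ∧ b ∈ M) := by
    ext y
    simp only [mem_ofPred_eq, idealOfType, List.mem_filter, decide_eq_true_eq]
    refine and_congr_right fun hy => ?_
    rw [hSx, mem_compactification_iff hact hne hy, hsub]
    rw [h.ideal_eq] at hy
    obtain ⟨-, M, hM, he⟩ := hy
    constructor
    · intro hh
      rw [he] at hh
      exact ⟨M, ⟨hM, hh⟩, he⟩
    · rintro ⟨M', ⟨-, hh⟩, he'⟩
      rw [he']
      exact hh
  rw [numCorners, h1, h2, hc.encard_finOfType fun M hM => h.fin_sub M (List.mem_filter.1 hM).1,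
    (h.ideal.mono fun I hI => (List.mem_filter.1 hI).1).encard_idealOfType hc, Nat.cast_add]

/-- All the faces of a kind have the same number of vertices, if this holds combinatorially. -/
theorem numCorners_of_forall (h : HasType t Ls Ms Is) (R : Label → Label → Prop) {k : ℕ}
    (hk : ∀ L ∈ Ls, ∀ a ∈ L, ∀ b ∈ L, R a b → count (Ms.filter fun M => a ∈ M ∧ b ∈ M) +
        count (Is.filter fun I => a ∈ I ∧ b ∈ I) = k) {S : Set Mink}
    (hS : S ∈ {S ∈ strata t 2 | ∃ a b, R a b ∧ wallsThrough t S = {a, b}}) :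
    numCorners t S = k := by
  obtain ⟨hS, a, b, hR, hab⟩ := hS
  obtain ⟨L, hL, hl⟩ := h.complex.exists_wallsThrough_subset hS
  rw [h.numCorners_eq hS hab, hk L hL a (hl a (by simp [hab])) b (hl b (by simp [hab])) hR]

theorem pair_mem_faces (h : HasType t Ls Ms Is) (R : Label → Label → Prop)
    (hne : ∀ a b, R a b → a ≠ b)
    (hex : ∀ a ∈ allLabels, ∀ b ∈ allLabels, R a b → ∃ L ∈ Ls, a ∈ L ∧ b ∈ L) {a b : Label}
    (hR : R a b) :
    wall t a ∩ wall t b ∈ {S ∈ strata t 2 | ∃ a b, R a b ∧ wallsThrough t S = {a, b}} := by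
  obtain ⟨L, hL, ha, hb⟩ := hex a (mem_allLabels a) b (mem_allLabels b) hR
  have := h.complex.pair_mem_strata (hne a b hR) hL ha hb
  exact ⟨this.1, a, b, hR, this.2⟩

end HasType

/-- The dihedral angles at the faces. -/
theorem dihedralAngle_spec (ht : 0 < t) {Ls : List (List Label)} (hc : IsComplex t Ls)
    (hA : ∀ L ∈ Ls, AnglesOK L) {S : Set Mink} (hS : S ∈ strata t 2) {a b : Label} (hab : a ≠ b)
    (hw : wallsThrough t S = {a, b}) :
    (Red a b → dihedralAngle (vec t a) (vec t b) = theta t) ∧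
      (Green a b → dihedralAngle (vec t a) (vec t b) = phi t) ∧
      (¬ Red a b → ¬ Green a b → dihedralAngle (vec t a) (vec t b) = Real.pi / 2) := by
  refine ⟨dihedralAngle_of_red ht, dihedralAngle_of_green, fun hr hg => ?_⟩
  obtain ⟨L, hL, hl⟩ := hc.exists_wallsThrough_subset hS
  rw [hw] at hl
  have := ((hA L hL).pair a (hl a (by simp)) b (hl b (by simp)) hab).2
  exact dihedralAngle_of_lor_eq_zero (lor_of_orth ht.ne' ((this.resolve_left hr).resolve_left hg))

theorem not_three_isPos {Ls : List (List Label)}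
    (h : ∀ L ∈ Ls, ∀ a ∈ L, IsPos a → ∀ b ∈ L, IsPos b → a ≠ b → ∀ c ∈ L, IsPos c → a ≠ c →
      b = c) {L : List Label} (hL : L ∈ Ls) {a b c : Label} (ha : a ∈ L) (hb : b ∈ L) (hc : c ∈ L)
    (hn : [a, b, c].Nodup) : ¬ (IsPos a ∧ IsPos b ∧ IsPos c) := by
  rintro ⟨pa, pb, pc⟩
  simp only [List.nodup_cons, List.mem_cons, List.not_mem_nil, or_false, not_or, not_false_eq_true,
    List.nodup_nil, and_true] at hn
  exact hn.2 (h L hL a ha pa b hb pb hn.1.1 c hc pc hn.1.2)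

/-- The angles of the walls along their edges. -/
theorem HasType.edgeAngle (ht : t ∈ Ioo (0 : ℝ) 1) {Ls Ms Is : List (List Label)}
    (h : HasType t Ls Ms Is)
    (h3 : t < t₁ ∨ ∀ L ∈ Ls, ∀ a ∈ L, IsPos a → ∀ b ∈ L, IsPos b → a ≠ b → ∀ c ∈ L, IsPos c →
      a ≠ c → b = c) {S : Set Mink} (hS : S ∈ strata t 1) :
    (∃ a b c, [a, b, c].Nodup ∧ wallsThrough t S = {a, b, c}) ∧
      ∀ a b c, [a, b, c].Nodup → wallsThrough t S = {a, b, c} →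
        (IsPos a → IsPos b → IsPos c → t < t₁ ∧ edgeAngle t a b c = psi t) ∧
        (¬ (IsPos a ∧ IsPos b ∧ IsPos c) →
          (Red b c → edgeAngle t a b c = theta t) ∧
          (Green b c → edgeAngle t a b c = phi t) ∧
          (¬ Red b c → ¬ Green b c → edgeAngle t a b c = Real.pi / 2)) := by
  refine ⟨h.complex.exists_triple hS, fun a b c hn hw => ?_⟩
  obtain ⟨L, hL, hl⟩ := h.complex.exists_wallsThrough_subset hS
  have hact : a ∈ active t := (show a ∈ wallsThrough t S by simp [hw]).1
  rw [hw] at hl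
  have ha : a ∈ L := hl a (by simp)
  have hb : b ∈ L := hl b (by simp)
  have hc : c ∈ L := hl c (by simp)
  have hn' := hn
  simp only [List.nodup_cons, List.mem_cons, List.not_mem_nil, or_false, not_or, not_false_eq_true,
    List.nodup_nil, and_true] at hn
  have := edgeAngle_spec ht (h.angles L hL) ha hb hc hn.1.1 hn.1.2 hn.2
    (lor_vec_self_pos ht.1 hact)
  refine ⟨fun pa pb pc => ⟨?_, this.1 pa pb pc⟩, this.2⟩
  exact h3.resolve_right fun h3 => not_three_isPos h3 hL ha hb hc hn' ⟨pa, pb, pc⟩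

/-- The angles of red and green polygons. -/
theorem HasType.cornerAngle (ht : t ∈ Ioo (0 : ℝ) 1) {Ls Ms Is : List (List Label)}
    (h : HasType t Ls Ms Is)
    (h4 : t < t₂ ∨ ∀ L ∈ Ls, ∃ l ∈ L, ¬ IsPos l) {x : Mink} (hx : x ∈ finVertices t)
    {a b c d : Label} (hn : [a, b, c, d].Nodup) (hw : wallsThrough t {x} = {a, b, c, d}) :
    (Green a b → cornerAngle t a b c d = theta t) ∧
      (Red a b →
        (IsPos c → IsPos d → cornerAngle t a b c d = eta t) ∧
        (Green c d → cornerAngle t a b c d = phi t) ∧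
        (¬ (IsPos c ∧ IsPos d) → ¬ Green c d → cornerAngle t a b c d = Real.pi / 2)) := by
  rw [wallsThrough_singleton (h.complex.mem_finVertices_iff.1 hx).1] at hw
  have hx' := hx
  rw [h.fin_eq] at hx'
  obtain ⟨-, L, hLM, he⟩ := hx'
  have hL := (h.fin_sub L hLM).1
  have hl : ∀ l, l ∈ L ↔ l = a ∨ l = b ∨ l = c ∨ l = d := fun l => by
    have : l ∈ {l | l ∈ L} ↔ l ∈ ({a, b, c, d} : Set Label) := by rw [← he, hw]
    simpa using this
  refine cornerAngle_spec ht (h.angles L hL) (by simp [hl]) (by simp [hl]) (by simp [hl])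
    (by simp [hl]) hn (h4.imp_right fun h4 hp => ?_)
  obtain ⟨l, hlL, hlp⟩ := h4 L hL
  rcases (hl l).1 hlL with rfl | rfl | rfl | rfl
  exacts [hlp hp.1, hlp hp.2.1, hlp hp.2.2.1, hlp hp.2.2.2]

/-! ### The types of the polytopes -/

theorem hasType_above (ht : t ∈ Ioo t₁ 1) :
    HasType t aboveSets (letterSets ++ poleSets) boxSets := by
  have ht0 : 0 < t := t₁_pos.trans ht.1
  have hc := isComplex_above ht
  exact ⟨hc, by decide +kernel, hc.finVertices_eq_finOfType (by decide +kernel),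
    isIdealFamily_box ⟨ht0, ht.2.le⟩ (by decide +kernel),
    idealVertices_eq_box ⟨ht0, ht.2⟩ hc.nonempty ht.1.ne' (t₂_lt_t₁.trans ht.1).ne', anglesOK_above⟩

theorem hasType_at_t₁ : HasType t₁ atT₁Sets letterSets (boxSets ++ prismSets) :=
  ⟨isComplex_at_t₁, by decide +kernel, isComplex_at_t₁.finVertices_eq_finOfType (by decide +kernel),
    (isIdealFamily_box ⟨t₁_pos, t₁_lt_one.le⟩ (by decide +kernel)).append isIdealFamily_prism,
    idealVertices_t₁, anglesOK_at_t₁⟩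

theorem hasType_between (ht : t ∈ Ioo t₂ t₁) :
    HasType t betweenSets (letterSets ++ (tripleNegSets ++ triplePoleSets)) boxSets := by
  have ht0 : 0 < t := t₂_pos.trans ht.1
  have ht1 : t < 1 := ht.2.trans t₁_lt_one
  have hc := isComplex_between ht
  exact ⟨hc, by decide +kernel, hc.finVertices_eq_finOfType (by decide +kernel),
    isIdealFamily_box ⟨ht0, ht1.le⟩ (by decide +kernel),
    idealVertices_eq_box ⟨ht0, ht1⟩ hc.nonempty ht.2.ne ht.1.ne', anglesOK_between⟩

theorem hasType_at_t₂ :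
    HasType t₂ atT₂Sets (letterSets ++ tripleNegSets) (boxSets ++ apexSets) :=
  ⟨isComplex_at_t₂, by decide +kernel, isComplex_at_t₂.finVertices_eq_finOfType (by decide +kernel),
    (isIdealFamily_box ⟨t₂_pos, (t₂_lt_t₁.trans t₁_lt_one).le⟩
      (by decide +kernel)).append isIdealFamily_apex,
    idealVertices_t₂, anglesOK_at_t₂⟩

theorem hasType_below (ht : t ∈ Ioo 0 t₂) :
    HasType t belowSets (letterSets ++ tripleNegSets ++ apexSets) boxSets := by
  have ht1 : t < 1 := ht.2.trans (t₂_lt_t₁.trans t₁_lt_one)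
  have hc := isComplex_below ht
  exact ⟨hc, by decide +kernel, hc.finVertices_eq_finOfType (by decide +kernel),
    isIdealFamily_box ⟨ht.1, ht1.le⟩ (by decide +kernel),
    idealVertices_eq_box ⟨ht.1, ht1⟩ hc.nonempty (ht.2.trans t₂_lt_t₁).ne ht.2.ne, anglesOK_below⟩

/-- The five types of combinatorics before the time `1`. -/
theorem stage_cases (ht : t ∈ Ioo (0 : ℝ) 1) :
    t ∈ Ioo t₁ 1 ∨ t = t₁ ∨ t ∈ Ioo t₂ t₁ ∨ t = t₂ ∨ t ∈ Ioo 0 t₂ := by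
  rcases lt_trichotomy t t₁ with h | h | h
  · rcases lt_trichotomy t t₂ with h' | h' | h'
    · exact .inr (.inr (.inr (.inr ⟨ht.1, h'⟩)))
    · exact .inr (.inr (.inr (.inl h')))
    · exact .inr (.inr (.inl ⟨h', h⟩))
  · exact .inr (.inl h)
  · exact .inl ⟨h, ht.2⟩

end CellFamily

namespace CellFamily

open Label

variable {t : ℝ}

/-! ### The face poset -/

/-- The incidence sets of the points, finite or ideal, of the compactified polytope. They index its
faces: such a set corresponds to the face with relatively interior points on exactly these walls. -/
def keys (t : ℝ) : Set (Set Label) := {T | ∃ p ∈ slice t, lor p p ≤ 0 ∧ tight t p = T}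

theorem closedStratum_subset_iff {T J : Set Label} (hT : T ∈ keys t) (hJ : J ⊆ active t) :
    closedStratum t T ⊆ closedStratum t J ↔ J ⊆ T := by
  obtain ⟨p, hp, h0, rfl⟩ := hT
  exact ⟨fun h l hl => ⟨hJ hl, (h ⟨hp, h0, fun l hl => hl.2⟩).2.2 l hl⟩,
    fun h q hq => ⟨hq.1, hq.2.1, fun l hl => hq.2.2 l (h hl)⟩⟩

theorem subset_active_of_mem_keys {T : Set Label} (hT : T ∈ keys t) : T ⊆ active t := by
  obtain ⟨p, -, -, rfl⟩ := hT
  exact tight_subset_active p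

namespace HasType

variable {Ls Ms Is : List (List Label)}

theorem lor_eq_zero_of_tight (h : HasType t Ls Ms Is) {p : Mink} (hp : p ∈ slice t)
    (h0 : lor p p ≤ 0) (hI : ∃ I ∈ Is, tight t p = {l | l ∈ I}) : lor p p = 0 := by
  obtain ⟨I, hI, he⟩ := hI
  by_contra hne
  obtain ⟨L, hL, hl⟩ := h.complex.covers p hp (lt_of_le_of_ne h0 hne)
  exact h.ideal.not_subset I hI L hL fun l hlI => hl l (he ▸ hlI)

theorem mem_keys_iff (h : HasType t Ls Ms Is) {T : Set Label} :
    T ∈ keys t ↔ (∃ L ∈ Ls, ∀ l ∈ T, l ∈ L) ∨ ∃ I ∈ Is, T = {l | l ∈ I} := by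
  constructor
  · rintro ⟨p, hp, h0, rfl⟩
    rcases h0.lt_or_eq with h0 | h0
    · exact .inl (h.complex.covers p hp h0)
    · have hn : p ∈ idealVertices t := by
        rw [idealVertices_eq h.complex.nonempty]; exact ⟨hp, h0⟩
      rw [h.ideal_eq] at hn
      exact .inr hn.2
  · rintro (hL | ⟨I, hI, rfl⟩)
    · obtain ⟨x, hx, rfl⟩ := h.complex.exists_tight_eq_iff.2 hL
      exact ⟨_, inv_smul_mem_slice hx, (lor_inv_smul_neg hx.1).le,
        tight_smul (inv_ne_zero hx.1.2.ne') x⟩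
    · obtain ⟨n, hn, h0, he⟩ := h.ideal.realized I hI
      exact ⟨n, hn, h0.le, he⟩

/-- An ideal vertex is the only point of the compactified polytope on all its walls. -/
theorem closedStratum_ideal (h : HasType t Ls Ms Is) {n : Mink} (hn : n ∈ idealVertices t) :
    closedStratum t (tight t n) = {n} := by
  have hn' := hn
  rw [h.ideal_eq] at hn'
  rw [idealVertices_eq h.complex.nonempty] at hn
  ext q
  refine ⟨fun hq => ?_, ?_⟩
  · by_contra hne
    have hneg := lor_neg_of_ne hn.1.1 hq.1.1 hn.2.le hq.2.1 fun e => hne e.symm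
    have hs : (1 / 2 : ℝ) • n + (1 / 2 : ℝ) • q ∈ slice t :=
      slice_convexComb hn.1 hq.1 (by norm_num) (by norm_num) (by norm_num)
    have hpp : lor ((1 / 2 : ℝ) • n + (1 / 2 : ℝ) • q) ((1 / 2 : ℝ) • n + (1 / 2 : ℝ) • q) < 0 := by
      simp only [lor_add_left, lor_add_right, lor_smul_left, lor_smul_right, hn.2, lor_comm q n]
      linarith [hq.2.1]
    refine hpp.ne (h.lor_eq_zero_of_tight hs hpp.le ?_)
    obtain ⟨-, I, hI, he⟩ := hn'
    refine ⟨I, hI, he ▸ Set.ext fun l => ?_⟩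
    simp only [tight, mem_ofPred_eq, lor_add_left, lor_smul_left]
    refine and_congr_right fun hl => ⟨fun h0 => ?_, fun h0 => ?_⟩
    · linarith [hn.1.2 l hl, hq.1.2 l hl]
    · rw [h0, hq.2.2 l ⟨hl, h0⟩]; simp
  · rintro rfl
    exact ⟨hn.1, hn.2.le, fun l hl => hl.2⟩

theorem mem_closedFaces_iff (h : HasType t Ls Ms Is) {K : Set Mink} :
    K ∈ closedFaces t ↔ ∃ T ∈ keys t, closedStratum t T = K := by
  constructor
  · rintro (⟨I, hI, hne, rfl⟩ | ⟨n, hn, rfl⟩)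
    · obtain ⟨x, hx, -, he⟩ := exists_stratum_eq hI hne
      refine ⟨tight t x, ⟨_, inv_smul_mem_slice hx, (lor_inv_smul_neg hx.1).le,
        tight_smul (inv_ne_zero hx.1.2.ne') x⟩, ?_⟩
      rw [he, compactification_stratum (he ▸ hne)]
    · refine ⟨tight t n, ?_, h.closedStratum_ideal hn⟩
      rw [idealVertices_eq h.complex.nonempty] at hn
      exact ⟨n, hn.1, hn.2.le, rfl⟩
  · rintro ⟨T, ⟨p, hp, h0, rfl⟩, rfl⟩
    rcases h0.lt_or_eq with h0 | h0
    · obtain ⟨c, hc, hx⟩ := exists_mem_P_of_slice hp h0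
      have hne : (stratum t (tight t p)).Nonempty := by
        rw [← tight_smul hc.ne' p]; exact ⟨_, self_mem_stratum hx⟩
      exact .inl ⟨tight t p, tight_subset_active p, hne, (compactification_stratum hne).symm⟩
    · have hn : p ∈ idealVertices t := by
        rw [idealVertices_eq h.complex.nonempty]; exact ⟨hp, h0⟩
      exact .inr ⟨p, hn, h.closedStratum_ideal hn⟩

theorem isIdeal_closedStratum_iff (h : HasType t Ls Ms Is) {T : Set Label} (hT : T ∈ keys t) :
    (∃ n ∈ idealVertices t, closedStratum t T = {n}) ↔ ∃ I ∈ Is, T = {l | l ∈ I} := by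
  obtain ⟨p, hp, h0, rfl⟩ := hT
  constructor
  · rintro ⟨n, hn, he⟩
    have hpn : p ∈ ({n} : Set Mink) := he ▸ ⟨hp, h0, fun l hl => hl.2⟩
    rw [mem_singleton_iff.1 hpn]
    rw [h.ideal_eq] at hn
    exact hn.2
  · intro hI
    have hn : p ∈ idealVertices t := by
      rw [idealVertices_eq h.complex.nonempty]; exact ⟨hp, h.lor_eq_zero_of_tight hp h0 hI⟩
    exact ⟨p, hn, h.closedStratum_ideal hn⟩

open scoped Classical in
/-- The linear hull of a face of the compactified polytope. Ideal vertices are an exception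
to the count of walls, as more than four walls may meet there. -/
theorem finrank_closedStratum (h : HasType t Ls Ms Is) {T : Set Label} (hT : T ∈ keys t) :
    Module.finrank ℝ (Submodule.span ℝ (closedStratum t T)) =
      if ∃ I ∈ Is, T = {l | l ∈ I} then 1 else 5 - T.ncard := by
  split_ifs with hI
  · obtain ⟨n, hn, he⟩ := (h.isIdeal_closedStratum_iff hT).2 hI
    rw [he]
    refine finrank_span_singleton fun h0 => ?_
    rw [idealVertices_eq h.complex.nonempty] at hn
    have := hn.1.1
    rw [h0] at this
    simp at this
  · obtain ⟨x, hx, rfl⟩ := h.complex.exists_tight_eq_iff.2 ((h.mem_keys_iff.1 hT).resolve_right hI)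
    rw [← compactification_stratum ⟨x, self_mem_stratum hx⟩,
      span_compactification fun y hy => hy.1.1, span_stratum hx]
    have := finrank_perp (h.complex.isSimple x hx)
    omega

/-- The face poset is isomorphic to the opposite of the poset of incidence sets. -/
noncomputable def faceEquiv (h : HasType t Ls Ms Is) : keys t ≃ closedFaces t :=
  Equiv.ofBijective (fun T => ⟨closedStratum t T, h.mem_closedFaces_iff.2 ⟨T, T.2, rfl⟩⟩) <| by
    refine ⟨fun T T' he => Subtype.ext ?_, fun K => ?_⟩
    · have he' : closedStratum t (T : Set Label) = closedStratum t T' := congrArg Subtype.val he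
      exact Subset.antisymm
        ((closedStratum_subset_iff T'.2 (subset_active_of_mem_keys T.2)).1 he'.symm.subset)
        ((closedStratum_subset_iff T.2 (subset_active_of_mem_keys T'.2)).1 he'.subset)
    · obtain ⟨T, hT, he⟩ := h.mem_closedFaces_iff.1 K.2
      exact ⟨⟨T, hT⟩, Subtype.ext he⟩

theorem coe_faceEquiv (h : HasType t Ls Ms Is) (T : keys t) :
    (h.faceEquiv T : Set Mink) = closedStratum t T := rfl

theorem faceEquiv_le_iff (h : HasType t Ls Ms Is) {T T' : keys t} :
    h.faceEquiv T ≤ h.faceEquiv T' ↔ (T' : Set Label) ⊆ T :=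
  closedStratum_subset_iff T.2 (subset_active_of_mem_keys T'.2)

/-- Two polytopes of the same type have the same combinatorics: the face posets are identified
through the incidence sets. -/
theorem labelledCombEquiv {s : ℝ} (hs : HasType s Ls Ms Is) (ht : HasType t Ls Ms Is)
    (ha : active s = active t) : LabelledCombEquiv s t := by
  have hk : keys s = keys t := by
    ext T
    rw [hs.mem_keys_iff, ht.mem_keys_iff]
  let e₀ : closedFaces s ≃ closedFaces t :=
    hs.faceEquiv.symm.trans ((Equiv.setCongr hk).trans ht.faceEquiv)
  have he₀ : ∀ T (hT : T ∈ keys s), e₀ (hs.faceEquiv ⟨T, hT⟩) = ht.faceEquiv ⟨T, hk ▸ hT⟩ := by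
    intro T hT
    simp [e₀]
  have hsurj : ∀ K : closedFaces s, ∃ (T : Set Label) (hT : T ∈ keys s), K = hs.faceEquiv ⟨T, hT⟩ :=
    fun K => ⟨_, (hs.faceEquiv.symm K).2, (hs.faceEquiv.apply_symm_apply K).symm⟩
  refine ⟨ha, ⟨e₀, ?_⟩, fun K => ?_, fun l hl K => ?_⟩
  · intro K K'
    obtain ⟨T, hT, rfl⟩ := hsurj K
    obtain ⟨T', hT', rfl⟩ := hsurj K'
    rw [he₀, he₀, ht.faceEquiv_le_iff, hs.faceEquiv_le_iff]
  · obtain ⟨T, hT, rfl⟩ := hsurj K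
    change Module.finrank ℝ (Submodule.span ℝ ((e₀ _ : closedFaces t) : Set Mink)) = _ ∧
      (_ ↔ ∃ n ∈ idealVertices t, ((e₀ _ : closedFaces t) : Set Mink) = {n})
    rw [he₀, hs.coe_faceEquiv, ht.coe_faceEquiv]
    have hT' : T ∈ keys t := hk ▸ hT
    exact ⟨by rw [hs.finrank_closedStratum hT, ht.finrank_closedStratum hT'],
      by rw [hs.isIdeal_closedStratum_iff hT, ht.isIdeal_closedStratum_iff hT']⟩
  · obtain ⟨T, hT, rfl⟩ := hsurj K
    change _ ↔ ((e₀ _ : closedFaces t) : Set Mink) ⊆ _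
    have hl' : l ∈ active t := ha ▸ hl
    have hT' : T ∈ keys t := hk ▸ hT
    rw [he₀, hs.coe_faceEquiv, ht.coe_faceEquiv, wall, wall,
      compactification_stratum (hs.complex.wallsNonempty.wall_nonempty hl),
      compactification_stratum (ht.complex.wallsNonempty.wall_nonempty hl'),
      closedStratum_subset_iff hT (singleton_subset_iff.2 hl),
      closedStratum_subset_iff hT' (singleton_subset_iff.2 hl')]

end HasType

/-! ### Invariants of the combinatorics -/

theorem compactification_singleton (x : Mink) : compactification {x} = {(x 0)⁻¹ • x} := by
  simp [compactification]

/-- The finite vertices are the non-ideal elements of rank one of the face poset. -/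
theorem image_finVertices (hs : IsSimple t) :
    (fun x => compactification {x}) '' finVertices t =
      {K ∈ closedFaces t | Module.finrank ℝ (Submodule.span ℝ K) = 1 ∧
        ¬ ∃ n ∈ idealVertices t, K = {n}} := by
  ext K
  constructor
  · rintro ⟨x, hx, rfl⟩
    rw [finVertices_eq hs] at hx
    have h1 := stratum_eq_singleton hs hx.1 hx.2
    refine ⟨.inl ⟨tight t x, tight_subset_active x, ⟨x, self_mem_stratum hx.1⟩, by rw [h1]⟩, ?_, ?_⟩
    · rw [span_compactification (singleton_subset_iff.2 hx.1.1), ← h1, span_stratum hx.1]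
      have := finrank_perp (hs x hx.1)
      have h4 : (tight t x).ncard = 4 := hx.2
      change Module.finrank ℝ (perp t (tight t x)) = 1
      omega
    · rintro ⟨n, hn, he⟩
      simp only [compactification_singleton] at he
      rw [← singleton_injective he] at hn
      exact (lor_inv_smul_neg hx.1.1).ne hn.2
  · rintro ⟨⟨I, hI, hne, rfl⟩ | hn, hr, hni⟩
    · obtain ⟨x, hx, -, he⟩ := exists_stratum_eq hI hne
      rw [he, span_compactification fun y hy => hy.1.1, span_stratum hx] at hr
      have := finrank_perp (hs x hx)
      have h4 : (tight t x).ncard = 4 := by omega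
      refine ⟨x, by rw [finVertices_eq hs]; exact ⟨hx, h4⟩, ?_⟩
      rw [he, stratum_eq_singleton hs hx h4]
    · exact absurd hn hni

/-- Hence the face poset, with dimensions and ideal vertices marked, determines the number of finite
vertices. -/
theorem encard_vertexFaces (hs : IsSimple t) :
    {K ∈ closedFaces t | Module.finrank ℝ (Submodule.span ℝ K) = 1 ∧
        ¬ ∃ n ∈ idealVertices t, K = {n}}.encard = (finVertices t).encard := by
  rw [← image_finVertices hs, InjOn.encard_image]
  intro x hx y hy he
  rw [finVertices_eq hs] at hx hy
  simp only [compactification_singleton] at he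
  have he := singleton_injective he
  refine eq_of_smul_mem_Hyp hy.1.1 hx.1.1 (c := x 0 * (y 0)⁻¹) ?_
  rw [mul_smul, ← he, smul_inv_smul₀ hx.1.1.2.ne']

theorem CombEquiv.encard_finVertices {s : ℝ} (h : CombEquiv s t) (hs : IsSimple s)
    (ht : IsSimple t) : (finVertices s).encard = (finVertices t).encard := by
  obtain ⟨e, he⟩ := h
  rw [← encard_vertexFaces hs, ← encard_vertexFaces ht]
  let As : Set (closedFaces s) := {K | Module.finrank ℝ (Submodule.span ℝ (K : Set Mink)) = 1 ∧
    ¬ ∃ n ∈ idealVertices s, (K : Set Mink) = {n}}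
  let At : Set (closedFaces t) := {K | Module.finrank ℝ (Submodule.span ℝ (K : Set Mink)) = 1 ∧
    ¬ ∃ n ∈ idealVertices t, (K : Set Mink) = {n}}
  have h1 : e ⁻¹' At = As := by
    ext K
    simp only [At, As, mem_preimage, mem_ofPred_eq, (he K).1, (he K).2]
  have h2 : e '' As = At := by rw [← h1, image_preimage_eq _ e.surjective]
  have h3 : As.encard = At.encard := by rw [← h2, e.injective.encard_image]
  have h4 : ∀ (X : Set (Set Mink)) (p : Set Mink → Prop),
      {K ∈ X | p K}.encard = {K : X | p K}.encard := by
    intro X p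
    rw [← Subtype.val_injective.encard_image]
    congr 1
    ext K
    simp [and_comm]
  rw [h4, h4]
  exact h3

end CellFamily

namespace CellFamily

open Label

variable {t : ℝ}

/-! ### Finite volume -/

theorem convex_slice (t : ℝ) : Convex ℝ (slice t) :=
  fun _ hp _ hq _ _ ha hb hab => slice_convexComb hp hq ha hb hab

theorem isClosed_slice (t : ℝ) : IsClosed (slice t) := by
  have h : slice t = {p | p 0 = 1} ∩ (⋂ l ∈ active t, {p | lor p (vec t l) ≤ 0}) := by
    ext p; simp [slice]
  rw [h]
  exact (isClosed_eq (by fun_prop) continuous_const).inter (isClosed_biInter fun l _ =>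
    isClosed_le (continuous_lor continuous_id continuous_const) continuous_const)

theorem abs_le_one_of_mem_slice (ht : t ∈ Ioc (0 : ℝ) 1) {p : Mink} (hp : p ∈ slice t)
    (j : Fin 5) : |p j| ≤ 1 := by
  have h := slice_subset_ball ht hp
  have h0 := hp.1
  rw [lor, h0] at h
  rw [← sq_le_one_iff_abs_le_one]
  have key : p 0 ^ 2 ≤ 1 ∧ p 1 ^ 2 ≤ 1 ∧ p 2 ^ 2 ≤ 1 ∧ p 3 ^ 2 ≤ 1 ∧ p 4 ^ 2 ≤ 1 := by
    refine ⟨by rw [h0]; norm_num, ?_, ?_, ?_, ?_⟩ <;>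
    linarith only [h, sq_nonneg (p 1), sq_nonneg (p 2), sq_nonneg (p 3), sq_nonneg (p 4)]
  fin_cases j
  exacts [key.1, key.2.1, key.2.2.1, key.2.2.2.1, key.2.2.2.2]

theorem isCompact_slice (ht : t ∈ Ioc (0 : ℝ) 1) : IsCompact (slice t) := by
  refine Metric.isCompact_of_isClosed_isBounded (isClosed_slice t) ?_
  refine (Metric.isBounded_closedBall (x := (0 : Mink)) (r := 1)).subset fun p hp => ?_
  rw [mem_closedBall_zero_iff, pi_norm_le_iff_of_nonneg zero_le_one]
  exact fun j => abs_le_one_of_mem_slice ht hp j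

/-- An extreme point of the slice polyhedron is determined by the walls on which it lies. -/
theorem injOn_tight_extremePoints (t : ℝ) : InjOn (tight t) ((slice t).extremePoints ℝ) := by
  intro x hx y hy he
  by_contra hne
  have key : ∀ᶠ ε : ℝ in nhdsWithin 0 (Ioi 0), ∀ l : Label, l ∈ active t →
      lor (x + ε • (x - y)) (vec t l) ≤ 0 := by
    rw [Filter.eventually_all]
    intro l
    by_cases hl : l ∈ active t
    · rcases (hx.1.2 l hl).lt_or_eq with h | h
      · have c : Continuous fun ε : ℝ => lor (x + ε • (x - y)) (vec t l) :=
          continuous_lor (by fun_prop) continuous_const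
        have := (c.tendsto 0).eventually_lt_const (u := 0) (by simpa using h)
        filter_upwards [nhdsWithin_le_nhds this] with ε hε _ using hε.le
      · have h' : lor y (vec t l) = 0 := (he ▸ (⟨hl, h⟩ : l ∈ tight t x) : l ∈ tight t y).2
        refine Filter.Eventually.of_forall fun ε _ => ?_
        rw [lor_add_left, lor_smul_left, lor_sub_left, h, h']
        simp
    · exact Filter.Eventually.of_forall fun ε h => absurd h hl
  obtain ⟨ε, hε, hε0⟩ := (key.and self_mem_nhdsWithin).exists
  have hε0 : 0 < ε := hε0
  have hz : x + ε • (x - y) ∈ slice t := ⟨by simp [hx.1.1, hy.1.1], hε⟩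
  have hseg : x ∈ openSegment ℝ (x + ε • (x - y)) y := by
    refine ⟨1 / (1 + ε), ε / (1 + ε), by positivity, by positivity, by field_simp, ?_⟩
    ext j
    simp
    field_simp
    ring
  have h := hx.2 hz hy.1 hseg
  have h2 : ε • (x - y) = 0 := by simpa using h
  exact hne (sub_eq_zero.1 ((smul_eq_zero.1 h2).resolve_left hε0.ne'))

/-- The slice polyhedron is a convex hull of finitely many points. -/
theorem exists_slice_eq_convexHull (ht : t ∈ Ioc (0 : ℝ) 1) :
    ∃ E : Finset Mink, slice t = convexHull ℝ (E : Set Mink) := by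
  have hf : ((slice t).extremePoints ℝ).Finite :=
    Finite.of_finite_image (toFinite _) (injOn_tight_extremePoints t)
  refine ⟨hf.toFinset, ?_⟩
  rw [hf.coe_toFinset, ← (hf.isClosed_convexHull ℝ).closure_eq,
    closure_convexHull_extremePoints (isCompact_slice ht) (convex_slice t)]

/-- Far away, the polytope is concentrated near finitely many rays: if `p = x / x₀` is a convex
combination of the extreme points of the slice, then `⟨p, p⟩ = -1 / x₀²` forces all the weights but
one to be of order `1 / x₀²`, as distinct points of the closed ball have negative products. -/
theorem exists_near_rays (ht : t ∈ Ioc (0 : ℝ) 1) : ∃ E : Finset Mink, ∃ C > (0 : ℝ),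
    (∀ v ∈ E, v ∈ slice t) ∧ ∀ x ∈ P t, ∃ v ∈ E, ∀ j, |x j - x 0 * v j| ≤ C / x 0 := by
  classical
  obtain ⟨E, hE⟩ := exists_slice_eq_convexHull ht
  have hES : ∀ v ∈ E, v ∈ slice t := fun v hv => hE ▸ subset_convexHull ℝ _ hv
  obtain ⟨δ, hδ, hδE⟩ : ∃ δ > (0 : ℝ), ∀ u ∈ E, ∀ v ∈ E, u ≠ v → lor u v ≤ -δ := by
    have h : ∀ e ∈ E ×ˢ E, e.1 ≠ e.2 → 0 < -lor e.1 e.2 := by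
      intro e he hne
      rw [Finset.mem_product] at he
      have h1 := hES _ he.1
      have h2 := hES _ he.2
      linarith [lor_neg_of_ne h1.1 h2.1 (slice_subset_ball ht h1) (slice_subset_ball ht h2) hne]
    rcases ((E ×ˢ E).filter fun e => e.1 ≠ e.2).eq_empty_or_nonempty with h0 | h0
    · refine ⟨1, one_pos, fun u hu v hv hne => ?_⟩
      have : (u, v) ∈ (E ×ˢ E).filter fun e => e.1 ≠ e.2 := by simp [hu, hv, hne]
      rw [h0] at this
      simp at this
    · obtain ⟨e, he, hmin⟩ := Finset.exists_min_image _ (fun e : Mink × Mink => -lor e.1 e.2) h0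
      rw [Finset.mem_filter] at he
      refine ⟨_, h e he.1 he.2, fun u hu v hv hne => ?_⟩
      have := hmin (u, v) (by simp [hu, hv, hne])
      simp only at this ⊢
      linarith
  refine ⟨E, 2 * (E.card + 1) / δ, by positivity, hES, fun x hx => ?_⟩
  have hx0 := hx.1.2
  have hp := inv_smul_mem_slice hx
  set p : Mink := (x 0)⁻¹ • x with hpdef
  have hpp : lor p p = -(1 / x 0 ^ 2) := by
    rw [hpdef, lor_smul_left, lor_smul_right, hx.1.1]
    field_simp
  rw [hE, Finset.mem_convexHull'] at hp
  obtain ⟨w, hw0, hw1, hwp⟩ := hp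
  have hne : E.Nonempty := by
    by_contra h
    rw [Finset.not_nonempty_iff_eq_empty] at h
    simp [h] at hw1
  obtain ⟨v, hv, hmax⟩ := Finset.exists_max_image E w hne
  have hwv : 1 ≤ (E.card + 1) * w v := by
    have h1 : ∑ u ∈ E, w u ≤ E.card • w v := Finset.sum_le_card_nsmul E w (w v) hmax
    rw [hw1, nsmul_eq_mul] at h1
    linarith [hw0 v hv]
  have hprod : ∀ y, lor p y = ∑ u ∈ E, w u * lor u y := by
    intro y
    rw [← hwp, lor_sum_left]
    exact Finset.sum_congr rfl fun u _ => lor_smul_left _ _ _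
  have hnonpos : ∀ u ∈ E, ∀ u' ∈ E, lor u u' ≤ 0 := by
    intro u hu u' hu'
    by_cases h : u = u'
    · exact h ▸ slice_subset_ball ht (hES u hu)
    · linarith [hδE u hu u' hu' h]
  have hpu : ∀ u ∈ E, lor p u ≤ 0 := fun u hu => by
    rw [hprod]
    exact Finset.sum_nonpos fun u' hu' => mul_nonpos_of_nonneg_of_nonpos (hw0 u' hu')
      (hnonpos u' hu' u hu)
  have h1 : lor p p ≤ w v * lor p v := by
    rw [hprod p, ← Finset.add_sum_erase E _ hv, lor_comm v p]
    have : ∑ u ∈ E.erase v, w u * lor u p ≤ 0 := Finset.sum_nonpos fun u hu => by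
      have hu := (Finset.mem_erase.1 hu).2
      exact mul_nonpos_of_nonneg_of_nonpos (hw0 u hu) (lor_comm u p ▸ hpu u hu)
    linarith
  have hrest : ∑ u ∈ E.erase v, w u = 1 - w v := by
    rw [← hw1, ← Finset.add_sum_erase E w hv]; ring
  have h2 : lor p v ≤ -δ * (1 - w v) := by
    rw [hprod v, ← Finset.add_sum_erase E _ hv, ← hrest, Finset.mul_sum]
    have h3 : ∑ u ∈ E.erase v, w u * lor u v ≤ ∑ u ∈ E.erase v, -δ * w u :=
      Finset.sum_le_sum fun u hu => by
        obtain ⟨hne, hu⟩ := Finset.mem_erase.1 hu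
        nlinarith only [mul_le_mul_of_nonneg_left (hδE u hu v hv hne) (hw0 u hu)]
    have h4 := mul_nonpos_of_nonneg_of_nonpos (hw0 v hv) (hnonpos v hv v hv)
    linarith
  have hw1' : 0 ≤ 1 - w v := by
    rw [← hrest]
    exact Finset.sum_nonneg fun u hu => hw0 u (Finset.mem_erase.1 hu).2
  have h5 : δ * (1 - w v) ≤ (E.card + 1) * (1 / x 0 ^ 2) := by
    have h6 : w v * (δ * (1 - w v)) ≤ 1 / x 0 ^ 2 := by
      have := mul_le_mul_of_nonneg_left h2 (hw0 v hv)
      linarith only [this, h1, hpp]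
    have h7 := mul_le_mul_of_nonneg_left h6 (show (0 : ℝ) ≤ E.card + 1 by positivity)
    have h8 := mul_le_mul_of_nonneg_right hwv (mul_nonneg hδ.le hw1')
    linarith only [h7, h8]
  refine ⟨v, hv, fun j => ?_⟩
  have h9 : p j - v j = ∑ u ∈ E.erase v, w u * (u j - v j) := by
    have e1 : p j = ∑ u ∈ E, w u * u j := by rw [← hwp]; simp
    have e2 : v j = ∑ u ∈ E, w u * v j := by rw [← Finset.sum_mul, hw1, one_mul]
    rw [Finset.sum_erase _ (by simp)]
    simp only [mul_sub, Finset.sum_sub_distrib]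
    rw [← e1, ← e2]
  have h10 : |p j - v j| ≤ 2 * (1 - w v) := by
    rw [h9, ← hrest, Finset.mul_sum]
    refine (Finset.abs_sum_le_sum_abs _ _).trans (Finset.sum_le_sum fun u hu => ?_)
    have hu := (Finset.mem_erase.1 hu).2
    rw [abs_mul, abs_of_nonneg (hw0 u hu), mul_comm]
    refine mul_le_mul_of_nonneg_right ?_ (hw0 u hu)
    linarith [abs_sub (u j) (v j), abs_le_one_of_mem_slice ht (hES u hu) j,
      abs_le_one_of_mem_slice ht (hES v hv) j]
  have h11 : x j - x 0 * v j = x 0 * (p j - v j) := by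
    simp only [hpdef, Pi.smul_apply, smul_eq_mul]
    field_simp
  rw [h11, abs_mul, abs_of_pos hx0, le_div_iff₀ hx0]
  have h12 : 1 - w v ≤ (E.card + 1) * (1 / x 0 ^ 2) / δ := by
    rw [le_div_iff₀ hδ]; linarith
  calc x 0 * |p j - v j| * x 0 ≤ x 0 * (2 * ((E.card + 1) * (1 / x 0 ^ 2) / δ)) * x 0 := by
        gcongr
        linarith
    _ = 2 * (E.card + 1) / δ := by field_simp

theorem hypVol_le_volume (S : Set Mink) : hypVol S ≤ volume (hypPoint ⁻¹' S) := by
  rw [hypVol, ← setLIntegral_one]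
  refine lintegral_mono fun y => ?_
  rw [ENNReal.ofReal_le_one, div_le_one (by simp only [hypPoint, Matrix.cons_val_zero]; positivity)]
  simp only [hypPoint, Matrix.cons_val_zero]
  rw [Real.one_le_sqrt]
  linarith [sq_nonneg (y 0), sq_nonneg (y 1), sq_nonneg (y 2), sq_nonneg (y 3)]

/-- In the chart, the part of the polytope near the ray of `v` with `k + 1 ≤ x₀² < k + 2` lies in a
cube around `√(k + 1) v` whose volume is of order `1 / (k + 1)²`, by `exists_near_rays`. -/
theorem hypVol_P_lt_top (ht : t ∈ Ioc (0 : ℝ) 1) : hypVol (P t) < ⊤ := by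
  obtain ⟨E, C, hC, hES, hE⟩ := exists_near_rays ht
  have hcover : hypPoint ⁻¹' P t ⊆ ⋃ v ∈ E, ⋃ k : ℕ, Metric.closedBall
      (fun j : Fin 4 => √(k + 1) * v j.succ) ((C + 1) / √(k + 1)) := by
    intro y hy
    obtain ⟨v, hv, hnear⟩ := hE _ hy
    set x := hypPoint y with hxdef
    have hx0 : 0 < x 0 := hy.1.2
    have hx1 : 1 ≤ x 0 ^ 2 := by
      have := hy.1.1
      rw [lor] at this
      nlinarith only [this, sq_nonneg (x 1), sq_nonneg (x 2), sq_nonneg (x 3), sq_nonneg (x 4)]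
    obtain ⟨k, hk⟩ : ∃ k : ℕ, ⌊x 0 ^ 2⌋₊ = k + 1 :=
      Nat.exists_eq_succ_of_ne_zero (Nat.floor_pos.2 hx1).ne'
    have hk1 : ((k + 1 : ℕ) : ℝ) ≤ x 0 ^ 2 := hk ▸ Nat.floor_le (by positivity)
    have hk2 : x 0 ^ 2 < ((k + 1 : ℕ) : ℝ) + 1 := hk ▸ Nat.lt_floor_add_one _
    push_cast at hk1 hk2
    simp only [mem_iUnion]
    refine ⟨v, hv, k, ?_⟩
    have hs : 0 < √((k : ℝ) + 1) := by positivity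
    have hs2 : √((k : ℝ) + 1) ^ 2 = k + 1 := Real.sq_sqrt (by positivity)
    set r := √((k : ℝ) + 1)
    have hrx : r ≤ x 0 := by
      rw [← hs2] at hk1
      exact (pow_le_pow_iff_left₀ hs.le hx0.le two_ne_zero).1 hk1
    have hdiff : x 0 - r ≤ 1 / r := by
      rw [le_div_iff₀ hs]
      nlinarith only [hk2, hs2, hrx, hs]
    rw [Metric.mem_closedBall, dist_pi_le_iff (by positivity)]
    intro j
    have hyj : y j = x j.succ := by
      fin_cases j <;> rfl
    rw [Real.dist_eq, hyj]
    have e : x j.succ - r * v j.succ = (x j.succ - x 0 * v j.succ) + (x 0 - r) * v j.succ := by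
      ring
    rw [e]
    refine (abs_add_le _ _).trans ?_
    rw [add_div, abs_mul, abs_of_nonneg (sub_nonneg.2 hrx)]
    refine add_le_add ((hnear _).trans (by gcongr)) ?_
    exact (mul_le_of_le_one_right (sub_nonneg.2 hrx)
      (abs_le_one_of_mem_slice ht (hES v hv) _)).trans hdiff
  have hsum : Summable fun k : ℕ => (2 * ((C + 1) / √((k : ℝ) + 1))) ^ 4 := by
    have h1 : Summable fun k : ℕ => (1 : ℝ) / ((k + 1 : ℕ) : ℝ) ^ 2 :=
      (summable_nat_add_iff 1).2 (Real.summable_one_div_nat_pow.2 one_lt_two)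
    refine (h1.mul_left ((2 * (C + 1)) ^ 4)).congr fun k => ?_
    have hs2 : √((k : ℝ) + 1) ^ 4 = (k + 1) ^ 2 := by
      rw [show 4 = 2 * 2 by norm_num, pow_mul, Real.sq_sqrt (by positivity)]
    rw [mul_pow, mul_pow, div_pow, hs2]
    push_cast
    ring
  refine (hypVol_le_volume _).trans_lt ((measure_mono hcover).trans_lt ?_)
  refine (measure_biUnion_finset_le _ _).trans_lt (ENNReal.sum_lt_top.2 fun v _ => ?_)
  refine (measure_iUnion_le _).trans_lt ?_
  have hvol : ∀ k : ℕ, volume (Metric.closedBall (fun j : Fin 4 => √((k : ℝ) + 1) * v j.succ)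
      ((C + 1) / √((k : ℝ) + 1))) = ENNReal.ofReal ((2 * ((C + 1) / √((k : ℝ) + 1))) ^ 4) := by
    intro k
    rw [Real.volume_pi_closedBall _ (by positivity), Fintype.card_fin]
  simp_rw [hvol]
  exact hsum.tsum_ofReal_lt_top

end CellFamily

namespace CellFamily

open Label

variable {t : ℝ}

/-! ### The six pieces of the parameter interval -/

/-- The pieces of the parameter interval are distinguished by the number of finite vertices. -/
theorem piece_cases (ht : t ∈ Ioc (0 : ℝ) 1) : IsSimple t ∧
    (t ∈ Ioo 0 t₂ ∧ (finVertices t).encard = 34 ∨ t = t₂ ∧ (finVertices t).encard = 32 ∨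
      t ∈ Ioo t₂ t₁ ∧ (finVertices t).encard = 40 ∨ t = t₁ ∧ (finVertices t).encard = 24 ∨
      t ∈ Ioo t₁ 1 ∧ (finVertices t).encard = 48 ∨ t = 1 ∧ (finVertices t).encard = 0) := by
  have key : ∀ {Ls : List (List Label)} {n : ℕ}, IsComplex t Ls → count (subsets Ls 4) = n →
      (finVertices t).encard = n := fun h hn => by rw [h.encard_finVertices_eq_count, hn]
  rcases ht.2.lt_or_eq with h1 | rfl
  · rcases stage_cases ⟨ht.1, h1⟩ with h | rfl | h | rfl | h
    · exact ⟨(isComplex_above h).isSimple, .inr <| .inr <| .inr <| .inr <| .inl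
        ⟨h, key (isComplex_above h) count_above.2.2.2⟩⟩
    · exact ⟨isComplex_at_t₁.isSimple, .inr <| .inr <| .inr <| .inl
        ⟨rfl, key isComplex_at_t₁ count_at_t₁.2.2.2⟩⟩
    · exact ⟨(isComplex_between h).isSimple, .inr <| .inr <| .inl
        ⟨h, key (isComplex_between h) count_between.2.2.2⟩⟩
    · exact ⟨isComplex_at_t₂.isSimple, .inr <| .inl
        ⟨rfl, key isComplex_at_t₂ count_at_t₂.2.2.2⟩⟩
    · exact ⟨(isComplex_below h).isSimple, .inl
        ⟨h, key (isComplex_below h) count_below.2.2.2⟩⟩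
  · exact ⟨isComplex_at_one.isSimple, .inr <| .inr <| .inr <| .inr <| .inr
      ⟨rfl, key isComplex_at_one count_at_one⟩⟩

theorem CombEquiv.samePiece {s : ℝ} (hs : s ∈ Ioc (0 : ℝ) 1) (ht : t ∈ Ioc (0 : ℝ) 1)
    (h : CombEquiv s t) : SamePiece s t := by
  obtain ⟨ss, hs⟩ := piece_cases hs
  obtain ⟨st, ht⟩ := piece_cases ht
  have he := h.encard_finVertices ss st
  rcases hs with ⟨hs, h1⟩ | ⟨hs, h1⟩ | ⟨hs, h1⟩ | ⟨hs, h1⟩ | ⟨hs, h1⟩ | ⟨hs, h1⟩ <;>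
  rcases ht with ⟨ht, h2⟩ | ⟨ht, h2⟩ | ⟨ht, h2⟩ | ⟨ht, h2⟩ | ⟨ht, h2⟩ | ⟨ht, h2⟩ <;>
  first
  | exact .inl (hs.trans ht.symm)
  | exact .inr (.inl ⟨hs, ht⟩)
  | exact .inr (.inr (.inl ⟨hs, ht⟩))
  | exact .inr (.inr (.inr ⟨hs, ht⟩))
  | exact absurd (h1.symm.trans (he.trans h2)) (by norm_num)

theorem active_eq_of_lt {s : ℝ} (hs : t₂ < s) (ht : t₂ < t) : active s = active t := by
  simp [active, hs, ht]

theorem active_eq_of_le {s : ℝ} (hs : s ≤ t₂) (ht : t ≤ t₂) : active s = active t := by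
  simp [active, hs.not_gt, ht.not_gt]

theorem SamePiece.labelledCombEquiv {s : ℝ} (h : SamePiece s t) : LabelledCombEquiv s t := by
  rcases h with rfl | ⟨hs, ht⟩ | ⟨hs, ht⟩ | ⟨hs, ht⟩
  · exact ⟨rfl, OrderIso.refl _, fun K => ⟨rfl, Iff.rfl⟩, fun l _ K => Iff.rfl⟩
  · exact (hasType_below hs).labelledCombEquiv (hasType_below ht)
      (active_eq_of_le hs.2.le ht.2.le)
  · exact (hasType_between hs).labelledCombEquiv (hasType_between ht)
      (active_eq_of_lt hs.1 ht.1)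
  · exact (hasType_above hs).labelledCombEquiv (hasType_above ht)
      (active_eq_of_lt (t₂_lt_t₁.trans hs.1) (t₂_lt_t₁.trans ht.1))

/-! ### Walls, faces and edges -/

/-- The properties that hold at all times, collected from the six pieces. -/
theorem exists_isComplex (ht : t ∈ Ioc (0 : ℝ) 1) :
    ∃ Ls, IsComplex t Ls ∧ IsIdealFamily t Ls boxSets ∧ ∀ L ∈ Ls, AnglesOK L := by
  rcases ht.2.lt_or_eq with h1 | rfl
  · rcases stage_cases ⟨ht.1, h1⟩ with h | rfl | h | rfl | h
    · exact ⟨_, isComplex_above h, isIdealFamily_box ht (by decide +kernel), anglesOK_above⟩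
    · exact ⟨_, isComplex_at_t₁, isIdealFamily_box ht (by decide +kernel), anglesOK_at_t₁⟩
    · exact ⟨_, isComplex_between h, isIdealFamily_box ht (by decide +kernel), anglesOK_between⟩
    · exact ⟨_, isComplex_at_t₂, isIdealFamily_box ht (by decide +kernel), anglesOK_at_t₂⟩
    · exact ⟨_, isComplex_below h, isIdealFamily_box ht (by decide +kernel), anglesOK_below⟩
  · exact ⟨_, isComplex_at_one, isIdealFamily_box ht (by decide +kernel), anglesOK_at_one⟩

theorem redFaces_spec (ht : t ∈ Ioo (0 : ℝ) 1) :
    (∀ a b, Red a b → wall t a ∩ wall t b ∈ redFaces t) ∧ (redFaces t).encard = 12 := by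
  have key : ∀ {Ls Ms Is : List (List Label)}, HasType t Ls Ms Is →
      (∀ a ∈ allLabels, ∀ b ∈ allLabels, Red a b → ∃ L ∈ Ls, a ∈ L ∧ b ∈ L) →
      count ((subsets Ls 2).filter fun L => ∃ a ∈ L, ∃ b ∈ L, Red a b) = 12 →
      (∀ a b, Red a b → wall t a ∩ wall t b ∈ redFaces t) ∧ (redFaces t).encard = 12 :=
    fun h hex hn => ⟨fun a b hR => h.pair_mem_faces Red (fun _ _ => Red.ne) hex hR,
      (h.complex.encard_pairs Red fun _ _ => Red.ne).trans (by rw [hn]; rfl)⟩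
  rcases stage_cases ht with h | rfl | h | rfl | h
  · exact key (hasType_above h) (by decide +kernel) (by decide +kernel)
  · exact key hasType_at_t₁ (by decide +kernel) (by decide +kernel)
  · exact key (hasType_between h) (by decide +kernel) (by decide +kernel)
  · exact key hasType_at_t₂ (by decide +kernel) (by decide +kernel)
  · exact key (hasType_below h) (by decide +kernel) (by decide +kernel)

theorem numCorners_red_of_ge (ht : t ∈ Ico t₁ 1) : ∀ S ∈ redFaces t, numCorners t S = 4 := by
  intro S hS
  rcases ht.1.eq_or_lt with rfl | h
  · exact hasType_at_t₁.numCorners_of_forall Red (by decide +kernel) hS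
  · exact (hasType_above ⟨h, ht.2⟩).numCorners_of_forall Red (by decide +kernel) hS

theorem numCorners_red_between (ht : t ∈ Ioo t₂ t₁) : ∀ S ∈ redFaces t, numCorners t S = 6 :=
  fun _ hS => (hasType_between ht).numCorners_of_forall Red (by decide +kernel) hS

theorem numCorners_red_of_le (ht : t ∈ Ioc 0 t₂) : ∀ S ∈ redFaces t, numCorners t S = 5 := by
  intro S hS
  rcases ht.2.eq_or_lt with rfl | h
  · exact hasType_at_t₂.numCorners_of_forall Red (by decide +kernel) hS
  · exact (hasType_below ⟨ht.1, h⟩).numCorners_of_forall Red (by decide +kernel) hS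

theorem greenFaces_spec (ht : t ∈ Ioo t₁ 1) :
    (∀ a b, Green a b → wall t a ∩ wall t b ∈ greenFaces t) ∧
      (greenFaces t).encard = 8 ∧ ∀ S ∈ greenFaces t, numCorners t S = 3 := by
  have h := hasType_above ht
  refine ⟨fun a b hR => h.pair_mem_faces Green (fun _ _ => Green.ne) (by decide +kernel) hR, ?_,
    fun S hS => h.numCorners_of_forall Green (by decide +kernel) hS⟩
  refine (h.complex.encard_pairs Green fun _ _ => Green.ne).trans ?_
  rw [show count ((subsets aboveSets 2).filter fun L => ∃ a ∈ L, ∃ b ∈ L, Green a b) = 8 by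
    decide +kernel]
  rfl

theorem greenFaces_eq_empty (ht : t ∈ Ioc 0 t₁) : greenFaces t = ∅ := by
  have key : ∀ {Ls : List (List Label)}, IsComplex t Ls →
      count ((subsets Ls 2).filter fun L => ∃ a ∈ L, ∃ b ∈ L, Green a b) = 0 →
      greenFaces t = ∅ := fun h hn => by
    rw [← encard_eq_zero]
    exact (h.encard_pairs Green fun _ _ => Green.ne).trans (by rw [hn]; rfl)
  rcases stage_cases ⟨ht.1, ht.2.trans_lt t₁_lt_one⟩ with h | rfl | h | rfl | h
  · exact absurd h.1 ht.2.not_gt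
  · exact key isComplex_at_t₁ (by decide +kernel)
  · exact key (isComplex_between h) (by decide +kernel)
  · exact key isComplex_at_t₂ (by decide +kernel)
  · exact key (isComplex_below h) (by decide +kernel)

theorem edge_spec (ht : t ∈ Ioo (0 : ℝ) 1) {S : Set Mink} (hS : S ∈ strata t 1) :
    (∃ a b c, [a, b, c].Nodup ∧ wallsThrough t S = {a, b, c}) ∧
      ∀ a b c, [a, b, c].Nodup → wallsThrough t S = {a, b, c} →
        (IsPos a → IsPos b → IsPos c → t < t₁ ∧ edgeAngle t a b c = psi t) ∧
        (¬ (IsPos a ∧ IsPos b ∧ IsPos c) →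
          (Red b c → edgeAngle t a b c = theta t) ∧
          (Green b c → edgeAngle t a b c = phi t) ∧
          (¬ Red b c → ¬ Green b c → edgeAngle t a b c = Real.pi / 2)) := by
  rcases stage_cases ht with h | rfl | h | rfl | h
  · exact (hasType_above h).edgeAngle ht (.inr (by decide +kernel)) hS
  · exact hasType_at_t₁.edgeAngle ht (.inr (by decide +kernel)) hS
  · exact (hasType_between h).edgeAngle ht (.inl h.2) hS
  · exact hasType_at_t₂.edgeAngle ht (.inl t₂_lt_t₁) hS
  · exact (hasType_below h).edgeAngle ht (.inl (h.2.trans t₂_lt_t₁)) hS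

theorem corner_spec (ht : t ∈ Ioo (0 : ℝ) 1) {x : Mink} (hx : x ∈ finVertices t)
    {a b c d : Label} (hn : [a, b, c, d].Nodup) (hw : wallsThrough t {x} = {a, b, c, d}) :
    (Green a b → cornerAngle t a b c d = theta t) ∧
      (Red a b →
        (IsPos c → IsPos d → cornerAngle t a b c d = eta t) ∧
        (Green c d → cornerAngle t a b c d = phi t) ∧
        (¬ (IsPos c ∧ IsPos d) → ¬ Green c d → cornerAngle t a b c d = Real.pi / 2)) := by
  rcases stage_cases ht with h | rfl | h | rfl | h
  · exact (hasType_above h).cornerAngle ht (.inr (by decide +kernel)) hx hn hw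
  · exact hasType_at_t₁.cornerAngle ht (.inr (by decide +kernel)) hx hn hw
  · exact (hasType_between h).cornerAngle ht (.inr (by decide +kernel)) hx hn hw
  · exact hasType_at_t₂.cornerAngle ht (.inr (by decide +kernel)) hx hn hw
  · exact (hasType_below h).cornerAngle ht (.inl h.2) hx hn hw

/-! ### Numbers and types of vertices -/

theorem boxVertices_spec (ht : t ∈ Ioc (0 : ℝ) 1) : (boxVertices t).encard = 12 ∧
    ∀ i : Fin 8, Odd i.val → {n ∈ boxVertices t | pos i ∈ wallsAtIdeal t n}.encard = 3 := by
  obtain ⟨Ls, hc, hI, -⟩ := exists_isComplex ht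
  rw [boxVertices_eq ht hc hI]
  refine ⟨?_, fun i hi => ?_⟩
  · rw [hI.encard_idealOfType hc, show count boxSets = 12 by decide +kernel]
    rfl
  · have h1 : {n ∈ idealOfType t boxSets | pos i ∈ wallsAtIdeal t n} =
        idealOfType t (boxSets.filter fun I => pos i ∈ I) := by
      ext n
      simp only [idealOfType, mem_ofPred_eq, List.mem_filter, decide_eq_true_eq]
      constructor
      · rintro ⟨⟨hn, I, hI, he⟩, hi⟩
        rw [wallsAtIdeal_eq hc.wallsNonempty hn, he] at hi
        exact ⟨hn, I, ⟨hI, hi⟩, he⟩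
      · rintro ⟨hn, I, ⟨hI, hi⟩, he⟩
        refine ⟨⟨hn, I, hI, he⟩, ?_⟩
        rw [wallsAtIdeal_eq hc.wallsNonempty hn, he]
        exact hi
    rw [h1, (hI.mono fun J hJ => (List.mem_filter.1 hJ).1).encard_idealOfType hc,
      (show ∀ i : Fin 8, Odd i.val → count (boxSets.filter fun I => pos i ∈ I) = 3 by
        decide +kernel) i hi]
    rfl

theorem encard_letterVertices (ht : t ∈ Ioc (0 : ℝ) 1) {Ls : List (List Label)}
    (hc : IsComplex t Ls) (hL : ∀ M ∈ letterSets, M ∈ Ls ∧ M.length = 4) :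
    (letterVertices t).encard = 24 := by
  rw [letterVertices_eq ht hc, hc.encard_finOfType hL,
    show count letterSets = 24 by decide +kernel]
  rfl

theorem encard_tripleNegVertices (ht : t ∈ Ioc (0 : ℝ) 1) {Ls : List (List Label)}
    (hc : IsComplex t Ls) (hL : ∀ M ∈ tripleNegSets, M ∈ Ls ∧ M.length = 4) :
    (tripleNegVertices t).encard = 8 := by
  rw [tripleNegVertices_eq ht hc, hc.encard_finOfType hL,
    show count tripleNegSets = 8 by decide +kernel]
  rfl

theorem spec_above (ht : t ∈ Ioo t₁ 1) : HasCounts t 24 108 144 60 ∧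
    idealVertices t = boxVertices t ∧
    finVertices t = letterVertices t ∪ poleVertices t ∧
    (letterVertices t).encard = 24 ∧ (poleVertices t).encard = 24 := by
  have h := hasType_above ht
  have ht' : t ∈ Ioc (0 : ℝ) 1 := ⟨t₁_pos.trans ht.1, ht.2.le⟩
  have hp := poleVertices_eq ⟨ht.1, ht.2.le⟩ h.complex
  refine ⟨?_, ?_, ?_, encard_letterVertices ht' h.complex (by decide +kernel), ?_⟩
  · have := h.hasCounts
    rw [count_above.1, count_above.2.1, count_above.2.2.1,
      show count (letterSets ++ poleSets) + count boxSets = 60 by decide +kernel] at this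
    exact this
  · rw [boxVertices_eq ht' h.complex h.ideal, h.ideal_eq]
  · rw [letterVertices_eq ht' h.complex, hp, h.fin_eq, finOfType_append]
  · rw [hp, h.complex.encard_finOfType (by decide +kernel),
      show count poleSets = 24 by decide +kernel]
    rfl

theorem spec_at_t₁ : HasCounts t₁ 24 100 120 44 ∧
    theta t₁ = Real.pi / 3 ∧
    idealVertices t₁ = boxVertices t₁ ∪ prismVertices t₁ ∧
    finVertices t₁ = letterVertices t₁ ∧
    (prismVertices t₁).encard = 8 ∧ (letterVertices t₁).encard = 24 := by
  have h := hasType_at_t₁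
  have ht : t₁ ∈ Ioc (0 : ℝ) 1 := ⟨t₁_pos, t₁_lt_one.le⟩
  refine ⟨?_, ?_, ?_, ?_, ?_, encard_letterVertices ht h.complex (by decide +kernel)⟩
  · have := h.hasCounts
    rw [count_at_t₁.1, count_at_t₁.2.1, count_at_t₁.2.2.1,
      show count letterSets + count (boxSets ++ prismSets) = 44 by decide +kernel] at this
    exact this
  · rw [theta, t₁_sq, show (3 * (3 / 5) - 1 : ℝ) / (1 + 3 / 5) = 1 / 2 by norm_num,
      ← Real.cos_pi_div_three]
    exact Real.arccos_cos (by positivity) (by linarith [Real.pi_pos])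
  · rw [boxVertices_eq ht h.complex (h.ideal.mono fun J hJ => List.mem_append_left _ hJ),
      prismVertices_eq, h.ideal_eq, idealOfType_append]
  · rw [letterVertices_eq ht h.complex, h.fin_eq]
  · rw [prismVertices_eq, isIdealFamily_prism.encard_idealOfType h.complex,
      show count prismSets = 8 by decide +kernel]
    rfl

theorem spec_between (ht : t ∈ Ioo t₂ t₁) : HasCounts t 24 100 128 52 ∧
    idealVertices t = boxVertices t ∧
    finVertices t = letterVertices t ∪ (tripleNegVertices t ∪ triplePoleVertices t) ∧
    (letterVertices t).encard = 24 ∧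
    (tripleNegVertices t ∪ triplePoleVertices t).encard = 16 ∧
    (tripleNegVertices t).encard = 8 ∧ (triplePoleVertices t).encard = 8 := by
  have h := hasType_between ht
  have ht' : t ∈ Ioc (0 : ℝ) 1 := ⟨t₂_pos.trans ht.1, (ht.2.trans t₁_lt_one).le⟩
  refine ⟨?_, ?_, ?_, encard_letterVertices ht' h.complex (by decide +kernel), ?_,
    encard_tripleNegVertices ht' h.complex (by decide +kernel), ?_⟩
  · have := h.hasCounts
    rw [count_between.1, count_between.2.1,
      count_between.2.2.1,
      show count (letterSets ++ (tripleNegSets ++ triplePoleSets)) + count boxSets = 52 by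
        decide +kernel] at this
    exact this
  · rw [boxVertices_eq ht' h.complex h.ideal, h.ideal_eq]
  · rw [letterVertices_eq ht' h.complex, tripleNegVertices_eq ht' h.complex,
      triplePoleVertices_eq ht' h.complex, h.fin_eq, finOfType_append, finOfType_append]
  · rw [tripleNegVertices_eq ht' h.complex, triplePoleVertices_eq ht' h.complex,
      ← finOfType_append, h.complex.encard_finOfType (by decide +kernel),
      show count (tripleNegSets ++ triplePoleSets) = 16 by decide +kernel]
    rfl
  · rw [triplePoleVertices_eq ht' h.complex, h.complex.encard_finOfType (by decide +kernel),
      show count triplePoleSets = 8 by decide +kernel]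
    rfl

theorem spec_at_t₂ : HasCounts t₂ 22 92 116 46 ∧
    theta t₂ = Real.arccos (1 / 3) ∧
    idealVertices t₂ = boxVertices t₂ ∪ idealApexVertices t₂ ∧
    finVertices t₂ = letterVertices t₂ ∪ tripleNegVertices t₂ ∧
    (idealApexVertices t₂).encard = 2 ∧
    (letterVertices t₂).encard = 24 ∧ (tripleNegVertices t₂).encard = 8 := by
  have h := hasType_at_t₂
  have ht : t₂ ∈ Ioc (0 : ℝ) 1 := ⟨t₂_pos, (t₂_lt_t₁.trans t₁_lt_one).le⟩
  refine ⟨?_, ?_, ?_, ?_, ?_, encard_letterVertices ht h.complex (by decide +kernel),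
    encard_tripleNegVertices ht h.complex (by decide +kernel)⟩
  · have := h.hasCounts
    rw [count_at_t₂.1, count_at_t₂.2.1, count_at_t₂.2.2.1,
      show count (letterSets ++ tripleNegSets) + count (boxSets ++ apexSets) = 46 by
        decide +kernel] at this
    exact this
  · rw [theta, t₂_sq, show (3 * (1 / 2) - 1 : ℝ) / (1 + 1 / 2) = 1 / 3 by norm_num]
  · rw [boxVertices_eq ht h.complex (h.ideal.mono fun J hJ => List.mem_append_left _ hJ),
      idealApexVertices_eq, h.ideal_eq, idealOfType_append]
  · rw [letterVertices_eq ht h.complex, tripleNegVertices_eq ht h.complex, h.fin_eq,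
      finOfType_append]
  · rw [idealApexVertices_eq, isIdealFamily_apex.encard_idealOfType h.complex,
      show count apexSets = 2 by decide +kernel]
    rfl

theorem spec_below (ht : t ∈ Ioo 0 t₂) : HasCounts t 22 92 116 46 ∧
    idealVertices t = boxVertices t ∧
    finVertices t = letterVertices t ∪ tripleNegVertices t ∪ apexVertices t ∧
    (letterVertices t).encard = 24 ∧ (tripleNegVertices t).encard = 8 ∧
    (apexVertices t).encard = 2 := by
  have h := hasType_below ht
  have ht' : t ∈ Ioc (0 : ℝ) 1 := ⟨ht.1, (ht.2.trans (t₂_lt_t₁.trans t₁_lt_one)).le⟩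
  refine ⟨?_, ?_, ?_, encard_letterVertices ht' h.complex (by decide +kernel),
    encard_tripleNegVertices ht' h.complex (by decide +kernel), ?_⟩
  · have := h.hasCounts
    rw [count_below.1, count_below.2.1, count_below.2.2.1,
      show count (letterSets ++ tripleNegSets ++ apexSets) + count boxSets = 46 by
        decide +kernel] at this
    exact this
  · rw [boxVertices_eq ht' h.complex h.ideal, h.ideal_eq]
  · rw [letterVertices_eq ht' h.complex, tripleNegVertices_eq ht' h.complex,
      apexVertices_eq ht' h.complex, h.fin_eq, finOfType_append, finOfType_append]
  · rw [apexVertices_eq ht' h.complex, h.complex.encard_finOfType (by decide +kernel),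
      show count apexSets = 2 by decide +kernel]
    rfl

end CellFamily

open CellFamily CellFamily.Label in
theorem mainTheorem7 :
    -- finite volume
    (∀ t ∈ Ioc (0 : ℝ) 1, hypVol (P t) < ⊤) ∧
    -- the combinatorics, with the names of the walls, is constant in the three intervals,
    -- and changes precisely at the critical times
    (∀ s ∈ Ioc (0 : ℝ) 1, ∀ t ∈ Ioc (0 : ℝ) 1, SamePiece s t → LabelledCombEquiv s t) ∧
    (∀ s ∈ Ioc (0 : ℝ) 1, ∀ t ∈ Ioc (0 : ℝ) 1, CombEquiv s t ↔ SamePiece s t) ∧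
    -- every half-space contributes exactly one wall
    (∀ t ∈ Ioc (0 : ℝ) 1, BijOn (wall t) (active t) (strata t 3)) ∧
    -- every face is the intersection of two walls, and its dihedral angle
    (∀ t ∈ Ioc (0 : ℝ) 1, ∀ S ∈ strata t 2,
      (∃ a b, a ≠ b ∧ wallsThrough t S = {a, b} ∧ S = wall t a ∩ wall t b) ∧
      ∀ a b, a ≠ b → wallsThrough t S = {a, b} →
        (Red a b → dihedralAngle (vec t a) (vec t b) = theta t) ∧
        (Green a b → dihedralAngle (vec t a) (vec t b) = phi t) ∧
        (¬ Red a b → ¬ Green a b → dihedralAngle (vec t a) (vec t b) = Real.pi / 2)) ∧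
    -- the red polygons
    (∀ t ∈ Ioo (0 : ℝ) 1, (∀ a b, Red a b → wall t a ∩ wall t b ∈ redFaces t) ∧
      (redFaces t).encard = 12) ∧
    (∀ t ∈ Ico t₁ 1, ∀ S ∈ redFaces t, numCorners t S = 4) ∧
    (∀ t ∈ Ioo t₂ t₁, ∀ S ∈ redFaces t, numCorners t S = 6) ∧
    (∀ t ∈ Ioc 0 t₂, ∀ S ∈ redFaces t, numCorners t S = 5) ∧
    -- the green triangles
    (∀ t ∈ Ioo t₁ 1, (∀ a b, Green a b → wall t a ∩ wall t b ∈ greenFaces t) ∧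
      (greenFaces t).encard = 8 ∧ ∀ S ∈ greenFaces t, numCorners t S = 3) ∧
    (∀ t ∈ Ioc 0 t₁, greenFaces t = ∅) ∧
    -- every edge lies on three walls, and the dihedral angles of the walls along their edges
    (∀ t ∈ Ioo (0 : ℝ) 1, ∀ S ∈ strata t 1,
      (∃ a b c, [a, b, c].Nodup ∧ wallsThrough t S = {a, b, c}) ∧
      ∀ a b c, [a, b, c].Nodup → wallsThrough t S = {a, b, c} →
        (IsPos a → IsPos b → IsPos c → t < t₁ ∧ edgeAngle t a b c = psi t) ∧
        (¬ (IsPos a ∧ IsPos b ∧ IsPos c) →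
          (Red b c → edgeAngle t a b c = theta t) ∧
          (Green b c → edgeAngle t a b c = phi t) ∧
          (¬ Red b c → ¬ Green b c → edgeAngle t a b c = Real.pi / 2))) ∧
    -- the interior angles of the red and green polygons at their finite vertices
    (∀ t ∈ Ioo (0 : ℝ) 1, ∀ x ∈ finVertices t, ∀ a b c d, [a, b, c, d].Nodup →
      wallsThrough t {x} = {a, b, c, d} →
        (Green a b → cornerAngle t a b c d = theta t) ∧
        (Red a b →
          (IsPos c → IsPos d → cornerAngle t a b c d = eta t) ∧
          (Green c d → cornerAngle t a b c d = phi t) ∧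
          (¬ (IsPos c ∧ IsPos d) → ¬ Green c d → cornerAngle t a b c d = Real.pi / 2))) ∧
    -- the twelve ideal vertices that exist at all times
    (∀ t ∈ Ioc (0 : ℝ) 1, (boxVertices t).encard = 12 ∧
      ∀ i : Fin 8, Odd i.val → {n ∈ boxVertices t | pos i ∈ wallsAtIdeal t n}.encard = 3) ∧
    -- the first interval
    (∀ t ∈ Ioo t₁ 1, HasCounts t 24 108 144 60 ∧
      idealVertices t = boxVertices t ∧
      finVertices t = letterVertices t ∪ poleVertices t ∧
      (letterVertices t).encard = 24 ∧ (poleVertices t).encard = 24) ∧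
    -- the first critical time
    (HasCounts t₁ 24 100 120 44 ∧
      theta t₁ = Real.pi / 3 ∧
      idealVertices t₁ = boxVertices t₁ ∪ prismVertices t₁ ∧
      finVertices t₁ = letterVertices t₁ ∧
      (prismVertices t₁).encard = 8 ∧ (letterVertices t₁).encard = 24) ∧
    -- the second interval
    (∀ t ∈ Ioo t₂ t₁, HasCounts t 24 100 128 52 ∧
      idealVertices t = boxVertices t ∧
      finVertices t = letterVertices t ∪ (tripleNegVertices t ∪ triplePoleVertices t) ∧
      (letterVertices t).encard = 24 ∧
      (tripleNegVertices t ∪ triplePoleVertices t).encard = 16 ∧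
      (tripleNegVertices t).encard = 8 ∧ (triplePoleVertices t).encard = 8) ∧
    -- the second critical time
    (HasCounts t₂ 22 92 116 46 ∧
      theta t₂ = Real.arccos (1 / 3) ∧
      idealVertices t₂ = boxVertices t₂ ∪ idealApexVertices t₂ ∧
      finVertices t₂ = letterVertices t₂ ∪ tripleNegVertices t₂ ∧
      (idealApexVertices t₂).encard = 2 ∧
      (letterVertices t₂).encard = 24 ∧ (tripleNegVertices t₂).encard = 8) ∧
    -- the last interval
    (∀ t ∈ Ioo 0 t₂, HasCounts t 22 92 116 46 ∧
      idealVertices t = boxVertices t ∧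
      finVertices t = letterVertices t ∪ tripleNegVertices t ∪ apexVertices t ∧
      (letterVertices t).encard = 24 ∧ (tripleNegVertices t).encard = 8 ∧
      (apexVertices t).encard = 2) := by
  refine ⟨fun t ht => hypVol_P_lt_top ht, fun s _ t _ h => h.labelledCombEquiv,
    fun s hs t ht => ⟨fun h => h.samePiece hs ht, fun h => ?_⟩, fun t ht => ?_,
    fun t ht S hS => ?_, fun t ht => redFaces_spec ht, fun t ht => numCorners_red_of_ge ht,
    fun t ht => numCorners_red_between ht, fun t ht => numCorners_red_of_le ht,
    fun t ht => greenFaces_spec ht, fun t ht => greenFaces_eq_empty ht,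
    fun t ht S hS => edge_spec ht hS, fun t ht x hx a b c d hn hw => corner_spec ht hx hn hw,
    fun t ht => boxVertices_spec ht, fun t ht => spec_above ht, spec_at_t₁,
    fun t ht => spec_between ht, spec_at_t₂, fun t ht => spec_below ht⟩
  · obtain ⟨-, e, he, -⟩ := h.labelledCombEquiv
    exact ⟨e, he⟩
  · obtain ⟨Ls, hc, -⟩ := exists_isComplex ht
    exact hc.wall_bijOn
  · obtain ⟨Ls, hc, -, hA⟩ := exists_isComplex ht
    exact ⟨hc.exists_pair hS, fun a b hab hw => dihedralAngle_spec ht.1 hc hA hS hab hw⟩
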